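/- **Setting.** Let $\mathbf F$ be an algebraically closed field of characteristic $p>3$, $\Gamma$ a countable abelian group with a bicharacter $(\,,):\Gamma\times\Gamma\to\mathbf F^\times$ (biadditive, $(\alpha,\beta)(\beta,\alpha)=1$); call $\alpha\in\Gamma$ even if $(\alpha,\alpha)=1$ and odd otherwise. Let $V=\bigoplus_{\alpha\in\Gamma}V_\alpha$ be a $\Gamma$-graded $\mathbf F$-space with all $V_\alpha$ finite dimensional. $\mathrm{cgl}(V)$ is the space of endomorphisms of $V$ that vanish on all but finitely many $V_\alpha$, with its $\Gamma$-grading, the color bracket $[x,y]=xy-(\alpha,\beta)yx$ ($x$ of degree $\alpha$, $y$ of degree $\beta$) and the $p$-map $x^{[p]}=x^p$ on homogeneous elements of even degree; it equals $\mathfrak{gl}(V)$ if $V$ is finite dimensional. Let $\mathfrak g\subseteq\mathrm{cgl}(V)$ be an algebraic Lie color algebra: a graded subspace closed under the color bracket and the $p$-map, together with a Zariski closed subgroup $G\subseteq\prod_\alpha GL(V_\alpha)$ that normalizes $\mathfrak g$ and satisfies $\mathrm{Lie}(G)=\mathfrak g_{\bar 0}$. Let $T$ be a maximal torus of $G$,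 $H=\mathrm{Lie}(T)$, and let $\Phi$ be the set of nonzero weights of $T$ in $\mathfrak g$. Assume that $\mathfrak g=H\oplus\bigoplus_{\delta\in\Phi}\mathfrak g_\delta$, that the root spaces $\mathfrak g_\delta$ are one-dimensional (hence homogeneous), and that $\Phi=-\Phi$. A positive system of $\Phi$ is a subset $\Phi^+$ with $\Phi=\Phi^+\cup-\Phi^+$ such that no nonempty sum of elements of $\Phi^+$ is $0$. Fix one, and put $N^{\pm}=\bigoplus_{\delta\in\Phi^+}\mathfrak g_{\pm\delta}$. Let $(\mathfrak g,\mathcal Z,\{\delta_i\}_{i=1}^m)$ be an FP triple: $\Phi_1\subseteq\Phi$ is a subsystem (if $a,b\in\Phi_1$, $k,l\in\mathbb Z$ and $ka+lb\in\Phi$, then $ka+lb\in\Phi_1$) with $\Phi\setminus\Phi_1$ finite, $\mathcal Z=H\oplus\bigoplus_{\delta\in\Phi_1}\mathfrak g_\delta$, $\Phi_1^+=\Phi_1\cap\Phi^+$, $\Phi^+\setminus\Phi_1^+=\{\delta_1,\dots,\delta_m\}$ with distinct $\delta_i$, and * for $1\le i\le m+1$ the set $\Phi_i^+=\Phi_1^+\cup\{-\delta_1,\dots,-\delta_{i-1},\delta_i,\dots,\delta_m\}$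 is a positive system of $\Phi$, in which, for $i\le m$, $\delta_i$ is simple (not a sum of two elements of $\Phi_i^+$); * for $1\le i\le m$ the set $A=\{-\delta_1,\dots,-\delta_i\}$ is additive and normalized by $\Phi_1^+$: if $a\in A$, $b\in A\cup\Phi_1^+$ and $a+b\in\Phi$, then $a+b\in A$. Put $P_0=\mathcal Z+\sum_{i=1}^m\mathfrak g_{\delta_i}$. Choose nonzero root vectors $e_{\delta_i}\in\mathfrak g_{\delta_i}$, $f_{\delta_i}\in\mathfrak g_{-\delta_i}$, and assume that for each $i$ their degrees are both even or both odd; in an exponent at $e_{\delta_i}$ or $f_{\delta_i}$, $\bar p$ means $p$ in the even case and $2$ in the odd case. Let $\chi$ be a linear function on $\mathfrak g$ with $\chi(\mathfrak g_\alpha)=0$ for $\alpha\neq\bar 0$, in standard form: $\chi=\chi_s+\chi_n$ with $\chi_s(N^\pm)=0$, $\chi_n(H+N^+)=0$, and for $\delta\in\Phi^+$, $\chi([\mathfrak g_\delta,\mathfrak g_{-\delta}])\ne0$ implies $\chi(\mathfrak g_\delta)=\chi(\mathfrak g_{-\delta})=0$. Assume $\chi(\mathfrak g_{\pm\delta_i})=0$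 for all $i$. For a restricted color subalgebra $S\subseteq\mathfrak g$ and a linear function $\psi$ on $\mathfrak g$ that vanishes on $\mathfrak g_\alpha$ for $\alpha\ne\bar0$, $u_\psi(S)$ is the quotient of the enveloping algebra $U(S)$ by the relations $x^p-x^{[p]}=\psi(x)^p$ for homogeneous $x\in S$ of even degree. Modules and submodules are $\Gamma$-graded, and simple means having exactly two graded submodules. Let $\mathcal M(\lambda)$ be a simple $u_\chi(P_0)$-module that contains a maximal vector of weight $\lambda\in H^*$, i.e. a nonzero homogeneous $v$ with $N^+v=0$ and $hv=\lambda(h)v$ for $h\in H$, and let $$Z^\chi(\mathcal M(\lambda))=u_\chi(\mathfrak g)\otimes_{u_\chi(P_0)}\mathcal M(\lambda).$$ **Theorem 3.11.** The element $x=e_{\delta_1}^{\bar p-1}\cdots e_{\delta_m}^{\bar p-1}f_{\delta_1}^{\bar p-1}\cdots f_{\delta_m}^{\bar p-1}$ of $u_{\chi_s}(\mathfrak g)$ lies in the $T$-weight space $u_{\chi_s}(\mathfrak g)_0$ of weight $0$, and there is a unique $f\in u_{\chi_s}(H)$ with $x-f\in u_{\chi_s}(\mathfrak g)N^+$ (its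 Harish-Chandra image). The weight $\lambda$ extends uniquely to an algebra homomorphism $u_{\chi_s}(H)\to\mathbf F$; let $f(\lambda(h))$ be the value of this homomorphism at $f$. Then $Z^\chi(\mathcal M(\lambda))$ is simple if and only if $f(\lambda(h))\neq0$. Here $\mathfrak g$ may be finite or infinite dimensional; no finiteness is imposed on $\mathcal M(\lambda)$, so the theorem applies in particular to finite-dimensional $\mathfrak g$ and to the simple $u_\chi(P_0)$-modules with a maximal vector in category $\mathcal O$ for $\mathfrak g=\mathrm{cgl}(V)$. -/

import Mathlib

open scoped TensorProduct

namespace ColorLie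

/-! ### Bicharacters, gradings, color subalgebras of `gl(V)` -/

section Grading

variable {Γ F V : Type*} [AddCommGroup Γ] [Field F] [AddCommGroup V] [Module F V]

/-- A (color) bicharacter on the abelian group `Γ` with values in `F^×`. -/
structure Bicharacter (Γ F : Type*) [AddCommGroup Γ] [Field F] where
  toFun : Γ → Γ → Fˣ
  skew : ∀ a b, toFun a b * toFun b a = 1
  map_add_right : ∀ a b c, toFun a (b + c) = toFun a b * toFun a c
  map_add_left : ∀ a b c, toFun (a + b) c = toFun a c * toFun b c

instance : CoeFun (Bicharacter Γ F) (fun _ => Γ → Γ → Fˣ) := ⟨Bicharacter.toFun⟩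

/-- `V = ⊕ 𝒱 γ`. -/
def IsGrading (𝒱 : Γ → Submodule F V) : Prop :=
  iSupIndep 𝒱 ∧ ⨆ γ, 𝒱 γ = ⊤

/-- A subspace is graded if it is the sum of its intersections with the homogeneous components. -/
def IsGradedSub (𝒱 : Γ → Submodule F V) (N : Submodule F V) : Prop :=
  N = ⨆ γ, N ⊓ 𝒱 γ

/-- `gl(V)_α`, the endomorphisms of degree `α`. -/
def homEnd (𝒱 : Γ → Submodule F V) (α : Γ) : Submodule F (Module.End F V) where
  carrier := {f | ∀ γ, ∀ v ∈ 𝒱 γ, f v ∈ 𝒱 (γ + α)}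
  add_mem' hf hg γ v hv := (𝒱 (γ + α)).add_mem (hf γ v hv) (hg γ v hv)
  zero_mem' γ _ _ := (𝒱 (γ + α)).zero_mem
  smul_mem' c _ hf γ v hv := (𝒱 (γ + α)).smul_mem c (hf γ v hv)

/-- `cgl(V)`: the endomorphisms that vanish on all but finitely many components of `V`. (If all the
components are finite dimensional, such an endomorphism is a finite sum of homogeneous ones.) -/
def cgl (𝒱 : Γ → Submodule F V) : Submodule F (Module.End F V) where
  carrier := {f | {α | ¬ ∀ v ∈ 𝒱 α, f v = 0}.Finite}
  add_mem' {f g} hf hg := by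
    refine (Set.Finite.union hf hg).subset fun α hα => ?_
    by_contra h
    simp only [Set.mem_union, Set.mem_ofPred_eq, not_or, not_not] at h
    exact hα fun v hv => by simp [h.1 v hv, h.2 v hv]
  zero_mem' := by simp
  smul_mem' c f hf := by
    refine Set.Finite.subset hf fun α hα h => hα fun v hv => by simp [h v hv]

/-- The color bracket `[x,y] = xy - (α,β) yx` of `x ∈ gl(V)_α` and `y ∈ gl(V)_β`. -/
def colorBracket (ε : Bicharacter Γ F) (α β : Γ) (x y : Module.End F V) : Module.End F V :=
  x * y - (ε α β : F) • (y * x)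

/-- `S` is a restricted Lie color subalgebra of `gl(V)`: a graded subspace which is closed under the
color bracket and under the `p`-map `x ↦ x^p` of the homogeneous elements `x` with even degree. -/
structure IsRestrictedSubalgebra (p : ℕ) (ε : Bicharacter Γ F) (𝒱 : Γ → Submodule F V)
    (S : Submodule F (Module.End F V)) : Prop where
  graded : IsGradedSub (homEnd 𝒱) S
  bracket_mem : ∀ α β, ∀ x ∈ S ⊓ homEnd 𝒱 α, ∀ y ∈ S ⊓ homEnd 𝒱 β, colorBracket ε α β x y ∈ S
  pow_mem : ∀ α, ε α α = 1 → ∀ x ∈ S ⊓ homEnd 𝒱 α, x ^ p ∈ S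

open Classical in
/-- `p̄(x)` for a nonzero homogeneous `x`: it is `p` if the degree of `x` is even and `2` if the
degree of `x` is odd. -/
noncomputable def pbar (p : ℕ) (ε : Bicharacter Γ F) (𝒱 : Γ → Submodule F V)
    (x : Module.End F V) : ℕ :=
  if ∃ α, ε α α = 1 ∧ x ∈ homEnd 𝒱 α then p else 2

end Grading

/-! ### Algebraic groups of degree-preserving automorphisms, and their Lie algebras -/

section Groups

variable {Γ F V : Type*} [AddCommGroup Γ] [Field F] [AddCommGroup V] [Module F V]

/-- `GL({m_α}) = ∏ GL(V_α)`, the group of the degree-preserving automorphisms of `V`. -/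
def gradedGL (𝒱 : Γ → Submodule F V) : Subgroup (LinearMap.GeneralLinearGroup F V) where
  carrier := {g | ∀ γ, ∀ v ∈ 𝒱 γ,
    (g : Module.End F V) v ∈ 𝒱 γ ∧ ((g⁻¹ : LinearMap.GeneralLinearGroup F V) : Module.End F V) v ∈ 𝒱 γ}
  mul_mem' {a b} ha hb γ v hv := by
    refine ⟨?_, ?_⟩
    · simpa using (ha γ _ (hb γ v hv).1).1
    · simpa [mul_inv_rev] using (hb γ _ (ha γ v hv).2).2
  one_mem' γ v hv := by simpa using hv
  inv_mem' {a} ha γ v hv := by simpa using (ha γ v hv).symm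

/-- The value at an endomorphism `x` of a polynomial in the matrix coefficients `x ↦ φ (x v)`. -/
noncomputable def coordEval (x : Module.End F V) (P : MvPolynomial (Module.Dual F V × V) F) : F :=
  MvPolynomial.eval (fun c => c.1 (x c.2)) P

/-- The polynomial `P` in the matrix coefficients vanishes on `G`. -/
def Vanishes (G : Subgroup (LinearMap.GeneralLinearGroup F V))
    (P : MvPolynomial (Module.Dual F V × V) F) : Prop :=
  ∀ g ∈ G, coordEval (g : Module.End F V) P = 0

/-- `G` is a linear algebraic subgroup of `∏ GL(V_α)`, i.e. a Zariski closed one. -/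
def IsClosedSubgroup (𝒱 : Γ → Submodule F V)
    (G : Subgroup (LinearMap.GeneralLinearGroup F V)) : Prop :=
  G ≤ gradedGL 𝒱 ∧
    ∀ g ∈ gradedGL 𝒱, (∀ P, Vanishes G P → coordEval (g : Module.End F V) P = 0) → g ∈ G

/-- `Lie(G)`: the tangent space of `G` at `1`, inside `Lie(∏ GL(V_α)) = cgl(V)_0 = ⊕ gl(V_α)`; it
consists of the `x` along which every polynomial that vanishes on `G` has zero derivative at `1`. -/
noncomputable def lieOf (𝒱 : Γ → Submodule F V)
    (G : Subgroup (LinearMap.GeneralLinearGroup F V)) : Submodule F (Module.End F V) where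
  carrier := {x | x ∈ cgl 𝒱 ⊓ homEnd 𝒱 0 ∧ ∀ P, Vanishes G P →
    ∑ c ∈ P.vars, coordEval (1 : Module.End F V) (MvPolynomial.pderiv c P) * c.1 (x c.2) = 0}
  add_mem' {x y} hx hy := ⟨Submodule.add_mem _ hx.1 hy.1, fun P hP => by
    simp [mul_add, Finset.sum_add_distrib, hx.2 P hP, hy.2 P hP]⟩
  zero_mem' := ⟨Submodule.zero_mem _, fun P _ => by simp⟩
  smul_mem' a x hx := ⟨Submodule.smul_mem _ a hx.1, fun P hP => by
    have h := congrArg (a * ·) (hx.2 P hP)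
    simp only [Finset.mul_sum, mul_zero] at h
    rw [← h]
    refine Finset.sum_congr rfl fun c _ => ?_
    simp only [LinearMap.smul_apply, map_smul, smul_eq_mul]
    ring⟩

/-- A torus: a Zariski closed, connected (equivalently, irreducible), diagonalizable subgroup. -/
structure IsTorus (𝒱 : Γ → Submodule F V)
    (T : Subgroup (LinearMap.GeneralLinearGroup F V)) : Prop where
  closed : IsClosedSubgroup 𝒱 T
  irreducible : ∀ P Q, Vanishes T (P * Q) → Vanishes T P ∨ Vanishes T Q
  diagonalizable :
    Submodule.span F {v : V | ∃ c : T →* Fˣ, ∀ t : T,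
      ((t : LinearMap.GeneralLinearGroup F V) : Module.End F V) v = (c t : F) • v} = ⊤

/-- A maximal torus of `G`. -/
structure IsMaximalTorus (𝒱 : Γ → Submodule F V)
    (G T : Subgroup (LinearMap.GeneralLinearGroup F V)) : Prop where
  torus : IsTorus 𝒱 T
  le : T ≤ G
  maximal : ∀ T', IsTorus 𝒱 T' → T' ≤ G → T ≤ T' → T' = T

/-- `𝔤` is an algebraic Lie color algebra, with algebraic group `G`. As `G` preserves degrees,
conjugation by its elements gives automorphisms of `𝔤` that respect the grading, the color bracket
and the `p`-map as soon as it maps `𝔤` to itself. -/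
structure IsAlgebraic (p : ℕ) (ε : Bicharacter Γ F) (𝒱 : Γ → Submodule F V)
    (𝔤 : Submodule F (Module.End F V)) (G : Subgroup (LinearMap.GeneralLinearGroup F V)) :
    Prop where
  grading : IsGrading 𝒱
  finiteDimensional : ∀ γ, FiniteDimensional F (𝒱 γ)
  le_cgl : 𝔤 ≤ cgl 𝒱
  restricted : IsRestrictedSubalgebra p ε 𝒱 𝔤
  closed : IsClosedSubgroup 𝒱 G
  conj_mem : ∀ g ∈ G, ∀ x ∈ 𝔤, (g : Module.End F V) * x *
    ((g⁻¹ : LinearMap.GeneralLinearGroup F V) : Module.End F V) ∈ 𝔤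
  lie_eq : lieOf 𝒱 G = 𝔤 ⊓ homEnd 𝒱 0

end Groups

/-! ### Roots -/

section Roots

variable {Γ F V : Type*} [AddCommGroup Γ] [Field F] [AddCommGroup V] [Module F V]

/-- The group of characters of `T`, written additively. -/
abbrev Char (T : Subgroup (LinearMap.GeneralLinearGroup F V)) : Type _ := Additive (T →* Fˣ)

/-- The weight space of weight `δ` for the conjugation action of `T` on `gl(V)`. -/
def conjWeight (T : Subgroup (LinearMap.GeneralLinearGroup F V)) (δ : Char T) :
    Submodule F (Module.End F V) where
  carrier := {x | ∀ t : T, ((t : LinearMap.GeneralLinearGroup F V) : Module.End F V) * x *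
    (((t : LinearMap.GeneralLinearGroup F V)⁻¹ : LinearMap.GeneralLinearGroup F V) :
      Module.End F V) = ((δ.toMul t : Fˣ) : F) • x}
  add_mem' hx hy t := by rw [mul_add, add_mul, hx t, hy t, smul_add]
  zero_mem' t := by simp
  smul_mem' a x hx t := by
    rw [mul_smul_comm, smul_mul_assoc, hx t, smul_comm]

/-- The weight space `𝔤_δ`. -/
def rootSpace (𝔤 : Submodule F (Module.End F V)) (T : Subgroup (LinearMap.GeneralLinearGroup F V))
    (δ : Char T) : Submodule F (Module.End F V) :=
  𝔤 ⊓ conjWeight T δ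

/-- The root system `Φ`: the nonzero weights of `T` in `𝔤`. -/
def roots (𝔤 : Submodule F (Module.End F V)) (T : Subgroup (LinearMap.GeneralLinearGroup F V)) :
    Set (Char T) :=
  {δ | δ ≠ 0 ∧ rootSpace 𝔤 T δ ≠ ⊥}

/-- The root space decomposition `𝔤 = H ⊕ ⊕_{δ ∈ Φ} 𝔤_δ` with `H = Lie(T)`, one-dimensional root
spaces, and `Φ = -Φ`. (The sum of weight spaces is always direct.) -/
structure HasRootDecomposition (𝒱 : Γ → Submodule F V) (𝔤 : Submodule F (Module.End F V))
    (T : Subgroup (LinearMap.GeneralLinearGroup F V)) : Prop where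
  sum_eq : 𝔤 = lieOf 𝒱 T ⊔ ⨆ δ ∈ roots 𝔤 T, rootSpace 𝔤 T δ
  finrank_eq_one : ∀ δ ∈ roots 𝔤 T, Module.finrank F (rootSpace 𝔤 T δ) = 1
  neg_mem : ∀ δ ∈ roots 𝔤 T, -δ ∈ roots 𝔤 T

section Combinatorics

variable {X : Type*} [AddCommGroup X]

/-- A system of positive roots: every root is positive or negative, and no sum of (one or more)
positive roots is zero. -/
structure IsPositiveSystem (Φ P : Set X) : Prop where
  subset : P ⊆ Φ
  mem_or_neg_mem : ∀ δ ∈ Φ, δ ∈ P ∨ -δ ∈ P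
  zero_notMem : (0 : X) ∉ AddSubsemigroup.closure P

/-- A simple root of the positive system `P`: a positive root that is not a sum of two positive
roots. -/
def IsSimpleRoot (P : Set X) (δ : X) : Prop :=
  δ ∈ P ∧ ∀ a ∈ P, ∀ b ∈ P, a + b ≠ δ

/-- A subsystem of `Φ`. -/
def IsSubsystem (Φ Φ₁ : Set X) : Prop :=
  Φ₁ ⊆ Φ ∧ ∀ a ∈ Φ₁, ∀ b ∈ Φ₁, ∀ k l : ℤ, k • a + l • b ∈ Φ → k • a + l • b ∈ Φ₁

/-- An additive subset of `Φ`. -/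
def IsAdditiveSubset (Φ A : Set X) : Prop :=
  A ⊆ Φ ∧ ∀ a ∈ A, ∀ b ∈ A, a + b ∈ Φ → a + b ∈ A

/-- The set `Φ₁⁺ ∪ {-δ_j : j < k} ∪ {δ_j : j ≥ k}` (indices start at `0`). -/
def fpSet (P Φ₁ : Set X) {m : ℕ} (δ : Fin m → X) (k : ℕ) : Set X :=
  (Φ₁ ∩ P) ∪ {x | ∃ j : Fin m, (j : ℕ) < k ∧ x = -δ j} ∪ {x | ∃ j : Fin m, k ≤ (j : ℕ) ∧ x = δ j}

/-- The data `Φ ⊇ Φ⁺ = P`, `Φ₁`, `δ_1, …, δ_m` form a Friedlander-Parshall triple (indices start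
at `0`). -/
structure IsFPTriple (Φ P Φ₁ : Set X) {m : ℕ} (δ : Fin m → X) : Prop where
  subsystem : IsSubsystem Φ Φ₁
  finite_diff : (Φ \ Φ₁).Finite
  injective : Function.Injective δ
  range_eq : Set.range δ = P \ Φ₁
  positive : ∀ k ≤ m, IsPositiveSystem Φ (fpSet P Φ₁ δ k)
  simple : ∀ i : Fin m, IsSimpleRoot (fpSet P Φ₁ δ i) (δ i)
  additive : ∀ i : Fin m, IsAdditiveSubset Φ {x | ∃ j ≤ i, x = -δ j}
  normalized : ∀ i : Fin m, ∀ β ∈ Φ₁ ∩ P, ∀ j ≤ i, β + -δ j ∈ Φ → ∃ l ≤ i, β + -δ j = -δ l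

end Combinatorics

/-- `N⁺`, the sum of the positive root spaces. -/
def nPlus (𝔤 : Submodule F (Module.End F V)) (T : Subgroup (LinearMap.GeneralLinearGroup F V))
    (P : Set (Char T)) : Submodule F (Module.End F V) :=
  ⨆ δ ∈ P, rootSpace 𝔤 T δ

/-- `N⁻`, the sum of the negative root spaces. -/
def nMinus (𝔤 : Submodule F (Module.End F V)) (T : Subgroup (LinearMap.GeneralLinearGroup F V))
    (P : Set (Char T)) : Submodule F (Module.End F V) :=
  ⨆ δ ∈ P, rootSpace 𝔤 T (-δ)

/-- `P₀ = 𝒵 + 𝒩₀⁺`, where `𝒵 = H ⊕ ⊕_{δ ∈ Φ₁} 𝔤_δ` and `𝒩₀⁺ = ⊕ 𝔤_{δ_i}`. -/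
noncomputable def parabolic (𝒱 : Γ → Submodule F V) (𝔤 : Submodule F (Module.End F V))
    (T : Subgroup (LinearMap.GeneralLinearGroup F V)) (Φ₁ : Set (Char T)) {m : ℕ}
    (δ : Fin m → Char T) : Submodule F (Module.End F V) :=
  (lieOf 𝒱 T ⊔ ⨆ β ∈ Φ₁, rootSpace 𝔤 T β) ⊔ ⨆ i, rootSpace 𝔤 T (δ i)

theorem HasRootDecomposition.torus_le {𝒱 : Γ → Submodule F V} {𝔤 : Submodule F (Module.End F V)}
    {T : Subgroup (LinearMap.GeneralLinearGroup F V)} (h : HasRootDecomposition 𝒱 𝔤 T) :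
    lieOf 𝒱 T ≤ 𝔤 :=
  le_sup_left.trans h.sum_eq.ge

theorem HasRootDecomposition.parabolic_le {𝒱 : Γ → Submodule F V}
    {𝔤 : Submodule F (Module.End F V)} {T : Subgroup (LinearMap.GeneralLinearGroup F V)}
    (h : HasRootDecomposition 𝒱 𝔤 T) (Φ₁ : Set (Char T)) {m : ℕ} (δ : Fin m → Char T) :
    parabolic 𝒱 𝔤 T Φ₁ δ ≤ 𝔤 :=
  sup_le (sup_le h.torus_le (iSup₂_le fun _ _ => inf_le_left)) (iSup_le fun _ => inf_le_left)

/-- `χ = χs + χn` is a linear function in `𝔤*_{f,0}` in the standard form. -/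
structure IsStandardForm (ε : Bicharacter Γ F) (𝒱 : Γ → Submodule F V)
    (𝔤 : Submodule F (Module.End F V)) (T : Subgroup (LinearMap.GeneralLinearGroup F V))
    (P : Set (Char T)) (χ χs χn : 𝔤 →ₗ[F] F) : Prop where
  degree_zero : ∀ α, α ≠ 0 → ∀ x : 𝔤, (x : Module.End F V) ∈ homEnd 𝒱 α → χ x = 0
  eq_add : χ = χs + χn
  semisimple_part : ∀ x : 𝔤, (x : Module.End F V) ∈ nPlus 𝔤 T P ⊔ nMinus 𝔤 T P → χs x = 0
  nilpotent_part : ∀ x : 𝔤, (x : Module.End F V) ∈ lieOf 𝒱 T ⊔ nPlus 𝔤 T P → χn x = 0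
  root_vectors : ∀ δ ∈ P, ∀ α β, ∀ e ∈ rootSpace 𝔤 T δ ⊓ homEnd 𝒱 α,
    ∀ f ∈ rootSpace 𝔤 T (-δ) ⊓ homEnd 𝒱 β, ∀ h : 𝔤,
    (h : Module.End F V) = colorBracket ε α β e f → χ h ≠ 0 →
    ∀ x : 𝔤, (x : Module.End F V) ∈ rootSpace 𝔤 T δ ⊔ rootSpace 𝔤 T (-δ) → χ x = 0

end Roots

/-! ### Reduced enveloping algebras -/

section Enveloping

variable {Γ F V : Type*} [AddCommGroup Γ] [Field F] [AddCommGroup V] [Module F V]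

/-- The defining relations of `u_χ(S)`: those of `U(S)`, and `x^p - x^{[p]} = χ(x)^p` for the
homogeneous `x ∈ S` of even degree. -/
inductive RedRel (p : ℕ) (ε : Bicharacter Γ F) (𝒱 : Γ → Submodule F V)
    {𝔤 : Submodule F (Module.End F V)} (χ : 𝔤 →ₗ[F] F) (S : Submodule F (Module.End F V)) :
    TensorAlgebra F S → TensorAlgebra F S → Prop
  | bracket (α β : Γ) (x y z : S) (hx : (x : Module.End F V) ∈ homEnd 𝒱 α)
      (hy : (y : Module.End F V) ∈ homEnd 𝒱 β)
      (hz : (z : Module.End F V) = colorBracket ε α β x y) :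
      RedRel p ε 𝒱 χ S (TensorAlgebra.ι F x * TensorAlgebra.ι F y)
        ((ε α β : F) • (TensorAlgebra.ι F y * TensorAlgebra.ι F x) + TensorAlgebra.ι F z)
  | power (α : Γ) (hα : ε α α = 1) (x z : S) (w : 𝔤) (hx : (x : Module.End F V) ∈ homEnd 𝒱 α)
      (hz : (z : Module.End F V) = (x : Module.End F V) ^ p)
      (hw : (w : Module.End F V) = (x : Module.End F V)) :
      RedRel p ε 𝒱 χ S (TensorAlgebra.ι F x ^ p)
        (TensorAlgebra.ι F z + algebraMap F (TensorAlgebra F S) (χ w ^ p))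

/-- The `χ`-reduced enveloping algebra `u_χ(S)` of a restricted Lie color subalgebra `S ⊆ 𝔤`, for a
linear function `χ` on `𝔤` that vanishes on `𝔤_α` for `α ≠ 0`. -/
abbrev RedEnv (p : ℕ) (ε : Bicharacter Γ F) (𝒱 : Γ → Submodule F V)
    {𝔤 : Submodule F (Module.End F V)} (χ : 𝔤 →ₗ[F] F) (S : Submodule F (Module.End F V)) :
    Type _ :=
  RingQuot (RedRel p ε 𝒱 χ S)

variable (p : ℕ) (ε : Bicharacter Γ F) (𝒱 : Γ → Submodule F V)
  {𝔤 : Submodule F (Module.End F V)} (χ : 𝔤 →ₗ[F] F)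

/-- The canonical map `S → u_χ(S)`. -/
noncomputable def RedEnv.ι (S : Submodule F (Module.End F V)) : S →ₗ[F] RedEnv p ε 𝒱 χ S :=
  (RingQuot.mkAlgHom F (RedRel p ε 𝒱 χ S)).toLinearMap ∘ₗ TensorAlgebra.ι F

/-- The canonical homomorphism `u_χ(S) → u_χ(S')` for `S ⊆ S'`. -/
noncomputable def RedEnv.map {S S' : Submodule F (Module.End F V)} (h : S ≤ S') :
    RedEnv p ε 𝒱 χ S →ₐ[F] RedEnv p ε 𝒱 χ S' :=
  RingQuot.liftAlgHom F ⟨TensorAlgebra.lift F (RedEnv.ι p ε 𝒱 χ S' ∘ₗ Submodule.inclusion h), by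
    intro a b hab
    cases hab with
    | bracket α β x y z hx hy hz =>
      have := RingQuot.mkAlgHom_rel F (RedRel.bracket (p := p) (ε := ε) (𝒱 := 𝒱) (χ := χ) (S := S')
        α β (Submodule.inclusion h x) (Submodule.inclusion h y) (Submodule.inclusion h z) hx hy hz)
      simpa [RedEnv.ι] using this
    | power α hα x z w hx hz hw =>
      have := RingQuot.mkAlgHom_rel F (RedRel.power (p := p) (ε := ε) (𝒱 := 𝒱) (χ := χ) (S := S')
        α hα (Submodule.inclusion h x) (Submodule.inclusion h z) w hx hz hw)
      simpa [RedEnv.ι] using this⟩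

/-- For a family `𝒢` of subspaces indexed by an abelian group `A`: the span in `u_χ(S)` of the
products `x_1 ⋯ x_n` with `x_i ∈ S ∩ 𝒢 a_i` and `a_1 + ⋯ + a_n = a`. This gives the `Γ`-grading of
`u_χ(S)` and the weight spaces of a torus. -/
def RedEnv.piece (S : Submodule F (Module.End F V)) {A : Type*} [AddCommGroup A]
    (𝒢 : A → Submodule F (Module.End F V)) (a : A) : Submodule F (RedEnv p ε 𝒱 χ S) :=
  Submodule.span F {u | ∃ l : List (A × S), (∀ q ∈ l, (q.2 : Module.End F V) ∈ 𝒢 q.1) ∧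
    (l.map Prod.fst).sum = a ∧ u = (l.map fun q => RedEnv.ι p ε 𝒱 χ S q.2).prod}

/-- The left ideal `u_χ(𝔤) N⁺` of `u_χ(𝔤)`. -/
def nPlusIdeal (T : Subgroup (LinearMap.GeneralLinearGroup F V)) (P : Set (Char T)) :
    Submodule (RedEnv p ε 𝒱 χ 𝔤) (RedEnv p ε 𝒱 χ 𝔤) :=
  Submodule.span _ {u | ∃ x : 𝔤, (x : Module.End F V) ∈ nPlus 𝔤 T P ∧ u = RedEnv.ι p ε 𝒱 χ 𝔤 x}

/-- `y ∈ u_χ(H)` is the image of `x ∈ u_χ(𝔤)` under the Harish-Chandra homomorphism, for `χ`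
standard semisimple: `x` has `T`-weight zero, and `y` is its component in `u_χ(H)` for the
decomposition `u_χ(𝔤)_0 = u_χ(H) ⊕ (u_χ(𝔤) N⁺ ∩ u_χ(𝔤)_0)`. -/
def IsHarishChandraImage {T : Subgroup (LinearMap.GeneralLinearGroup F V)} (P : Set (Char T))
    (hH : lieOf 𝒱 T ≤ 𝔤) (x : RedEnv p ε 𝒱 χ 𝔤) (y : RedEnv p ε 𝒱 χ (lieOf 𝒱 T)) : Prop :=
  x ∈ RedEnv.piece p ε 𝒱 χ 𝔤 (conjWeight T) 0 ∧
    x - RedEnv.map p ε 𝒱 χ hH y ∈ nPlusIdeal p ε 𝒱 χ T P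

/-- `e_1^{p̄-1} ⋯ e_m^{p̄-1} f_1^{p̄-1} ⋯ f_m^{p̄-1} ∈ u_χ(𝔤)`. -/
noncomputable def topElement {m : ℕ} (e f : Fin m → 𝔤) : RedEnv p ε 𝒱 χ 𝔤 :=
  (List.ofFn fun i => RedEnv.ι p ε 𝒱 χ 𝔤 (e i) ^ (pbar p ε 𝒱 (e i : Module.End F V) - 1)).prod *
  (List.ofFn fun i => RedEnv.ι p ε 𝒱 χ 𝔤 (f i) ^ (pbar p ε 𝒱 (f i : Module.End F V) - 1)).prod

end Enveloping

/-! ### Graded modules and induction -/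

section Modules

variable {Γ F : Type*} [AddCommGroup Γ] [Field F]

/-- A graded module is simple if it is nonzero and has no graded submodules besides `0` and
itself. -/
def IsGradedSimple (A : Type*) [Ring A] [Algebra F A] {W : Type*} [AddCommGroup W] [Module F W]
    [Module A W] [IsScalarTower F A W] (𝒲 : Γ → Submodule F W) : Prop :=
  Nontrivial W ∧
    ∀ N : Submodule A W, IsGradedSub 𝒲 (N.restrictScalars F) → N = ⊥ ∨ N = ⊤

/-- The relations `ab ⊗ m = a ⊗ bm`. -/
def balancing {A B : Type*} [Ring A] [Algebra F A] [Ring B] [Algebra F B] (φ : B →ₐ[F] A)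
    (M : Type*) [AddCommGroup M] [Module F M] [Module B M] : Submodule A (A ⊗[F] M) :=
  Submodule.span A {w | ∃ (a : A) (b : B) (m : M), w = (a * φ b) ⊗ₜ[F] m - a ⊗ₜ[F] (b • m)}

/-- The induced module `A ⊗_B M` for a homomorphism `B → A`. -/
abbrev Induced {A B : Type*} [Ring A] [Algebra F A] [Ring B] [Algebra F B] (φ : B →ₐ[F] A)
    (M : Type*) [AddCommGroup M] [Module F M] [Module B M] : Type _ :=
  (A ⊗[F] M) ⧸ balancing φ M

/-- The grading of `A ⊗_B M`: the component of degree `γ` is spanned by the `a ⊗ m` with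
`deg a + deg m = γ`. -/
def Induced.grade {A B : Type*} [Ring A] [Algebra F A] [Ring B] [Algebra F B] (φ : B →ₐ[F] A)
    {M : Type*} [AddCommGroup M] [Module F M] [Module B M] (𝒜 : Γ → Submodule F A)
    (ℳ : Γ → Submodule F M) (γ : Γ) : Submodule F (Induced φ M) :=
  Submodule.span F {w | ∃ α β, α + β = γ ∧ ∃ a ∈ 𝒜 α, ∃ m ∈ ℳ β,
    w = Submodule.Quotient.mk (a ⊗ₜ[F] m)}

variable {V : Type*} [AddCommGroup V] [Module F V] (p : ℕ) (ε : Bicharacter Γ F)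
  (𝒱 : Γ → Submodule F V) {𝔤 : Submodule F (Module.End F V)} (χ : 𝔤 →ₗ[F] F)

/-- `M = ⊕ ℳ γ` is a graded `u_χ(S)`-module. -/
structure IsGradedModule (S : Submodule F (Module.End F V)) {M : Type*} [AddCommGroup M]
    [Module F M] [Module (RedEnv p ε 𝒱 χ S) M] (ℳ : Γ → Submodule F M) : Prop where
  grading : IsGrading ℳ
  smul_mem : ∀ α β, ∀ x : S, (x : Module.End F V) ∈ homEnd 𝒱 α → ∀ m ∈ ℳ β,
    RedEnv.ι p ε 𝒱 χ S x • m ∈ ℳ (α + β)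

/-- `v` is a maximal vector of `H`-weight `wt` in the graded `u_χ(S)`-module `M`. -/
structure IsMaximalVector (S : Submodule F (Module.End F V))
    {T : Subgroup (LinearMap.GeneralLinearGroup F V)} (P : Set (Char T))
    {M : Type*} [AddCommGroup M] [Module F M] [Module (RedEnv p ε 𝒱 χ S) M]
    (ℳ : Γ → Submodule F M) (wt : lieOf 𝒱 T →ₗ[F] F) (v : M) : Prop where
  ne_zero : v ≠ 0
  homogeneous : ∃ γ, v ∈ ℳ γ
  nPlus_smul : ∀ x : S, (x : Module.End F V) ∈ nPlus 𝔤 T P → RedEnv.ι p ε 𝒱 χ S x • v = 0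
  torus_smul : ∀ (x : S) (h : lieOf 𝒱 T), (x : Module.End F V) = (h : Module.End F V) →
    RedEnv.ι p ε 𝒱 χ S x • v = wt h • v

/-- The induced module `Z^χ(M) = u_χ(𝔤) ⊗_{u_χ(S)} M` of a graded `u_χ(S)`-module is simple (as a
graded `u_χ(𝔤)`-module). -/
def InducedIsSimple {S : Submodule F (Module.End F V)} (hS : S ≤ 𝔤) {M : Type*} [AddCommGroup M]
    [Module F M] [Module (RedEnv p ε 𝒱 χ S) M] (ℳ : Γ → Submodule F M) : Prop :=
  IsGradedSimple (RedEnv p ε 𝒱 χ 𝔤) (W := Induced (RedEnv.map p ε 𝒱 χ hS) M)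
    (Induced.grade (RedEnv.map p ε 𝒱 χ hS) (RedEnv.piece p ε 𝒱 χ 𝔤 (homEnd 𝒱)) ℳ)

end Modules

end ColorLie

namespace ColorLie

/-! ### Commutators and `p`-th powers in characteristic `p`. -/

section CharP

variable {F : Type*} [Field F] (p : ℕ) [CharP F p]

/-! Write `W` for the induced module, `τ x` for `1 ⊗ x`, and `e^top`, `f^top` for the two halves of
the element in question. By a Poincaré–Birkhoff–Witt theorem (`IsHomFamily.exists_pbw`,
`IsHomFamily.exists_coeff`) the reduced enveloping algebra of `𝔤` is a free right module over that
of `P₀`, with basis the monomials `f_1^{k_1} ⋯ f_m^{k_m}`, `k_j < p̄`. Hence an element of `W` has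
unique coordinates `κ k` in `M` (`RootData.exists_coordinates`). The remaining arguments are mostly
about weights, taken in the character group of `T`, where a nonempty sum of positive roots is never
zero: a correction term vanishes because no monomial has its weight.

The product `e^top f^top` has weight zero. Sorting it modulo the left ideal of `N⁺` leaves an
element of `u(H)`, its Harish-Chandra image, so `e^top f^top τ v = c τ v`, where `c` is the value of
the weight at that image. Sorting uses only the bracket relations, so it can be done in the algebras
for `χ` and `χs` at once (`RootData.exists_hc_image`); on `H` the two functions agree. The image is
unique because a linear projection onto `u(H)` kills the left ideal
(`RootData.exists_hc_projection`).

Let `c ≠ 0` and let `N` be a nonzero graded submodule. Multiplying a nonzero element of `N` by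
suitable powers of `f_1`, then `f_2`, and so on, raises all exponents to the top, so `N` contains
some `f^top τ x` with `x ≠ 0` (`InducedData.exists_top_smul_mem`). The Levi part commutes with
`f^top` up to scalars and multiples of `f^top` (`RootData.levi_mul_top`), and the `e_j` annihilate
`M`. So the `x` with `f^top τ x ∈ N` form a graded submodule of `M`, which is all of `M`. Now `f^top
τ v ∈ N`, and applying `e^top` gives `c τ v ∈ N`; simplicity of `M` gives `τ M ⊆ N`, and `τ M`
generates `W`.

Let `c = 0`. The vector `f^top τ v` is killed by the root vectors of the last positive system of the
triple, which contains `Φ₁⁺` and all `-δ_j`. Going back through the chain of positive systems,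
multiply by the largest powers `e_m^{s_m}`, then `e_{m-1}^{s_{m-1}}`, and so on, that do not give
zero (`InducedData.exists_e_word`). The result is nonzero and killed by `N⁺`. As `e^top f^top τ v =
0`, the exponents are not all maximal, so its weight is strictly below that of `τ v` and its
component in `M` is zero. Such a vector generates a proper graded submodule
(`InducedData.not_isGradedSimple`).

The PBW theorem is proved by Bergman's diamond lemma (`wordLift_normalForm_rule`). Overlaps of two
quadratic rules are resolved by the color Jacobi identity, where `p > 3` allows division by 2 and 3;
overlaps with a `p`-th power rule are resolved by `[x, y^p] = (ad y)^p x`. -/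

theorem choose_prime_pred_cast (hp : p.Prime) (m : ℕ) (hm : m ≤ p - 1) :
    (((p - 1).choose m : ℕ) : F) = (-1) ^ m := by
  induction m with
  | zero => simp
  | succ k ih =>
    have hk := ih (by omega)
    have h1 : (p - 1).choose k + (p - 1).choose (k + 1) = p.choose (k + 1) := by
      obtain ⟨q, rfl⟩ : ∃ q, p = q + 1 := ⟨p - 1, by have := hp.pos; omega⟩
      simp [Nat.choose_succ_succ]
    have h2 : ((p.choose (k + 1) : ℕ) : F) = 0 :=
      (CharP.cast_eq_zero_iff F p _).2 (hp.dvd_choose_self (by omega) (by omega))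
    rw [← h1, Nat.cast_add, hk] at h2
    rw [pow_succ]
    linear_combination h2

variable [Fact p.Prime]

/-- In characteristic `p`, `(R - L)^(p-1) = ∑ L^t R^(p-1-t)` for commuting `L` and `R`. -/
theorem sub_pow_prime_pred {A : Type*} [Ring A] [Algebra F A] {L R : A} (h : Commute L R) :
    (R - L) ^ (p - 1) = ∑ t ∈ Finset.range p, L ^ t * R ^ (p - 1 - t) := by
  have hp : p.Prime := Fact.out
  have h' : Commute (-L) R := h.neg_left
  have e : R - L = -L + R := by abel
  rw [e, h'.add_pow, Nat.sub_add_cancel hp.one_le]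
  refine Finset.sum_congr rfl fun t ht => ?_
  have ht' : t ≤ p - 1 := by have := Finset.mem_range.1 ht; omega
  have hc : (((p - 1).choose t : ℕ) : A) = algebraMap F A ((-1) ^ t) := by
    rw [← choose_prime_pred_cast p hp t ht', map_natCast]
  rw [hc, ← Algebra.commutes, ← mul_assoc, neg_pow L t, ← mul_assoc, map_pow, map_neg, map_one,
    ← pow_add, Even.neg_one_pow ⟨t, rfl⟩, one_mul]

/-- The geometric sum for exponent `p - 1` telescopes when multiplied by `R - L`. -/
theorem sub_pow_prime {A : Type*} [Ring A] [Algebra F A] {L R : A} (h : Commute L R) :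
    (R - L) ^ p = R ^ p - L ^ p := by
  have hp : p.Prime := Fact.out
  have e : (R - L) ^ p = (R - L) * (R - L) ^ (p - 1) := by
    rw [← pow_succ', Nat.sub_add_cancel hp.one_le]
  rw [e, sub_pow_prime_pred (F := F) p h]
  have := h.mul_neg_geom_sum₂ p
  rw [← neg_sub L R, neg_mul]
  have h2 := h.mul_geom_sum₂ p
  rw [h2]; abel

section

variable {A : Type*} [Ring A]

/-- The coefficients need not commute, so the usual power rule becomes a sum over the position of
the differentiated factor. For a linear polynomial this sum will be recognized as an iterated
commutator. -/
theorem derivative_noncomm_pow (Q : Polynomial A) (n : ℕ) :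
    Polynomial.derivative (Q ^ n) =
      ∑ k ∈ Finset.range n, Q ^ k * Polynomial.derivative Q * Q ^ (n - 1 - k) := by
  induction n with
  | zero => simp
  | succ n ih =>
    rw [pow_succ, Polynomial.derivative_mul, ih, Finset.sum_range_succ, Finset.sum_mul]
    congr 1
    · refine Finset.sum_congr rfl fun k hk => ?_
      have : n + 1 - 1 - k = (n - 1 - k) + 1 := by have := Finset.mem_range.1 hk; omega
      rw [this, pow_succ]; simp only [mul_assoc]
    · simp

theorem mem_of_iterate_commutator [Algebra F A] (R : Submodule F A) (Q : A)
    (hQ : ∀ r ∈ R, r * Q - Q * r ∈ R) (n : ℕ) (r : A) (hr : r ∈ R) :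
    ((LinearMap.mulRight F Q - LinearMap.mulLeft F Q) ^ n) r ∈ R := by
  induction n with
  | zero => simpa
  | succ n ih =>
    rw [pow_succ', Module.End.mul_apply]
    simpa using hQ _ ih

/-- Left and right multiplication by `a` commute, so the geometric sum formula applies to these
operators. The case `q = 1` serves Jacobson's formula; `q` a value of the bicharacter serves the
overlap of a letter with a `p`-th power. -/
theorem sum_pow_mul_pow [Algebra F A] (q : F) (a x : A) :
    ∑ t ∈ Finset.range p, q ^ t • (a ^ t * x * a ^ (p - 1 - t)) =
      ((LinearMap.mulRight F a - q • LinearMap.mulLeft F a) ^ (p - 1)) x := by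
  have hc : Commute (q • LinearMap.mulLeft F a) (LinearMap.mulRight F a) := by
    refine Commute.smul_left ?_ q
    exact LinearMap.ext fun c => (mul_assoc a c a).symm
  rw [sub_pow_prime_pred (F := F) p hc, LinearMap.sum_apply]
  refine Finset.sum_congr rfl fun t _ => ?_
  simp [smul_pow, LinearMap.pow_mulLeft, LinearMap.pow_mulRight, mul_assoc]

/-- This is `(ad a)^p = ad (a^p)`, with a twist by `q`: the Frobenius identity for the commuting
operators of left and right multiplication. -/
theorem pow_prime_commutator [Algebra F A] (q : F) (a x : A) :
    ((LinearMap.mulRight F a - q • LinearMap.mulLeft F a) ^ p) x =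
      x * a ^ p - q ^ p • (a ^ p * x) := by
  have hc : Commute (q • LinearMap.mulLeft F a) (LinearMap.mulRight F a) := by
    refine Commute.smul_left ?_ q
    exact LinearMap.ext fun c => (mul_assoc a c a).symm
  rw [sub_pow_prime (F := F) p hc]
  simp [smul_pow, LinearMap.pow_mulLeft, LinearMap.pow_mulRight]

open Polynomial in
/-- Jacobson's formula: `(X + Y)^p - X^p - Y^p` is a Lie polynomial in `X` and `Y`. -/
theorem add_pow_prime_sub_mem [Algebra F A] (R : Submodule F A) (X Y : A) (hX : X ∈ R)
    (hXR : ∀ r ∈ R, r * X - X * r ∈ R) (hYR : ∀ r ∈ R, r * Y - Y * r ∈ R) :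
    (X + Y) ^ p - X ^ p - Y ^ p ∈ R := by
  have hp : p.Prime := Fact.out
  -- Expand `(tX + Y)^p` in a central variable `t`. Its derivative in `t` is the `(p-1)`-fold
  -- commutator of `X` with `tX + Y`, so the derivative has coefficients in `R`.
  set Q : A[X] := C X * Polynomial.X + C Y with hQdef
  let RR : Submodule F A[X] :=
    { carrier := {f | ∀ n, f.coeff n ∈ R}
      add_mem' := fun hf hg n => by rw [coeff_add]; exact R.add_mem (hf n) (hg n)
      zero_mem' := fun n => by simp
      smul_mem' := fun c f hf n => by rw [coeff_smul]; exact R.smul_mem c (hf n) }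
  have hQ : ∀ r ∈ RR, r * Q - Q * r ∈ RR := by
    intro r hr n
    have e : r * Q - Q * r = (r * C X - C X * r) * Polynomial.X + (r * C Y - C Y * r) := by
      rw [hQdef, mul_add, add_mul, sub_mul, ← mul_assoc, mul_assoc (C X) Polynomial.X r, X_mul,
        ← mul_assoc]
      abel
    rw [e]
    cases n with
    | zero => simpa using hYR _ (hr 0)
    | succ n =>
      rw [coeff_add, coeff_mul_X]
      simpa using R.add_mem (hXR _ (hr n)) (hYR _ (hr (n + 1)))
  have hder : derivative (Q ^ p) ∈ RR := by
    have hdQ : derivative Q = C X := by simp [hQdef]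
    have h1 := sum_pow_mul_pow (F := F) p 1 Q (C X)
    rw [derivative_noncomm_pow, hdQ]
    simp only [one_pow, one_smul] at h1
    rw [h1]
    refine mem_of_iterate_commutator RR Q hQ _ _ fun n => ?_
    rw [coeff_C]; split_ifs
    · exact hX
    · exact R.zero_mem
  have hdeg : Q.natDegree ≤ 1 := by
    rw [hQdef]; exact natDegree_linear_le
  have hdegp : (Q ^ p).natDegree < p + 1 := by
    have := natDegree_pow_le_of_le p hdeg
    omega
  -- Differentiation multiplies this coefficient by `n + 1`, which is invertible below `p`. Only the
  -- two extreme coefficients, `X^p` and `Y^p`, escape.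
  have hcoef : ∀ n, n + 1 < p → (Q ^ p).coeff (n + 1) ∈ R := by
    intro n hn
    have h := hder n
    rw [coeff_derivative] at h
    have hne : ((n + 1 : ℕ) : F) ≠ 0 := by
      rw [Ne, CharP.cast_eq_zero_iff F p]
      exact fun h => absurd (Nat.le_of_dvd (by omega) h) (by omega)
    have h3 : (Q ^ p).coeff (n + 1) = ((n + 1 : ℕ) : F)⁻¹ • ((Q ^ p).coeff (n + 1) * ((n : A) + 1)) := by
      have : ((n : A) + 1) = algebraMap F A ((n + 1 : ℕ) : F) := by simp
      rw [this, ← Algebra.commutes, ← Algebra.smul_def, smul_smul, inv_mul_cancel₀ hne, one_smul]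
    rw [h3]; exact R.smul_mem _ h
  have hev : (X + Y) ^ p = ∑ i ∈ Finset.range (p + 1), (Q ^ p).coeff i := by
    let φ : A[X] →+* A := eval₂RingHom' (RingHom.id A) 1 (fun a => Commute.one_right _)
    have hφ : φ Q = X + Y := by
      simp [φ, hQdef, eval₂RingHom']
    have : φ (Q ^ p) = (X + Y) ^ p := by rw [map_pow, hφ]
    rw [← this]
    have h2 : φ (Q ^ p) = eval₂ (RingHom.id A) 1 (Q ^ p) := rfl
    rw [h2, eval₂_eq_sum_range' _ hdegp]
    simp
  have h0 : (Q ^ p).coeff 0 = Y ^ p := by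
    have : constantCoeff (Q ^ p) = constantCoeff Q ^ p := map_pow _ _ _
    simpa [hQdef] using this
  have hpc : (Q ^ p).coeff p = X ^ p := by
    have := coeff_pow_of_natDegree_le (m := p) (n := 1) hdeg
    rw [mul_one] at this
    rw [this, hQdef]; simp [coeff_C]
  obtain ⟨k, hk⟩ : ∃ k, p = k + 1 := ⟨p - 1, by have := hp.pos; omega⟩
  have : (X + Y) ^ p - X ^ p - Y ^ p = ∑ i ∈ Finset.range k, (Q ^ p).coeff (i + 1) := by
    rw [hev, Finset.sum_range_succ, hpc]
    conv_lhs => rw [show Finset.range p = Finset.range (k + 1) by rw [hk]]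
    rw [Finset.sum_range_succ', h0]; abel
  rw [this]
  exact R.sum_mem fun i hi => hcoef i (by have := Finset.mem_range.1 hi; omega)

end

end CharP

/-! ### Words in an ordered alphabet and their normal forms. -/

section WordProduct

variable {I A : Type*} [Ring A]

/-- The product of the elements of `A` named by the letters of a word. -/
def wd (β : I → A) (w : List I) : A := (w.map β).prod

@[simp] theorem wd_nil (β : I → A) : wd β [] = 1 := rfl
@[simp] theorem wd_cons (β : I → A) (i : I) (w : List I) : wd β (i :: w) = β i * wd β w := by
  simp [wd]
theorem wd_append (β : I → A) (u w : List I) : wd β (u ++ w) = wd β u * wd β w := by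
  simp [wd]
theorem wd_replicate (β : I → A) (n : ℕ) (i : I) : wd β (List.replicate n i) = β i ^ n := by
  simp [wd]

end WordProduct

section Words

variable {I : Type*} [LinearOrder I]

/-- The number of inversions of a word. -/
def inversions : List I → ℕ
  | [] => 0
  | a :: l => l.countP (· < a) + inversions l

/-- Every other letter sees the same letters to its right, so only the exchanged pair changes the
count. -/
theorem inversions_swap (a b : List I) {i j : I} (h : i < j) :
    inversions (a ++ [i, j] ++ b) < inversions (a ++ [j, i] ++ b) := by
  induction a with
  | nil => simp [inversions, h, h.not_gt]; omega
  | cons x a ih =>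
    simp only [List.cons_append, inversions]
    have : List.countP (· < x) (a ++ [i, j] ++ b) = List.countP (· < x) (a ++ [j, i] ++ b) :=
      List.Perm.countP_eq _ (((List.Perm.swap _ _ []).append_left a).append_right b)
    rw [this]; omega

/-- The order on words used for rewriting is generated by shortening and by sorting two adjacent
letters. -/
inductive WordStep : List I → List I → Prop
  | len {u v : List I} (h : u.length < v.length) : WordStep u v
  | swap (a b : List I) {i j : I} (h : i < j) : WordStep (a ++ [i, j] ++ b) (a ++ [j, i] ++ b)

/-- The strict order on words generated by `WordStep`. -/
def WordLT : List I → List I → Prop := Relation.TransGen WordStep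

/-- The pair (length, number of inversions) decreases lexicographically. -/
theorem wordStep_wf : WellFounded (WordStep (I := I)) := by
  refine Subrelation.wf (r := InvImage (Prod.Lex (· < ·) (· < ·))
    (fun w : List I => (w.length, inversions w))) ?_
    (InvImage.wf _ (WellFounded.prod_lex wellFounded_lt wellFounded_lt))
  intro u v h
  cases h with
  | len h => exact Prod.Lex.left _ _ h
  | swap a b h =>
    rename_i i j
    have e : (a ++ [i, j] ++ b).length = (a ++ [j, i] ++ b).length := by
      simp only [List.length_append, List.length_cons, List.length_nil]
    show Prod.Lex _ _ (_, _) (_, _)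
    rw [e]
    exact Prod.Lex.right _ (inversions_swap a b h)

theorem wordLT_wf : WellFounded (WordLT (I := I)) := wordStep_wf.transGen

theorem WordLT.of_length {u v : List I} (h : u.length < v.length) : WordLT u v :=
  Relation.TransGen.single (.len h)

theorem WordLT.of_swap (a b : List I) {i j : I} (h : i < j) :
    WordLT (a ++ [i, j] ++ b) (a ++ [j, i] ++ b) :=
  Relation.TransGen.single (.swap a b h)

theorem WordLT.trans {u v w : List I} (h : WordLT u v) (h' : WordLT v w) : WordLT u w :=
  Relation.TransGen.trans h h'

theorem WordStep.append {u v : List I} (h : WordStep u v) (a b : List I) :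
    WordStep (a ++ u ++ b) (a ++ v ++ b) := by
  cases h with
  | len h => exact .len (by simp; omega)
  | swap c d h =>
    have := WordStep.swap (a ++ c) (d ++ b) h
    simpa only [List.append_assoc] using this

theorem WordLT.append {u v : List I} (h : WordLT u v) (a b : List I) :
    WordLT (a ++ u ++ b) (a ++ v ++ b) :=
  Relation.TransGen.lift (fun w => a ++ w ++ b) (fun _ _ h => WordStep.append h a b) _ _ h

variable (od pw : I → Prop) (p : ℕ)

/-- The left hand sides of the rewriting rules. -/
inductive IsRedex : List I → Prop
  | swap {i j : I} (h : i < j) : IsRedex [j, i]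
  | square {i : I} (h : od i) : IsRedex [i, i]
  | power {i : I} (h : pw i) : IsRedex (List.replicate p i)

/-- The words to which no rewriting rule applies. -/
def Normal (w : List I) : Prop := ∀ W, IsRedex od pw p W → ¬ W <:+: w

variable {od pw p}

theorem Normal.of_infix {w w' : List I} (h : Normal od pw p w) (h' : w' <:+: w) :
    Normal od pw p w' := fun W hW hi => h W hW (hi.trans h')

theorem replicate_count_prefix {i : I} {l : List I} (hs : l.Pairwise (· ≤ ·))
    (hi : ∀ x ∈ l, i ≤ x) : List.replicate (l.count i) i <+: l := by
  induction l with
  | nil => simp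
  | cons b l ih =>
    rw [List.pairwise_cons] at hs
    by_cases hb : b = i
    · subst hb
      rw [List.count_cons_self, List.replicate_succ, List.prefix_cons_inj]
      exact ih hs.2 fun x hx => hi x (List.mem_cons_of_mem _ hx)
    · have hlt : i < b := lt_of_le_of_ne (hi b List.mem_cons_self) (Ne.symm hb)
      have : (b :: l).count i = 0 := by
        rw [List.count_eq_zero]
        intro h
        rcases List.mem_cons.1 h with h | h
        · exact hb h.symm
        · exact absurd (hs.1 i h) (not_le.2 hlt)
      rw [this]; simp

/-- Equal letters of a sorted word are adjacent. This turns the absence of forbidden subwords into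
bounds on multiplicities. -/
theorem replicate_count_infix (i : I) {l : List I} (hs : l.Pairwise (· ≤ ·)) :
    List.replicate (l.count i) i <:+: l := by
  induction l with
  | nil => simp
  | cons b l ih =>
    by_cases hb : b < i
    · rw [List.count_cons_of_ne hb.ne]
      exact List.infix_cons (ih (List.pairwise_cons.1 hs).2)
    · refine (replicate_count_prefix hs fun x hx => ?_).isInfix
      rcases List.mem_cons.1 hx with rfl | hx
      · exact not_lt.1 hb
      · exact (not_lt.1 hb).trans ((List.pairwise_cons.1 hs).1 x hx)

theorem Normal.sorted {w : List I} (h : Normal od pw p w) : w.Pairwise (· ≤ ·) := by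
  rw [← List.isChain_iff_pairwise]
  induction w with
  | nil => simp
  | cons a l ih =>
    have hl := ih (h.of_infix (List.suffix_cons a l).isInfix)
    cases l with
    | nil => simp
    | cons b l =>
      rw [List.isChain_cons_cons]
      refine ⟨not_lt.1 fun hlt => h _ (.swap hlt) ⟨[], l, rfl⟩, hl⟩

theorem normal_iff {w : List I} : Normal od pw p w ↔ w.Pairwise (· ≤ ·) ∧
    (∀ i, od i → w.count i < 2) ∧ (∀ i, pw i → w.count i < p) := by
  constructor
  · intro h
    refine ⟨h.sorted, fun i hi => ?_, fun i hi => ?_⟩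
    · by_contra hc
      refine h _ (.square hi) (List.IsInfix.trans ?_ (replicate_count_infix i h.sorted))
      exact ⟨[], List.replicate (w.count i - 2) i, by
        rw [List.nil_append, show [i, i] = List.replicate 2 i from rfl, List.replicate_append_replicate]
        congr 1; omega⟩
    · by_contra hc
      refine h _ (.power hi) (List.IsInfix.trans ?_ (replicate_count_infix i h.sorted))
      exact ⟨[], List.replicate (w.count i - p) i, by
        rw [List.nil_append, List.replicate_append_replicate]
        congr 1; omega⟩
  · rintro ⟨hs, ho, hp⟩ W hW hi
    cases hW with
    | swap h =>
      have := hs.sublist hi.sublist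
      simp at this
      exact absurd this (not_le.2 h)
    | square h =>
      rename_i i
      have h3 := hi.sublist.count_le i
      have h2 := ho _ h
      simp at h3; omega
    | @power i h =>
      have h3 := hi.sublist.count_le i
      have h2 := hp _ h
      simp at h3; omega

/-- The two words share no letter, so no multiplicity grows at the junction. -/
theorem Normal.append {u w : List I} (hu : Normal od pw p u) (hw : Normal od pw p w)
    (h : ∀ x ∈ u, ∀ y ∈ w, x < y) : Normal od pw p (u ++ w) := by
  rw [normal_iff] at *
  have key : ∀ i, u.count i = 0 ∨ w.count i = 0 := by
    intro i
    by_contra! hc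
    have h1 := List.count_pos_iff.1 (Nat.pos_of_ne_zero hc.1)
    have h2 := List.count_pos_iff.1 (Nat.pos_of_ne_zero hc.2)
    exact lt_irrefl _ (h i h1 i h2)
  refine ⟨List.pairwise_append.2 ⟨hu.1, hw.1, fun x hx y hy => (h x hx y hy).le⟩, ?_, ?_⟩
  · intro i hi
    rw [List.count_append]
    have := hu.2.1 i hi; have := hw.2.1 i hi
    rcases key i with h | h <;> omega
  · intro i hi
    rw [List.count_append]
    have := hu.2.2 i hi; have := hw.2.2 i hi
    rcases key i with h | h <;> omega

theorem not_normal_iff {w : List I} : ¬ Normal od pw p w ↔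
    ∃ a W b, IsRedex od pw p W ∧ a ++ W ++ b = w := by
  simp only [Normal, not_forall, not_not, List.IsInfix]
  constructor
  · rintro ⟨W, hW, a, b, h⟩; exact ⟨a, W, b, hW, h⟩
  · rintro ⟨a, W, b, hW, h⟩; exact ⟨W, hW, a, b, h⟩

section Span

variable {F A X : Type*} [Field F] [Ring A] [Algebra F A] [AddCommMonoid X]

variable (F) in
/-- The span of the words of length at most `n` and weight `μ` with letters in `J`. -/
def wordSpan (β : I → A) (J : Set I) (ω : I → X) (n : ℕ) (μ : X) : Submodule F A :=
  Submodule.span F {x | ∃ w : List I, (∀ i ∈ w, i ∈ J) ∧ w.length ≤ n ∧ (w.map ω).sum = μ ∧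
    x = wd β w}

variable (F od pw p) in
/-- The span of the normal words of weight `μ` with letters in `J`. -/
def normalSpan (β : I → A) (J : Set I) (ω : I → X) (μ : X) : Submodule F A :=
  Submodule.span F {x | ∃ w : List I, Normal od pw p w ∧ (∀ i ∈ w, i ∈ J) ∧ (w.map ω).sum = μ ∧
    x = wd β w}

/-- Noetherian induction: a forbidden subword is replaced by words of length at most one, or by the
sorted pair. Weight and alphabet are carried along, so one lemma yields the spanning half of PBW for
the whole algebra, for each span of `f_1, …, f_n`, and degree by degree. -/
theorem wd_mem_normalSpan (β : I → A) (J : Set I) (ω : I → X) (h2 : 2 ≤ p)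
    (hswap : ∀ i ∈ J, ∀ j ∈ J, i < j →
      ∃ c : F, β j * β i - c • (β i * β j) ∈ wordSpan F β J ω 1 (ω j + ω i))
    (hsq : ∀ i ∈ J, od i → β i * β i ∈ wordSpan F β J ω 1 (ω i + ω i))
    (hpw : ∀ i ∈ J, pw i → β i ^ p ∈ wordSpan F β J ω 1 (p • ω i))
    (w : List I) (hw : ∀ i ∈ w, i ∈ J) :
    wd β w ∈ normalSpan od pw p F β J ω (w.map ω).sum := by
  revert hw
  refine wordStep_wf.induction
    (C := fun w => (∀ i ∈ w, i ∈ J) → wd β w ∈ normalSpan od pw p F β J ω (w.map ω).sum) w ?_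
  intro w ih hw
  by_cases hn : Normal od pw p w
  · exact Submodule.subset_span ⟨w, hn, hw, rfl, rfl⟩
  obtain ⟨a, W, b, hW, rfl⟩ := not_normal_iff.1 hn
  -- A redex has at least two letters, so a replacement of length at most one shortens the whole
  -- word.
  have key : ∀ μ, μ = (W.map ω).sum → 2 ≤ W.length → ∀ x ∈ wordSpan F β J ω 1 μ,
      wd β a * x * wd β b ∈ normalSpan od pw p F β J ω ((a ++ W ++ b).map ω).sum := by
    intro μ hμ hlen x hx
    unfold wordSpan at hx
    induction hx using Submodule.span_induction with
    | mem x hx =>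
      obtain ⟨w', hJ, hl, hs, rfl⟩ := hx
      have := ih (a ++ w' ++ b) (.len (by simp; omega)) (by
        intro i hi
        simp only [List.mem_append] at hi hw
        rcases hi with (hi | hi) | hi
        · exact hw _ (.inl (.inl hi))
        · exact hJ _ hi
        · exact hw _ (.inr hi))
      rw [wd_append, wd_append] at this
      convert this using 2
      simp [hs, hμ]
    | zero => simp
    | add x y _ _ hx hy => rw [mul_add, add_mul]; exact Submodule.add_mem _ hx hy
    | smul c x _ hx =>
      rw [mul_smul_comm, smul_mul_assoc]; exact Submodule.smul_mem _ _ hx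
  have hWJ : ∀ i ∈ W, i ∈ J := fun i hi => hw i (by simp [hi])
  rw [wd_append, wd_append]
  cases hW with
  | @swap i j h =>
    obtain ⟨c, hc⟩ := hswap i (hWJ i (by simp)) j (hWJ j (by simp)) h
    have h1 := key _ (by simp) (by simp) _ hc
    have h3 := ih (a ++ [i, j] ++ b) (.swap a b h) (by
      intro x hx
      refine hw x ?_
      simp only [List.mem_append, List.mem_cons, List.not_mem_nil, or_false] at hx ⊢
      tauto)
    have e : ((a ++ [i, j] ++ b).map ω).sum = ((a ++ [j, i] ++ b).map ω).sum :=
      List.Perm.sum_eq ((((List.Perm.swap _ _ []).append_left a).append_right b).map ω)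
    rw [e, wd_append, wd_append] at h3
    have := Submodule.add_mem _ h1 (Submodule.smul_mem _ c h3)
    convert this using 1
    simp [mul_sub, sub_mul]
  | @square i h =>
    have := key _ (by simp) (by simp) _ (hsq i (hWJ i (by simp)) h)
    simpa using this
  | @power i h =>
    rw [wd_replicate]
    exact key _ (by simp) (by simpa using h2) _
      (hpw i (hWJ i (List.mem_replicate.2 ⟨by omega, rfl⟩)) h)

end Span

end Words

/-! ### Bergman's diamond lemma in the free algebra. -/

section Diamond

variable {I F : Type*} [LinearOrder I] [Field F]

/-- A word as an element of the free algebra. -/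
abbrev mon (w : List I) : FreeAlgebra F I := wd (FreeAlgebra.ι F) w

theorem basisFreeMonoid_apply (w : FreeMonoid I) :
    FreeAlgebra.basisFreeMonoid F I w = mon (F := F) w.toList := by
  simp [FreeAlgebra.basisFreeMonoid, FreeAlgebra.equivMonoidAlgebraFreeMonoid, wd,
    MonoidAlgebra.lift_apply, FreeMonoid.lift_apply]

/-- The linear map on the free algebra with prescribed values at the words. -/
noncomputable def wordLift {E : Type*} [AddCommGroup E] [Module F E] (g : List I → E) : FreeAlgebra F I →ₗ[F] E :=
  (FreeAlgebra.basisFreeMonoid F I).constr F (fun w => g w.toList)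

theorem wordLift_mon {E : Type*} [AddCommGroup E] [Module F E] (g : List I → E) (w : List I) :
    wordLift (F := F) g (mon (F := F) w) = g w := by
  have h := basisFreeMonoid_apply (F := F) (FreeMonoid.ofList w)
  rw [FreeMonoid.toList_ofList] at h
  rw [← h, wordLift, Module.Basis.constr_basis, FreeMonoid.toList_ofList]

/-- The span of the `a (W - f) b` for the rewriting rules `W → f` with `aWb < w`. -/
def relSpan (rule : List I → FreeAlgebra F I → Prop) (w : List I) : Submodule F (FreeAlgebra F I) :=
  Submodule.span F {x | ∃ a W f b, rule W f ∧ WordLT (a ++ W ++ b) w ∧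
    x = mon a * (mon W - f) * mon b}

theorem mul_mem_relSpan {rule : List I → FreeAlgebra F I → Prop} {v : List I} {x : FreeAlgebra F I}
    (hx : x ∈ relSpan rule v) (a b : List I) :
    mon a * x * mon b ∈ relSpan rule (a ++ v ++ b) := by
  unfold relSpan at hx
  induction hx using Submodule.span_induction with
  | mem x hx =>
    obtain ⟨a', W, f, b', h1, h2, rfl⟩ := hx
    refine Submodule.subset_span ⟨a ++ a', W, f, b' ++ b, h1, ?_, ?_⟩
    · simpa only [List.append_assoc] using h2.append a b
    · simp only [wd_append, mul_assoc]
  | zero => simp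
  | add x y _ _ hx hy => rw [mul_add, add_mul]; exact Submodule.add_mem _ hx hy
  | smul c x _ hx => rw [mul_smul_comm, smul_mul_assoc]; exact Submodule.smul_mem _ _ hx

open Classical in
/-- The normal form map of a rewriting system on words. -/
noncomputable def normalForm (rule : List I → FreeAlgebra F I → Prop) : List I → FreeAlgebra F I :=
  wordLT_wf.fix fun w rec =>
    -- An arbitrary redex is rewritten; independence of this choice is what the diamond lemma
    -- proves.
    if h : ∃ q : List I × List I × FreeAlgebra F I × List I, rule q.2.1 q.2.2.1 ∧ q.1 ++ q.2.1 ++ q.2.2.2 = w then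
      wordLift (F := F) (fun u => if hu : WordLT u w then rec u hu else 0)
        (mon h.choose.1 * h.choose.2.2.1 * mon h.choose.2.2.2)
    else mon w

theorem mul_mem_span_lt {W : List I} {f : FreeAlgebra F I}
    (hf : f ∈ Submodule.span F {x | ∃ u, WordLT u W ∧ x = mon u}) (a b : List I) :
    mon a * f * mon b ∈ Submodule.span F {x | ∃ u, WordLT u (a ++ W ++ b) ∧ x = mon u} := by
  induction hf using Submodule.span_induction with
  | mem x hx =>
    obtain ⟨u, hu, rfl⟩ := hx
    exact Submodule.subset_span ⟨a ++ u ++ b, hu.append a b, by simp only [wd_append]⟩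
  | zero => simp
  | add x y _ _ hx hy => rw [mul_add, add_mul]; exact Submodule.add_mem _ hx hy
  | smul c x _ hx => rw [mul_smul_comm, smul_mul_assoc]; exact Submodule.smul_mem _ _ hx

variable {rule : List I → FreeAlgebra F I → Prop}

theorem normalForm_of_irreducible {w : List I} (h : ∀ W f, rule W f → ¬ W <:+: w) :
    normalForm rule w = mon w := by
  rw [normalForm, WellFounded.fix_eq, dif_neg]
  rintro ⟨q, h1, h2⟩
  exact h _ _ h1 ⟨_, _, h2⟩

/-- One unfolding of the recursion. Every word of the reduct is smaller than `w`, so the default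
value 0 of the guarded recursive call never occurs. -/
theorem normalForm_eq (hf : ∀ W f, rule W f →
      f ∈ Submodule.span F {x | ∃ u, WordLT u W ∧ x = mon u})
    {w : List I} (h : ∃ a W f b, rule W f ∧ a ++ W ++ b = w) :
    ∃ a W f b, rule W f ∧ a ++ W ++ b = w ∧
      normalForm rule w = wordLift (F := F) (normalForm rule) (mon a * f * mon b) := by
  have h' : ∃ q : List I × List I × FreeAlgebra F I × List I, rule q.2.1 q.2.2.1 ∧ q.1 ++ q.2.1 ++ q.2.2.2 = w := by
    obtain ⟨a, W, f, b, h1, h2⟩ := h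
    exact ⟨(a, W, f, b), h1, h2⟩
  refine ⟨_, _, _, _, h'.choose_spec.1, h'.choose_spec.2, ?_⟩
  conv_lhs => rw [normalForm, WellFounded.fix_eq, dif_pos h']
  have hm := mul_mem_span_lt (hf _ _ h'.choose_spec.1) h'.choose.1 h'.choose.2.2.2
  rw [h'.choose_spec.2] at hm
  generalize mon h'.choose.1 * h'.choose.2.2.1 * mon h'.choose.2.2.2 = t at hm
  induction hm using Submodule.span_induction with
  | mem x hx =>
    obtain ⟨u, hu, rfl⟩ := hx
    rw [wordLift_mon, wordLift_mon, dif_pos hu]; rfl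
  | zero => simp
  | add x y _ _ hx hy => rw [map_add, map_add, hx, hy]
  | smul c x _ hx => rw [map_smul, map_smul, hx]

/-- Bergman's diamond lemma. -/
theorem wordLift_normalForm_rule (hf : ∀ W f, rule W f →
      f ∈ Submodule.span F {x | ∃ u, WordLT u W ∧ x = mon u})
    (hres : ∀ a W f b a' W' f' b', rule W f → rule W' f' → a ++ W ++ b = a' ++ W' ++ b' →
      mon a * f * mon b - mon a' * f' * mon b' ∈ relSpan rule (a ++ W ++ b))
    (a W : List I) (f : FreeAlgebra F I) (b : List I) (h : rule W f) :
    wordLift (F := F) (normalForm rule) (mon a * (mon W - f) * mon b) = 0 := by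
  -- The statement for induction: all one-step reductions of `w` have the same normal form.
  suffices H : ∀ w : List I, ∀ a W f b, rule W f → a ++ W ++ b = w →
      wordLift (F := F) (normalForm rule) (mon a * f * mon b) = normalForm rule w by
    rw [mul_sub, sub_mul, map_sub, ← wd_append, ← wd_append, wordLift_mon,
      H _ a W f b h rfl, sub_self]
  intro w
  refine wordLT_wf.induction (C := fun w => ∀ a W f b, rule W f → a ++ W ++ b = w →
      wordLift (F := F) (normalForm rule) (mon a * f * mon b) = normalForm rule w) w ?_
  intro w ih a W f b hr hw
  obtain ⟨a', W', f', b', hr', hw', he⟩ := normalForm_eq hf ⟨a, W, f, b, hr, hw⟩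
  -- The relations in `relSpan` have leading words below `w`, where the induction hypothesis
  -- applies.
  have key : ∀ x ∈ relSpan rule w, wordLift (F := F) (normalForm rule) x = 0 := by
    intro x hx
    unfold relSpan at hx
    induction hx using Submodule.span_induction with
    | mem x hx =>
      obtain ⟨c, V, g, d, h1, h2, rfl⟩ := hx
      rw [mul_sub, sub_mul, map_sub, ← wd_append, ← wd_append, wordLift_mon,
        ih _ h2 c V g d h1 rfl, sub_self]
    | zero => simp
    | add x y _ _ hx hy => rw [map_add, hx, hy, add_zero]
    | smul c x _ hx => rw [map_smul, hx, smul_zero]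
  have := key _ (hw ▸ hres a W f b a' W' f' b' hr hr' (hw.trans hw'.symm))
  rw [map_sub, sub_eq_zero] at this
  rw [this, he]

/-- Both reducts lead to `f c f'`. The errors `f c (W' - f')` and `(W - f) c f'` involve only words
below `W c W'`. -/
theorem resolve_disjoint (hf : ∀ W f, rule W f →
      f ∈ Submodule.span F {x | ∃ u, WordLT u W ∧ x = mon u})
    (W c W' : List I) (f f' : FreeAlgebra F I) (h : rule W f) (h' : rule W' f') :
    f * mon (c ++ W') - mon (W ++ c) * f' ∈ relSpan rule (W ++ c ++ W') := by
  have h1 : f * mon c * (mon W' - f') ∈ relSpan rule (W ++ c ++ W') := by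
    have hm := hf _ _ h
    clear h
    induction hm using Submodule.span_induction with
    | mem x hx =>
      obtain ⟨u, hu, rfl⟩ := hx
      refine Submodule.subset_span ⟨u ++ c, W', f', [], h', ?_, ?_⟩
      · simpa only [List.append_assoc, List.nil_append, List.append_nil] using hu.append [] (c ++ W')
      · simp [wd_append]
    | zero => simp
    | add x y _ _ hx hy => rw [add_mul, add_mul]; exact Submodule.add_mem _ hx hy
    | smul c x _ hx => rw [smul_mul_assoc, smul_mul_assoc]; exact Submodule.smul_mem _ _ hx
  have h2 : (mon W - f) * mon c * f' ∈ relSpan rule (W ++ c ++ W') := by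
    have hm := hf _ _ h'
    clear h' h1
    induction hm using Submodule.span_induction with
    | mem x hx =>
      obtain ⟨u, hu, rfl⟩ := hx
      refine Submodule.subset_span ⟨[], W, f, c ++ u, h, ?_, ?_⟩
      · simpa only [List.append_assoc, List.nil_append, List.append_nil] using hu.append (W ++ c) []
      · simp [wd_append, mul_assoc]
    | zero => simp
    | add x y _ _ hx hy => rw [mul_add]; exact Submodule.add_mem _ hx hy
    | smul c x _ hx => rw [mul_smul_comm]; exact Submodule.smul_mem _ _ hx
  have := Submodule.sub_mem _ h1 h2
  convert this using 1
  simp only [wd_append]; noncomm_ring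

/-- It is enough to resolve the minimal overlaps and the inclusions. -/
theorem resolve_of_overlaps (hf : ∀ W f, rule W f →
      f ∈ Submodule.span F {x | ∃ u, WordLT u W ∧ x = mon u})
    (hov : ∀ c d e f f', d ≠ [] → rule (c ++ d) f → rule (d ++ e) f' →
      f * mon e - mon c * f' ∈ relSpan rule (c ++ d ++ e))
    (hinc : ∀ c W e f f', rule (c ++ W ++ e) f → rule W f' →
      f - mon c * f' * mon e ∈ relSpan rule (c ++ W ++ e))
    (a W : List I) (f : FreeAlgebra F I) (b a' W' : List I) (f' : FreeAlgebra F I) (b' : List I) (h : rule W f)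
    (h' : rule W' f') (he : a ++ W ++ b = a' ++ W' ++ b') :
    mon a * f * mon b - mon a' * f' * mon b' ∈ relSpan rule (a ++ W ++ b) := by
  -- By symmetry the first redex may be assumed to begin no later than the second. They are then
  -- disjoint, nested, or properly overlapping.
  have main : ∀ (a W : List I) (f : FreeAlgebra F I) (b a' W' : List I) (f' : FreeAlgebra F I) (b' : List I), rule W f →
      rule W' f' → a ++ W ++ b = a' ++ W' ++ b' → (∃ c, a' = a ++ c) →
      mon a * f * mon b - mon a' * f' * mon b' ∈ relSpan rule (a ++ W ++ b) := by
    rintro a W f b _ W' f' b' h h' he ⟨c, rfl⟩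
    have he' : W ++ b = c ++ (W' ++ b') := by
      simpa only [List.append_assoc, List.append_cancel_left_eq] using he
    rcases List.append_eq_append_iff.1 he' with ⟨c', hc, hb⟩ | ⟨d, hW, hd⟩
    · subst hc; subst hb
      have := mul_mem_relSpan (resolve_disjoint hf W c' W' f f' h h') a b'
      simp only [List.append_assoc] at this ⊢
      convert this using 1
      simp only [wd_append]; noncomm_ring
    · rcases List.append_eq_append_iff.1 hd with ⟨e, hd', hb⟩ | ⟨e, hW', hb⟩
      · subst hd'; subst hb; subst hW
        have := mul_mem_relSpan (hinc c W' e f f' (by simpa only [List.append_assoc] using h) h') a b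
        simp only [List.append_assoc] at this ⊢
        convert this using 1
        simp only [wd_append]; noncomm_ring
      · subst hW; subst hW'; subst hb
        by_cases hdn : d = []
        · subst hdn
          simp only [List.append_nil, List.nil_append] at h h' ⊢
          have := mul_mem_relSpan (resolve_disjoint hf c [] e f f' h h') a b'
          simp only [List.append_assoc, List.nil_append, List.append_nil] at this ⊢
          convert this using 1
          simp only [wd_append]; noncomm_ring
        · have := mul_mem_relSpan (hov c d e f f' hdn h h') a b'
          simp only [List.append_assoc] at this ⊢
          convert this using 1
          simp only [wd_append]; noncomm_ring
  have he2 := he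
  simp only [List.append_assoc] at he2
  rcases List.append_eq_append_iff.1 he2 with ⟨c, hc, -⟩ | ⟨c, hc, -⟩
  · exact main a W f b a' W' f' b' h h' he ⟨c, hc⟩
  · have := main a' W' f' b' a W f b h' h he.symm ⟨c, hc⟩
    rw [he, ← neg_sub]
    exact Submodule.neg_mem _ this

end Diamond

/-! ### Independent families, bicharacters and homogeneous endomorphisms. -/

section Independence

variable {K I F E : Type*} [Field F] [AddCommGroup E] [Module F E]

/-- Split a combination into the terms with label `κ` and the others. The second part lies in `W κ`
and in the sum of the other pieces, so it is zero. -/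
theorem mem_span_image_of_iSupIndep {W : K → Submodule F E} (hW : iSupIndep W) {b : I → E}
    {k : I → K} (hb : ∀ i, b i ∈ W (k i)) {x : E} (hx : x ∈ Submodule.span F (Set.range b))
    {κ : K} (hκ : x ∈ W κ) : x ∈ Submodule.span F (b '' {i | k i = κ}) := by
  have e : Set.range b = b '' {i | k i = κ} ∪ b '' {i | k i ≠ κ} := by
    rw [← Set.image_univ, ← Set.image_union]
    congr 1
    ext i; simp [em]
  rw [e, Submodule.span_union, Submodule.mem_sup] at hx
  obtain ⟨y, hy, z, hz, rfl⟩ := hx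
  have hyW : y ∈ W κ := by
    refine Submodule.span_le.2 ?_ hy
    rintro _ ⟨i, hi, rfl⟩
    have : k i = κ := hi
    exact this ▸ hb i
  have hzW : z ∈ ⨆ j, ⨆ (_ : j ≠ κ), W j := by
    refine Submodule.span_le.2 ?_ hz
    rintro _ ⟨i, hi, rfl⟩
    exact Submodule.mem_iSup_of_mem (k i) (Submodule.mem_iSup_of_mem hi (hb i))
  have hz0 : z = 0 := by
    have h1 : z ∈ W κ := by simpa using Submodule.sub_mem _ hκ hyW
    simpa using (disjoint_iff_inf_le.1 (hW κ)) ⟨h1, hzW⟩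
  rw [hz0, add_zero]; exact hy

end Independence

section Grading

variable {Γ F V : Type*} [AddCommGroup Γ] [Field F] [AddCommGroup V] [Module F V]
  {𝒱 : Γ → Submodule F V} {ε : Bicharacter Γ F}

theorem Bicharacter.mul_skew (ε : Bicharacter Γ F) (a b : Γ) : (ε a b : F) * (ε b a : F) = 1 := by
  rw [← Units.val_mul, ε.skew, Units.val_one]

theorem Bicharacter.add_left (ε : Bicharacter Γ F) (a b c : Γ) :
    (ε (a + b) c : F) = (ε a c : F) * (ε b c : F) := by rw [ε.map_add_left, Units.val_mul]

theorem Bicharacter.add_right (ε : Bicharacter Γ F) (a b c : Γ) :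
    (ε a (b + c) : F) = (ε a b : F) * (ε a c : F) := by rw [ε.map_add_right, Units.val_mul]

theorem Bicharacter.zero_left (ε : Bicharacter Γ F) (a : Γ) : ε 0 a = 1 := by
  have := ε.map_add_left 0 0 a
  rw [add_zero] at this
  exact left_eq_mul.1 this

theorem Bicharacter.zero_right (ε : Bicharacter Γ F) (a : Γ) : ε a 0 = 1 := by
  have := ε.map_add_right a 0 0
  rw [add_zero] at this
  exact left_eq_mul.1 this

theorem Bicharacter.nsmul_left (ε : Bicharacter Γ F) (a b : Γ) (n : ℕ) :
    ε (n • a) b = ε a b ^ n := by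
  induction n with
  | zero => simp [ε.zero_left]
  | succ n ih => rw [succ_nsmul, ε.map_add_left, ih, pow_succ]

theorem Bicharacter.nsmul_right (ε : Bicharacter Γ F) (a b : Γ) (n : ℕ) :
    ε a (n • b) = ε a b ^ n := by
  induction n with
  | zero => simp [ε.zero_right]
  | succ n ih => rw [succ_nsmul, ε.map_add_right, ih, pow_succ]

theorem Bicharacter.self_eq (ε : Bicharacter Γ F) {a : Γ} (h : ε a a ≠ 1) : (ε a a : F) = -1 := by
  have := ε.mul_skew a a
  rcases mul_self_eq_one_iff.1 this with h' | h'
  · exact absurd (Units.ext h') h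
  · exact h'

theorem mul_mem_homEnd {α β : Γ} {x y : Module.End F V} (hx : x ∈ homEnd 𝒱 α)
    (hy : y ∈ homEnd 𝒱 β) : x * y ∈ homEnd 𝒱 (α + β) := by
  intro γ v hv
  have := hx _ _ (hy γ v hv)
  rwa [add_assoc, add_comm β α] at this

theorem colorBracket_mem_homEnd {α β : Γ} {x y : Module.End F V} (hx : x ∈ homEnd 𝒱 α)
    (hy : y ∈ homEnd 𝒱 β) : colorBracket ε α β x y ∈ homEnd 𝒱 (α + β) :=
  Submodule.sub_mem _ (mul_mem_homEnd hx hy)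
    (Submodule.smul_mem _ _ (add_comm β α ▸ mul_mem_homEnd hy hx))

theorem one_mem_homEnd : (1 : Module.End F V) ∈ homEnd 𝒱 0 := fun γ v hv => by
  simpa using hv

theorem pow_mem_homEnd {α : Γ} {x : Module.End F V} (hx : x ∈ homEnd 𝒱 α) (n : ℕ) :
    x ^ n ∈ homEnd 𝒱 (n • α) := by
  induction n with
  | zero => simpa using one_mem_homEnd
  | succ n ih => rw [pow_succ, succ_nsmul]; exact mul_mem_homEnd ih hx

/-- Evaluation at a homogeneous vector reduces this to the independence of the components of `V`;
homogeneous vectors span `V`. -/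
theorem homEnd_iSupIndep (h𝒱 : IsGrading 𝒱) : iSupIndep (homEnd 𝒱) := by
  intro α
  rw [disjoint_iff_inf_le]
  rintro f ⟨h1, h2⟩
  rw [Submodule.mem_bot]
  have hv : ∀ γ, ∀ v ∈ 𝒱 γ, f v = 0 := by
    intro γ v hv
    have h3 : f v ∈ ⨆ j, ⨆ (_ : j ≠ γ + α), 𝒱 j := by
      have : (⨆ j, ⨆ (_ : j ≠ α), homEnd 𝒱 j) ≤
          (⨆ j, ⨆ (_ : j ≠ γ + α), 𝒱 j).comap (LinearMap.applyₗ v) := by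
        refine iSup₂_le fun β hβ g hg => ?_
        refine Submodule.mem_iSup_of_mem (γ + β) (Submodule.mem_iSup_of_mem ?_ (hg γ v hv))
        simpa using hβ
      exact this h2
    simpa using (disjoint_iff_inf_le.1 (h𝒱.1 (γ + α))) ⟨h1 γ v hv, h3⟩
  have : (⊤ : Submodule F V) ≤ LinearMap.ker f := by
    rw [← h𝒱.2]
    exact iSup_le fun γ v hv' => hv γ v hv'
  exact LinearMap.ker_eq_top.1 (top_le_iff.1 this)

end Grading

/-! ### The universal property of `u_χ(S)`, tested on a homogeneous family. -/

section Lift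

variable {Γ F V I : Type*} [AddCommGroup Γ] [Field F] [AddCommGroup V] [Module F V]

/-- A homogeneous family of endomorphisms that spans a restricted color subalgebra. -/
structure IsHomFamily (p : ℕ) (ε : Bicharacter Γ F) (𝒱 : Γ → Submodule F V)
    (S : Submodule F (Module.End F V)) (b : I → Module.End F V) (deg : I → Γ) : Prop where
  span_eq : Submodule.span F (Set.range b) = S
  mem_homEnd : ∀ i, b i ∈ homEnd 𝒱 (deg i)
  bracket_mem : ∀ i j, colorBracket ε (deg i) (deg j) (b i) (b j) ∈ S
  pow_mem : ∀ i, ε (deg i) (deg i) = 1 → b i ^ p ∈ S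

variable {p : ℕ} {ε : Bicharacter Γ F} {𝒱 : Γ → Submodule F V}
  {S : Submodule F (Module.End F V)} {b : I → Module.End F V} {deg : I → Γ}

theorem IsHomFamily.mem (hb : IsHomFamily p ε 𝒱 S b deg) (i : I) : b i ∈ S :=
  hb.span_eq ▸ Submodule.subset_span ⟨i, rfl⟩

theorem IsHomFamily.mem_span (hb : IsHomFamily p ε 𝒱 S b deg) (h𝒱 : IsGrading 𝒱) {α : Γ}
    {x : Module.End F V} (hx : x ∈ S) (hα : x ∈ homEnd 𝒱 α) :
    x ∈ Submodule.span F (b '' {i | deg i = α}) :=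
  mem_span_image_of_iSupIndep (homEnd_iSupIndep h𝒱) hb.mem_homEnd (hb.span_eq.symm ▸ hx) hα

variable {A : Type*} [Ring A] [Algebra F A]

/-- The graph of a linear map `ρ : S → A`, as a subspace of the algebra `A × End(V)`. -/
def graphSub (ρ : S →ₗ[F] A) : Submodule F (A × Module.End F V) :=
  LinearMap.range (ρ.prod S.subtype)

theorem mem_graphSub {ρ : S →ₗ[F] A} {x : S} : (ρ x, (x : Module.End F V)) ∈ graphSub ρ :=
  ⟨x, rfl⟩

theorem mem_graphSub_of {ρ : S →ₗ[F] A} {u : A × Module.End F V} (z : S) (h1 : u.1 = ρ z)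
    (h2 : u.2 = z) : u ∈ graphSub ρ := ⟨z, Prod.ext h1.symm h2.symm⟩

theorem mem_graphSub_iff {ρ : S →ₗ[F] A} {u : A × Module.End F V} :
    u ∈ graphSub ρ ↔ ∃ h : u.2 ∈ S, ρ ⟨u.2, h⟩ = u.1 := by
  constructor
  · rintro ⟨x, rfl⟩; exact ⟨x.2, rfl⟩
  · rintro ⟨h, h'⟩; exact ⟨⟨u.2, h⟩, Prod.ext h' rfl⟩

/-- Saying that `ρ` respects a bracket means that a twisted commutator in `A × End(V)` stays in the
graph. In this form the condition is bilinear, and an element of degree `γ` is a combination of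
family members of degree `γ`. -/
theorem IsHomFamily.bracket_mem_graph (hb : IsHomFamily p ε 𝒱 S b deg) (h𝒱 : IsGrading 𝒱)
    {ρ : S →ₗ[F] A}
    (hbr : ∀ i j, ∀ z : S, (z : Module.End F V) = colorBracket ε (deg i) (deg j) (b i) (b j) →
      ρ ⟨b i, hb.mem i⟩ * ρ ⟨b j, hb.mem j⟩ =
        (ε (deg i) (deg j) : F) • (ρ ⟨b j, hb.mem j⟩ * ρ ⟨b i, hb.mem i⟩) + ρ z)
    {α β : Γ} {u v : A × Module.End F V} (hu : u ∈ graphSub ρ) (huα : u.2 ∈ homEnd 𝒱 α)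
    (hv : v ∈ graphSub ρ) (hvβ : v.2 ∈ homEnd 𝒱 β) :
    u * v - (ε α β : F) • (v * u) ∈ graphSub ρ := by
  set g : I → A × Module.End F V := fun i => (ρ ⟨b i, hb.mem i⟩, b i) with hg
  have key : ∀ γ, ∀ u : A × Module.End F V, u ∈ graphSub ρ → u.2 ∈ homEnd 𝒱 γ →
      u ∈ Submodule.span F (g '' {i | deg i = γ}) := by
    intro γ u hu huγ
    obtain ⟨x, rfl⟩ := hu
    obtain ⟨x, hx⟩ := x
    have h1 := hb.mem_span h𝒱 hx huγ
    have h2 : ∀ y, ∀ hy : y ∈ Submodule.span F (b '' {i | deg i = γ}), ∀ hyS : y ∈ S,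
        (ρ ⟨y, hyS⟩, y) ∈ Submodule.span F (g '' {i | deg i = γ}) := by
      intro y hy
      have hle : Submodule.span F (b '' {i | deg i = γ}) ≤ S := by
        rw [← hb.span_eq]; exact Submodule.span_mono (Set.image_subset_range _ _)
      induction hy using Submodule.span_induction with
      | mem y hy => 
        obtain ⟨i, hi, rfl⟩ := hy
        intro _
        exact Submodule.subset_span ⟨i, hi, rfl⟩
      | zero =>
        intro hyS
        have : (ρ ⟨0, hyS⟩, (0 : Module.End F V)) = 0 := by
          have : (⟨0, hyS⟩ : S) = 0 := rfl
          rw [this, map_zero]; rfl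
        rw [this]; exact Submodule.zero_mem _
      | add y z hy hz hy' hz' =>
        intro hyS
        have := Submodule.add_mem _ (hy' (hle hy)) (hz' (hle hz))
        convert this using 1
        rw [Prod.mk_add_mk, ← map_add]; rfl
      | smul c y hy hy' =>
        intro hyS
        have := Submodule.smul_mem _ c (hy' (hle hy))
        convert this using 1
        rw [Prod.smul_mk, ← map_smul]; rfl
    exact h2 x h1 hx
  have hu' := key α u hu huα
  have hv' := key β v hv hvβ
  clear hu huα hv hvβ
  induction hu' using Submodule.span_induction with
  | mem u hu =>
    obtain ⟨i, hi, rfl⟩ := hu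
    induction hv' using Submodule.span_induction with
    | mem v hv =>
      obtain ⟨j, hj, rfl⟩ := hv
      have hi' : deg i = α := hi
      have hj' : deg j = β := hj
      subst hi'; subst hj'
      refine mem_graphSub_of ⟨_, hb.bracket_mem i j⟩ ?_ rfl
      have := hbr i j ⟨_, hb.bracket_mem i j⟩ rfl
      show ρ ⟨b i, hb.mem i⟩ * ρ ⟨b j, hb.mem j⟩ -
        (ε (deg i) (deg j) : F) • (ρ ⟨b j, hb.mem j⟩ * ρ ⟨b i, hb.mem i⟩) = _
      rw [this, add_sub_cancel_left]
    | zero => simp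
    | add v w _ _ hv hw =>
      have := Submodule.add_mem _ hv hw
      convert this using 1
      rw [mul_add, add_mul, smul_add]; abel
    | smul c v _ hv =>
      have := Submodule.smul_mem _ c hv
      convert this using 1
      rw [mul_smul_comm, smul_mul_assoc, smul_sub, smul_comm]
  | zero => simp
  | add u w _ _ hu hw =>
    have := Submodule.add_mem _ hu hw
    convert this using 1
    rw [mul_add, add_mul, smul_add]; abel
  | smul c u _ hu =>
    have := Submodule.smul_mem _ c hu
    convert this using 1
    rw [mul_smul_comm, smul_mul_assoc, smul_sub, smul_comm]

/-- The `p`-th power is not additive, but by Jacobson's formula in `A × End(V)` the defect for a sum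
is a Lie polynomial, and the graph is closed under the brackets that occur in it. -/
theorem IsHomFamily.pow_mem_graph [CharP F p] [Fact p.Prime] (hb : IsHomFamily p ε 𝒱 S b deg)
    (h𝒱 : IsGrading 𝒱) {ρ : S →ₗ[F] A} (ψ : S →ₗ[F] F)
    (hbr : ∀ i j, ∀ z : S, (z : Module.End F V) = colorBracket ε (deg i) (deg j) (b i) (b j) →
      ρ ⟨b i, hb.mem i⟩ * ρ ⟨b j, hb.mem j⟩ =
        (ε (deg i) (deg j) : F) • (ρ ⟨b j, hb.mem j⟩ * ρ ⟨b i, hb.mem i⟩) + ρ z)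
    (hpw : ∀ i, ε (deg i) (deg i) = 1 → ∀ z : S, (z : Module.End F V) = b i ^ p →
      ρ ⟨b i, hb.mem i⟩ ^ p = ρ z + algebraMap F A (ψ ⟨b i, hb.mem i⟩ ^ p))
    {α : Γ} (hα : ε α α = 1) (x : Module.End F V)
    (hx : x ∈ Submodule.span F (b '' {i | deg i = α})) (hxS : x ∈ S) :
    (ρ ⟨x, hxS⟩, x) ^ p - (algebraMap F A (ψ ⟨x, hxS⟩ ^ p), 0) ∈ graphSub ρ := by
  have hp : p.Prime := Fact.out
  have : ExpChar F p := .prime hp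
  have hle : Submodule.span F (b '' {i | deg i = α}) ≤ S := by
    rw [← hb.span_eq]; exact Submodule.span_mono (Set.image_subset_range _ _)
  have hle' : Submodule.span F (b '' {i | deg i = α}) ≤ homEnd 𝒱 α := by
    refine Submodule.span_le.2 ?_
    rintro _ ⟨i, hi, rfl⟩
    have : deg i = α := hi
    exact this ▸ hb.mem_homEnd i
  induction hx using Submodule.span_induction with
  | mem x hx =>
    obtain ⟨i, hi, rfl⟩ := hx
    have hi' : deg i = α := hi
    subst hi'
    refine mem_graphSub_of ⟨_, hb.pow_mem i hα⟩ ?_ (by simp)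
    have := hpw i hα ⟨b i ^ p, hb.pow_mem i hα⟩ rfl
    show ρ ⟨b i, hb.mem i⟩ ^ p - algebraMap F A (ψ ⟨b i, hb.mem i⟩ ^ p) = _
    rw [this, add_sub_cancel_right]
  | zero =>
    have : (⟨0, hxS⟩ : S) = 0 := rfl
    rw [this, map_zero, map_zero, zero_pow hp.ne_zero, map_zero]
    have : ((0, 0) : A × Module.End F V) = 0 := rfl
    rw [this, zero_pow hp.ne_zero, sub_zero]; exact Submodule.zero_mem _
  | add x y hx hy ihx ihy =>
    -- For even `α` the bicharacter is 1 on `(kα, α)`. On these degrees the color bracket with an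
    -- element of degree `α` is therefore the plain commutator of Jacobson's formula.
    set R : Submodule F (A × Module.End F V) :=
      Submodule.span F {u | u ∈ graphSub ρ ∧ ∃ k : ℕ, u.2 ∈ homEnd 𝒱 (k • α)} with hR
    have hR1 : R ≤ graphSub ρ := Submodule.span_le.2 fun u hu => hu.1
    have hcl : ∀ z (hz : z ∈ Submodule.span F (b '' {i | deg i = α})),
        ∀ r ∈ R, r * (ρ ⟨z, hle hz⟩, z) - (ρ ⟨z, hle hz⟩, z) * r ∈ R := by
      intro z hz r hr
      rw [hR] at hr
      induction hr using Submodule.span_induction with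
      | mem u hu =>
        obtain ⟨hu, k, hk⟩ := hu
        have h1 := hb.bracket_mem_graph h𝒱 hbr hu hk (mem_graphSub (x := ⟨z, hle hz⟩)) (hle' hz)
        have h2 : (ε (k • α) α : F) = 1 := by rw [ε.nsmul_left, hα]; simp
        rw [h2, one_smul] at h1
        refine Submodule.subset_span ⟨h1, k + 1, ?_⟩
        have h3 := colorBracket_mem_homEnd (ε := ε) hk (hle' hz)
        rw [colorBracket, h2, one_smul, ← succ_nsmul] at h3
        exact h3
      | zero => simp
      | add u v _ _ hu hv =>
        have := Submodule.add_mem _ hu hv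
        convert this using 1
        rw [mul_add, add_mul]; abel
      | smul c u _ hu =>
        have := Submodule.smul_mem _ c hu
        convert this using 1
        rw [mul_smul_comm, smul_mul_assoc, smul_sub]
    have hJ := add_pow_prime_sub_mem p R (ρ ⟨x, hle hx⟩, x) (ρ ⟨y, hle hy⟩, y)
      (Submodule.subset_span ⟨mem_graphSub, 1, by simpa using hle' hx⟩) (hcl x hx) (hcl y hy)
    have := Submodule.add_mem _ (Submodule.add_mem _ (ihx (hle hx)) (ihy (hle hy))) (hR1 hJ)
    have e1 : (ρ ⟨x + y, hxS⟩, x + y) =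
        ((ρ ⟨x, hle hx⟩, x) + (ρ ⟨y, hle hy⟩, y) : A × Module.End F V) := by
      rw [Prod.mk_add_mk, ← map_add]; rfl
    have e2 : ψ ⟨x + y, hxS⟩ = ψ ⟨x, hle hx⟩ + ψ ⟨y, hle hy⟩ := by rw [← map_add]; rfl
    rw [e1, e2, add_pow_expChar, map_add]
    convert this using 1
    have e3 : ((algebraMap F A (ψ ⟨x, hle hx⟩ ^ p) + algebraMap F A (ψ ⟨y, hle hy⟩ ^ p), 0) :
      A × Module.End F V) = (algebraMap F A (ψ ⟨x, hle hx⟩ ^ p), 0) +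
        (algebraMap F A (ψ ⟨y, hle hy⟩ ^ p), 0) := by simp
    rw [e3]; abel
  | smul c x hx ih =>
    have e1 : (ρ ⟨c • x, hxS⟩, c • x) = (c • (ρ ⟨x, hle hx⟩, x) : A × Module.End F V) := by
      rw [Prod.smul_mk, ← map_smul]; rfl
    have e2 : ψ ⟨c • x, hxS⟩ = c * ψ ⟨x, hle hx⟩ := by rw [← smul_eq_mul, ← map_smul]; rfl
    have := Submodule.smul_mem _ (c ^ p) (ih (hle hx))
    rw [e1, e2, smul_pow, mul_pow, map_mul, ← Algebra.smul_def]
    convert this using 1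
    rw [smul_sub]; simp

/-- A linear map that respects the defining relations of `u_χ(S)` on a homogeneous spanning family
extends to `u_χ(S)`. -/
theorem IsHomFamily.exists_lift [CharP F p] [Fact p.Prime] (hb : IsHomFamily p ε 𝒱 S b deg)
    (h𝒱 : IsGrading 𝒱) {𝔤 : Submodule F (Module.End F V)} (χ : 𝔤 →ₗ[F] F) (hS : S ≤ 𝔤)
    (ρ : S →ₗ[F] A)
    (hbr : ∀ i j, ∀ z : S, (z : Module.End F V) = colorBracket ε (deg i) (deg j) (b i) (b j) →
      ρ ⟨b i, hb.mem i⟩ * ρ ⟨b j, hb.mem j⟩ =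
        (ε (deg i) (deg j) : F) • (ρ ⟨b j, hb.mem j⟩ * ρ ⟨b i, hb.mem i⟩) + ρ z)
    (hpw : ∀ i, ε (deg i) (deg i) = 1 → ∀ z : S, (z : Module.End F V) = b i ^ p →
      ρ ⟨b i, hb.mem i⟩ ^ p = ρ z + algebraMap F A (χ ⟨b i, hS (hb.mem i)⟩ ^ p)) :
    ∃ φ : RedEnv p ε 𝒱 χ S →ₐ[F] A, ∀ x, φ (RedEnv.ι p ε 𝒱 χ S x) = ρ x := by
  refine ⟨RingQuot.liftAlgHom F ⟨TensorAlgebra.lift F ρ, ?_⟩, fun x => ?_⟩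
  · intro a a' h
    cases h with
    | bracket α β x y z hx hy hz =>
      have := hb.bracket_mem_graph h𝒱 hbr (mem_graphSub (x := x)) hx (mem_graphSub (x := y)) hy
      rw [mem_graphSub_iff] at this
      obtain ⟨h1, h2⟩ := this
      have e : (⟨_, h1⟩ : S) = z := Subtype.ext hz.symm
      rw [e] at h2
      simp only [map_mul, map_add, map_smul, TensorAlgebra.lift_ι_apply]
      rw [h2]
      simp
    | power α hα x z w hx hz hw =>
      have := hb.pow_mem_graph h𝒱 (χ ∘ₗ Submodule.inclusion hS) hbr
        hpw hα x (hb.mem_span h𝒱 x.2 hx) x.2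
      rw [mem_graphSub_iff] at this
      obtain ⟨h1, h2⟩ := this
      have e : (⟨_, h1⟩ : S) = z := Subtype.ext (by simp [hz])
      rw [e] at h2
      have e2 : Submodule.inclusion hS x = w := Subtype.ext hw.symm
      simp only [map_pow, map_add, TensorAlgebra.lift_ι_apply, AlgHom.commutes]
      rw [h2]
      simp [e2]
  · simp [RedEnv.ι]

end Lift

/-! ### The defining relations in the free algebra on a basis. -/

section Relators

variable {Γ F V I : Type*} [AddCommGroup Γ] [Field F] [AddCommGroup V] [Module F V]
  {p : ℕ} {ε : Bicharacter Γ F} {𝒱 : Γ → Submodule F V}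
  {S : Submodule F (Module.End F V)} {bs : Module.Basis I F S} {deg : I → Γ}

/-- The linear map from `S` to the free algebra on a basis of `S`. -/
noncomputable def freeLin (bs : Module.Basis I F S) : S →ₗ[F] FreeAlgebra F I :=
  bs.constr F (FreeAlgebra.ι F)

theorem freeLin_basis (i : I) : freeLin bs (bs i) = FreeAlgebra.ι F i :=
  bs.constr_basis F _ i

variable (hb : IsHomFamily p ε 𝒱 S (fun i => (bs i : Module.End F V)) deg)

/-- The color bracket of two basis elements. -/
noncomputable def IsHomFamily.br (i j : I) : S := ⟨_, hb.bracket_mem i j⟩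

/-- The defining relation of the enveloping algebra for two basis elements. -/
noncomputable def IsHomFamily.relator (i j : I) : FreeAlgebra F I :=
  FreeAlgebra.ι F i * FreeAlgebra.ι F j -
    (ε (deg i) (deg j) : F) • (FreeAlgebra.ι F j * FreeAlgebra.ι F i) - freeLin bs (hb.br i j)

/-- The relation `x^p = x^{[p]} + ψ(x)^p` for a basis element. -/
noncomputable def IsHomFamily.powRelator (ψ : S →ₗ[F] F) (i : I)
    (h : ε (deg i) (deg i) = 1) : FreeAlgebra F I :=
  FreeAlgebra.ι F i ^ p - (freeLin bs ⟨_, hb.pow_mem i h⟩ +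
    algebraMap F (FreeAlgebra F I) (ψ (bs i) ^ p))

/-- Exchanging the two letters multiplies a relator by a nonzero scalar, and the relator of an even
letter with itself is zero. So the descending pairs and the odd squares suffice. -/
theorem IsHomFamily.relator_mem [LinearOrder I] (Q : Submodule F (FreeAlgebra F I))
    {i j : I} (h1 : i < j → hb.relator j i ∈ Q) (h2 : j < i → hb.relator i j ∈ Q)
    (h3 : i = j → ε (deg i) (deg i) ≠ 1 → hb.relator i i ∈ Q) : hb.relator i j ∈ Q := by
  rcases lt_trichotomy i j with h | h | h
  · have e : hb.relator i j = -(ε (deg i) (deg j) : F) • hb.relator j i := by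
      have h4 : hb.br i j = -(ε (deg i) (deg j) : F) • hb.br j i := by
        apply Subtype.ext
        have := ε.mul_skew (deg i) (deg j)
        simp only [br, colorBracket, Submodule.coe_smul, smul_sub, smul_smul, neg_mul, this]
        module
      simp only [relator, h4, map_smul, smul_sub, smul_smul, neg_mul, ε.mul_skew]
      module
    rw [e]
    exact Q.smul_mem _ (h1 h)
  · subst h
    by_cases ho : ε (deg i) (deg i) = 1
    · have e : hb.relator i i = 0 := by
        have h4 : hb.br i i = 0 := by
          apply Subtype.ext
          simp [br, colorBracket, ho]
        simp [relator, h4, ho]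
      rw [e]; exact Q.zero_mem
    · exact h3 rfl ho
  · exact h2 h

theorem IsHomFamily.mem_span_basis (h𝒱 : IsGrading 𝒱)
    (hb : IsHomFamily p ε 𝒱 S (fun i => (bs i : Module.End F V)) deg) {γ : Γ} {z : S}
    (hz : (z : Module.End F V) ∈ homEnd 𝒱 γ) :
    z ∈ Submodule.span F (bs '' {i | deg i = γ}) := by
  have h := hb.mem_span h𝒱 z.2 hz
  have e : (fun i => (bs i : Module.End F V)) '' {i | deg i = γ} =
      S.subtype '' (bs '' {i | deg i = γ}) := by
    rw [Set.image_image]; rfl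
  rw [e, ← Submodule.map_span] at h
  obtain ⟨w, hw, hwz⟩ := h
  have : w = z := Subtype.ext hwz
  exact this ▸ hw

/-- An element of degree `γ` is a combination of basis vectors of that degree, so its relation with
a letter is the same combination of basic relators. -/
theorem IsHomFamily.relator_left (h𝒱 : IsGrading 𝒱) {Q : Submodule F (FreeAlgebra F I)} {k : I}
    (hQ : ∀ l, hb.relator k l ∈ Q) {γ : Γ} {z w : S} (hz : (z : Module.End F V) ∈ homEnd 𝒱 γ)
    (hw : (w : Module.End F V) = colorBracket ε (deg k) γ (bs k) z) :
    FreeAlgebra.ι F k * freeLin bs z - (ε (deg k) γ : F) • (freeLin bs z * FreeAlgebra.ι F k) -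
      freeLin bs w ∈ Q := by
  suffices H : ∃ w : S, (w : Module.End F V) = colorBracket ε (deg k) γ (bs k) z ∧
      FreeAlgebra.ι F k * freeLin bs z - (ε (deg k) γ : F) • (freeLin bs z * FreeAlgebra.ι F k) -
        freeLin bs w ∈ Q by
    obtain ⟨w', h1, h2⟩ := H
    have : w = w' := Subtype.ext (hw.trans h1.symm)
    rwa [this]
  have h := hb.mem_span_basis h𝒱 hz
  clear hz hw w
  induction h using Submodule.span_induction with
  | mem z hz =>
    obtain ⟨l, hl, rfl⟩ := hz
    have hl' : deg l = γ := hl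
    subst hl'
    refine ⟨hb.br k l, rfl, ?_⟩
    rw [freeLin_basis]; exact hQ l
  | zero => exact ⟨0, by simp [colorBracket], by simp⟩
  | add x y _ _ hx hy =>
    obtain ⟨w1, h1, h1'⟩ := hx
    obtain ⟨w2, h2, h2'⟩ := hy
    refine ⟨w1 + w2, ?_, ?_⟩
    · rw [Submodule.coe_add, h1, h2]; simp only [colorBracket, Submodule.coe_add, mul_add, add_mul]
      module
    · have := Q.add_mem h1' h2'
      convert this using 1
      simp only [map_add, mul_add, add_mul]; module
  | smul c x _ hx =>
    obtain ⟨w1, h1, h1'⟩ := hx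
    refine ⟨c • w1, ?_, ?_⟩
    · rw [Submodule.coe_smul, h1]
      simp only [colorBracket, Submodule.coe_smul, mul_smul_comm, smul_mul_assoc]
      module
    · have := Q.smul_mem c h1'
      convert this using 1
      simp only [map_smul, mul_smul_comm, smul_mul_assoc]; module

theorem IsHomFamily.relator_right (h𝒱 : IsGrading 𝒱) {Q : Submodule F (FreeAlgebra F I)} {k : I}
    (hQ : ∀ l, hb.relator l k ∈ Q) {γ : Γ} {z w : S} (hz : (z : Module.End F V) ∈ homEnd 𝒱 γ)
    (hw : (w : Module.End F V) = colorBracket ε γ (deg k) z (bs k)) :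
    freeLin bs z * FreeAlgebra.ι F k - (ε γ (deg k) : F) • (FreeAlgebra.ι F k * freeLin bs z) -
      freeLin bs w ∈ Q := by
  suffices H : ∃ w : S, (w : Module.End F V) = colorBracket ε γ (deg k) z (bs k) ∧
      freeLin bs z * FreeAlgebra.ι F k - (ε γ (deg k) : F) • (FreeAlgebra.ι F k * freeLin bs z) -
        freeLin bs w ∈ Q by
    obtain ⟨w', h1, h2⟩ := H
    have : w = w' := Subtype.ext (hw.trans h1.symm)
    rwa [this]
  have h := hb.mem_span_basis h𝒱 hz
  clear hz hw w
  induction h using Submodule.span_induction with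
  | mem z hz =>
    obtain ⟨l, hl, rfl⟩ := hz
    have hl' : deg l = γ := hl
    subst hl'
    refine ⟨hb.br l k, rfl, ?_⟩
    rw [freeLin_basis]; exact hQ l
  | zero => exact ⟨0, by simp [colorBracket], by simp⟩
  | add x y _ _ hx hy =>
    obtain ⟨w1, h1, h1'⟩ := hx
    obtain ⟨w2, h2, h2'⟩ := hy
    refine ⟨w1 + w2, ?_, ?_⟩
    · rw [Submodule.coe_add, h1, h2]; simp only [colorBracket, Submodule.coe_add, mul_add, add_mul]
      module
    · have := Q.add_mem h1' h2'
      convert this using 1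
      simp only [map_add, mul_add, add_mul]; module
  | smul c x _ hx =>
    obtain ⟨w1, h1, h1'⟩ := hx
    refine ⟨c • w1, ?_, ?_⟩
    · rw [Submodule.coe_smul, h1]
      simp only [colorBracket, Submodule.coe_smul, mul_smul_comm, smul_mul_assoc]
      module
    · have := Q.smul_mem c h1'
      convert this using 1
      simp only [map_smul, mul_smul_comm, smul_mul_assoc]; module

/-- A formal identity: `b1, b2, b3` stand for the three brackets and `l1, l2, l3` for the double
brackets. The cubic monomials cancel on the left, and `hl` is the color Jacobi identity. -/
theorem jacobi_identity {A : Type*} [Ring A] [Algebra F A] (x y z b1 b2 b3 l1 l2 l3 : A)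
    (a b c a' : F) (h : a * a' = 1) (hl : l1 = l2 + a • l3) :
    x * (y * z - c • (z * y) - b1) - (a * b) • ((y * z - c • (z * y) - b1) * x)
      - (x * y - a • (y * x) - b2) * z + (b * c) • (z * (x * y - a • (y * x) - b2))
      - a • (y * (x * z - b • (z * x) - b3)) + c • ((x * z - b • (z * x) - b3) * y) =
    -(x * b1 - (a * b) • (b1 * x) - l1) + (b2 * z - (b * c) • (z * b2) - l2)
      + a • (y * b3 - (a' * c) • (b3 * y) - l3) := by
  subst hl
  have e : a • ((a' * c) • (b3 * y)) = c • (b3 * y) := by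
    rw [smul_smul, ← mul_assoc, h, one_mul]
  simp only [mul_sub, sub_mul, smul_sub, mul_smul_comm, smul_mul_assoc, mul_assoc, e]
  module

theorem IsHomFamily.bracket_mem_of_mem_homEnd (h𝒱 : IsGrading 𝒱)
    (hb : IsHomFamily p ε 𝒱 S (fun i => (bs i : Module.End F V)) deg) {α β : Γ} {x y : S}
    (hx : (x : Module.End F V) ∈ homEnd 𝒱 α) (hy : (y : Module.End F V) ∈ homEnd 𝒱 β) :
    colorBracket ε α β x y ∈ S := by
  have h1 := hb.mem_span_basis h𝒱 hx
  have h2 := hb.mem_span_basis h𝒱 hy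
  clear hx hy
  induction h1 using Submodule.span_induction with
  | mem x hx =>
    obtain ⟨l, rfl, rfl⟩ := hx
    induction h2 using Submodule.span_induction with
    | mem y hy =>
      obtain ⟨m, rfl, rfl⟩ := hy
      exact hb.bracket_mem l m
    | zero => simp [colorBracket]
    | add y z _ _ hy hz =>
      have := S.add_mem hy hz
      convert this using 1
      simp only [colorBracket, Submodule.coe_add, mul_add, add_mul]; module
    | smul c y _ hy =>
      have := S.smul_mem c hy
      convert this using 1
      simp only [colorBracket, Submodule.coe_smul, mul_smul_comm, smul_mul_assoc]; module
  | zero => simp [colorBracket]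
  | add y z _ _ hy hz =>
    have := S.add_mem hy hz
    convert this using 1
    simp only [colorBracket, Submodule.coe_add, mul_add, add_mul]; module
  | smul c y _ hy =>
    have := S.smul_mem c hy
    convert this using 1
    simp only [colorBracket, Submodule.coe_smul, mul_smul_comm, smul_mul_assoc]; module

/-- The Jacobi identity, modulo the relations of length two. -/
theorem IsHomFamily.jacobi_relator (h𝒱 : IsGrading 𝒱) {Q : Submodule F (FreeAlgebra F I)}
    (hQ : ∀ k l, hb.relator k l ∈ Q) (k j i : I) :
    FreeAlgebra.ι F k * hb.relator j i
      - ((ε (deg k) (deg j) : F) * ε (deg k) (deg i)) • (hb.relator j i * FreeAlgebra.ι F k)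
      - hb.relator k j * FreeAlgebra.ι F i
      + ((ε (deg k) (deg i) : F) * ε (deg j) (deg i)) • (FreeAlgebra.ι F i * hb.relator k j)
      - (ε (deg k) (deg j) : F) • (FreeAlgebra.ι F j * hb.relator k i)
      + (ε (deg j) (deg i) : F) • (hb.relator k i * FreeAlgebra.ι F j) ∈ Q := by
  have hd := fun i j => colorBracket_mem_homEnd (ε := ε) (hb.mem_homEnd i) (hb.mem_homEnd j)
  let w1 : S := ⟨_, hb.bracket_mem_of_mem_homEnd h𝒱 (hb.mem_homEnd k) (x := bs k) (y := hb.br j i) (hd j i)⟩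
  let w2 : S := ⟨_, hb.bracket_mem_of_mem_homEnd h𝒱 (hd k j) (x := hb.br k j) (y := bs i) (hb.mem_homEnd i)⟩
  let w3 : S := ⟨_, hb.bracket_mem_of_mem_homEnd h𝒱 (hb.mem_homEnd j) (x := bs j) (y := hb.br k i) (hd k i)⟩
  -- The color Jacobi identity, computed in `End(V)`.
  have hw : w1 = w2 + (ε (deg k) (deg j) : F) • w3 := by
    apply Subtype.ext
    simp only [w1, w2, w3, br, colorBracket, Submodule.coe_add, Submodule.coe_smul, ε.add_left,
      ε.add_right]
    have e : ∀ u : Module.End F V, (ε (deg k) (deg j) : F) •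
        ((ε (deg j) (deg k) : F) * ε (deg j) (deg i)) • u = (ε (deg j) (deg i) : F) • u := by
      intro u
      rw [smul_smul, ← mul_assoc, ε.mul_skew, one_mul]
    simp only [mul_sub, sub_mul, smul_sub, mul_smul_comm, smul_mul_assoc, mul_assoc, e]
    module
  have h1 := hb.relator_left h𝒱 (hQ k) (z := hb.br j i) (w := w1) (hd j i) rfl
  have h2 := hb.relator_right h𝒱 (fun l => hQ l i) (z := hb.br k j) (w := w2) (hd k j) rfl
  have h3 := hb.relator_left h𝒱 (hQ j) (z := hb.br k i) (w := w3) (hd k i) rfl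
  simp only [ε.add_left, ε.add_right] at h1 h2 h3
  have := Q.add_mem (Q.add_mem (Q.neg_mem h1) h2) (Q.smul_mem (ε (deg k) (deg j) : F) h3)
  rw [← jacobi_identity _ _ _ _ _ _ _ _ _ _ _ _ _ (ε.mul_skew (deg k) (deg j))
    (by rw [hw, map_add, map_smul])] at this
  exact this

end Relators

/-! ### Resolution of the ambiguities of the rewriting system. -/

section PBW

variable {Γ F V I : Type*} [AddCommGroup Γ] [Field F] [AddCommGroup V] [Module F V]
  {p : ℕ} {ε : Bicharacter Γ F} {𝒱 : Γ → Submodule F V}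
  {S : Submodule F (Module.End F V)} {bs : Module.Basis I F S} {deg : I → Γ}

/-- The relation `[x, y^p] = (ad y)^p x`, modulo the relations of length at most `p`. -/
theorem IsHomFamily.powRelator_commutator [CharP F p] [Fact p.Prime]
    (hb : IsHomFamily p ε 𝒱 S (fun i => (bs i : Module.End F V)) deg) (h𝒱 : IsGrading 𝒱)
    {ψ : S →ₗ[F] F} (hψ : ∀ i, ψ (bs i) ≠ 0 → deg i = 0)
    {i : I} (h : ε (deg i) (deg i) = 1) (k : I)
    {Q : Submodule F (FreeAlgebra F I)}
    (hQ : ∀ s t l l', s + t + 2 ≤ p →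
      FreeAlgebra.ι F i ^ s * hb.relator l l' * FreeAlgebra.ι F i ^ t ∈ Q) :
    FreeAlgebra.ι F k * hb.powRelator ψ i h
      - (ε (deg k) (deg i) : F) ^ p • (hb.powRelator ψ i h * FreeAlgebra.ι F k)
      - ∑ t ∈ Finset.range p, (ε (deg k) (deg i) : F) ^ t •
        (FreeAlgebra.ι F i ^ t * hb.relator k i * FreeAlgebra.ι F i ^ (p - 1 - t)) ∈ Q := by
  have hp : p.Prime := Fact.out
  set q : F := (ε (deg k) (deg i) : F) with hq
  set x : FreeAlgebra F I := FreeAlgebra.ι F i with hx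
  set Op := LinearMap.mulRight F x - q • LinearMap.mulLeft F x with hOp
  set OpE := LinearMap.mulRight F (bs i : Module.End F V) -
    q • LinearMap.mulLeft F (bs i : Module.End F V) with hOpE
  -- Relations of total length at most `n + 1`. Each application of `Op` lengthens them by one
  -- letter, so after `p - 1` steps they have length at most `p`.
  let Qn : ℕ → Submodule F (FreeAlgebra F I) := fun n => Submodule.span F
    {y | ∃ s t l l', s + t + 1 ≤ n ∧ y = x ^ s * hb.relator l l' * x ^ t}
  have hQn : ∀ n, n + 1 ≤ p → Qn n ≤ Q := by
    intro n hn
    refine Submodule.span_le.2 ?_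
    rintro _ ⟨s, t, l, l', h1, rfl⟩
    exact hQ s t l l' (by omega)
  have hOpQ : ∀ n, ∀ y ∈ Qn n, Op y ∈ Qn (n + 1) := by
    intro n y hy
    have : Qn n ≤ (Qn (n + 1)).comap Op := by
      refine Submodule.span_le.2 ?_
      rintro _ ⟨s, t, l, l', h1, rfl⟩
      show Op _ ∈ Qn (n + 1)
      have e : Op (x ^ s * hb.relator l l' * x ^ t) =
          x ^ s * hb.relator l l' * x ^ (t + 1) - q • (x ^ (s + 1) * hb.relator l l' * x ^ t) := by
        simp [hOp, pow_succ x t, pow_succ' x s, mul_assoc]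
      rw [e]
      exact Submodule.sub_mem _ (Submodule.subset_span ⟨s, t + 1, l, l', by omega, rfl⟩)
        (Submodule.smul_mem _ _ (Submodule.subset_span ⟨s + 1, t, l, l', by omega, rfl⟩))
    exact this hy
  -- Iterated brackets in `S` follow the iterated operator in the free algebra, up to `Qn n`.
  -- Evenness of the degree of `x_i` keeps the scalar equal to `q` at each step.
  have hiter : ∀ n, ∃ v : S, (v : Module.End F V) = (OpE ^ n) (hb.br k i) ∧
      (v : Module.End F V) ∈ homEnd 𝒱 (deg k + (n + 1) • deg i) ∧
      (Op ^ n) (freeLin bs (hb.br k i)) - freeLin bs v ∈ Qn n := by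
    intro n
    induction n with
    | zero =>
      refine ⟨hb.br k i, by simp, ?_, by simp⟩
      rw [zero_add, one_smul]
      exact colorBracket_mem_homEnd (hb.mem_homEnd k) (hb.mem_homEnd i)
    | succ n ih =>
      obtain ⟨v, h1, h2, h3⟩ := ih
      have hqv : (ε (deg k + (n + 1) • deg i) (deg i) : F) = q := by
        rw [ε.add_left, ε.nsmul_left, h]; simp [hq]
      let w : S := ⟨_, hb.bracket_mem_of_mem_homEnd h𝒱 h2 (hb.mem_homEnd i)⟩
      refine ⟨w, ?_, ?_, ?_⟩
      · rw [pow_succ', Module.End.mul_apply, ← h1]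
        simp only [w, colorBracket, hqv]
        simp [hOpE]
      · have := colorBracket_mem_homEnd (ε := ε) h2 (hb.mem_homEnd i)
        rwa [add_assoc, ← succ_nsmul] at this
      · have h4 := hb.relator_right h𝒱 (Q := Qn (n + 1)) (k := i) (w := w)
          (fun l => Submodule.subset_span ⟨0, 0, l, i, by omega, by simp⟩) h2 rfl
        have h5 := Submodule.add_mem _ (hOpQ n _ h3) h4
        rw [hqv] at h5
        convert h5 using 1
        rw [map_sub, pow_succ', Module.End.mul_apply]
        simp only [hOp, LinearMap.sub_apply, LinearMap.smul_apply, LinearMap.mulRight_apply,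
          LinearMap.mulLeft_apply]
        abel
  obtain ⟨v, h1, h2, h3⟩ := hiter (p - 1)
  rw [sum_pow_mul_pow p q x (hb.relator k i)]
  have hE : (v : Module.End F V) = colorBracket ε (deg k) (p • deg i) (bs k)
      ((bs i : Module.End F V) ^ p) := by
    have : (hb.br k i : Module.End F V) = OpE (bs k) := by
      simp [IsHomFamily.br, colorBracket, hOpE, hq]
    rw [h1, this, ← Module.End.mul_apply, ← pow_succ, Nat.sub_add_cancel hp.one_le, hOpE,
      pow_prime_commutator p q]
    simp [colorBracket, ε.nsmul_right, hq]
  have h4 := hb.relator_left h𝒱 (Q := Q) (k := k) (z := ⟨_, hb.pow_mem i h⟩) (w := v)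
    (fun l => by simpa using hQ 0 0 k l hp.two_le) (pow_mem_homEnd (hb.mem_homEnd i) p) hE
  have h5 := hQn (p - 1) (by have := hp.one_le; omega) h3
  have hr : hb.relator k i = Op (FreeAlgebra.ι F k) - freeLin bs (hb.br k i) := by
    simp [IsHomFamily.relator, hOp, hx, hq]
  rw [hr, map_sub, ← Module.End.mul_apply, ← pow_succ, Nat.sub_add_cancel hp.one_le,
    pow_prime_commutator p q x, ← hOp]
  have hq2 : (ε (deg k) (p • deg i) : F) = q ^ p := by rw [ε.nsmul_right]; simp [hq]
  rw [hq2] at h4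
  -- The constant `ψ(x_i)^p` must commute with `x_k` without a twist; where it is nonzero, `x_i` has
  -- degree 0 and `q = 1`.
  have h6 : (1 - q ^ p) * ψ (bs i) ^ p = 0 := by
    by_cases h0 : ψ (bs i) = 0
    · rw [h0, zero_pow hp.ne_zero, mul_zero]
    · have : q = 1 := by rw [hq, hψ i h0, ε.zero_right]; simp
      rw [this]; simp
  have h7 := Q.add_mem (Q.neg_mem h4) h5
  convert h7 using 1
  rw [IsHomFamily.powRelator, ← hx]
  have h8 : (ψ (bs i) ^ p) • FreeAlgebra.ι F k = (q ^ p * ψ (bs i) ^ p) • FreeAlgebra.ι F k := by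
    congr 1; linear_combination h6
  simp only [mul_sub, sub_mul, mul_add, add_mul, Algebra.algebraMap_eq_smul_one, mul_smul_comm,
    smul_mul_assoc, mul_one, one_mul, smul_sub, smul_add, smul_smul, ← h8]
  abel

variable [LinearOrder I]

/-- The rewriting rules of the enveloping algebra. -/
inductive PBWRule (hb : IsHomFamily p ε 𝒱 S (fun i => (bs i : Module.End F V)) deg)
    (ψ : S →ₗ[F] F) : List I → FreeAlgebra F I → Prop
  -- The leading term of the relator of an odd letter with itself is `2 x^2`, hence the factor
  -- `1/2`.
  | pair {j i : I} (θ : F)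
      (h : (i < j ∧ θ = 1) ∨ (i = j ∧ ε (deg i) (deg i) ≠ 1 ∧ θ = 2⁻¹)) :
      PBWRule hb ψ [j, i] (mon [j, i] - θ • hb.relator j i)
  | power {i : I} (h : ε (deg i) (deg i) = 1) :
      PBWRule hb ψ (List.replicate p i) (mon (List.replicate p i) - hb.powRelator ψ i h)

variable {hb : IsHomFamily p ε 𝒱 S (fun i => (bs i : Module.End F V)) deg} {ψ : S →ₗ[F] F}

theorem freeLin_mem_span_mon {W : List I} (hW : 1 < W.length) (z : S) :
    freeLin bs z ∈ Submodule.span F {x | ∃ u, WordLT u W ∧ x = mon u} := by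
  have : z ∈ Submodule.span F (Set.range bs) := bs.span_eq ▸ Submodule.mem_top
  induction this using Submodule.span_induction with
  | mem z hz =>
    obtain ⟨i, rfl⟩ := hz
    exact Submodule.subset_span ⟨[i], .of_length (by simpa using hW), by
      rw [freeLin_basis]; simp [mon]⟩
  | zero => simp
  | add x y _ _ hx hy => rw [map_add]; exact Submodule.add_mem _ hx hy
  | smul c x _ hx => rw [map_smul]; exact Submodule.smul_mem _ _ hx

theorem PBWRule.mem_span (h2 : (2 : F) ≠ 0) (hp : 2 ≤ p) {W : List I} {f : FreeAlgebra F I}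
    (h : PBWRule hb ψ W f) : f ∈ Submodule.span F {x | ∃ u, WordLT u W ∧ x = mon u} := by
  cases h with
  | @pair j i θ h =>
    rcases h with ⟨h, rfl⟩ | ⟨rfl, ho, rfl⟩
    · have e : mon [j, i] - (1 : F) • hb.relator j i =
          (ε (deg j) (deg i) : F) • mon [i, j] + freeLin bs (hb.br j i) := by
        simp [mon, IsHomFamily.relator]
        abel
      rw [e]
      exact Submodule.add_mem _ (Submodule.smul_mem _ _ (Submodule.subset_span
        ⟨[i, j], by simpa using WordLT.of_swap [] [] h, rfl⟩)) (freeLin_mem_span_mon (by simp) _)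
    · have e : mon [i, i] - (2 : F)⁻¹ • hb.relator i i = (2 : F)⁻¹ • freeLin bs (hb.br i i) := by
        have : (2 : F)⁻¹ * 2 = 1 := inv_mul_cancel₀ h2
        have h3 : mon [i, i] = ((2 : F)⁻¹ * 2) • mon (F := F) [i, i] := by rw [this, one_smul]
        rw [h3]
        simp only [mon, IsHomFamily.relator, ε.self_eq ho, wd_cons, wd_nil, mul_one]
        module
      rw [e]
      exact Submodule.smul_mem _ _ (freeLin_mem_span_mon (by simp) _)
  | @power i h =>
    have e : mon (List.replicate p i) - hb.powRelator ψ i h =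
        freeLin bs ⟨_, hb.pow_mem i h⟩ + (ψ (bs i) ^ p) • mon [] := by
      simp [mon, wd_replicate, IsHomFamily.powRelator, Algebra.algebraMap_eq_smul_one]
    rw [e]
    exact Submodule.add_mem _ (freeLin_mem_span_mon (by simp; omega) _)
      (Submodule.smul_mem _ _ (Submodule.subset_span ⟨[], .of_length (by simp; omega), rfl⟩))

/-- Up to a nonzero scalar a relator does not depend on the order of its letters; the leading word
of the rule is the descending one. -/
theorem relator_mem_relSpan (h2 : (2 : F) ≠ 0) {i j : I} {a b w : List I}
    (h : WordLT (a ++ [max i j, min i j] ++ b) w) :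
    mon a * hb.relator i j * mon b ∈ relSpan (PBWRule hb ψ) w := by
  have key : ∀ {i j : I} (θ : F), θ ≠ 0 →
      ((i < j ∧ θ = 1) ∨ (i = j ∧ ε (deg i) (deg i) ≠ 1 ∧ θ = 2⁻¹)) →
      WordLT (a ++ [j, i] ++ b) w →
      mon a * hb.relator j i * mon b ∈ relSpan (PBWRule hb ψ) w := by
    intro i j θ hθ hr hw
    have : mon a * (mon [j, i] - (mon [j, i] - θ • hb.relator j i)) * mon b ∈
        relSpan (PBWRule hb ψ) w :=
      Submodule.subset_span ⟨a, [j, i], _, b, .pair θ hr, hw, rfl⟩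
    rw [sub_sub_cancel, mul_smul_comm, smul_mul_assoc] at this
    have h3 := Submodule.smul_mem _ θ⁻¹ this
    rwa [smul_smul, inv_mul_cancel₀ hθ, one_smul] at h3
  let Λ : FreeAlgebra F I →ₗ[F] FreeAlgebra F I :=
    LinearMap.mulRight F (mon b) ∘ₗ LinearMap.mulLeft F (mon a)
  refine hb.relator_mem ((relSpan (PBWRule hb ψ) w).comap Λ) ?_ ?_ ?_
  · intro hij
    rw [max_eq_right hij.le, min_eq_left hij.le] at h
    exact key 1 one_ne_zero (.inl ⟨hij, rfl⟩) h
  · intro hij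
    rw [max_eq_left hij.le, min_eq_right hij.le] at h
    exact key 1 one_ne_zero (.inl ⟨hij, rfl⟩) h
  · rintro rfl ho
    rw [max_self, min_self] at h
    exact key 2⁻¹ (inv_ne_zero h2) (.inr ⟨rfl, ho, rfl⟩) h

theorem relator_mem_relSpan_of_length (h2 : (2 : F) ≠ 0) {i j : I} {a b w : List I}
    (h : a.length + b.length + 2 < w.length) :
    mon a * hb.relator i j * mon b ∈ relSpan (PBWRule hb ψ) w :=
  relator_mem_relSpan h2 (.of_length (by simp; omega))

theorem powRelator_mem_relSpan {i : I} (h : ε (deg i) (deg i) = 1) {a b w : List I}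
    (hw : WordLT (a ++ List.replicate p i ++ b) w) :
    mon a * hb.powRelator ψ i h * mon b ∈ relSpan (PBWRule hb ψ) w := by
  have : mon a * (mon (List.replicate p i) - (mon (List.replicate p i) - hb.powRelator ψ i h)) *
      mon b ∈ relSpan (PBWRule hb ψ) w :=
    Submodule.subset_span ⟨a, _, _, b, .power h, hw, rfl⟩
  rwa [sub_sub_cancel] at this

/-- The Jacobi relation on `k, j, i`, freed of the terms whose leading words are smaller
rearrangements of `k j i`. A repeated odd letter makes terms of the relation coincide, which is
compensated by division by 2, or by 3 if all letters are equal. -/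
theorem overlap_pair_pair (h𝒱 : IsGrading 𝒱) (h2 : (2 : F) ≠ 0) (h3 : (3 : F) ≠ 0) {k j i : I}
    {θ θ' : F}
    (h : (j < k ∧ θ = 1) ∨ (j = k ∧ ε (deg j) (deg j) ≠ 1 ∧ θ = 2⁻¹))
    (h' : (i < j ∧ θ' = 1) ∨ (i = j ∧ ε (deg i) (deg i) ≠ 1 ∧ θ' = 2⁻¹)) :
    θ' • (FreeAlgebra.ι F k * hb.relator j i) - θ • (hb.relator k j * FreeAlgebra.ι F i) ∈
      relSpan (PBWRule hb ψ) [k, j, i] := by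
  set Q := relSpan (PBWRule hb ψ) [k, j, i] with hQdef
  have hJ := hb.jacobi_relator h𝒱 (Q := Q) (fun l l' => by
    simpa [mon] using relator_mem_relSpan_of_length (hb := hb) (ψ := ψ) h2 (i := l) (j := l') (a := []) (b := [])
      (w := [k, j, i]) (by simp)) k j i
  have hL : ∀ a l l', WordLT [a, max l l', min l l'] [k, j, i] →
      FreeAlgebra.ι F a * hb.relator l l' ∈ Q := fun a l l' hw => by
    simpa [mon] using relator_mem_relSpan (hb := hb) (ψ := ψ) h2 (a := [a]) (b := []) (i := l)
      (j := l') (w := [k, j, i]) (by simpa using hw)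
  have hR : ∀ a l l', WordLT [max l l', min l l', a] [k, j, i] →
      hb.relator l l' * FreeAlgebra.ι F a ∈ Q := fun a l l' hw => by
    simpa [mon] using relator_mem_relSpan (hb := hb) (ψ := ψ) h2 (a := []) (b := [a]) (i := l)
      (j := l') (w := [k, j, i]) (by simpa using hw)
  rcases h with ⟨hkj, rfl⟩ | ⟨rfl, ho, rfl⟩ <;> rcases h' with ⟨hji, rfl⟩ | ⟨rfl, ho', rfl⟩
  · have hki := hji.trans hkj
    have w1 : WordLT [j, k, i] [k, j, i] := by simpa using WordLT.of_swap [] [i] hkj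
    have w2 : WordLT [k, i, j] [k, j, i] := by simpa using WordLT.of_swap [k] [] hji
    have w3 : WordLT [j, i, k] [k, j, i] :=
      .trans (by simpa using WordLT.of_swap [j] [] hki) w1
    have w4 : WordLT [i, k, j] [k, j, i] :=
      .trans (by simpa using WordLT.of_swap [] [j] hki) w2
    have m1 := hR k j i (by rwa [max_eq_left hji.le, min_eq_right hji.le])
    have m2 := hL i k j (by rwa [max_eq_left hkj.le, min_eq_right hkj.le])
    have m3 := hL j k i (by rwa [max_eq_left hki.le, min_eq_right hki.le])
    have m4 := hR j k i (by rwa [max_eq_left hki.le, min_eq_right hki.le])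
    have := Q.sub_mem (Q.add_mem (Q.sub_mem (Q.add_mem hJ
      (Q.smul_mem ((ε (deg k) (deg j) : F) * ε (deg k) (deg i)) m1))
      (Q.smul_mem ((ε (deg k) (deg i) : F) * ε (deg j) (deg i)) m2))
      (Q.smul_mem (ε (deg k) (deg j) : F) m3)) (Q.smul_mem (ε (deg j) (deg i) : F) m4)
    convert this using 1
    module
  · have w1 : WordLT [i, k, i] [k, i, i] := by simpa using WordLT.of_swap [] [i] hkj
    have w2 : WordLT [i, i, k] [k, i, i] :=
      .trans (by simpa using WordLT.of_swap [i] [] hkj) w1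
    have m1 := hR k i i (by simpa using w2)
    have m2 := hL i k i (by rwa [max_eq_left hkj.le, min_eq_right hkj.le])
    have := Q.smul_mem (2 : F)⁻¹ (Q.add_mem (Q.sub_mem (Q.add_mem hJ
      (Q.smul_mem ((ε (deg k) (deg i) : F) * ε (deg k) (deg i)) m1))
      (Q.smul_mem ((ε (deg k) (deg i) : F) * ε (deg i) (deg i)) m2))
      (Q.smul_mem (ε (deg k) (deg i) : F) m2))
    convert this using 1
    have e : hb.relator k i * FreeAlgebra.ι F i =
        ((2 : F)⁻¹ * 2) • (hb.relator k i * FreeAlgebra.ι F i) := by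
      rw [inv_mul_cancel₀ h2, one_smul]
    rw [ε.self_eq ho']
    conv_lhs => rw [one_smul, e]
    module
  · have w1 : WordLT [j, i, j] [j, j, i] := by simpa using WordLT.of_swap [j] [] hji
    have w2 : WordLT [i, j, j] [j, j, i] :=
      .trans (by simpa using WordLT.of_swap [] [j] hji) w1
    have m1 := hR j j i (by rwa [max_eq_left hji.le, min_eq_right hji.le])
    have m2 := hL i j j (by simpa using w2)
    have := Q.smul_mem (2 : F)⁻¹ (Q.sub_mem (Q.add_mem (Q.sub_mem hJ
      (Q.smul_mem ((ε (deg j) (deg i) : F) * ε (deg j) (deg i)) m2))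
      (Q.smul_mem ((ε (deg j) (deg j) : F) * ε (deg j) (deg i)) m1))
      (Q.smul_mem (ε (deg j) (deg i) : F) m1))
    convert this using 1
    have e : FreeAlgebra.ι F j * hb.relator j i =
      ((2 : F)⁻¹ * 2) • (FreeAlgebra.ι F j * hb.relator j i) := by
      rw [inv_mul_cancel₀ h2, one_smul]
    rw [ε.self_eq ho]
    conv_lhs => rw [one_smul, e]
    module
  -- With three equal odd letters the six Jacobi terms add up to three times the commutator of the
  -- letter with its square relator.
  · have := Q.smul_mem ((2 : F)⁻¹ * 3⁻¹) hJ
    convert this using 1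
    rw [ε.self_eq ho]
    have e : (2 : F)⁻¹ = (2 : F)⁻¹ * 3⁻¹ * 3 := by
      rw [mul_assoc, inv_mul_cancel₀ h3, mul_one]
    conv_lhs => rw [e]
    module

theorem wordLT_replicate_left {i k : I} (h : i < k) (t : ℕ) (l : List I) :
    WordLT (List.replicate (t + 1) i ++ k :: l) (k :: (List.replicate (t + 1) i ++ l)) := by
  induction t with
  | zero => simpa using WordLT.of_swap [] l h
  | succ t ih =>
    have h1 := ih.append [i] []
    have h2 := WordLT.of_swap [] (List.replicate (t + 1) i ++ l) h
    refine WordLT.trans (v := i :: k :: (List.replicate (t + 1) i ++ l)) ?_ ?_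
    · simpa [List.replicate_succ] using h1
    · simpa [List.replicate_succ] using h2

theorem wordLT_replicate_right {i k : I} (h : k < i) (t : ℕ) (l : List I) :
    WordLT (l ++ k :: List.replicate (t + 1) i) (l ++ List.replicate (t + 1) i ++ [k]) := by
  induction t generalizing l with
  | zero => simpa using WordLT.of_swap l [] h
  | succ t ih =>
    have h1 := ih (l ++ [i])
    have h2 := WordLT.of_swap l (List.replicate (t + 1) i) h
    refine WordLT.trans (v := l ++ i :: k :: List.replicate (t + 1) i) ?_ ?_
    · simpa [List.replicate_succ] using h2
    · simpa [List.replicate_succ] using h1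

theorem mon_replicate (n : ℕ) (i : I) : mon (F := F) (List.replicate n i) = FreeAlgebra.ι F i ^ n :=
  wd_replicate _ _ _

theorem powRelator_commutator_relSpan [CharP F p] [Fact p.Prime] (h𝒱 : IsGrading 𝒱)
    (h2 : (2 : F) ≠ 0) (hψ : ∀ i, ψ (bs i) ≠ 0 → deg i = 0)
    {i : I} (h : ε (deg i) (deg i) = 1) (k : I) {w : List I} (hw : p < w.length) :
    FreeAlgebra.ι F k * hb.powRelator ψ i h
      - (ε (deg k) (deg i) : F) ^ p • (hb.powRelator ψ i h * FreeAlgebra.ι F k)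
      - ∑ t ∈ Finset.range p, (ε (deg k) (deg i) : F) ^ t •
        (FreeAlgebra.ι F i ^ t * hb.relator k i * FreeAlgebra.ι F i ^ (p - 1 - t)) ∈
      relSpan (PBWRule hb ψ) w := by
  refine hb.powRelator_commutator h𝒱 hψ h k fun s t l l' hst => ?_
  rw [← mon_replicate, ← mon_replicate]
  exact relator_mem_relSpan_of_length h2 (by simp; omega)

/-- In `[x_k, x_i^p] = (ad x_i)^p x_k` the leading word of the summand with index `t > 0` begins
with `i` and is smaller, as is that of `x_i^p x_k`. Only the summand `t = 0` remains. -/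
theorem overlap_pair_power [CharP F p] [Fact p.Prime] (h𝒱 : IsGrading 𝒱)
    (h2 : (2 : F) ≠ 0) (hψ : ∀ i, ψ (bs i) ≠ 0 → deg i = 0)
    {i : I} (h : ε (deg i) (deg i) = 1) {k : I} (hk : i < k) :
    FreeAlgebra.ι F k * hb.powRelator ψ i h - hb.relator k i * FreeAlgebra.ι F i ^ (p - 1) ∈
      relSpan (PBWRule hb ψ) (k :: List.replicate p i) := by
  have hp : p.Prime := Fact.out
  obtain ⟨r, hr⟩ : ∃ r, p = r + 1 := ⟨p - 1, by have := hp.one_le; omega⟩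
  have h0 := powRelator_commutator_relSpan (hb := hb) h𝒱 h2 hψ h k
    (w := k :: List.replicate p i) (by simp)
  have h1 : hb.powRelator ψ i h * FreeAlgebra.ι F k ∈
      relSpan (PBWRule hb ψ) (k :: List.replicate p i) := by
    have := powRelator_mem_relSpan (hb := hb) (ψ := ψ) h (a := []) (b := [k])
      (w := k :: List.replicate p i) (by
        have := wordLT_replicate_left hk r []
        rw [← hr] at this; simpa using this)
    simpa [mon] using this
  have h4 : ∑ t ∈ Finset.range p, (ε (deg k) (deg i) : F) ^ t •
        (FreeAlgebra.ι F i ^ t * hb.relator k i * FreeAlgebra.ι F i ^ (p - 1 - t)) -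
        hb.relator k i * FreeAlgebra.ι F i ^ (p - 1) ∈
        relSpan (PBWRule hb ψ) (k :: List.replicate p i) := by
    rw [show Finset.range p = Finset.range (r + 1) by rw [hr], Finset.sum_range_succ']
    simp only [pow_zero, one_smul, one_mul, Nat.sub_zero, add_sub_cancel_right]
    refine Submodule.sum_mem _ fun t ht => Submodule.smul_mem _ _ ?_
    have ht' := Finset.mem_range.1 ht
    rw [← mon_replicate, ← mon_replicate]
    refine relator_mem_relSpan h2 ?_
    rw [max_eq_left hk.le, min_eq_right hk.le]
    have := wordLT_replicate_left hk t (List.replicate (p - (t + 1)) i)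
    rw [List.replicate_append_replicate] at this
    have e : t + 1 + (p - (t + 1)) = p := by omega
    rw [e] at this
    convert this using 1
    have e2 : p - (t + 1) = (p - 1 - (t + 1)) + 1 := by omega
    rw [e2, List.replicate_succ (n := p - 1 - (t + 1))]
    simp
  have := Submodule.add_mem _ (Submodule.add_mem _ h0
    (Submodule.smul_mem _ ((ε (deg k) (deg i) : F) ^ p) h1)) h4
  convert this using 1
  abel

/-- The mirror image: now only the summand `t = p - 1` remains. Its relator has the wrong order of
letters, which costs a factor `-q`. -/
theorem overlap_power_pair [CharP F p] [Fact p.Prime] (h𝒱 : IsGrading 𝒱)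
    (h2 : (2 : F) ≠ 0) (hψ : ∀ i, ψ (bs i) ≠ 0 → deg i = 0)
    {i : I} (h : ε (deg i) (deg i) = 1) {k : I} (hk : k < i) :
    FreeAlgebra.ι F i ^ (p - 1) * hb.relator i k - hb.powRelator ψ i h * FreeAlgebra.ι F k ∈
      relSpan (PBWRule hb ψ) (List.replicate p i ++ [k]) := by
  have hp : p.Prime := Fact.out
  obtain ⟨r, hr⟩ : ∃ r, p = r + 1 := ⟨p - 1, by have := hp.one_le; omega⟩
  have h0 := powRelator_commutator_relSpan (hb := hb) h𝒱 h2 hψ h k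
    (w := List.replicate p i ++ [k]) (by simp)
  have h1 : FreeAlgebra.ι F k * hb.powRelator ψ i h ∈
      relSpan (PBWRule hb ψ) (List.replicate p i ++ [k]) := by
    have := powRelator_mem_relSpan (hb := hb) (ψ := ψ) h (a := [k]) (b := [])
      (w := List.replicate p i ++ [k]) (by
        have := wordLT_replicate_right hk r []
        rw [← hr] at this; simpa using this)
    simpa [mon] using this
  set q : F := (ε (deg k) (deg i) : F) with hq
  have hrel : hb.relator k i = -q • hb.relator i k := by
    have h4 : hb.br k i = -q • hb.br i k := by
      apply Subtype.ext
      have := ε.mul_skew (deg k) (deg i)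
      simp only [hq, IsHomFamily.br, colorBracket, Submodule.coe_smul, smul_sub, smul_smul,
        neg_mul, this]
      module
    simp only [IsHomFamily.relator, h4, map_smul, smul_sub, smul_smul, neg_mul, hq, ε.mul_skew]
    module
  have h4 : ∑ t ∈ Finset.range p, q ^ t •
        (FreeAlgebra.ι F i ^ t * hb.relator k i * FreeAlgebra.ι F i ^ (p - 1 - t)) +
        q ^ p • (FreeAlgebra.ι F i ^ (p - 1) * hb.relator i k) ∈
        relSpan (PBWRule hb ψ) (List.replicate p i ++ [k]) := by
    have e0 : ∑ t ∈ Finset.range p, q ^ t •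
        (FreeAlgebra.ι F i ^ t * hb.relator k i * FreeAlgebra.ι F i ^ (p - 1 - t)) +
        q ^ p • (FreeAlgebra.ι F i ^ (p - 1) * hb.relator i k) =
        ∑ t ∈ Finset.range r, q ^ t •
        (FreeAlgebra.ι F i ^ t * hb.relator k i * FreeAlgebra.ι F i ^ (p - 1 - t)) := by
      conv_lhs => rw [show Finset.range p = Finset.range (r + 1) by rw [hr]]
      rw [Finset.sum_range_succ]
      have e1 : p - 1 = r := by omega
      have e2 : q ^ p = q ^ r * q := by rw [hr, pow_succ]
      rw [e1, e2, Nat.sub_self, pow_zero, mul_one, hrel]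
      simp only [mul_smul_comm]
      module
    rw [e0]
    refine Submodule.sum_mem _ fun t ht => Submodule.smul_mem _ _ ?_
    have ht' := Finset.mem_range.1 ht
    rw [← mon_replicate, ← mon_replicate]
    refine relator_mem_relSpan h2 ?_
    rw [max_eq_right hk.le, min_eq_left hk.le]
    have := wordLT_replicate_right hk (p - 1 - t - 1) (List.replicate (t + 1) i)
    rw [List.replicate_append_replicate] at this
    have e : t + 1 + (p - 1 - t - 1 + 1) = p := by omega
    rw [e] at this
    convert this using 1
    have e2 : p - 1 - t = p - 1 - t - 1 + 1 := by omega
    rw [e2, List.replicate_succ' (n := t)]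
    simp
  have hq0 : q ^ p ≠ 0 := pow_ne_zero _ (Units.ne_zero _)
  have := Submodule.smul_mem _ (q ^ p)⁻¹ (Submodule.add_mem _ (Submodule.sub_mem _ h0 h1) h4)
  convert this using 1
  have e : ∀ y : FreeAlgebra F I, y = (q ^ p)⁻¹ • q ^ p • y := fun y => by
    rw [smul_smul, inv_mul_cancel₀ hq0, one_smul]
  rw [e (_ - _)]
  congr 1
  rw [smul_sub]
  abel

/-- An even letter has zero relator with itself, so it commutes with its power relator modulo
smaller relations; the rest is induction on the shift `s`. -/
theorem overlap_power_power [CharP F p] [Fact p.Prime] (h𝒱 : IsGrading 𝒱)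
    (h2 : (2 : F) ≠ 0) (hψ : ∀ i, ψ (bs i) ≠ 0 → deg i = 0)
    {i : I} (h : ε (deg i) (deg i) = 1) (s : ℕ) :
    FreeAlgebra.ι F i ^ s * hb.powRelator ψ i h - hb.powRelator ψ i h * FreeAlgebra.ι F i ^ s ∈
      relSpan (PBWRule hb ψ) (List.replicate (p + s) i) := by
  induction s with
  | zero => simp
  | succ s ih =>
    have h0 := powRelator_commutator_relSpan (hb := hb) h𝒱 h2 hψ h i
      (w := List.replicate (p + 1) i) (by simp)
    have hr : hb.relator i i = 0 := by
      have h4 : hb.br i i = 0 := by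
        apply Subtype.ext
        simp [IsHomFamily.br, colorBracket, h]
      simp [IsHomFamily.relator, h4, h]
    simp only [hr, h, mul_zero, zero_mul, smul_zero, Finset.sum_const_zero, sub_zero, Units.val_one,
      one_pow, one_smul] at h0
    have h1 := mul_mem_relSpan h0 [] (List.replicate s i)
    have h3 := mul_mem_relSpan ih [i] []
    rw [mon_replicate] at h1
    have e1 : [] ++ List.replicate (p + 1) i ++ List.replicate s i =
        List.replicate (p + (s + 1)) i := by
      rw [List.nil_append, List.replicate_append_replicate]; congr 1; omega
    have e2 : [i] ++ List.replicate (p + s) i ++ [] = List.replicate (p + (s + 1)) i := by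
      rw [List.append_nil, ← Nat.add_assoc, List.replicate_succ]; rfl
    rw [e1] at h1
    rw [e2] at h3
    have := Submodule.add_mem _ h1 h3
    convert this using 1
    simp only [mon, wd_cons, wd_nil, mul_one, one_mul, pow_succ', mul_sub, sub_mul, mul_assoc]
    abel

end PBW

/-! ### The Poincaré–Birkhoff–Witt theorem. -/

section PBWTheorem

variable {Γ F V I : Type*} [AddCommGroup Γ] [Field F] [AddCommGroup V] [Module F V]
  {p : ℕ} {ε : Bicharacter Γ F} {𝒱 : Γ → Submodule F V}
  {S : Submodule F (Module.End F V)} {bs : Module.Basis I F S} {deg : I → Γ} [LinearOrder I]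
  {hb : IsHomFamily p ε 𝒱 S (fun i => (bs i : Module.End F V)) deg} {ψ : S →ₗ[F] F}

theorem PBWRule.eq_pair_or_eq_replicate {W : List I} {f : FreeAlgebra F I} (h : PBWRule hb ψ W f) :
    (∃ (j i : I) (θ : F), W = [j, i] ∧ ((i < j ∧ θ = 1) ∨ (i = j ∧ ε (deg i) (deg i) ≠ 1 ∧ θ = 2⁻¹)) ∧
      f = mon [j, i] - θ • hb.relator j i) ∨
    ∃ i, ∃ h : ε (deg i) (deg i) = 1, W = List.replicate p i ∧
      f = mon (List.replicate p i) - hb.powRelator ψ i h := by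
  cases h with
  | pair θ h => exact .inl ⟨_, _, θ, rfl, h, rfl⟩
  | power h => exact .inr ⟨_, h, rfl, rfl⟩

/-- Redexes of one kind have equal length. As `p > 2`, a pair contains no `p`-th power, and the only
pair inside a power of an even letter is a repeated even letter, which is not a redex. -/
theorem PBWRule.inclusion (hp : 2 < p) {c W e : List I} {f f' : FreeAlgebra F I}
    (h : PBWRule hb ψ (c ++ W ++ e) f) (h' : PBWRule hb ψ W f') : c = [] ∧ e = [] ∧ f = f' := by
  have key : ∀ n m : ℕ, n = (c ++ W ++ e).length → m = W.length → n = m → c = [] ∧ e = [] := by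
    rintro _ _ rfl rfl h
    simp only [List.length_append] at h
    exact ⟨List.length_eq_zero_iff.1 (by omega), List.length_eq_zero_iff.1 (by omega)⟩
  rcases h.eq_pair_or_eq_replicate with ⟨j, i, θ, hW, hc, hf⟩ | ⟨i, ho, hW, hf⟩ <;>
    rcases h'.eq_pair_or_eq_replicate with ⟨j', i', θ', hW', hc', hf'⟩ | ⟨i', ho', hW', hf'⟩
  · obtain ⟨rfl, rfl⟩ := key 2 2 (by rw [hW]; rfl) (by rw [hW']; rfl) rfl
    rw [List.nil_append, List.append_nil, hW'] at hW
    simp only [List.cons.injEq, and_true] at hW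
    obtain ⟨rfl, rfl⟩ := hW
    refine ⟨rfl, rfl, ?_⟩
    have : θ = θ' := by
      rcases hc with ⟨h1, rfl⟩ | ⟨h1, _, rfl⟩ <;> rcases hc' with ⟨h2, rfl⟩ | ⟨h2, _, rfl⟩
      · rfl
      · exact absurd h2 h1.ne
      · exact absurd h1 h2.ne
      · rfl
    rw [hf, hf', this]
  · exfalso
    have := congrArg List.length hW
    rw [hW'] at this
    simp at this; omega
  · exfalso
    have h1 : ∀ x ∈ W, x = i := fun x hx => by
      have : x ∈ List.replicate p i := hW ▸ by simp [hx]
      exact List.eq_of_mem_replicate this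
    have hj := h1 j' (by simp [hW'])
    have hi := h1 i' (by simp [hW'])
    subst hj; subst hi
    rcases hc' with ⟨h2, _⟩ | ⟨_, h2, _⟩
    · exact lt_irrefl _ h2
    · exact h2 ho
  · obtain ⟨rfl, rfl⟩ := key p p (by rw [hW]; simp) (by rw [hW']; simp) rfl
    rw [List.nil_append, List.append_nil, hW'] at hW
    have : i' = i := by
      have : i' ∈ List.replicate p i := hW ▸ List.mem_replicate.2 ⟨by omega, rfl⟩
      exact List.eq_of_mem_replicate this
    subst this
    exact ⟨rfl, rfl, by rw [hf, hf']⟩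

theorem PBWRule.overlap [CharP F p] [Fact p.Prime] (hp : 3 < p) (h𝒱 : IsGrading 𝒱)
    (hψ : ∀ i, ψ (bs i) ≠ 0 → deg i = 0) {c d e : List I} {f f' : FreeAlgebra F I}
    (hd : d ≠ []) (h : PBWRule hb ψ (c ++ d) f) (h' : PBWRule hb ψ (d ++ e) f') :
    f * mon e - mon c * f' ∈ relSpan (PBWRule hb ψ) (c ++ d ++ e) := by
  have h2 : (2 : F) ≠ 0 := by
    have := CharP.cast_eq_zero_iff F p 2
    intro h0
    have := Nat.le_of_dvd (by norm_num) (this.1 (by exact_mod_cast h0)); omega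
  have h3 : (3 : F) ≠ 0 := by
    have := CharP.cast_eq_zero_iff F p 3
    intro h0
    have := Nat.le_of_dvd (by norm_num) (this.1 (by exact_mod_cast h0)); omega
  -- In a degenerate overlap one redex contains the other, so the two rules agree.
  by_cases hce : c = [] ∨ e = []
  · have h4 : ∀ {x y : FreeAlgebra F I} {w : List I}, x = y → x - y ∈ relSpan (PBWRule hb ψ) w := by
      rintro x _ w rfl; simp
    rcases hce with rfl | rfl
    · obtain ⟨h5, h6, h7⟩ := PBWRule.inclusion (p := p) (hb := hb) (ψ := ψ) (f := f') (f' := f) (c := []) (W := d) (e := e)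
        (by omega) (by simpa using h') (by simpa using h)
      subst h6; subst h7
      exact h4 (by simp)
    · obtain ⟨h5, h6, h7⟩ := PBWRule.inclusion (p := p) (hb := hb) (ψ := ψ) (c := c) (W := d) (e := []) (by omega)
        (by simpa using h) (by simpa using h')
      subst h5; subst h7
      exact h4 (by simp)
  push Not at hce
  obtain ⟨hc0, he0⟩ := hce
  have l1 : 0 < c.length := List.length_pos_iff.2 hc0
  have l2 : 0 < d.length := List.length_pos_iff.2 hd
  have l3 : 0 < e.length := List.length_pos_iff.2 he0
  have pairc : ∀ {c d : List I} {j i : I}, 0 < c.length → 0 < d.length → c ++ d = [j, i] →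
      c = [j] ∧ d = [i] := by
    intro c d j i l1 l2 hw
    have := congrArg List.length hw
    simp only [List.length_append, List.length_cons, List.length_nil] at this
    obtain ⟨x, rfl⟩ := List.length_eq_one_iff.1 (show c.length = 1 by omega)
    obtain ⟨y, rfl⟩ := List.length_eq_one_iff.1 (show d.length = 1 by omega)
    simpa using hw
  rcases h.eq_pair_or_eq_replicate with ⟨k, j, θ, hW, hc, rfl⟩ | ⟨i, ho, hW, rfl⟩ <;>
    rcases h'.eq_pair_or_eq_replicate with ⟨j', i', θ', hW', hc', rfl⟩ | ⟨i', ho', hW', rfl⟩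
  · obtain ⟨rfl, rfl⟩ := pairc l1 l2 hW
    obtain ⟨h5, rfl⟩ := pairc l2 l3 hW'
    obtain rfl : j = j' := by simpa using h5
    have := overlap_pair_pair (hb := hb) (ψ := ψ) h𝒱 h2 h3 hc hc'
    have e1 : [k] ++ [j] ++ [i'] = [k, j, i'] := rfl
    rw [e1]
    convert this using 1
    simp only [mon, wd_cons, wd_nil, mul_one, sub_mul, mul_sub, mul_smul_comm, smul_mul_assoc,
      mul_assoc]
    abel
  · obtain ⟨rfl, rfl⟩ := pairc l1 l2 hW
    obtain ⟨h5, h6⟩ : j = i' ∧ e = List.replicate (p - 1) i' := by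
      obtain ⟨r, hr⟩ : ∃ r, p = r + 1 := ⟨p - 1, by omega⟩
      rw [hr, List.replicate_succ] at hW'
      rw [hr]
      simpa using hW'
    subst h5
    rcases hc with ⟨hc, rfl⟩ | ⟨rfl, hc, -⟩
    swap
    · exact absurd ho' hc
    have := overlap_pair_power (hb := hb) (ψ := ψ) h𝒱 h2 hψ ho' hc
    have e1 : [k] ++ [j] ++ e = k :: List.replicate p j := by
      rw [← hW']; rfl
    rw [e1]
    convert this using 1
    rw [← hW', h6]
    simp only [mon, wd_cons, wd_nil, wd_append, mul_one, one_smul, sub_mul, mul_sub, mul_assoc,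
      wd_replicate]
    abel
  · obtain ⟨rfl, rfl⟩ := pairc l2 l3 hW'
    obtain ⟨h5, h6⟩ : j' = i ∧ c = List.replicate (p - 1) i := by
      obtain ⟨r, hr⟩ : ∃ r, p = r + 1 := ⟨p - 1, by omega⟩
      rw [hr, List.replicate_succ'] at hW
      rw [hr]
      have := List.append_inj' hW rfl
      simpa [and_comm] using this
    subst h5
    rcases hc' with ⟨hc, rfl⟩ | ⟨rfl, hc, -⟩
    swap
    · exact absurd ho hc
    have := overlap_power_pair (hb := hb) (ψ := ψ) h𝒱 h2 hψ ho hc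
    rw [hW]
    convert this using 1
    rw [← hW, h6]
    simp only [mon, wd_cons, wd_nil, wd_append, mul_one, one_smul, sub_mul, mul_sub, mul_assoc,
      wd_replicate]
    abel
  · have hd1 : ∀ x ∈ c ++ d, x = i := fun x hx => List.eq_of_mem_replicate (hW ▸ hx)
    have hd2 : ∀ x ∈ d ++ e, x = i' := fun x hx => List.eq_of_mem_replicate (hW' ▸ hx)
    obtain rfl : i = i' := by
      obtain ⟨x, hx⟩ := List.exists_mem_of_length_pos l2
      rw [← hd1 x (by simp [hx]), ← hd2 x (by simp [hx])]
    have hlen : c.length = e.length := by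
      have e1 := congrArg List.length hW
      have e2 := congrArg List.length hW'
      simp only [List.length_append, List.length_replicate] at e1 e2
      omega
    have hc1 : c = List.replicate c.length i :=
      List.eq_replicate_of_mem fun x hx => hd1 x (by simp [hx])
    have he1 : e = List.replicate c.length i := by
      rw [hlen]; exact List.eq_replicate_of_mem fun x hx => hd2 x (by simp [hx])
    have := overlap_power_power (hb := hb) (ψ := ψ) h𝒱 h2 hψ ho c.length
    have e1 : c ++ d ++ e = List.replicate (p + c.length) i := by
      rw [hW, he1, List.replicate_append_replicate]
    rw [e1]
    convert this using 1
    rw [he1, hc1]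
    simp only [mon, wd_append, sub_mul, mul_sub, wd_replicate, List.length_replicate, ← pow_add]
    rw [add_comm p]
    abel

/-- The Poincaré–Birkhoff–Witt theorem: the normal words in a homogeneous basis of `S` are linearly
independent in `u_χ(S)`. -/
theorem IsHomFamily.exists_pbw [CharP F p] [Fact p.Prime] (hp : 3 < p) (h𝒱 : IsGrading 𝒱)
    (hb : IsHomFamily p ε 𝒱 S (fun i => (bs i : Module.End F V)) deg)
    {𝔤 : Submodule F (Module.End F V)} (χ : 𝔤 →ₗ[F] F) (hS : S ≤ 𝔤)
    (hχ : ∀ i, χ (Submodule.inclusion hS (bs i)) ≠ 0 → deg i = 0) :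
    ∃ Θ : RedEnv p ε 𝒱 χ S →ₗ[F] FreeAlgebra F I,
      ∀ w, Normal (fun i => ε (deg i) (deg i) ≠ 1) (fun i => ε (deg i) (deg i) = 1) p w →
        Θ (wd (fun i => RedEnv.ι p ε 𝒱 χ S (bs i)) w) = mon w := by
  classical
  set ψ : S →ₗ[F] F := χ ∘ₗ Submodule.inclusion hS with hψ
  set rule := PBWRule hb ψ with hrule
  have h2 : (2 : F) ≠ 0 := by
    have := CharP.cast_eq_zero_iff F p 2
    intro h0
    have := Nat.le_of_dvd (by norm_num) (this.1 (by exact_mod_cast h0)); omega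
  have hf : ∀ W f, rule W f → f ∈ Submodule.span F {x | ∃ u, WordLT u W ∧ x = mon u} :=
    fun W f h => h.mem_span h2 (by omega)
  have hnf := wordLift_normalForm_rule hf (resolve_of_overlaps hf
    (fun c d e f f' hd h h' => PBWRule.overlap hp h𝒱 hχ hd h h')
    (fun c W e f f' h h' => by
      obtain ⟨rfl, rfl, rfl⟩ := PBWRule.inclusion (by omega) h h'
      simp))
  have hmon : Submodule.span F (Set.range (mon (F := F) (I := I))) = ⊤ := by
    rw [eq_top_iff, ← (FreeAlgebra.basisFreeMonoid F I).span_eq]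
    refine Submodule.span_mono ?_
    rintro _ ⟨w, rfl⟩
    exact ⟨w.toList, (basisFreeMonoid_apply w).symm⟩
  -- A left ideal that contains the right translates of all rules: left multiplication on the
  -- quotient then satisfies the rules, while the normal form map still vanishes on `J`.
  let J : Submodule (FreeAlgebra F I) (FreeAlgebra F I) := Submodule.span _
    {x | ∃ W f b, rule W f ∧ x = (mon W - f) * mon b}
  let K : Submodule F (FreeAlgebra F I) := Submodule.span F
    {x | ∃ a W f b, rule W f ∧ x = mon a * (mon W - f) * mon b}
  have hK : ∀ x ∈ K, wordLift (normalForm rule) x = 0 := by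
    intro x hx
    have : K ≤ LinearMap.ker (wordLift (F := F) (normalForm rule)) := by
      refine Submodule.span_le.2 ?_
      rintro _ ⟨a, W, f, b, h, rfl⟩
      exact hnf a W f b h
    exact this hx
  have hKmul : ∀ a, ∀ x ∈ K, a * x ∈ K := by
    intro a x hx
    have ha : a ∈ Submodule.span F (Set.range (mon (F := F) (I := I))) := hmon ▸ Submodule.mem_top
    induction ha using Submodule.span_induction with
    | mem a ha =>
      obtain ⟨a, rfl⟩ := ha
      have : K ≤ K.comap (LinearMap.mulLeft F (mon a)) := by
        refine Submodule.span_le.2 ?_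
        rintro _ ⟨c, W, f, b, h, rfl⟩
        exact Submodule.subset_span ⟨a ++ c, W, f, b, h, by simp [wd_append, mul_assoc]⟩
      exact this hx
    | zero => simp
    | add y z _ _ hy hz => rw [add_mul]; exact K.add_mem hy hz
    | smul c y _ hy => rw [smul_mul_assoc]; exact K.smul_mem _ hy
  have hJK : ∀ x ∈ J, x ∈ K := by
    intro x hx
    induction hx using Submodule.span_induction with
    | mem x hx =>
      obtain ⟨W, f, b, h, rfl⟩ := hx
      exact Submodule.subset_span ⟨[], W, f, b, h, by simp⟩
    | zero => simp
    | add x y _ _ hx hy => exact K.add_mem hx hy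
    | smul a x _ hx => exact hKmul a x hx
  let L : FreeAlgebra F I →ₐ[F] Module.End F (FreeAlgebra F I ⧸ J) := Algebra.lsmul F F _
  have hL : ∀ a y, L a (Submodule.Quotient.mk y) = Submodule.Quotient.mk (a * y) := fun a y => rfl
  have hL0 : ∀ r, (∀ b, r * mon b ∈ J) → L r = 0 := by
    intro r hr
    refine LinearMap.ext fun y => ?_
    obtain ⟨y, rfl⟩ := Submodule.Quotient.mk_surjective _ y
    rw [hL, LinearMap.zero_apply, Submodule.Quotient.mk_eq_zero]
    have hy : y ∈ Submodule.span F (Set.range (mon (F := F) (I := I))) := hmon ▸ Submodule.mem_top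
    have : Submodule.span F (Set.range (mon (F := F) (I := I))) ≤
        (J.restrictScalars F).comap (LinearMap.mulLeft F r) := by
      refine Submodule.span_le.2 ?_
      rintro _ ⟨b, rfl⟩
      exact hr b
    exact this hy
  have hrel : ∀ i j, L (hb.relator i j) = 0 := by
    have key : ∀ (j i : I) (θ : F), θ ≠ 0 →
        ((i < j ∧ θ = 1) ∨ (i = j ∧ ε (deg i) (deg i) ≠ 1 ∧ θ = 2⁻¹)) →
        L (hb.relator j i) = 0 := by
      intro j i θ hθ h
      have : L (θ • hb.relator j i) = 0 := by
        refine hL0 _ fun b => Submodule.subset_span ⟨_, _, b, PBWRule.pair θ h, ?_⟩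
        rw [sub_sub_cancel]
      rw [map_smul] at this
      exact (smul_eq_zero.1 this).resolve_left hθ
    intro i j
    refine hb.relator_mem (LinearMap.ker L.toLinearMap) (fun h => key _ _ 1 one_ne_zero (.inl ⟨h, rfl⟩))
      (fun h => key _ _ 1 one_ne_zero (.inl ⟨h, rfl⟩))
      (fun h ho => key _ _ 2⁻¹ (inv_ne_zero h2) (.inr ⟨rfl, ho, rfl⟩))
  have hpow : ∀ i h, L (hb.powRelator ψ i h) = 0 := by
    intro i h
    refine hL0 _ fun b => Submodule.subset_span ⟨_, _, b, PBWRule.power h, ?_⟩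
    rw [sub_sub_cancel]
  obtain ⟨φ, hφ⟩ := hb.exists_lift h𝒱 χ hS (L.toLinearMap ∘ₗ freeLin bs) (by
    intro i j z hz
    have e : z = hb.br i j := Subtype.ext hz
    have h1 := hrel i j
    rw [IsHomFamily.relator, map_sub, map_sub, map_smul, map_mul, map_mul, sub_eq_zero,
      sub_eq_iff_eq_add'] at h1
    show L (freeLin bs (bs i)) * L (freeLin bs (bs j)) =
      _ • (L (freeLin bs (bs j)) * L (freeLin bs (bs i))) + L (freeLin bs z)
    rw [freeLin_basis, freeLin_basis, h1, e, add_comm]) (by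
    intro i h z hz
    have e : z = ⟨_, hb.pow_mem i h⟩ := Subtype.ext hz
    have h1 := hpow i h
    rw [IsHomFamily.powRelator, map_sub, map_add, map_pow, sub_eq_zero, AlgHom.commutes] at h1
    show L (freeLin bs (bs i)) ^ p = L (freeLin bs z) + _
    rw [freeLin_basis, h1, e]
    rfl)
  obtain ⟨Λ, hΛ⟩ : ∃ Λ : (FreeAlgebra F I ⧸ J) →ₗ[F] FreeAlgebra F I,
      ∀ y, Λ (Submodule.Quotient.mk y) = wordLift (normalForm rule) y :=
    ⟨((J.restrictScalars F).liftQ (wordLift (normalForm rule))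
      (fun x hx => hK x (hJK x hx))) ∘ₗ
      (Submodule.Quotient.restrictScalarsEquiv F J).symm.toLinearMap, fun y => rfl⟩
  -- Let an element act on the class of 1 and take the normal form of the result.
  refine ⟨Λ ∘ₗ LinearMap.applyₗ (Submodule.Quotient.mk 1) ∘ₗ φ.toLinearMap, ?_⟩
  intro w hw
  have h1 : ∀ w : List I, φ (wd (fun i => RedEnv.ι p ε 𝒱 χ S (bs i)) w) = L (mon w) := by
    intro w
    induction w with
    | nil => simp
    | cons i w ih =>
      have e : mon (F := F) (i :: w) = FreeAlgebra.ι F i * mon w := wd_cons _ _ _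
      rw [wd_cons, map_mul, ih, hφ, e, map_mul]
      show L (freeLin bs (bs i)) * _ = _
      rw [freeLin_basis]
  show Λ (φ (wd _ w) (Submodule.Quotient.mk 1)) = _
  rw [h1, hL, mul_one, hΛ]
  rw [wordLift_mon]
  refine normalForm_of_irreducible fun W f h => ?_
  rcases h.eq_pair_or_eq_replicate with ⟨j, i, θ, rfl, h, -⟩ | ⟨i, ho, rfl, -⟩
  · rcases h with ⟨h, -⟩ | ⟨rfl, h, -⟩
    · exact hw _ (.swap h)
    · exact hw _ (.square h)
  · exact hw _ (.power ho)

end PBWTheorem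

/-! ### Generators and spanning words of `u_χ(S)`. -/

section Basic

variable {Γ F V : Type*} [AddCommGroup Γ] [Field F] [AddCommGroup V] [Module F V]
  {p : ℕ} {ε : Bicharacter Γ F} {𝒱 : Γ → Submodule F V} {𝔤 : Submodule F (Module.End F V)}
  {χ : 𝔤 →ₗ[F] F} {S : Submodule F (Module.End F V)}

theorem RedEnv.ι_mul_ι {α β : Γ} {x y z : S} (hx : (x : Module.End F V) ∈ homEnd 𝒱 α)
    (hy : (y : Module.End F V) ∈ homEnd 𝒱 β)
    (hz : (z : Module.End F V) = colorBracket ε α β x y) :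
    RedEnv.ι p ε 𝒱 χ S x * RedEnv.ι p ε 𝒱 χ S y =
      (ε α β : F) • (RedEnv.ι p ε 𝒱 χ S y * RedEnv.ι p ε 𝒱 χ S x) + RedEnv.ι p ε 𝒱 χ S z := by
  have := RingQuot.mkAlgHom_rel F (RedRel.bracket (p := p) (ε := ε) (𝒱 := 𝒱) (χ := χ) (S := S)
    α β x y z hx hy hz)
  simpa [RedEnv.ι] using this

theorem RedEnv.ι_pow {α : Γ} (hα : ε α α = 1) {x z : S} {w : 𝔤}
    (hx : (x : Module.End F V) ∈ homEnd 𝒱 α)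
    (hz : (z : Module.End F V) = (x : Module.End F V) ^ p)
    (hw : (w : Module.End F V) = (x : Module.End F V)) :
    RedEnv.ι p ε 𝒱 χ S x ^ p = RedEnv.ι p ε 𝒱 χ S z +
      algebraMap F (RedEnv p ε 𝒱 χ S) (χ w ^ p) := by
  have := RingQuot.mkAlgHom_rel F (RedRel.power (p := p) (ε := ε) (𝒱 := 𝒱) (χ := χ) (S := S)
    α hα x z w hx hz hw)
  simpa [RedEnv.ι] using this

theorem RedEnv.map_ι {S' : Submodule F (Module.End F V)} (h : S ≤ S') (x : S) :
    RedEnv.map p ε 𝒱 χ h (RedEnv.ι p ε 𝒱 χ S x) =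
      RedEnv.ι p ε 𝒱 χ S' (Submodule.inclusion h x) := by
  simp [RedEnv.map, RedEnv.ι]

theorem RedEnv.algHom_ext {A : Type*} [Ring A] [Algebra F A] {φ φ' : RedEnv p ε 𝒱 χ S →ₐ[F] A}
    (h : ∀ x, φ (RedEnv.ι p ε 𝒱 χ S x) = φ' (RedEnv.ι p ε 𝒱 χ S x)) : φ = φ' := by
  apply RingQuot.ringQuot_ext'
  apply TensorAlgebra.hom_ext
  ext x
  exact h x

theorem RedEnv.induction {C : RedEnv p ε 𝒱 χ S → Prop}
    (algebraMap : ∀ r : F, C (algebraMap F _ r)) (ι : ∀ x, C (RedEnv.ι p ε 𝒱 χ S x))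
    (mul : ∀ a b, C a → C b → C (a * b)) (add : ∀ a b, C a → C b → C (a + b)) (a) : C a := by
  obtain ⟨a, rfl⟩ := RingQuot.mkAlgHom_surjective F (RedRel p ε 𝒱 χ S) a
  induction a using TensorAlgebra.induction with
  | algebraMap r => rw [AlgHom.commutes]; exact algebraMap r
  | ι x => exact ι x
  | mul a b ha hb => rw [map_mul]; exact mul _ _ ha hb
  | add a b ha hb => rw [map_add]; exact add _ _ ha hb

end Basic

section Spanning

variable {Γ F V I X : Type*} [AddCommGroup Γ] [Field F] [AddCommGroup V] [Module F V]
  {p : ℕ} {ε : Bicharacter Γ F} {𝒱 : Γ → Submodule F V}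
  {S : Submodule F (Module.End F V)} {b : I → Module.End F V} {deg : I → Γ}

theorem IsHomFamily.map_mem_wordSpan [AddCommMonoid X] {A : Type*} [Ring A] [Algebra F A]
    (hb : IsHomFamily p ε 𝒱 S b deg) (ρ : S →ₗ[F] A) {J : Set I} {ω : I → X} {μ : X} {z : S}
    (hz : (z : Module.End F V) ∈ Submodule.span F (b '' {k | k ∈ J ∧ ω k = μ})) :
    ρ z ∈ wordSpan F (fun i => ρ ⟨b i, hb.mem i⟩) J ω 1 μ := by
  have e : b '' {k | k ∈ J ∧ ω k = μ} =
      S.subtype '' ((fun i => (⟨b i, hb.mem i⟩ : S)) '' {k | k ∈ J ∧ ω k = μ}) := by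
    rw [Set.image_image]; rfl
  rw [e, ← Submodule.map_span] at hz
  obtain ⟨w, hw, hwz⟩ := hz
  obtain rfl : w = z := Subtype.ext hwz
  have : Submodule.span F ((fun i => (⟨b i, hb.mem i⟩ : S)) '' {k | k ∈ J ∧ ω k = μ}) ≤
      (wordSpan F (fun i => ρ ⟨b i, hb.mem i⟩) J ω 1 μ).comap ρ := by
    refine Submodule.span_le.2 ?_
    rintro _ ⟨k, ⟨h1, h2⟩, rfl⟩
    exact Submodule.subset_span ⟨[k], by simpa using h1, by simp, by simpa using h2, by simp⟩
  exact this hw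

/-- The predicate `pw` selects the letters whose `p`-th powers are reduced. If it is empty, only
brackets are used, so the result holds in any algebra that satisfies the bracket relations. -/
theorem IsHomFamily.wd_mem_normalSpan [AddCommMonoid X] [LinearOrder I] {A : Type*} [Ring A]
    [Algebra F A] (hb : IsHomFamily p ε 𝒱 S b deg) (h2 : (2 : F) ≠ 0) (hp : 2 ≤ p)
    (ρ : S →ₗ[F] A)
    (hbr : ∀ i j, ∀ z : S, (z : Module.End F V) = colorBracket ε (deg i) (deg j) (b i) (b j) →
      ρ ⟨b i, hb.mem i⟩ * ρ ⟨b j, hb.mem j⟩ =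
        (ε (deg i) (deg j) : F) • (ρ ⟨b j, hb.mem j⟩ * ρ ⟨b i, hb.mem i⟩) + ρ z)
    (J : Set I) (ω : I → X)
    (hω : ∀ i ∈ J, ∀ j ∈ J, colorBracket ε (deg i) (deg j) (b i) (b j) ∈
      Submodule.span F (b '' {k | k ∈ J ∧ ω k = ω i + ω j}))
    (pw : I → Prop)
    (hpw : ∀ i ∈ J, pw i → ∃ (z : S) (c : F), ρ ⟨b i, hb.mem i⟩ ^ p = ρ z + algebraMap F A c ∧
      (z : Module.End F V) ∈ Submodule.span F (b '' {k | k ∈ J ∧ ω k = p • ω i}) ∧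
      (c ≠ 0 → p • ω i = 0))
    (w : List I) (hw : ∀ i ∈ w, i ∈ J) :
    wd (fun i => ρ ⟨b i, hb.mem i⟩) w ∈
      normalSpan (fun i => ε (deg i) (deg i) ≠ 1) pw p F (fun i => ρ ⟨b i, hb.mem i⟩) J ω
        (w.map ω).sum := by
  refine ColorLie.wd_mem_normalSpan _ J ω hp ?_ ?_ ?_ w hw
  · intro i hi j hj _
    refine ⟨ε (deg j) (deg i), ?_⟩
    rw [hbr j i ⟨_, hb.bracket_mem j i⟩ rfl, add_sub_cancel_left]
    exact hb.map_mem_wordSpan ρ (hω j hj i hi)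
  · intro i hi ho
    have h := hbr i i ⟨_, hb.bracket_mem i i⟩ rfl
    have h3 : ρ ⟨b i, hb.mem i⟩ * ρ ⟨b i, hb.mem i⟩ =
        (2 : F)⁻¹ • ρ ⟨_, hb.bracket_mem i i⟩ := by
      rw [ε.self_eq ho] at h
      have h4 : ρ ⟨_, hb.bracket_mem i i⟩ = (2 : F) • (ρ ⟨b i, hb.mem i⟩ * ρ ⟨b i, hb.mem i⟩) := by
        rw [two_smul, ← sub_eq_iff_eq_add'.2 h]; module
      rw [h4, smul_smul, inv_mul_cancel₀ h2, one_smul]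
    rw [h3]
    exact Submodule.smul_mem _ _ (hb.map_mem_wordSpan ρ (hω i hi i hi))
  · intro i hi hpi
    obtain ⟨z, c, h1, h4, h3⟩ := hpw i hi hpi
    rw [h1]
    refine Submodule.add_mem _ (hb.map_mem_wordSpan ρ h4) ?_
    by_cases hc : c = 0
    · rw [hc, map_zero]; exact Submodule.zero_mem _
    · rw [Algebra.algebraMap_eq_smul_one]
      exact Submodule.smul_mem _ _ (Submodule.subset_span ⟨[], by simp, by simp, by simp [h3 hc], by simp⟩)

variable {𝔤 : Submodule F (Module.End F V)} {χ : 𝔤 →ₗ[F] F}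

theorem IsHomFamily.span_wd (hb : IsHomFamily p ε 𝒱 S b deg) :
    Submodule.span F (Set.range (wd fun i => RedEnv.ι p ε 𝒱 χ S ⟨b i, hb.mem i⟩)) = ⊤ := by
  set W := Submodule.span F (Set.range (wd fun i => RedEnv.ι p ε 𝒱 χ S ⟨b i, hb.mem i⟩)) with hW
  suffices H : ∀ x, x ∈ W from eq_top_iff.2 fun x _ => H x
  intro x
  induction x using RedEnv.induction with
  | algebraMap r =>
    rw [Algebra.algebraMap_eq_smul_one]
    exact W.smul_mem _ (Submodule.subset_span ⟨[], rfl⟩)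
  | ι x =>
    have hz : (x : Module.End F V) ∈ Submodule.span F (b '' {k | k ∈ Set.univ ∧ (0 : ℕ) = 0}) := by
      have : b '' {k | k ∈ Set.univ ∧ (0 : ℕ) = 0} = Set.range b := by simp
      rw [this, hb.span_eq]; exact x.2
    have h1 := hb.map_mem_wordSpan (RedEnv.ι p ε 𝒱 χ S) (ω := fun _ => 0) hz
    refine Submodule.span_mono ?_ h1
    rintro _ ⟨w, -, -, -, rfl⟩
    exact ⟨w, rfl⟩
  | mul a c ha hc =>
    rw [hW] at ha hc ⊢
    have := Submodule.mul_mem_mul ha hc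
    rw [Submodule.span_mul_span] at this
    refine Submodule.span_mono ?_ this
    rintro _ ⟨_, ⟨u, rfl⟩, _, ⟨w, rfl⟩, rfl⟩
    exact ⟨u ++ w, wd_append _ _ _⟩
  | add a c ha hc => exact W.add_mem ha hc

/-- `u_χ(S)` is spanned by the normal words. -/
theorem IsHomFamily.normalSpan_eq_top [LinearOrder I] (hb : IsHomFamily p ε 𝒱 S b deg)
    (h2 : (2 : F) ≠ 0) (hp : 2 ≤ p) (hS : S ≤ 𝔤) :
    Submodule.span F {x | ∃ w, Normal (fun i => ε (deg i) (deg i) ≠ 1)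
      (fun i => ε (deg i) (deg i) = 1) p w ∧
        x = wd (fun i => RedEnv.ι p ε 𝒱 χ S ⟨b i, hb.mem i⟩) w} = ⊤ := by
  rw [eq_top_iff, ← hb.span_wd, Submodule.span_le]
  rintro _ ⟨w, rfl⟩
  have := hb.wd_mem_normalSpan h2 hp (RedEnv.ι p ε 𝒱 χ S)
    (fun i j z hz => RedEnv.ι_mul_ι (hb.mem_homEnd i) (hb.mem_homEnd j) hz) Set.univ
    (fun _ => (0 : ℕ)) (fun i _ j _ => by
      simpa [hb.span_eq] using hb.bracket_mem i j)
    (fun i => ε (deg i) (deg i) = 1) (fun i _ h => ⟨⟨_, hb.pow_mem i h⟩, _,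
      RedEnv.ι_pow (w := ⟨b i, hS (hb.mem i)⟩) h (hb.mem_homEnd i) rfl rfl, by
        simpa [hb.span_eq] using hb.pow_mem i h, by simp⟩)
    w (by simp)
  refine Submodule.span_mono ?_ this
  rintro _ ⟨w, h, -, -, rfl⟩
  exact ⟨w, h, rfl⟩

end Spanning

/-! ### Freeness over the subalgebra of an upper set of letters. -/

section RelativeFreeness

variable {Γ F V I : Type*} [AddCommGroup Γ] [Field F] [AddCommGroup V] [Module F V]
  {p : ℕ} {ε : Bicharacter Γ F} {𝒱 : Γ → Submodule F V} [LinearOrder I]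
  {𝔤 S' : Submodule F (Module.End F V)} {bs : Module.Basis I F 𝔤} {deg : I → Γ}

/-- `u_χ(𝔤)` is a free right module over `u_χ(S')`, where `S'` is spanned by the basis elements with
index in an upper set `J`; a basis consists of the normal words in the other letters. -/
theorem IsHomFamily.exists_coeff [CharP F p] [Fact p.Prime] (hp : 3 < p) (h𝒱 : IsGrading 𝒱)
    (hb : IsHomFamily p ε 𝒱 𝔤 (fun i => (bs i : Module.End F V)) deg) (χ : 𝔤 →ₗ[F] F)
    (hχ : ∀ i, χ (bs i) ≠ 0 → deg i = 0) {J : Set I} (hJ : IsUpperSet J) (hS' : S' ≤ 𝔤)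
    (hb' : IsHomFamily p ε 𝒱 S' (fun i : J => (bs i : Module.End F V)) (fun i : J => deg i)) :
    ∃ κ : List I → RedEnv p ε 𝒱 χ 𝔤 →ₗ[F] RedEnv p ε 𝒱 χ S',
      ∀ u u', Normal (fun i => ε (deg i) (deg i) ≠ 1) (fun i => ε (deg i) (deg i) = 1) p u' →
        (∀ i ∈ u', i ∉ J) → ∀ s, κ u (wd (fun i => RedEnv.ι p ε 𝒱 χ 𝔤 (bs i)) u' *
          RedEnv.map p ε 𝒱 χ hS' s) = if u = u' then s else 0 := by
  classical
  have h2 : (2 : F) ≠ 0 := by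
    have := CharP.cast_eq_zero_iff F p 2
    intro h0
    have := Nat.le_of_dvd (by norm_num) (this.1 (by exact_mod_cast h0)); omega
  obtain ⟨Θ, hΘ⟩ := hb.exists_pbw hp h𝒱 χ le_rfl hχ
  let β' : I → RedEnv p ε 𝒱 χ S' := fun i =>
    if h : i ∈ J then RedEnv.ι p ε 𝒱 χ S' ⟨bs i, hb'.mem ⟨i, h⟩⟩ else 0
  -- A PBW monomial is cut at its first letter in `J`: the initial part names the basis word, the
  -- rest is the coefficient.
  refine ⟨fun u => wordLift (fun w => if u = w.takeWhile (· ∉ J) then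
    wd β' (w.dropWhile (· ∉ J)) else 0) ∘ₗ Θ, ?_⟩
  intro u u' hu' hu'J s
  have hs := hb'.normalSpan_eq_top (χ := χ) h2 (by omega) hS'
  have hs' : s ∈ Submodule.span F _ := hs.symm ▸ Submodule.mem_top
  clear hs
  induction hs' using Submodule.span_induction with
  | mem s hs =>
    obtain ⟨w, hw, rfl⟩ := hs
    have e1 : RedEnv.map p ε 𝒱 χ hS' (wd (fun i : J => RedEnv.ι p ε 𝒱 χ S' ⟨bs i, hb'.mem i⟩) w) =
        wd (fun i => RedEnv.ι p ε 𝒱 χ 𝔤 (bs i)) (w.map Subtype.val) := by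
      simp only [wd, map_list_prod, List.map_map]
      congr 2
      funext i
      simp only [Function.comp_apply, RedEnv.map_ι]
      rfl
    have e2 : wd (fun i : J => RedEnv.ι p ε 𝒱 χ S' ⟨bs i, hb'.mem i⟩) w =
        wd β' (w.map Subtype.val) := by
      simp only [wd, List.map_map]
      congr 2
      funext i
      simp [β']
    have hw' : Normal (fun i => ε (deg i) (deg i) ≠ 1) (fun i => ε (deg i) (deg i) = 1) p
        (w.map Subtype.val) := by
      rw [normal_iff] at hw ⊢
      have hc : ∀ i : I, ∀ n, 0 < n → (∀ h : i ∈ J, w.count ⟨i, h⟩ < n) →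
          (w.map Subtype.val).count i < n := by
        intro i n hn h
        by_cases hi : i ∈ J
        · have := List.count_map_of_injective w Subtype.val Subtype.val_injective (⟨i, hi⟩ : J)
          simp only at this
          rw [this]; exact h hi
        · rw [List.count_eq_zero_of_not_mem]
          · exact hn
          · simp [hi]
      refine ⟨?_, fun i hi => hc i 2 (by norm_num) fun h => by
          convert hw.2.1 ⟨i, h⟩ hi,
        fun i hi => hc i p (by omega) fun h => by
          convert hw.2.2 ⟨i, h⟩ hi⟩
      rw [List.pairwise_map]
      exact hw.1
    have hn := hu'.append hw' (by
      intro x hx y hy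
      obtain ⟨⟨y, hyJ⟩, -, rfl⟩ := List.mem_map.1 hy
      by_contra hxy
      exact hu'J x hx (hJ (not_lt.1 hxy) hyJ))
    rw [e1, ← wd_append, LinearMap.comp_apply, hΘ _ hn, wordLift_mon, e2]
    have t1 : (u' ++ w.map Subtype.val).takeWhile (· ∉ J) = u' := by
      rw [List.takeWhile_append_of_pos (by simpa using hu'J)]
      rcases w with _ | ⟨y, w⟩ <;> simp
    have t2 : (u' ++ w.map Subtype.val).dropWhile (· ∉ J) = w.map Subtype.val := by
      rw [List.dropWhile_append_of_pos (by simpa using hu'J)]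
      rcases w with _ | ⟨y, w⟩ <;> simp
    rw [t1, t2]
  | zero => simp
  | add x y _ _ hx hy =>
    rw [map_add, mul_add, map_add, hx, hy]
    split_ifs <;> simp
  | smul c x _ hx =>
    rw [map_smul, mul_smul_comm, map_smul, hx]
    split_ifs <;> simp

/-- A normal word is sorted and `J` is an upper set, so all letters after the first one in `J` are
in `J` too. -/
theorem IsHomFamily.span_wd_mul_map [CharP F p] [Fact p.Prime] (hp : 3 < p)
    (hb : IsHomFamily p ε 𝒱 𝔤 (fun i => (bs i : Module.End F V)) deg) (χ : 𝔤 →ₗ[F] F)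
    {J : Set I} (hJ : IsUpperSet J) (hS' : S' ≤ 𝔤)
    (hb' : IsHomFamily p ε 𝒱 S' (fun i : J => (bs i : Module.End F V)) (fun i : J => deg i)) :
    Submodule.span F {x | ∃ u s, Normal (fun i => ε (deg i) (deg i) ≠ 1)
      (fun i => ε (deg i) (deg i) = 1) p u ∧ (∀ i ∈ u, i ∉ J) ∧
        x = wd (fun i => RedEnv.ι p ε 𝒱 χ 𝔤 (bs i)) u * RedEnv.map p ε 𝒱 χ hS' s} = ⊤ := by
  classical
  have h2 : (2 : F) ≠ 0 := by
    have := CharP.cast_eq_zero_iff F p 2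
    intro h0
    have := Nat.le_of_dvd (by norm_num) (this.1 (by exact_mod_cast h0)); omega
  rw [eq_top_iff, ← hb.normalSpan_eq_top (χ := χ) h2 (by omega) le_rfl, Submodule.span_le]
  rintro _ ⟨w, hw, rfl⟩
  have hs := hw.sorted
  refine Submodule.subset_span ⟨w.takeWhile (· ∉ J), ((w.dropWhile (· ∉ J)).map fun i =>
    if h : i ∈ J then RedEnv.ι p ε 𝒱 χ S' ⟨bs i, hb'.mem ⟨i, h⟩⟩ else 0).prod,
    hw.of_infix (List.takeWhile_prefix _).isInfix, fun i hi => ?_, ?_⟩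
  · simpa using List.mem_takeWhile_imp hi
  · have hd : ∀ i ∈ w.dropWhile (· ∉ J), i ∈ J := by
      clear hw
      induction w with
      | nil => simp
      | cons a w ih =>
        rw [List.pairwise_cons] at hs
        by_cases ha : a ∈ J
        · rw [List.dropWhile_cons_of_neg (by simpa using ha)]
          intro i hi
          rcases List.mem_cons.1 hi with rfl | hi
          · exact ha
          · exact hJ (hs.1 i hi) ha
        · rw [List.dropWhile_cons_of_pos (by simpa using ha)]
          exact ih hs.2
    rw [map_list_prod, List.map_map]
    have : (w.dropWhile (· ∉ J)).map (RedEnv.map p ε 𝒱 χ hS' ∘ fun i =>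
        if h : i ∈ J then RedEnv.ι p ε 𝒱 χ S' ⟨bs i, hb'.mem ⟨i, h⟩⟩ else 0) =
        (w.dropWhile (· ∉ J)).map fun i => RedEnv.ι p ε 𝒱 χ 𝔤 (bs i) := by
      refine List.map_congr_left fun i hi => ?_
      simp only [Function.comp_apply, dif_pos (hd i hi), RedEnv.map_ι]
      rfl
    rw [this]
    conv_lhs => rw [← List.takeWhile_append_dropWhile (p := (· ∉ J)) (l := w), wd_append]
    rfl

end RelativeFreeness

/-! ### Weights of the torus. -/

section Weights

variable {Γ F V : Type*} [AddCommGroup Γ] [Field F] [AddCommGroup V] [Module F V]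
  {𝒱 : Γ → Submodule F V} {ε : Bicharacter Γ F} {T : Subgroup (LinearMap.GeneralLinearGroup F V)}

theorem mul_mem_conjWeight {μ ν : Char T} {x y : Module.End F V} (hx : x ∈ conjWeight T μ)
    (hy : y ∈ conjWeight T ν) : x * y ∈ conjWeight T (μ + ν) := by
  intro t
  have h1 := hx t
  have h2 := hy t
  set g : Module.End F V := ((t : LinearMap.GeneralLinearGroup F V) : Module.End F V)
  set g' : Module.End F V := (((t : LinearMap.GeneralLinearGroup F V)⁻¹ :
    LinearMap.GeneralLinearGroup F V) : Module.End F V)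
  have h3 : g' * g = 1 := Units.inv_mul _
  have e : g * (x * y) * g' = (g * x * g') * (g * y * g') := by
    calc g * (x * y) * g' = g * x * 1 * y * g' := by noncomm_ring
      _ = g * x * (g' * g) * y * g' := by rw [h3]
      _ = _ := by noncomm_ring
  rw [e, h1, h2, toMul_add, MonoidHom.mul_apply, Units.val_mul, smul_mul_smul_comm]

theorem colorBracket_mem_conjWeight {μ ν : Char T} {α β : Γ} {x y : Module.End F V}
    (hx : x ∈ conjWeight T μ) (hy : y ∈ conjWeight T ν) :
    colorBracket ε α β x y ∈ conjWeight T (μ + ν) :=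
  Submodule.sub_mem _ (mul_mem_conjWeight hx hy)
    (Submodule.smul_mem _ _ (add_comm ν μ ▸ mul_mem_conjWeight hy hx))

theorem pow_mem_conjWeight {μ : Char T} {x : Module.End F V} (hx : x ∈ conjWeight T μ) (n : ℕ) :
    x ^ n ∈ conjWeight T (n • μ) := by
  induction n with
  | zero =>
    rw [pow_zero, zero_nsmul]
    intro t
    rw [mul_one, Units.mul_inv]; simp
  | succ n ih => rw [pow_succ, succ_nsmul]; exact mul_mem_conjWeight ih hx

theorem IsTorus.commute (hT : IsTorus 𝒱 T) (s t : T) :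
    ((s : LinearMap.GeneralLinearGroup F V) : Module.End F V) *
      ((t : LinearMap.GeneralLinearGroup F V) : Module.End F V) =
    ((t : LinearMap.GeneralLinearGroup F V) : Module.End F V) *
      ((s : LinearMap.GeneralLinearGroup F V) : Module.End F V) := by
  refine LinearMap.ext_on hT.diagonalizable ?_
  rintro v ⟨c, hc⟩
  simp only [Module.End.mul_apply, hc, map_smul]
  rw [smul_comm]

/-- Conjugations by elements of `T` commute, and a weight space lies in a simultaneous eigenspace.
Distinct characters are distinct families of eigenvalues. -/
theorem IsTorus.conjWeight_iSupIndep (hT : IsTorus 𝒱 T) :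
    iSupIndep (conjWeight T) := by
  let f : T → Module.End F (Module.End F V) := fun t =>
    LinearMap.mulLeft F ((t : LinearMap.GeneralLinearGroup F V) : Module.End F V) ∘ₗ
    LinearMap.mulRight F (((t : LinearMap.GeneralLinearGroup F V)⁻¹ :
      LinearMap.GeneralLinearGroup F V) : Module.End F V)
  have hcomm : ∀ s t, Commute (f s) (f t) := by
    intro s t
    refine LinearMap.ext fun x => ?_
    have h1 := hT.commute s t
    have h2 := hT.commute t⁻¹ s⁻¹
    simp only [InvMemClass.coe_inv] at h2
    simp only [f, Module.End.mul_apply, LinearMap.comp_apply, LinearMap.mulLeft_apply,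
      LinearMap.mulRight_apply]
    simp only [mul_assoc]
    rw [h2]
    simp only [← mul_assoc]
    rw [h1]
  have h := Module.End.independent_iInf_maxGenEigenspace_of_forall_mapsTo f
    (fun s t φ => Module.End.mapsTo_maxGenEigenspace_of_comm (hcomm t s) φ)
  have h' := h.comp (f := fun μ : Char T => fun t : T => ((μ.toMul t : Fˣ) : F)) (by
    intro μ ν h
    apply Additive.toMul.injective
    ext t
    exact congrFun h t)
  refine h'.mono fun μ x hx => ?_
  simp only [Function.comp_apply, Submodule.mem_iInf]
  intro t
  refine Module.End.eigenspace_le_maxGenEigenspace ?_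
  rw [Module.End.mem_eigenspace_iff]
  have := hx t
  simp only [f, LinearMap.comp_apply, LinearMap.mulLeft_apply,
      LinearMap.mulRight_apply]
  rw [← mul_assoc]; exact this

/-- A linear identity between matrix coefficients that holds on `G` is its own derivative, so it
holds on the tangent space. -/
theorem lieOf_mem_linear {G : Subgroup (LinearMap.GeneralLinearGroup F V)} {h : Module.End F V}
    (hh : h ∈ lieOf 𝒱 G) {φ ψ : Module.Dual F V} {v w : V}
    (hG : ∀ g ∈ G, φ ((g : Module.End F V) v) = ψ ((g : Module.End F V) w)) : φ (h v) = ψ (h w) := by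
  classical
  by_cases heq : (φ, v) = (ψ, w)
  · rw [Prod.mk.injEq] at heq; rw [heq.1, heq.2]
  set P : MvPolynomial (Module.Dual F V × V) F := MvPolynomial.X (φ, v) - MvPolynomial.X (ψ, w)
  have h1 := hh.2 P (by
    intro g hg
    simp [P, coordEval, hG g hg])
  have h2 : ∑ c ∈ P.vars, coordEval (1 : Module.End F V) (MvPolynomial.pderiv c P) * c.1 (h c.2) =
      ∑ c ∈ {(φ, v), (ψ, w)}, coordEval (1 : Module.End F V) (MvPolynomial.pderiv c P) *
        c.1 (h c.2) := by
    refine Finset.sum_subset ?_ ?_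
    · refine (MvPolynomial.vars_sub_subset _).trans ?_
      rw [MvPolynomial.vars_X, MvPolynomial.vars_X]
      rfl
    · intro c _ hc
      rw [MvPolynomial.pderiv_eq_zero_of_notMem_vars hc]
      simp [coordEval]
  rw [h2, Finset.sum_pair heq] at h1
  have heq' : (ψ, w) ≠ (φ, v) := fun h => heq h.symm
  simp [P, coordEval, MvPolynomial.pderiv_X, Pi.single_apply, heq, heq'] at h1
  linear_combination h1

/-- For fixed `t` the identity `ts = st` is linear in `s`, so it passes from `T` to its Lie algebra.
-/
theorem IsTorus.lieOf_le_conjWeight (hT : IsTorus 𝒱 T) : lieOf 𝒱 T ≤ conjWeight T 0 := by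
  intro h hh t
  set g : Module.End F V := ((t : LinearMap.GeneralLinearGroup F V) : Module.End F V) with hg
  have key : g * h = h * g := by
    refine LinearMap.ext fun v => ?_
    refine (Module.forall_dual_apply_eq_zero_iff F _).1 (fun φ => ?_) |> sub_eq_zero.1
    rw [map_sub, sub_eq_zero]
    exact lieOf_mem_linear hh (φ := φ ∘ₗ g) (ψ := φ) (v := v) (w := g v) fun s hs => by
      have := congrArg (fun x : Module.End F V => φ (x v)) (hT.commute ⟨s, hs⟩ t)
      exact this.symm
  rw [key, mul_assoc, Units.mul_inv]
  simp

theorem lieOf_le_homEnd : lieOf 𝒱 T ≤ homEnd 𝒱 0 := fun _ h => h.1.2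

/-- A weight vector of a graded space of endomorphisms is homogeneous if its weight space is
one-dimensional. -/
theorem exists_mem_homEnd (h𝒱 : IsGrading 𝒱) (hT : T ≤ gradedGL 𝒱)
    {𝔤 : Submodule F (Module.End F V)} (h𝔤 : IsGradedSub (homEnd 𝒱) 𝔤) {μ : Char T}
    (h1 : Module.finrank F (rootSpace 𝔤 T μ) = 1) {x : Module.End F V}
    (hx : x ∈ rootSpace 𝔤 T μ) : ∃ α, x ∈ homEnd 𝒱 α := by
  classical
  by_cases hx0 : x = 0
  · exact ⟨0, hx0 ▸ Submodule.zero_mem _⟩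
  have hx1 : x ∈ ⨆ α, 𝔤 ⊓ homEnd 𝒱 α := h𝔤 ▸ hx.1
  rw [Submodule.mem_iSup_iff_exists_finsupp] at hx1
  obtain ⟨g, hg, hsum⟩ := hx1
  -- `T` preserves degrees, so the homogeneous components of a weight vector are weight vectors. A
  -- nonzero one spans the weight space.
  have hgw : ∀ α, g α ∈ rootSpace 𝔤 T μ := by
    intro α
    refine ⟨(hg α).1, fun t => ?_⟩
    set a : Module.End F V := ((t : LinearMap.GeneralLinearGroup F V) : Module.End F V)
    set a' : Module.End F V := (((t : LinearMap.GeneralLinearGroup F V)⁻¹ :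
      LinearMap.GeneralLinearGroup F V) : Module.End F V)
    set c : F := ((μ.toMul t : Fˣ) : F)
    have hd : ∀ β, a * g β * a' - c • g β ∈ homEnd 𝒱 β := by
      intro β
      refine Submodule.sub_mem _ ?_ (Submodule.smul_mem _ _ (hg β).2)
      intro γ v hv
      exact (hT t.2 _ _ ((hg β).2 _ _ (hT t.2 γ v hv).2)).1
    have hs : ∑ β ∈ g.support, (a * g β * a' - c • g β) = 0 := by
      rw [Finset.sum_sub_distrib, ← Finset.smul_sum, ← Finset.sum_mul, ← Finset.mul_sum]
      have : ∑ β ∈ g.support, g β = x := hsum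
      rw [this, hx.2 t, sub_self]
    by_cases hα : α ∈ g.support
    · have := (iSupIndep_iff_finsetSum_eq_zero_imp_eq_zero _).1 (homEnd_iSupIndep h𝒱)
        g.support (fun β => a * g β * a' - c • g β) (fun β _ => hd β) hs α hα
      exact sub_eq_zero.1 this
    · have : g α = 0 := by simpa using hα
      rw [this]; simp
  obtain ⟨α, hα⟩ : ∃ α, g α ≠ 0 := by
    by_contra! h
    apply hx0
    rw [← hsum]
    exact Finset.sum_eq_zero fun α _ => h α
  refine ⟨α, ?_⟩
  obtain ⟨c, hc⟩ := exists_smul_eq_of_finrank_eq_one h1 (x := ⟨g α, hgw α⟩)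
    (by simpa [Subtype.ext_iff] using hα) ⟨x, hx⟩
  have : c • g α = x := congrArg Subtype.val hc
  rw [← this]
  exact Submodule.smul_mem _ _ (hg α).2

end Weights

/-! ### Positive systems and FP triples. -/

section Combinatorics

variable {X : Type*} [AddCommGroup X] {Φ P Φ₁ : Set X} {m : ℕ} {δ : Fin m → X}

/-- The form in which positivity is used below: one positive root is singled out, and the other
summands may be absent. -/
theorem IsPositiveSystem.add_ne_zero (hP : IsPositiveSystem Φ P) {a s : X} (ha : a ∈ P)
    (hs : s ∈ AddSubmonoid.closure P) : a + s ≠ 0 := by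
  have : a + s ∈ AddSubsemigroup.closure P := by
    induction hs using AddSubmonoid.closure_induction_right with
    | zero => rw [add_zero]; exact AddSubsemigroup.subset_closure ha
    | add_right s _ b hb ih =>
      rw [← add_assoc]
      exact AddSubsemigroup.add_mem _ ih (AddSubsemigroup.subset_closure hb)
  intro h
  rw [h] at this
  exact hP.zero_notMem this

theorem IsPositiveSystem.neg_notMem (hP : IsPositiveSystem Φ P) {a : X} (ha : a ∈ P) : -a ∉ P :=
  fun hna => hP.add_ne_zero ha (AddSubmonoid.subset_closure hna) (add_neg_cancel a)

theorem IsPositiveSystem.mem_of_add_mem (hP : IsPositiveSystem Φ P) {a b : X} (ha : a ∈ P)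
    (hb : b ∈ AddSubmonoid.closure P) (h : a + b ∈ Φ) : a + b ∈ P := by
  refine (hP.mem_or_neg_mem _ h).resolve_right fun h' => hP.add_ne_zero ha
    (AddSubmonoid.add_mem _ hb (AddSubmonoid.subset_closure h')) ?_
  rw [← add_assoc, add_neg_cancel]

theorem IsFPTriple.mem_pos (hFP : IsFPTriple Φ P Φ₁ δ) (j : Fin m) : δ j ∈ P :=
  (hFP.range_eq.subset ⟨j, rfl⟩).1

theorem IsFPTriple.notMem_levi (hFP : IsFPTriple Φ P Φ₁ δ) (j : Fin m) : δ j ∉ Φ₁ :=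
  (hFP.range_eq.subset ⟨j, rfl⟩).2

theorem IsFPTriple.add_mem_levi (hFP : IsFPTriple Φ P Φ₁ δ) {a b : X} (ha : a ∈ Φ₁) (hb : b ∈ Φ₁)
    (h : a + b ∈ Φ) : a + b ∈ Φ₁ := by
  simpa using hFP.subsystem.2 a ha b hb 1 1 (by simpa using h)

theorem IsFPTriple.nsmul_mem_levi (hFP : IsFPTriple Φ P Φ₁ δ) {a : X} (ha : a ∈ Φ₁) (n : ℕ)
    (h : n • a ∈ Φ) : n • a ∈ Φ₁ := by
  simpa using hFP.subsystem.2 a ha a ha n 0 (by simpa using h)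

theorem IsFPTriple.neg_mem_levi (hFP : IsFPTriple Φ P Φ₁ δ) {a : X} (ha : a ∈ Φ₁)
    (h : -a ∈ Φ) : -a ∈ Φ₁ := by
  simpa using hFP.subsystem.2 a ha a ha (-1) 0 (by simpa using h)

theorem IsFPTriple.neg_notMem_levi (hFP : IsFPTriple Φ P Φ₁ δ) (hP : IsPositiveSystem Φ P)
    (j : Fin m) : -δ j ∉ Φ₁ := by
  intro h
  have := hFP.neg_mem_levi h (by rw [neg_neg]; exact hP.subset (hFP.mem_pos j))
  rw [neg_neg] at this
  exact hFP.notMem_levi j this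

theorem IsFPTriple.cases_of_notMem_pos (hFP : IsFPTriple Φ P Φ₁ δ) (hP : IsPositiveSystem Φ P)
    {a : X} (ha : a ∈ Φ) (haP : a ∉ P) : (∃ j, a = -δ j) ∨ (a ∈ Φ₁ ∧ -a ∈ P) := by
  have h := (hP.mem_or_neg_mem a ha).resolve_left haP
  by_cases h1 : -a ∈ Φ₁
  · have := hFP.neg_mem_levi h1 (by rwa [neg_neg])
    rw [neg_neg] at this
    exact .inr ⟨this, h⟩
  · obtain ⟨j, hj⟩ : -a ∈ Set.range δ := hFP.range_eq ▸ ⟨h, h1⟩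
    exact .inl ⟨j, by rw [hj, neg_neg]⟩

theorem IsFPTriple.cases (hFP : IsFPTriple Φ P Φ₁ δ) (hP : IsPositiveSystem Φ P)
    {a : X} (ha : a ∈ Φ) : a ∈ Φ₁ ∨ (∃ j, a = δ j) ∨ ∃ j, a = -δ j := by
  by_cases haP : a ∈ P
  · by_cases h1 : a ∈ Φ₁
    · exact .inl h1
    · obtain ⟨j, hj⟩ : a ∈ Set.range δ := hFP.range_eq ▸ ⟨haP, h1⟩
      exact .inr (.inl ⟨j, hj.symm⟩)
  · rcases hFP.cases_of_notMem_pos hP ha haP with h | h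
    · exact .inr (.inr h)
    · exact .inl h.1

/-- The positive system in which all the `δ_j` are negative. -/
theorem IsFPTriple.neg_mem_last (j : Fin m) : -δ j ∈ fpSet P Φ₁ δ m :=
  .inl (.inr ⟨j, j.2, rfl⟩)

theorem sum_nsmul_mem_closure {Q : Set X} (k : Fin m → ℕ) (h : ∀ j, k j ≠ 0 → δ j ∈ Q) :
    ∑ j, k j • δ j ∈ AddSubmonoid.closure Q := by
  refine AddSubmonoid.sum_mem _ fun j _ => ?_
  by_cases hk : k j = 0
  · rw [hk, zero_smul]; exact AddSubmonoid.zero_mem _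
  · exact AddSubmonoid.nsmul_mem _ (AddSubmonoid.subset_closure (h j hk)) _

/-- A nonzero combination of the `δ_j` with nonnegative coefficients is not a sum of elements of
`-P`. -/
theorem IsFPTriple.sum_add_ne_zero (hFP : IsFPTriple Φ P Φ₁ δ) (hP : IsPositiveSystem Φ P)
    {k : Fin m → ℕ} (hk : k ≠ 0) {s : X} (hs : s ∈ AddSubmonoid.closure P) :
    ∑ j, k j • δ j + s ≠ 0 := by
  obtain ⟨i, hi⟩ := Function.ne_iff.1 hk
  obtain ⟨n, hn⟩ := Nat.exists_eq_succ_of_ne_zero hi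
  rw [Pi.zero_apply] at hi
  classical
  have e : ∑ j, k j • δ j = δ i + ∑ j, (Function.update k i n) j • δ j := by
    rw [← Finset.add_sum_erase _ _ (Finset.mem_univ i),
      ← Finset.add_sum_erase _ (fun j => Function.update k i n j • δ j) (Finset.mem_univ i), hn,
      Function.update_self, ← add_assoc, succ_nsmul']
    congr 1
    refine Finset.sum_congr rfl fun j hj => ?_
    rw [Function.update_of_ne (Finset.ne_of_mem_erase hj)]
  rw [e, add_assoc]
  exact hP.add_ne_zero (hFP.mem_pos i) (AddSubmonoid.add_mem _
    (sum_nsmul_mem_closure _ fun j _ => hFP.mem_pos j) hs)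

/-- A nonzero combination of the `δ_j` with nonnegative coefficients is not a sum of elements of
`Φ₁⁺`. -/
theorem IsFPTriple.sum_ne (hFP : IsFPTriple Φ P Φ₁ δ)
    {k : Fin m → ℕ} (hk : k ≠ 0) {s : X} (hs : s ∈ AddSubmonoid.closure (Φ₁ ∩ P)) :
    ∑ j, k j • δ j ≠ s := by
  -- In the last positive system of the chain both `Φ₁⁺` and all the `-δ_j` are positive.
  have hQ := hFP.positive m le_rfl
  obtain ⟨i, hi⟩ := Function.ne_iff.1 hk
  rw [Pi.zero_apply] at hi
  obtain ⟨n, hn⟩ := Nat.exists_eq_succ_of_ne_zero hi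
  classical
  have e : ∑ j, k j • δ j = δ i + ∑ j, (Function.update k i n) j • δ j := by
    rw [← Finset.add_sum_erase _ _ (Finset.mem_univ i),
      ← Finset.add_sum_erase _ (fun j => Function.update k i n j • δ j) (Finset.mem_univ i), hn,
      Function.update_self, ← add_assoc, succ_nsmul']
    congr 1
    refine Finset.sum_congr rfl fun j hj => ?_
    rw [Function.update_of_ne (Finset.ne_of_mem_erase hj)]
  intro h
  have h1 : s ∈ AddSubmonoid.closure (fpSet P Φ₁ δ m) :=
    AddSubmonoid.closure_mono (fun x hx => .inl (.inl hx)) hs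
  refine hQ.add_ne_zero (IsFPTriple.neg_mem_last i) (AddSubmonoid.add_mem _
    (sum_nsmul_mem_closure (δ := fun j => -δ j) (Function.update k i n)
      fun j _ => IsFPTriple.neg_mem_last j) h1) ?_
  rw [← h, e]
  simp only [smul_neg, Finset.sum_neg_distrib]
  abel

end Combinatorics

theorem exists_smul_eq_of_mem {F E : Type*} [Field F] [AddCommGroup E] [Module F E]
    {W : Submodule F E} (h : Module.finrank F W = 1) {x y : E} (hx : x ∈ W) (hx0 : x ≠ 0)
    (hy : y ∈ W) : ∃ c : F, c • x = y := by
  obtain ⟨c, hc⟩ := exists_smul_eq_of_finrank_eq_one h (x := ⟨x, hx⟩)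
    (by simpa [Subtype.ext_iff] using hx0) ⟨y, hy⟩
  exact ⟨c, congrArg Subtype.val hc⟩

/-! ### A basis ordered along the triangular decomposition. -/

section RootBasis

universe uF uV
variable {Γ I : Type*} {F : Type uF} {V : Type uV} [AddCommGroup Γ] [Field F] [AddCommGroup V]
  [Module F V]

/-- An ordered basis of `𝔤` that consists of the root vectors `f_1 < ⋯ < f_m`, root vectors for
`-Φ₁⁺`, a basis of `H`, and root vectors for `Φ⁺`. -/
structure IsRootBasis [LinearOrder I] (𝒱 : Γ → Submodule F V)
    (𝔤 : Submodule F (Module.End F V)) (T : Subgroup (LinearMap.GeneralLinearGroup F V))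
    (P Φ₁ : Set (Char T)) {m : ℕ} (δ : Fin m → Char T) (e f : Fin m → 𝔤)
    (bs : Module.Basis I F 𝔤) (deg : I → Γ) (ω : I → Char T) (r : I → ℕ) (ei fi : Fin m → I) :
    Prop where
  mem_homEnd : ∀ i, (bs i : Module.End F V) ∈ homEnd 𝒱 (deg i)
  mem_conjWeight : ∀ i, (bs i : Module.End F V) ∈ conjWeight T (ω i)
  deg_torus : ∀ i, ω i = 0 → deg i = 0
  mem_torus : ∀ i, ω i = 0 → (bs i : Module.End F V) ∈ lieOf 𝒱 T
  mem_roots : ∀ i, ω i ≠ 0 → ω i ∈ roots 𝔤 T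
  inj : ∀ i j, ω i = ω j → ω i ≠ 0 → i = j
  lt_of_rank : ∀ i j, r i < r j → i < j
  rank_f : ∀ j, r (fi j) = j
  rank_lt : ∀ i, r i < m → ∃ j, i = fi j
  rank_levi : ∀ i, r i = m → ω i ∈ Φ₁ ∧ -ω i ∈ P
  rank_torus : ∀ i, r i = m + 1 → ω i = 0
  rank_pos : ∀ i, r i = m + 2 → ω i ∈ P
  rank_le : ∀ i, r i ≤ m + 2
  weight_f : ∀ j, ω (fi j) = -δ j
  weight_e : ∀ j, ω (ei j) = δ j
  basis_f : ∀ j, bs (fi j) = f j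
  basis_e : ∀ j, bs (ei j) = e j

-- A basis of `H` together with one vector from each root space, the prescribed one at `±δ_j`. The
-- order compares ranks first and breaks ties by an arbitrary linear order.
open Classical in
theorem exists_isRootBasis {p : ℕ} {ε : Bicharacter Γ F} {𝒱 : Γ → Submodule F V}
    {𝔤 : Submodule F (Module.End F V)} {G T : Subgroup (LinearMap.GeneralLinearGroup F V)}
    (h𝔤 : IsAlgebraic p ε 𝒱 𝔤 G) (hT : IsMaximalTorus 𝒱 G T)
    (hroot : HasRootDecomposition 𝒱 𝔤 T) {P : Set (Char T)}
    (hP : IsPositiveSystem (roots 𝔤 T) P) {Φ₁ : Set (Char T)} {m : ℕ} {δ : Fin m → Char T}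
    (hFP : IsFPTriple (roots 𝔤 T) P Φ₁ δ) {e f : Fin m → 𝔤}
    (he : ∀ i, e i ≠ 0 ∧ (e i : Module.End F V) ∈ rootSpace 𝔤 T (δ i))
    (hf : ∀ i, f i ≠ 0 ∧ (f i : Module.End F V) ∈ rootSpace 𝔤 T (-δ i)) :
    ∃ (I : Type (max uF uV)) (_ : LinearOrder I) (bs : Module.Basis I F 𝔤) (deg : I → Γ)
      (ω : I → Char T) (r : I → ℕ) (ei fi : Fin m → I),
      IsRootBasis 𝒱 𝔤 T P Φ₁ δ e f bs deg ω r ei fi := by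
  have hδP : ∀ j, δ j ∈ P ∧ δ j ∉ Φ₁ := fun j => ⟨hFP.mem_pos j, hFP.notMem_levi j⟩
  have hPP : ∀ a ∈ P, -a ∉ P := by
    intro a ha hna
    exact hP.neg_notMem ha hna
  have hex : ∀ γ : roots 𝔤 T, ∃ x : Module.End F V, x ≠ 0 ∧ x ∈ rootSpace 𝔤 T γ ∧
      (∀ j, (γ : Char T) = δ j → x = e j) ∧ (∀ j, (γ : Char T) = -δ j → x = f j) := by
    rintro ⟨γ, hγ⟩
    by_cases h1 : ∃ j, γ = δ j
    · obtain ⟨j, rfl⟩ := h1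
      refine ⟨e j, by simpa using (he j).1, (he j).2, fun l hl => ?_, fun l hl => ?_⟩
      · rw [hFP.injective hl]
      · exact absurd (hδP j).1 (by have : δ j = -δ l := hl; rw [this]; exact hPP _ (hδP l).1)
    · by_cases h2 : ∃ j, γ = -δ j
      · obtain ⟨j, rfl⟩ := h2
        refine ⟨f j, by simpa using (hf j).1, (hf j).2, fun l hl => absurd ⟨l, hl⟩ h1, fun l hl => ?_⟩
        rw [hFP.injective (neg_injective hl)]
      · obtain ⟨x, hx, hx0⟩ := Submodule.exists_mem_ne_zero_of_ne_bot hγ.2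
        exact ⟨x, hx0, hx, fun l hl => absurd ⟨l, hl⟩ h1, fun l hl => absurd ⟨l, hl⟩ h2⟩
  choose x hx0 hxm hxe hxf using hex
  let bH := Module.Basis.ofVectorSpace F (lieOf 𝒱 T)
  let IH := Module.Basis.ofVectorSpaceIndex F (lieOf 𝒱 T)
  let b : IH ⊕ roots 𝔤 T → Module.End F V := Sum.elim (fun i => (bH i : Module.End F V)) x
  let ω : IH ⊕ roots 𝔤 T → Char T := Sum.elim (fun _ => 0) (fun γ => γ)
  have hind := hT.torus.conjWeight_iSupIndep
  have hw : ∀ i, b i ∈ conjWeight T (ω i) := by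
    rintro (i | γ)
    · exact hT.torus.lieOf_le_conjWeight (bH i).2
    · exact (hxm γ).2
  have hli : LinearIndependent F b := by
    refine LinearIndependent.sum_type ?_ ?_ ?_
    · exact bH.linearIndependent.map' (lieOf 𝒱 T).subtype (Submodule.ker_subtype _)
    · exact (hind.comp (f := fun γ : roots 𝔤 T => (γ : Char T)) Subtype.val_injective).linearIndependent _
        (fun γ => (hxm γ).2) hx0
    · refine (hind 0).mono (Submodule.span_le.2 ?_) (Submodule.span_le.2 ?_)
      · rintro _ ⟨i, rfl⟩
        exact hT.torus.lieOf_le_conjWeight (bH i).2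
      · rintro _ ⟨γ, rfl⟩
        exact Submodule.mem_iSup_of_mem (γ : Char T) (Submodule.mem_iSup_of_mem γ.2.1 (hxm γ).2)
  have hspan : Submodule.span F (Set.range b) = 𝔤 := by
    apply le_antisymm
    · refine Submodule.span_le.2 ?_
      rintro _ ⟨i | γ, rfl⟩
      · exact hroot.torus_le (bH i).2
      · exact (hxm γ).1
    · conv_lhs => rw [hroot.sum_eq]
      refine sup_le ?_ (iSup₂_le fun γ hγ => ?_)
      · intro h hh
        have h1 : (⟨h, hh⟩ : lieOf 𝒱 T) ∈ Submodule.span F (Set.range bH) :=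
          bH.span_eq ▸ Submodule.mem_top
        have h2 := Submodule.mem_map_of_mem (f := (lieOf 𝒱 T).subtype) h1
        rw [Submodule.map_span, ← Set.range_comp] at h2
        refine Submodule.span_mono ?_ h2
        rintro _ ⟨i, rfl⟩
        exact ⟨.inl i, rfl⟩
      · intro y hy
        obtain ⟨c, rfl⟩ := exists_smul_eq_of_mem (hroot.finrank_eq_one γ hγ) (hxm ⟨γ, hγ⟩)
          (hx0 ⟨γ, hγ⟩) hy
        exact Submodule.smul_mem _ _ (Submodule.subset_span ⟨.inr ⟨γ, hγ⟩, rfl⟩)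
  let bs : Module.Basis (IH ⊕ roots 𝔤 T) F 𝔤 :=
    (Module.Basis.span hli).map (LinearEquiv.ofEq _ _ hspan)
  have hbs : ∀ i, (bs i : Module.End F V) = b i := by
    intro i
    simp only [bs, Module.Basis.map_apply, LinearEquiv.coe_ofEq_apply, Module.Basis.span_apply]
  have hTg : T ≤ gradedGL 𝒱 := hT.torus.closed.1
  have hdeg : ∀ i, ∃ α, b i ∈ homEnd 𝒱 α ∧ (ω i = 0 → α = 0) := by
    rintro (i | γ)
    · exact ⟨0, lieOf_le_homEnd (bH i).2, fun _ => rfl⟩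
    · obtain ⟨α, hα⟩ := exists_mem_homEnd h𝔤.grading hTg h𝔤.restricted.graded
        (hroot.finrank_eq_one γ γ.2) (hxm γ)
      exact ⟨α, hα, fun h => absurd h γ.2.1⟩
  choose deg hdeg1 hdeg0 using hdeg
  have hδr : ∀ j, δ j ∈ roots 𝔤 T := fun j => hP.subset (hδP j).1
  -- Ranks `0, …, m-1` are the `f_j`; then come the negative roots of `Φ₁` at `m`, the torus at `m +
  -- 1` and the positive roots at `m + 2`. Sorted words are products in this order.
  let r : IH ⊕ roots 𝔤 T → ℕ := Sum.elim (fun _ => m + 1) (fun γ =>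
    if h : ∃ j, (γ : Char T) = -δ j then (h.choose : ℕ) else
      if (γ : Char T) ∈ P then m + 2 else m)
  let I' := IH ⊕ roots 𝔤 T
  letI wo : LinearOrder I' := linearOrderOfSTO WellOrderingRel
  let key : I' → ℕ ×ₗ I' := fun i => toLex (r i, i)
  have hkey : Function.Injective key := by
    intro i j h
    exact (Prod.ext_iff.1 (toLex.injective h)).2
  have hlt : ∀ i j, r i < r j → key i < key j := fun i j h => Prod.Lex.toLex_lt_toLex.2 (.inl h)
  let ord : LinearOrder I' := LinearOrder.lift' key hkey
  refine ⟨I', ord, bs, deg, ω, r, fun j => .inr ⟨δ j, hδr j⟩,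
    fun j => .inr ⟨-δ j, hroot.neg_mem _ (hδr j)⟩, ?_⟩
  have hrf : ∀ j, r (.inr ⟨-δ j, hroot.neg_mem _ (hδr j)⟩) = j := by
    intro j
    have h : ∃ l, -δ j = -δ l := ⟨j, rfl⟩
    have h2 := hFP.injective (neg_injective h.choose_spec)
    simp only [r, Sum.elim_inr]
    rw [dif_pos h]
    exact congrArg Fin.val h2.symm
  have hrcase : ∀ γ : roots 𝔤 T, (∃ j, (γ : Char T) = -δ j) ∨
      (r (.inr γ) = m + 2 ∧ (γ : Char T) ∈ P) ∨ (r (.inr γ) = m ∧ (γ : Char T) ∈ Φ₁ ∧ -(γ : Char T) ∈ P) := by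
    intro γ
    by_cases h1 : ∃ j, (γ : Char T) = -δ j
    · exact .inl h1
    by_cases h2 : (γ : Char T) ∈ P
    · refine .inr (.inl ⟨?_, h2⟩)
      simp only [r, Sum.elim_inr]
      rw [dif_neg h1, if_pos h2]
    · refine .inr (.inr ⟨?_, (hFP.cases_of_notMem_pos hP γ.2 h2).resolve_left h1⟩)
      simp only [r, Sum.elim_inr]
      rw [dif_neg h1, if_neg h2]
  have hrf' : ∀ γ : roots 𝔤 T, ∀ j, (γ : Char T) = -δ j → r (.inr γ) = j ∧
      γ = ⟨-δ j, hroot.neg_mem _ (hδr j)⟩ := by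
    rintro ⟨γ, hγ⟩ j rfl
    exact ⟨hrf j, rfl⟩
  exact
  { mem_homEnd := fun i => hbs i ▸ hdeg1 i
    mem_conjWeight := fun i => hbs i ▸ hw i
    deg_torus := hdeg0
    mem_torus := by
      rintro (i | γ) h
      · rw [hbs]; exact (bH i).2
      · exact absurd h γ.2.1
    mem_roots := by
      rintro (i | γ) h
      · exact absurd rfl h
      · exact γ.2
    inj := by
      rintro (i | γ) (j | γ') h h0
      · exact absurd rfl h0
      · exact absurd rfl h0
      · exact absurd h h0
      · exact congrArg _ (Subtype.ext h)
    lt_of_rank := hlt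
    rank_f := hrf
    rank_lt := by
      rintro (i | γ) h
      · exact absurd h (by simp [r])
      · rcases hrcase γ with ⟨j, hj⟩ | ⟨h1, _⟩ | ⟨h1, _⟩
        · exact ⟨j, congrArg _ (hrf' γ j hj).2⟩
        · omega
        · omega
    rank_levi := by
      rintro (i | γ) h
      · exact absurd h (by simp [r])
      · rcases hrcase γ with ⟨j, hj⟩ | ⟨h1, _⟩ | ⟨h1, h2⟩
        · have := (hrf' γ j hj).1
          have := j.2; omega
        · omega
        · exact h2
    rank_torus := by
      rintro (i | γ) h
      · rfl
      · rcases hrcase γ with ⟨j, hj⟩ | ⟨h1, _⟩ | ⟨h1, h2⟩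
        · have := (hrf' γ j hj).1
          have := j.2; omega
        · omega
        · omega
    rank_pos := by
      rintro (i | γ) h
      · exact absurd h (by simp [r])
      · rcases hrcase γ with ⟨j, hj⟩ | ⟨h1, h2⟩ | ⟨h1, h2⟩
        · have := (hrf' γ j hj).1
          have := j.2; omega
        · exact h2
        · omega
    rank_le := by
      rintro (i | γ)
      · simp [r]
      · rcases hrcase γ with ⟨j, hj⟩ | ⟨h1, h2⟩ | ⟨h1, h2⟩
        · have := (hrf' γ j hj).1
          have := j.2; omega
        · omega
        · omega
    weight_f := fun j => rfl
    weight_e := fun j => rfl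
    basis_f := fun j => Subtype.ext ((hbs _).trans (hxf _ j rfl))
    basis_e := fun j => Subtype.ext ((hbs _).trans (hxe _ j rfl)) }

end RootBasis

/-! ### Root sums that describe brackets with `P₀`. -/

section Combinatorics

variable {X : Type*} [AddCommGroup X] {Φ P Φ₁ : Set X} {m : ℕ} {δ : Fin m → X}

theorem IsFPTriple.delta_add_delta_ne (hFP : IsFPTriple Φ P Φ₁ δ) (i j : Fin m) {s : X}
    (hs : s ∈ Φ₁ ∩ P) : δ i + δ j ≠ s := by
  intro h
  refine (hFP.positive m le_rfl).add_ne_zero (IsFPTriple.neg_mem_last i)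
    (AddSubmonoid.add_mem _ (AddSubmonoid.subset_closure (IsFPTriple.neg_mem_last j))
      (AddSubmonoid.subset_closure (.inl (.inl hs)))) ?_
  rw [← h]; abel

theorem IsFPTriple.delta_ne_zero (hFP : IsFPTriple Φ P Φ₁ δ) (hP : IsPositiveSystem Φ P)
    (i : Fin m) : δ i ≠ 0 := by
  simpa using hP.add_ne_zero (hFP.mem_pos i) (AddSubmonoid.zero_mem _)

theorem IsFPTriple.nsmul_delta_ne_zero (hFP : IsFPTriple Φ P Φ₁ δ) (hP : IsPositiveSystem Φ P)
    (i : Fin m) {n : ℕ} (hn : n ≠ 0) : n • δ i ≠ 0 := by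
  obtain ⟨n, rfl⟩ := Nat.exists_eq_succ_of_ne_zero hn
  rw [Nat.succ_eq_add_one, succ_nsmul']
  exact hP.add_ne_zero (hFP.mem_pos i)
    (AddSubmonoid.nsmul_mem _ (AddSubmonoid.subset_closure (hFP.mem_pos i)) n)

/-- Consecutive positive systems of the chain differ only in the sign of one root. -/
theorem IsFPTriple.mem_succ {a : Fin m} {γ : X} (h : γ ∈ fpSet P Φ₁ δ a) (hne : γ ≠ δ a) :
    γ ∈ fpSet P Φ₁ δ (a + 1) := by
  rcases h with (h | ⟨j, hj, rfl⟩) | ⟨j, hj, rfl⟩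
  · exact .inl (.inl h)
  · exact .inl (.inr ⟨j, by omega, rfl⟩)
  · refine .inr ⟨j, ?_, rfl⟩
    have : (j : ℕ) ≠ a := fun h => hne (by rw [Fin.ext h])
    omega

/-- No proper multiple of `δ_a` is a root. -/
theorem IsFPTriple.nsmul_notMem (hFP : IsFPTriple Φ P Φ₁ δ) (hP : IsPositiveSystem Φ P)
    (a : Fin m) {n : ℕ} (hn : 2 ≤ n) : n • δ a ∉ Φ := by
  intro h
  have h1 := hFP.positive a a.2.le
  have h2 := hFP.positive (a + 1) a.2
  have ha : δ a ∈ fpSet P Φ₁ δ a := .inr ⟨a, le_rfl, rfl⟩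
  have ha' : -δ a ∈ fpSet P Φ₁ δ (a + 1) := .inl (.inr ⟨a, by omega, rfl⟩)
  -- A positive multiple other than `δ_a` would stay positive in the next system, where `-δ_a` is
  -- positive as well.
  rcases h1.mem_or_neg_mem _ h with h3 | h3
  · by_cases h4 : n • δ a = δ a
    · obtain ⟨k, rfl⟩ : ∃ k, n = k + 1 := ⟨n - 1, by omega⟩
      rw [succ_nsmul, add_eq_right] at h4
      exact hFP.nsmul_delta_ne_zero hP a (by omega) h4
    · refine h2.add_ne_zero (IsFPTriple.mem_succ h3 h4)
        (AddSubmonoid.nsmul_mem _ (AddSubmonoid.subset_closure ha') n) ?_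
      rw [smul_neg, add_neg_cancel]
  · refine h1.add_ne_zero h3 (AddSubmonoid.nsmul_mem _ (AddSubmonoid.subset_closure ha) n) ?_
    rw [neg_add_cancel]

/-- The weights of `P₀`. -/
def IsParabolicWeight (Φ₁ : Set X) (δ : Fin m → X) (a : X) : Prop :=
  a = 0 ∨ a ∈ Φ₁ ∨ ∃ j, a = δ j

/-- For positive `a` equality is a vanishing sum of positive roots; for negative `a` it makes `δ_i +
δ_j` equal to an element of `Φ₁⁺`, against the last positive system. -/
theorem IsFPTriple.levi_add_delta_ne (hFP : IsFPTriple Φ P Φ₁ δ) (hP : IsPositiveSystem Φ P)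
    (hneg : ∀ a ∈ Φ, -a ∈ Φ) {a : X} (ha : a ∈ Φ₁) (i j : Fin m) : a + δ i ≠ -δ j := by
  intro h
  rcases hP.mem_or_neg_mem a (hFP.subsystem.1 ha) with h1 | h1
  · refine hP.add_ne_zero h1 (AddSubmonoid.add_mem _ (AddSubmonoid.subset_closure (hFP.mem_pos i))
      (AddSubmonoid.subset_closure (hFP.mem_pos j))) ?_
    rw [← add_assoc, h, neg_add_cancel]
  · refine hFP.delta_add_delta_ne i j ⟨hFP.neg_mem_levi ha (hneg _ (hFP.subsystem.1 ha)), h1⟩ ?_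
    have : δ j = -(a + δ i) := by rw [h, neg_neg]
    rw [this]; abel

/-- On the level of weights this is the closure of `P₀` under brackets; the next lemma is the
analogue for the `p`-map. -/
theorem IsFPTriple.add_ne_neg_delta (hFP : IsFPTriple Φ P Φ₁ δ) (hP : IsPositiveSystem Φ P)
    (hneg : ∀ a ∈ Φ, -a ∈ Φ) {a b : X}
    (ha : IsParabolicWeight Φ₁ δ a) (hb : IsParabolicWeight Φ₁ δ b) (j : Fin m) :
    a + b ≠ -δ j := by
  have h0 : (0 : X) + 0 ≠ -δ j := by
    rw [add_zero]
    intro h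
    exact hFP.delta_ne_zero hP j (neg_eq_zero.1 h.symm)
  have hd : ∀ i, δ i ≠ -δ j := fun i h => hP.neg_notMem (hFP.mem_pos j) (h ▸ hFP.mem_pos i)
  rcases ha with rfl | ha | ⟨i, rfl⟩ <;> rcases hb with rfl | hb | ⟨l, rfl⟩
  · exact h0
  · rw [zero_add]
    rintro rfl
    exact hFP.neg_notMem_levi hP j hb
  · rw [zero_add]; exact hd l
  · rw [add_zero]
    rintro rfl
    exact hFP.neg_notMem_levi hP j ha
  · intro h
    have := hFP.add_mem_levi ha hb (h ▸ hneg _ (hP.subset (hFP.mem_pos j)))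
    exact hFP.neg_notMem_levi hP j (h ▸ this)
  · exact hFP.levi_add_delta_ne hP hneg ha l j
  · rw [add_zero]; exact hd i
  · rw [add_comm]; exact hFP.levi_add_delta_ne hP hneg hb i j
  · intro h
    refine hP.add_ne_zero (hFP.mem_pos i) (AddSubmonoid.add_mem _
      (AddSubmonoid.subset_closure (hFP.mem_pos l)) (AddSubmonoid.subset_closure (hFP.mem_pos j))) ?_
    rw [← add_assoc, h, neg_add_cancel]

theorem IsFPTriple.nsmul_ne_neg_delta (hFP : IsFPTriple Φ P Φ₁ δ) (hP : IsPositiveSystem Φ P)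
    (hneg : ∀ a ∈ Φ, -a ∈ Φ) {a : X} (ha : IsParabolicWeight Φ₁ δ a) (n : ℕ) (j : Fin m) :
    n • a ≠ -δ j := by
  rcases ha with rfl | ha | ⟨i, rfl⟩
  · rw [smul_zero]
    intro h
    exact hFP.delta_ne_zero hP j (neg_eq_zero.1 h.symm)
  · intro h
    have := hFP.nsmul_mem_levi ha n (h ▸ hneg _ (hP.subset (hFP.mem_pos j)))
    exact hFP.neg_notMem_levi hP j (h ▸ this)
  · intro h
    refine hP.add_ne_zero (hFP.mem_pos j) (AddSubmonoid.nsmul_mem _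
      (AddSubmonoid.subset_closure (hFP.mem_pos i)) n) ?_
    rw [h, add_neg_cancel]

/-- `Φ₁` normalizes the set of the `-δ_j`. -/
theorem IsFPTriple.levi_sub_delta (hFP : IsFPTriple Φ P Φ₁ δ) (hP : IsPositiveSystem Φ P)
    (hneg : ∀ a ∈ Φ, -a ∈ Φ) {a : X} (ha : a ∈ Φ₁) {j : Fin m} (h : a + -δ j ∈ Φ) :
    ∃ l, a + -δ j = -δ l := by
  rcases hFP.cases hP h with h1 | ⟨l, h1⟩ | h1
  · exfalso
    have h2 := hneg _ (hFP.subsystem.1 h1)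
    have h3 := hFP.add_mem_levi ha (hFP.neg_mem_levi h1 h2) (by
      have : a + -(a + -δ j) = δ j := by abel
      rw [this]; exact hP.subset (hFP.mem_pos j))
    have : a + -(a + -δ j) = δ j := by abel
    rw [this] at h3
    exact hFP.notMem_levi j h3
  · exfalso
    refine hFP.levi_add_delta_ne hP hneg
      (hFP.neg_mem_levi ha (hneg _ (hFP.subsystem.1 ha))) l j ?_
    rw [← h1]; abel
  · exact h1

theorem IsFPTriple.levi_add_delta (hFP : IsFPTriple Φ P Φ₁ δ) (hP : IsPositiveSystem Φ P)
    (hneg : ∀ a ∈ Φ, -a ∈ Φ) {a : X} (ha : a ∈ Φ₁) {j : Fin m} (h : a + δ j ∈ Φ) :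
    ∃ l, a + δ j = δ l := by
  obtain ⟨l, hl⟩ := hFP.levi_sub_delta hP hneg (hFP.neg_mem_levi ha (hneg _ (hFP.subsystem.1 ha)))
    (j := j) (by rw [← neg_add]; exact hneg _ h)
  exact ⟨l, by rw [← neg_add] at hl; exact neg_injective hl⟩

/-- Additivity bounds the index by the maximum, and equality would force one of the roots to be
zero. By strictness, moving `f_n` past words in `f_1, …, f_{n-1}` creates only words in these
letters. -/
theorem IsFPTriple.neg_delta_add (hFP : IsFPTriple Φ P Φ₁ δ) (hP : IsPositiveSystem Φ P)
    {a b : Fin m} (h : -δ a + -δ b ∈ Φ) : ∃ l, l < max a b ∧ -δ a + -δ b = -δ l := by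
  obtain ⟨l, hl, h1⟩ := (hFP.additive (max a b)).2 (-δ a) ⟨a, le_max_left _ _, rfl⟩ (-δ b)
    ⟨b, le_max_right _ _, rfl⟩ h
  refine ⟨l, lt_of_le_of_ne hl ?_, h1⟩
  rintro rfl
  rcases max_choice a b with h2 | h2 <;> rw [h2] at h1
  · rw [add_eq_left, neg_eq_zero] at h1
    exact hFP.delta_ne_zero hP b h1
  · rw [add_eq_right, neg_eq_zero] at h1
    exact hFP.delta_ne_zero hP a h1

end Combinatorics

/-! ### Subalgebras spanned by part of the basis. -/

section RootData

variable {Γ F V I X : Type*} [AddCommGroup Γ] [Field F] [AddCommGroup V] [Module F V]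
  [LinearOrder I] [AddCommGroup X]

/-- An ordered homogeneous basis of `𝔤` with weights: it consists of root vectors
`f_1 < ⋯ < f_m`, root vectors for `-Φ₁⁺`, a basis of `H`, and root vectors for `Φ⁺`. -/
structure RootData (p : ℕ) (ε : Bicharacter Γ F) (𝒱 : Γ → Submodule F V)
    (𝔤 : Submodule F (Module.End F V)) (Φ P Φ₁ : Set X) {m : ℕ} (δ : Fin m → X)
    (bs : Module.Basis I F 𝔤) (deg : I → Γ) (ω : I → X) (r : I → ℕ) (ei fi : Fin m → I) :
    Prop where
  grading : IsGrading 𝒱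
  family : IsHomFamily p ε 𝒱 𝔤 (fun i => (bs i : Module.End F V)) deg
  bracket_mem : ∀ i j, colorBracket ε (deg i) (deg j) (bs i : Module.End F V) (bs j) ∈
    Submodule.span F ((fun i => (bs i : Module.End F V)) '' {k | ω k = ω i + ω j})
  pow_mem : ∀ i, ε (deg i) (deg i) = 1 → (bs i : Module.End F V) ^ p ∈
    Submodule.span F ((fun i => (bs i : Module.End F V)) '' {k | ω k = p • ω i})
  pos : IsPositiveSystem Φ P
  fp : IsFPTriple Φ P Φ₁ δ
  neg_mem : ∀ a ∈ Φ, -a ∈ Φ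
  mem_roots : ∀ i, ω i ≠ 0 → ω i ∈ Φ
  inj : ∀ i j, ω i = ω j → ω i ≠ 0 → i = j
  lt_of_rank : ∀ i j, r i < r j → i < j
  rank_f : ∀ j, r (fi j) = j
  rank_lt : ∀ i, r i < m → ∃ j, i = fi j
  rank_levi : ∀ i, r i = m → ω i ∈ Φ₁ ∧ -ω i ∈ P
  rank_torus : ∀ i, r i = m + 1 → ω i = 0
  rank_pos : ∀ i, r i = m + 2 → ω i ∈ P
  rank_le : ∀ i, r i ≤ m + 2
  weight_f : ∀ j, ω (fi j) = -δ j
  weight_e : ∀ j, ω (ei j) = δ j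

variable {p : ℕ} {ε : Bicharacter Γ F} {𝒱 : Γ → Submodule F V}
  {𝔤 : Submodule F (Module.End F V)} {Φ P Φ₁ : Set X} {m : ℕ} {δ : Fin m → X}
  {bs : Module.Basis I F 𝔤} {deg : I → Γ} {ω : I → X} {r : I → ℕ} {ei fi : Fin m → I}

/-- Brackets and `p`-th powers respect weights, so closure of a subspace becomes a condition on the
weights in `J`. -/
theorem RootData.subfamily (d : RootData p ε 𝒱 𝔤 Φ P Φ₁ δ bs deg ω r ei fi) {J : Set I}
    (hadd : ∀ i ∈ J, ∀ j ∈ J, ∀ k, ω k = ω i + ω j → k ∈ J)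
    (hnsmul : ∀ i ∈ J, ∀ k, ω k = p • ω i → k ∈ J) {S' : Submodule F (Module.End F V)}
    (hS' : S' = Submodule.span F ((fun i => (bs i : Module.End F V)) '' J)) :
    IsHomFamily p ε 𝒱 S' (fun i : J => (bs i : Module.End F V)) (fun i : J => deg i) where
  span_eq := by
    rw [hS', Set.image_eq_range]
  mem_homEnd i := d.family.mem_homEnd i
  bracket_mem i j := by
    rw [hS']
    exact Submodule.span_mono (Set.image_mono fun k hk => hadd i i.2 j j.2 k hk)
      (d.bracket_mem i j)
  pow_mem i h := by
    rw [hS']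
    exact Submodule.span_mono (Set.image_mono fun k hk => hnsmul i i.2 k hk) (d.pow_mem i h)

theorem RootData.rank_eq_of_pos (d : RootData p ε 𝒱 𝔤 Φ P Φ₁ δ bs deg ω r ei fi) {i : I}
    (h : ω i ∈ P) : r i = m + 2 := by
  have h1 : ¬ r i < m := fun h1 => by
    obtain ⟨j, rfl⟩ := d.rank_lt i h1
    rw [d.weight_f] at h
    exact d.pos.neg_notMem (d.fp.mem_pos j) h
  have h2 : r i ≠ m := fun h2 => d.pos.neg_notMem h (d.rank_levi i h2).2
  have h3 : r i ≠ m + 1 := fun h3 => by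
    have := d.pos.add_ne_zero h (AddSubmonoid.zero_mem _)
    rw [add_zero] at this
    exact this (d.rank_torus i h3)
  have := d.rank_le i
  omega

theorem RootData.rank_eq_of_zero (d : RootData p ε 𝒱 𝔤 Φ P Φ₁ δ bs deg ω r ei fi) {i : I}
    (h : ω i = 0) : r i = m + 1 := by
  have h1 : ¬ r i < m := fun h1 => by
    obtain ⟨j, rfl⟩ := d.rank_lt i h1
    rw [d.weight_f, neg_eq_zero] at h
    exact d.fp.delta_ne_zero d.pos j h
  have h0 : (0 : X) ∉ P := fun h => by simpa using d.pos.add_ne_zero h (AddSubmonoid.zero_mem _)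
  have h2 : r i ≠ m := fun h2 => h0 (by simpa [h] using (d.rank_levi i h2).2)
  have h3 : r i ≠ m + 2 := fun h3 => h0 (h ▸ d.rank_pos i h3)
  have := d.rank_le i
  omega

theorem RootData.isParabolicWeight (d : RootData p ε 𝒱 𝔤 Φ P Φ₁ δ bs deg ω r ei fi) {i : I}
    (h : m ≤ r i) : IsParabolicWeight Φ₁ δ (ω i) := by
  have := d.rank_le i
  obtain h1 | h1 | h1 : r i = m ∨ r i = m + 1 ∨ r i = m + 2 := by omega
  · exact .inr (.inl (d.rank_levi i h1).1)
  · exact .inl (d.rank_torus i h1)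
  · have h2 := d.rank_pos i h1
    rcases d.fp.cases d.pos (d.pos.subset h2) with h3 | h3 | ⟨j, h3⟩
    · exact .inr (.inl h3)
    · exact .inr (.inr h3)
    · exact absurd (h3 ▸ h2) (d.pos.neg_notMem (d.fp.mem_pos j))

/-- The form required by relative freeness; `n = m` gives the parabolic and `n = m + 1` the Borel
subalgebra. -/
theorem RootData.isUpperSet (d : RootData p ε 𝒱 𝔤 Φ P Φ₁ δ bs deg ω r ei fi) (n : ℕ) :
    IsUpperSet {i | n ≤ r i} := by
  intro i j hij hi
  by_contra h
  have h1 : r j < r i := lt_of_lt_of_le (not_le.1 h) hi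
  exact absurd (d.lt_of_rank j i h1) (not_lt.2 hij)

theorem RootData.parabolic (d : RootData p ε 𝒱 𝔤 Φ P Φ₁ δ bs deg ω r ei fi)
    {S' : Submodule F (Module.End F V)}
    (hS' : S' = Submodule.span F ((fun i => (bs i : Module.End F V)) '' {i | m ≤ r i})) :
    IsHomFamily p ε 𝒱 S' (fun i : {i | m ≤ r i} => (bs i : Module.End F V))
      (fun i : {i | m ≤ r i} => deg i) := by
  refine d.subfamily ?_ ?_ hS'
  · intro i hi j hj k hk
    show m ≤ r k
    refine not_lt.1 fun h => ?_
    obtain ⟨l, rfl⟩ := d.rank_lt k h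
    rw [d.weight_f] at hk
    exact d.fp.add_ne_neg_delta d.pos d.neg_mem (d.isParabolicWeight hi) (d.isParabolicWeight hj) l
      hk.symm
  · intro i hi k hk
    show m ≤ r k
    refine not_lt.1 fun h => ?_
    obtain ⟨l, rfl⟩ := d.rank_lt k h
    rw [d.weight_f] at hk
    exact d.fp.nsmul_ne_neg_delta d.pos d.neg_mem (d.isParabolicWeight hi) p l hk.symm

theorem RootData.mem_closure (d : RootData p ε 𝒱 𝔤 Φ P Φ₁ δ bs deg ω r ei fi) {i : I}
    (h : m + 1 ≤ r i) : ω i ∈ AddSubmonoid.closure P := by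
  have := d.rank_le i
  obtain h1 | h1 : r i = m + 1 ∨ r i = m + 2 := by omega
  · rw [d.rank_torus i h1]; exact AddSubmonoid.zero_mem _
  · exact AddSubmonoid.subset_closure (d.rank_pos i h1)

theorem RootData.rank_of_mem_closure (d : RootData p ε 𝒱 𝔤 Φ P Φ₁ δ bs deg ω r ei fi) {i : I}
    (h : ω i ∈ AddSubmonoid.closure P) : m + 1 ≤ r i := by
  by_cases h0 : ω i = 0
  · exact (d.rank_eq_of_zero h0).ge
  · rcases d.pos.mem_or_neg_mem _ (d.mem_roots i h0) with h1 | h1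
    · rw [d.rank_eq_of_pos h1]; omega
    · exact absurd (neg_add_cancel _) (d.pos.add_ne_zero h1 h)

theorem RootData.borel (d : RootData p ε 𝒱 𝔤 Φ P Φ₁ δ bs deg ω r ei fi)
    {S' : Submodule F (Module.End F V)}
    (hS' : S' = Submodule.span F ((fun i => (bs i : Module.End F V)) '' {i | m + 1 ≤ r i})) :
    IsHomFamily p ε 𝒱 S' (fun i : {i | m + 1 ≤ r i} => (bs i : Module.End F V))
      (fun i : {i | m + 1 ≤ r i} => deg i) := by
  refine d.subfamily ?_ ?_ hS'
  · intro i hi j hj k hk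
    exact d.rank_of_mem_closure (hk ▸ AddSubmonoid.add_mem _ (d.mem_closure hi) (d.mem_closure hj))
  · intro i hi k hk
    exact d.rank_of_mem_closure (hk ▸ AddSubmonoid.nsmul_mem _ (d.mem_closure hi) _)

theorem RootData.torus (d : RootData p ε 𝒱 𝔤 Φ P Φ₁ δ bs deg ω r ei fi)
    {S' : Submodule F (Module.End F V)}
    (hS' : S' = Submodule.span F ((fun i => (bs i : Module.End F V)) '' {i | ω i = 0})) :
    IsHomFamily p ε 𝒱 S' (fun i : {i | ω i = 0} => (bs i : Module.End F V))
      (fun i : {i | ω i = 0} => deg i) := by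
  refine d.subfamily ?_ ?_ hS'
  · intro i hi j hj k hk
    have hi' : ω i = 0 := hi
    have hj' : ω j = 0 := hj
    rw [hi', hj', add_zero] at hk
    exact hk
  · intro i hi k hk
    have hi' : ω i = 0 := hi
    rw [hi', smul_zero] at hk
    exact hk

end RootData

/-! ### Ordered monomials in the `f_j`. -/

section WordSpan

variable {F A X I : Type*} [Field F] [Ring A] [Algebra F A] [AddCommMonoid X] {β : I → A}
  {J : Set I} {ω : I → X}

theorem mul_mem_wordSpan {n n' : ℕ} {μ μ' : X} {x y : A} (hx : x ∈ wordSpan F β J ω n μ)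
    (hy : y ∈ wordSpan F β J ω n' μ') : x * y ∈ wordSpan F β J ω (n + n') (μ + μ') := by
  have := Submodule.mul_mem_mul hx hy
  unfold wordSpan at this
  rw [Submodule.span_mul_span] at this
  refine Submodule.span_mono ?_ this
  rintro _ ⟨_, ⟨u, h1, h2, h3, rfl⟩, _, ⟨w, h4, h5, h6, rfl⟩, rfl⟩
  refine ⟨u ++ w, ?_, by simp; omega, by simp [h3, h6], (wd_append _ _ _).symm⟩
  intro i hi
  rcases List.mem_append.1 hi with hi | hi
  · exact h1 i hi
  · exact h4 i hi

theorem wd_mem_wordSpan {w : List I} (hw : ∀ i ∈ w, i ∈ J) :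
    wd β w ∈ wordSpan F β J ω w.length (w.map ω).sum :=
  Submodule.subset_span ⟨w, hw, le_rfl, rfl, rfl⟩

/-- If `y` normalizes the span of the letters in `J`, then it commutes with words in these letters up
to a scalar and words in these letters. -/
theorem exists_commute_wd {y : A} {μ : X}
    (hJ : ∀ j ∈ J, ∃ c : F, c ≠ 0 ∧ y * β j - c • (β j * y) ∈ wordSpan F β J ω 1 (μ + ω j))
    (w : List I) (hw : ∀ i ∈ w, i ∈ J) :
    ∃ c : F, c ≠ 0 ∧ y * wd β w - c • (wd β w * y) ∈
      wordSpan F β J ω w.length (μ + (w.map ω).sum) := by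
  induction w with
  | nil => exact ⟨1, one_ne_zero, by simp⟩
  | cons j w ih =>
    obtain ⟨c', hc', h'⟩ := ih fun i hi => hw i (List.mem_cons_of_mem _ hi)
    have hj : j ∈ J := hw j List.mem_cons_self
    obtain ⟨c, hc, h⟩ := hJ j hj
    refine ⟨c * c', mul_ne_zero hc hc', ?_⟩
    have h1 := mul_mem_wordSpan h (wd_mem_wordSpan (F := F) (β := β) (ω := ω)
      (fun i hi => hw i (List.mem_cons_of_mem _ hi)))
    have h2 := mul_mem_wordSpan (wd_mem_wordSpan (F := F) (β := β) (ω := ω) (w := [j])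
      (by simpa using hj)) h'
    have e1 : 1 + w.length = (j :: w).length := by simp; omega
    have e2 : μ + ω j + (w.map ω).sum = μ + ((j :: w).map ω).sum := by simp [add_assoc]
    have e3 : ([j].map ω).sum + (μ + (w.map ω).sum) = μ + ((j :: w).map ω).sum := by
      simp; abel
    have e4 : [j].length + w.length = (j :: w).length := by simp; omega
    rw [e1, e2] at h1
    rw [e3, e4] at h2
    have := Submodule.add_mem _ h1 (Submodule.smul_mem _ c h2)
    convert this using 1
    simp only [wd_cons, wd_nil, mul_one, sub_mul, mul_sub, smul_mul_assoc, mul_smul_comm, smul_sub,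
      mul_assoc, smul_smul]
    abel

end WordSpan

section FWords

variable {I : Type*} {m : ℕ}

/-- The word `f_1^{k_1} ⋯ f_m^{k_m}`. -/
def fword (fi : Fin m → I) (k : Fin m → ℕ) : List I :=
  (List.finRange m).flatMap fun j => List.replicate (k j) (fi j)

theorem mem_fword {fi : Fin m → I} {k : Fin m → ℕ} {i : I} :
    i ∈ fword fi k ↔ ∃ j, k j ≠ 0 ∧ i = fi j := by
  simp [fword, List.mem_flatMap, List.mem_replicate]

theorem sum_map_fword {X : Type*} [AddCommMonoid X] (fi : Fin m → I) (k : Fin m → ℕ) (ω : I → X) :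
    ((fword fi k).map ω).sum = ∑ j, k j • ω (fi j) := by
  rw [fword, List.map_flatMap, List.flatMap_def, List.sum_flatten, List.map_map, Fin.sum_univ_def]
  simp [Function.comp_def]

theorem fword_zero (fi : Fin m → I) : fword fi 0 = [] := by
  simp [fword]

theorem wd_fword {A : Type*} [Ring A] (fi : Fin m → I) (k : Fin m → ℕ) (β : I → A) :
    wd β (fword fi k) = (List.ofFn fun j => β (fi j) ^ k j).prod := by
  rw [wd, fword, List.map_flatMap, List.flatMap_def, List.prod_flatten, List.map_map,
    List.ofFn_eq_map]
  simp [Function.comp_def]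

theorem count_fword [DecidableEq I] {fi : Fin m → I} (hfi : Function.Injective fi)
    (k : Fin m → ℕ) (j : Fin m) : (fword fi k).count (fi j) = k j := by
  rw [fword, List.count_flatMap]
  simp only [Function.comp_def, List.count_replicate, beq_iff_eq, hfi.eq_iff]
  rw [← Fin.sum_univ_def]
  simp

theorem fword_injective {fi : Fin m → I} (hfi : Function.Injective fi) :
    Function.Injective (fword fi) := by
  classical
  intro k k' h
  funext j
  rw [← count_fword hfi k j, h, count_fword hfi]

end FWords

section RootData

variable {Γ F V I X : Type*} [AddCommGroup Γ] [Field F] [AddCommGroup V] [Module F V]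
  [LinearOrder I] [AddCommGroup X]
  {p : ℕ} {ε : Bicharacter Γ F} {𝒱 : Γ → Submodule F V}
  {𝔤 : Submodule F (Module.End F V)} {Φ P Φ₁ : Set X} {m : ℕ} {δ : Fin m → X}
  {bs : Module.Basis I F 𝔤} {deg : I → Γ} {ω : I → X} {r : I → ℕ} {ei fi : Fin m → I}

open Classical in
/-- The number `p̄` for a basis element. -/
noncomputable def order (p : ℕ) (ε : Bicharacter Γ F) (deg : I → Γ) (i : I) : ℕ :=
  if ε (deg i) (deg i) = 1 then p else 2

theorem RootData.strictMono (d : RootData p ε 𝒱 𝔤 Φ P Φ₁ δ bs deg ω r ei fi) : StrictMono fi := by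
  intro i j h
  refine d.lt_of_rank _ _ ?_
  rw [d.rank_f, d.rank_f]
  exact h

theorem RootData.sum_fword (d : RootData p ε 𝒱 𝔤 Φ P Φ₁ δ bs deg ω r ei fi) (k : Fin m → ℕ) :
    ((fword fi k).map ω).sum = -∑ j, k j • δ j := by
  rw [sum_map_fword, ← Finset.sum_neg_distrib]
  simp [d.weight_f]

theorem RootData.sorted_fword (d : RootData p ε 𝒱 𝔤 Φ P Φ₁ δ bs deg ω r ei fi) (k : Fin m → ℕ) :
    (fword fi k).Pairwise (· ≤ ·) := by
  rw [fword, List.pairwise_flatMap]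
  refine ⟨fun j _ => List.pairwise_replicate.2 (.inr le_rfl), ?_⟩
  refine (List.pairwise_lt_finRange m).imp fun {i j} h x hx y hy => ?_
  rw [List.eq_of_mem_replicate hx, List.eq_of_mem_replicate hy]
  exact (d.strictMono h).le

theorem RootData.normal_fword (d : RootData p ε 𝒱 𝔤 Φ P Φ₁ δ bs deg ω r ei fi) (hp : 0 < p)
    {k : Fin m → ℕ} (hk : ∀ j, k j < order p ε deg (fi j)) :
    Normal (fun i => ε (deg i) (deg i) ≠ 1) (fun i => ε (deg i) (deg i) = 1) p (fword fi k) := by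
  rw [normal_iff]
  have hc : ∀ i, (∀ j, i ≠ fi j) → (fword fi k).count i = 0 := by
    intro i hi
    refine List.count_eq_zero.2 fun h => ?_
    obtain ⟨j, -, hj⟩ := mem_fword.1 h
    exact hi j hj
  refine ⟨d.sorted_fword k, fun i hi => ?_, fun i hi => ?_⟩
  · by_cases h : ∃ j, i = fi j
    · obtain ⟨j, rfl⟩ := h
      rw [count_fword d.strictMono.injective]
      simpa [order, hi] using hk j
    · push Not at h; rw [hc i h]; norm_num
  · by_cases h : ∃ j, i = fi j
    · obtain ⟨j, rfl⟩ := h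
      rw [count_fword d.strictMono.injective]
      simpa [order, hi] using hk j
    · push Not at h; rw [hc i h]; exact hp

/-- A normal word is sorted, hence determined by its multiplicities, and these are bounded by `p̄`.
-/
theorem RootData.eq_fword (d : RootData p ε 𝒱 𝔤 Φ P Φ₁ δ bs deg ω r ei fi) {w : List I}
    (hw : Normal (fun i => ε (deg i) (deg i) ≠ 1) (fun i => ε (deg i) (deg i) = 1) p w)
    {n : ℕ} (hn : n ≤ m) (hwn : ∀ i ∈ w, r i < n) :
    ∃ k : Fin m → ℕ, (∀ j, k j < order p ε deg (fi j)) ∧ (∀ j : Fin m, n ≤ (j : ℕ) → k j = 0) ∧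
      w = fword fi k := by
  refine ⟨fun j => w.count (fi j), fun j => ?_, fun j hj => ?_, ?_⟩
  · rw [normal_iff] at hw
    rw [order]
    split_ifs with h
    · exact hw.2.2 _ h
    · exact hw.2.1 _ h
  · refine List.count_eq_zero.2 fun h => ?_
    have := hwn _ h
    rw [d.rank_f] at this
    omega
  · refine List.Perm.eq_of_pairwise (le := (· ≤ ·)) (fun a b _ _ h h' => le_antisymm h h')
      hw.sorted (d.sorted_fword _) (List.perm_iff_count.2 fun i => ?_)
    by_cases h : ∃ j, i = fi j
    · obtain ⟨j, rfl⟩ := h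
      rw [count_fword d.strictMono.injective]
    · rw [List.count_eq_zero.2 fun hi => h ?_, List.count_eq_zero.2 fun hi => h ?_]
      · obtain ⟨j, -, hj⟩ := mem_fword.1 hi
        exact ⟨j, hj⟩
      · exact d.rank_lt i (lt_of_lt_of_le (hwn i hi) hn)

variable {χ : 𝔤 →ₗ[F] F}

/-- The span of the `f_1^{k_1} ⋯ f_n^{k_n}` of weight `μ` with `k_j < p̄`. -/
def fSpan (p : ℕ) (ε : Bicharacter Γ F) (𝒱 : Γ → Submodule F V) (χ : 𝔤 →ₗ[F] F)
    (bs : Module.Basis I F 𝔤) (deg : I → Γ) (δ : Fin m → X) (fi : Fin m → I)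
    (n : ℕ) (μ : X) : Submodule F (RedEnv p ε 𝒱 χ 𝔤) :=
  Submodule.span F {x | ∃ k : Fin m → ℕ, (∀ j, k j < order p ε deg (fi j)) ∧
    (∀ j : Fin m, n ≤ (j : ℕ) → k j = 0) ∧ μ = -∑ j, k j • δ j ∧
    x = wd (fun i => RedEnv.ι p ε 𝒱 χ 𝔤 (bs i)) (fword fi k)}

/-- The vanishing statements below rest on this: no admissible exponent has the given weight. -/
theorem fSpan_eq_bot {n : ℕ} {μ : X} (h : ∀ k : Fin m → ℕ, (∀ j, k j < order p ε deg (fi j)) →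
    (∀ j : Fin m, n ≤ (j : ℕ) → k j = 0) → μ ≠ -∑ j, k j • δ j) :
    fSpan p ε 𝒱 χ bs deg δ fi n μ = ⊥ := by
  rw [eq_bot_iff, fSpan, Submodule.span_le]
  rintro _ ⟨k, h1, h2, h3, rfl⟩
  exact absurd h3 (h k h1 h2)

theorem RootData.rank_of_weight (d : RootData p ε 𝒱 𝔤 Φ P Φ₁ δ bs deg ω r ei fi) {k : I}
    {l : Fin m} (h : ω k = -δ l) : k = fi l :=
  d.inj _ _ (by rw [h, d.weight_f]) (by
    rw [h]; exact neg_ne_zero.2 (d.fp.delta_ne_zero d.pos l))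

theorem RootData.two_ne_zero [CharP F p] (hp : 3 < p) : (2 : F) ≠ 0 := by
  have := CharP.cast_eq_zero_iff F p 2
  intro h0
  have := Nat.le_of_dvd (by norm_num) (this.1 (by exact_mod_cast h0)); omega

/-- The letters `f_1, …, f_n` are closed under brackets by additivity of the triple. Their `p`-th
powers in the even case are zero, because `p δ_j` is not a root and `χ` vanishes on `f_j`. -/
theorem RootData.wd_mem_fSpan [CharP F p]
    (d : RootData p ε 𝒱 𝔤 Φ P Φ₁ δ bs deg ω r ei fi) (hp : 3 < p)
    (hχ : ∀ j, χ (bs (fi j)) = 0) {n : ℕ} (hn : n ≤ m) {w : List I} (hw : ∀ i ∈ w, r i < n) :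
    wd (fun i => RedEnv.ι p ε 𝒱 χ 𝔤 (bs i)) w ∈
      fSpan p ε 𝒱 χ bs deg δ fi n (w.map ω).sum := by
  have h := d.family.wd_mem_normalSpan (RootData.two_ne_zero hp) (by omega)
    (RedEnv.ι p ε 𝒱 χ 𝔤)
    (fun i j z hz => RedEnv.ι_mul_ι (d.family.mem_homEnd i) (d.family.mem_homEnd j) hz)
    {i | r i < n} ω (fun i hi j hj => by
      refine Submodule.span_mono (Set.image_mono ?_) (d.bracket_mem i j)
      intro k hk
      refine ⟨?_, hk⟩
      have hk' : ω k = ω i + ω j := hk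
      obtain ⟨a, rfl⟩ := d.rank_lt i (lt_of_lt_of_le hi hn)
      obtain ⟨b, rfl⟩ := d.rank_lt j (lt_of_lt_of_le hj hn)
      have hi' : r (fi a) < n := hi
      have hj' : r (fi b) < n := hj
      rw [d.rank_f] at hi' hj'
      rw [d.weight_f, d.weight_f] at hk'
      have h0 : ω k ≠ 0 := by
        rw [hk', ← neg_add, neg_ne_zero]
        exact d.pos.add_ne_zero (d.fp.mem_pos a) (AddSubmonoid.subset_closure (d.fp.mem_pos b))
      obtain ⟨l, hl, h1⟩ := d.fp.neg_delta_add d.pos (hk' ▸ d.mem_roots k h0)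
      rw [d.rank_of_weight (hk'.trans h1)]
      show r (fi l) < n
      rw [d.rank_f]
      have : (l : ℕ) < max (a : ℕ) b := by
        have := Fin.lt_def.1 hl
        rcases max_choice a b with h | h <;> rw [h] at this
        · exact lt_max_of_lt_left this
        · exact lt_max_of_lt_right this
      exact this.trans (max_lt hi' hj'))
    (fun i => ε (deg i) (deg i) = 1) (fun i hi ho => by
      obtain ⟨a, rfl⟩ := d.rank_lt i (lt_of_lt_of_le hi hn)
      refine ⟨⟨_, d.family.pow_mem _ ho⟩, χ (bs (fi a)) ^ p, RedEnv.ι_pow ho (d.family.mem_homEnd _) rfl rfl,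
        Submodule.span_mono (Set.image_mono ?_) (d.pow_mem (fi a) ho), ?_⟩
      · intro k hk
        exfalso
        have hk' : ω k = p • ω (fi a) := hk
        rw [d.weight_f, smul_neg] at hk'
        have h0 : ω k ≠ 0 := by
          rw [hk', neg_ne_zero]
          exact d.fp.nsmul_delta_ne_zero d.pos a (by omega)
        have h1 := d.neg_mem _ (d.mem_roots k h0)
        rw [hk', neg_neg] at h1
        exact d.fp.nsmul_notMem d.pos a (by omega) h1
      · intro hc
        exact absurd (hχ a) (fun h => hc (by rw [h, zero_pow (by omega)])))
    w hw
  unfold normalSpan at h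
  refine Submodule.span_mono ?_ h
  rintro _ ⟨w', h1, h2, h3, rfl⟩
  obtain ⟨k, h4, h5, rfl⟩ := d.eq_fword h1 hn h2
  exact ⟨k, h4, h5, by rw [← h3, d.sum_fword], rfl⟩

/-- Commuting a basis element past a word in `f_1, …, f_n`. -/
theorem RootData.exists_commute_fword [CharP F p]
    (d : RootData p ε 𝒱 𝔤 Φ P Φ₁ δ bs deg ω r ei fi) (hp : 3 < p)
    (hχ : ∀ j, χ (bs (fi j)) = 0) {n : ℕ} (hn : n ≤ m) {i : I}
    (hi : ∀ j : Fin m, (j : ℕ) < n → ∀ k, ω k = ω i + -δ j → r k < n)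
    {w : List I} (hw : ∀ i ∈ w, r i < n) :
    ∃ c : F, c ≠ 0 ∧ RedEnv.ι p ε 𝒱 χ 𝔤 (bs i) * wd (fun i => RedEnv.ι p ε 𝒱 χ 𝔤 (bs i)) w -
      c • (wd (fun i => RedEnv.ι p ε 𝒱 χ 𝔤 (bs i)) w * RedEnv.ι p ε 𝒱 χ 𝔤 (bs i)) ∈
        fSpan p ε 𝒱 χ bs deg δ fi n (ω i + (w.map ω).sum) := by
  obtain ⟨c, hc, h⟩ := exists_commute_wd (F := F) (β := fun i => RedEnv.ι p ε 𝒱 χ 𝔤 (bs i))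
    (J := {i | r i < n}) (ω := ω) (y := RedEnv.ι p ε 𝒱 χ 𝔤 (bs i)) (μ := ω i) (fun j hj => by
      obtain ⟨b, rfl⟩ := d.rank_lt j (lt_of_lt_of_le hj hn)
      have hj' : r (fi b) < n := hj
      rw [d.rank_f] at hj'
      refine ⟨ε (deg i) (deg (fi b)), Units.ne_zero _, ?_⟩
      rw [RedEnv.ι_mul_ι (d.family.mem_homEnd i) (d.family.mem_homEnd (fi b))
        (z := d.family.br i (fi b)) rfl, add_sub_cancel_left]
      refine d.family.map_mem_wordSpan _ (Submodule.span_mono (Set.image_mono ?_)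
        (d.bracket_mem i (fi b)))
      intro k hk
      exact ⟨hi b hj' k (by rw [← d.weight_f]; exact hk), hk⟩) w hw
  refine ⟨c, hc, ?_⟩
  have hle : wordSpan F (fun i => RedEnv.ι p ε 𝒱 χ 𝔤 (bs i)) {i | r i < n} ω w.length
      (ω i + (w.map ω).sum) ≤ fSpan p ε 𝒱 χ bs deg δ fi n (ω i + (w.map ω).sum) := by
    refine Submodule.span_le.2 ?_
    rintro _ ⟨w', h1, -, h3, rfl⟩
    rw [← h3]
    exact d.wd_mem_fSpan hp hχ hn h1
  exact hle h

end RootData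

theorem smul_eq_sum_smul_map {F A W K : Type*} [Field F] [Ring A] [Algebra F A] [AddCommGroup W]
    [Module F W] [Module A W] [IsScalarTower F A W] (s : Finset K) (a : K → A) (f : K → W →ₗ[F] W)
    (c : F) {z : W} (hz : z = ∑ k ∈ s, a k • f k z) : c • z = ∑ k ∈ s, a k • f k (c • z) := by
  conv_lhs => rw [hz]
  rw [Finset.smul_sum]
  refine Finset.sum_congr rfl fun k _ => ?_
  rw [map_smul, smul_comm]

/-! ### Induced modules. -/

section Induced

variable {F A B M : Type*} [Field F] [Ring A] [Algebra F A] [Ring B] [Algebra F B] (φ : B →ₐ[F] A)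
  [AddCommGroup M] [Module F M] [Module B M]

/-- The map `m ↦ 1 ⊗ m`. -/
noncomputable def Induced.of : M →ₗ[F] Induced φ M :=
  ((balancing φ M).mkQ.restrictScalars F) ∘ₗ TensorProduct.mk F A M 1

theorem Induced.mk_tmul (a : A) (m : M) :
    (Submodule.Quotient.mk (a ⊗ₜ[F] m) : Induced φ M) = a • Induced.of φ m := by
  have : a ⊗ₜ[F] m = a • ((1 : A) ⊗ₜ[F] m) := by
    rw [TensorProduct.smul_tmul', smul_eq_mul, mul_one]
  rw [this, Submodule.Quotient.mk_smul]
  rfl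

theorem Induced.smul_of (b : B) (m : M) : φ b • Induced.of φ m = Induced.of φ (b • m) := by
  rw [← Induced.mk_tmul]
  show Submodule.Quotient.mk _ = Submodule.Quotient.mk _
  rw [Submodule.Quotient.eq]
  refine Submodule.subset_span ⟨1, b, m, ?_⟩
  rw [one_mul]
  rfl

theorem Induced.span_smul_of :
    Submodule.span F {w : Induced φ M | ∃ (a : A) (m : M), w = a • Induced.of φ m} = ⊤ := by
  rw [eq_top_iff]
  rintro w -
  obtain ⟨w, rfl⟩ := Submodule.Quotient.mk_surjective _ w
  induction w using TensorProduct.induction_on with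
  | zero => exact Submodule.zero_mem _
  | tmul a m => exact Submodule.subset_span ⟨a, m, Induced.mk_tmul φ a m⟩
  | add x y hx hy => exact Submodule.add_mem _ hx hy

/-- A map `A → B` of right `B`-modules induces `A ⊗_B M → B ⊗_B M = M`. -/
theorem Induced.exists_lift [IsScalarTower F B M] (κ : A →ₗ[F] B)
    (hκ : ∀ a b, κ (a * φ b) = κ a * b) :
    ∃ K : Induced φ M →ₗ[F] M, ∀ a m, K (a • Induced.of φ m) = κ a • m := by
  let L : A ⊗[F] M →ₗ[F] M := TensorProduct.lift
    (LinearMap.mk₂ F (fun a m => κ a • m) (fun a a' m => by rw [map_add, add_smul])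
      (fun c a m => by rw [map_smul, smul_assoc]) (fun a m m' => smul_add _ _ _)
      (fun c a m => by
        rw [← algebraMap_smul B c m, ← algebraMap_smul B c (κ a • m), ← mul_smul, ← mul_smul,
          Algebra.commutes]))
  have hL : ∀ a m, L (a ⊗ₜ m) = κ a • m := fun a m => rfl
  -- The balancing relations are generated over `A`, while `L` is only linear over `F`; quantifying
  -- over `a'` makes the claim stable under `A`.
  have h0 : ∀ w ∈ balancing φ M, ∀ a' : A, L (a' • w) = 0 := by
    intro w hw
    induction hw using Submodule.span_induction with
    | mem w hw =>
      obtain ⟨a, b, m, rfl⟩ := hw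
      intro a'
      rw [smul_sub, TensorProduct.smul_tmul', TensorProduct.smul_tmul', map_sub, hL, hL,
        smul_eq_mul, smul_eq_mul, ← mul_assoc, hκ, mul_smul, sub_self]
    | zero => simp
    | add x y _ _ hx hy => intro a'; rw [smul_add, map_add, hx, hy, add_zero]
    | smul a x _ hx => intro a'; rw [← mul_smul]; exact hx _
  refine ⟨(((balancing φ M).restrictScalars F).liftQ L (fun w hw => by
    simpa using h0 w hw 1)) ∘ₗ
      (Submodule.Quotient.restrictScalarsEquiv F (balancing φ M)).symm.toLinearMap, fun a m => ?_⟩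
  rw [← Induced.mk_tmul]
  exact hL a m

/-- The properties of the induced module `W = A ⊗_B M` with the map `τ m = 1 ⊗ m`. -/
structure IsInduced {F A B M W : Type*} [Field F] [Ring A] [Algebra F A] [Ring B] [Algebra F B]
    (φ : B →ₐ[F] A) [AddCommGroup M] [Module F M] [Module B M] [AddCommGroup W] [Module F W]
    [Module A W] (τ : M →ₗ[F] W) : Prop where
  smul_of : ∀ b m, φ b • τ m = τ (b • m)
  span_eq : Submodule.span F {w : W | ∃ (a : A) (m : M), w = a • τ m} = ⊤
  exists_lift : ∀ κ : A →ₗ[F] B, (∀ a b, κ (a * φ b) = κ a * b) →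
    ∃ K : W →ₗ[F] M, ∀ a m, K (a • τ m) = κ a • m

/-- The grading of an induced module, as in `Induced.grade`. -/
def inducedGrade {Γ F A M W : Type*} [AddCommGroup Γ] [Field F] [Ring A] [Algebra F A]
    [AddCommGroup M] [Module F M] [AddCommGroup W] [Module F W] [Module A W] (τ : M →ₗ[F] W)
    (𝒜 : Γ → Submodule F A) (ℳ : Γ → Submodule F M) (γ : Γ) : Submodule F W :=
  Submodule.span F {w | ∃ α β, α + β = γ ∧ ∃ a ∈ 𝒜 α, ∃ m ∈ ℳ β, w = a • τ m}

theorem Induced.grade_eq {Γ : Type*} [AddCommGroup Γ] (𝒜 : Γ → Submodule F A)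
    (ℳ : Γ → Submodule F M) :
    Induced.grade φ 𝒜 ℳ = inducedGrade (Induced.of φ : M →ₗ[F] Induced φ M) 𝒜 ℳ := by
  funext γ
  unfold Induced.grade inducedGrade
  simp only [Induced.mk_tmul]

theorem Induced.isInduced [IsScalarTower F B M] : IsInduced φ (Induced.of φ : M →ₗ[F] Induced φ M) where
  smul_of := Induced.smul_of φ
  span_eq := Induced.span_smul_of φ
  exists_lift := Induced.exists_lift φ

end Induced

/-! ### Coordinates and degrees in the induced module. -/

section Coordinates

variable {Γ F V I X : Type*} [AddCommGroup Γ] [Field F] [AddCommGroup V] [Module F V]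
  [LinearOrder I] [AddCommGroup X]
  {p : ℕ} {ε : Bicharacter Γ F} {𝒱 : Γ → Submodule F V}
  {𝔤 : Submodule F (Module.End F V)} {Φ P Φ₁ : Set X} {m : ℕ} {δ : Fin m → X}
  {bs : Module.Basis I F 𝔤} {deg : I → Γ} {ω : I → X} {r : I → ℕ} {ei fi : Fin m → I}
  {χ : 𝔤 →ₗ[F] F} {S' : Submodule F (Module.End F V)}

theorem RootData.fword_notMem (d : RootData p ε 𝒱 𝔤 Φ P Φ₁ δ bs deg ω r ei fi) (k : Fin m → ℕ) :
    ∀ i ∈ fword fi k, i ∉ {i | m ≤ r i} := by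
  intro i hi h
  obtain ⟨j, -, rfl⟩ := mem_fword.1 hi
  have : m ≤ r (fi j) := h
  rw [d.rank_f] at this
  omega

/-- Freeness over `u_χ(P₀)` decomposes the induced module as the direct sum of the `f^k ⊗ M`, and `κ
k` reads off one summand. -/
theorem RootData.exists_coordinates [CharP F p] [Fact p.Prime]
    (d : RootData p ε 𝒱 𝔤 Φ P Φ₁ δ bs deg ω r ei fi) (hp : 3 < p)
    (hχ : ∀ i, χ (bs i) ≠ 0 → deg i = 0) (hle : S' ≤ 𝔤)
    (hS' : S' = Submodule.span F ((fun i => (bs i : Module.End F V)) '' {i | m ≤ r i}))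
    (M : Type*) [AddCommGroup M] [Module F M] [Module (RedEnv p ε 𝒱 χ S') M]
    [IsScalarTower F (RedEnv p ε 𝒱 χ S') M] {W : Type*} [AddCommGroup W] [Module F W]
    [Module (RedEnv p ε 𝒱 χ 𝔤) W] [IsScalarTower F (RedEnv p ε 𝒱 χ 𝔤) W] {τ : M →ₗ[F] W}
    (hτ : IsInduced (RedEnv.map p ε 𝒱 χ hle) τ) :
    ∃ κ : (Fin m → ℕ) → W →ₗ[F] M,
      (∀ k k' v, (∀ j, k' j < order p ε deg (fi j)) →
        κ k (wd (fun i => RedEnv.ι p ε 𝒱 χ 𝔤 (bs i)) (fword fi k') • τ v) =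
          if k = k' then v else 0) ∧
      (∀ z, z = ∑ k ∈ Fintype.piFinset fun j => Finset.range (order p ε deg (fi j)),
        wd (fun i => RedEnv.ι p ε 𝒱 χ 𝔤 (bs i)) (fword fi k) • τ (κ k z)) := by
  classical
  have hb' := d.parabolic hS'
  obtain ⟨κ₀, hκ₀⟩ := d.family.exists_coeff hp d.grading χ hχ (d.isUpperSet m) hle hb'
  have hspan := d.family.span_wd_mul_map hp χ (d.isUpperSet m) hle hb'
  -- Right linearity of the coefficient maps, which lets them descend to the induced module.
  have hmul : ∀ u a b, κ₀ u (a * RedEnv.map p ε 𝒱 χ hle b) = κ₀ u a * b := by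
    intro u a b
    have ha : a ∈ Submodule.span F _ := hspan.symm ▸ Submodule.mem_top
    induction ha using Submodule.span_induction with
    | mem a ha =>
      obtain ⟨u', s, h1, h2, rfl⟩ := ha
      rw [mul_assoc, ← map_mul, hκ₀ _ _ h1 h2, hκ₀ _ _ h1 h2]
      split_ifs <;> simp
    | zero => simp
    | add x y _ _ hx hy => rw [add_mul, map_add, map_add, hx, hy, add_mul]
    | smul c x _ hx => rw [smul_mul_assoc, map_smul, map_smul, hx, smul_mul_assoc]
  choose κ hκ using fun k => hτ.exists_lift (κ₀ (fword fi k)) (hmul _)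
  have h1 : ∀ k k' v, (∀ j, k' j < order p ε deg (fi j)) →
        κ k (wd (fun i => RedEnv.ι p ε 𝒱 χ 𝔤 (bs i)) (fword fi k') • τ v) =
          if k = k' then v else 0 := by
    intro k k' v hk'
    have h2 := hκ₀ (fword fi k) (fword fi k') (d.normal_fword (by omega) hk') (d.fword_notMem k') 1
    rw [map_one, mul_one] at h2
    rw [hκ, h2]
    by_cases h : k = k'
    · rw [if_pos h, if_pos (by rw [h]), one_smul]
    · rw [if_neg h, if_neg (fun h' => h (fword_injective d.strictMono.injective h')), zero_smul]
  refine ⟨κ, h1, fun z => ?_⟩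
  have hz : z ∈ Submodule.span F {w : W |
      ∃ (a : RedEnv p ε 𝒱 χ 𝔤) (m : M), w = a • τ m} := by
    rw [hτ.span_eq]; trivial
  induction hz using Submodule.span_induction with
  | mem z hz =>
    obtain ⟨a, v, rfl⟩ := hz
    have ha : a ∈ Submodule.span F _ := hspan.symm ▸ Submodule.mem_top
    induction ha using Submodule.span_induction with
    | mem a ha =>
      obtain ⟨u, s, h2, h3, rfl⟩ := ha
      obtain ⟨k, hk, -, rfl⟩ := d.eq_fword h2 le_rfl (fun i hi => not_le.1 (h3 i hi))
      rw [mul_smul, hτ.smul_of]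
      simp only [h1 _ k _ hk]
      rw [Finset.sum_eq_single k]
      · rw [if_pos rfl]
      · intro k' _ hne
        rw [if_neg hne, map_zero, smul_zero]
      · intro hk'
        exact absurd (Fintype.mem_piFinset.2 fun j => Finset.mem_range.2 (hk j)) hk'
    | zero => simp
    | add x y _ _ hx hy =>
      rw [add_smul]
      simp only [map_add, smul_add, Finset.sum_add_distrib]
      rw [← hx, ← hy]
    | smul c x _ hx =>
      rw [smul_assoc]
      exact smul_eq_sum_smul_map _ _ (fun k => τ ∘ₗ κ k) c hx
  | zero => simp
  | add x y _ _ hx hy =>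
    simp only [map_add, smul_add, Finset.sum_add_distrib]
    rw [← hx, ← hy]
  | smul c x _ hx =>
    exact smul_eq_sum_smul_map _ _ (fun k => τ ∘ₗ κ k) c hx

theorem IsHomFamily.wd_mem_piece {b : I → Module.End F V}
    (hb : IsHomFamily p ε 𝒱 𝔤 b deg) {Y : Type*} [AddCommGroup Y] {𝒢 : Y → Submodule F (Module.End F V)}
    {ω : I → Y} (hω : ∀ i, b i ∈ 𝒢 (ω i)) (w : List I) :
    wd (fun i => RedEnv.ι p ε 𝒱 χ 𝔤 ⟨b i, hb.mem i⟩) w ∈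
      RedEnv.piece p ε 𝒱 χ 𝔤 𝒢 (w.map ω).sum := by
  refine Submodule.subset_span ⟨w.map fun i => (ω i, ⟨b i, hb.mem i⟩), ?_, ?_, ?_⟩
  · intro q hq
    obtain ⟨i, -, rfl⟩ := List.mem_map.1 hq
    exact hω i
  · rw [List.map_map]; rfl
  · rw [List.map_map]; rfl

/-- The homogeneous components of `u_χ(𝔤)` are spanned by words. -/
theorem IsHomFamily.piece_le {b : I → Module.End F V}
    (hb : IsHomFamily p ε 𝒱 𝔤 b deg) (h𝒱 : IsGrading 𝒱) (α : Γ) :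
    RedEnv.piece p ε 𝒱 χ 𝔤 (homEnd 𝒱) α ≤ Submodule.span F {x | ∃ w : List I,
      (w.map deg).sum = α ∧ x = wd (fun i => RedEnv.ι p ε 𝒱 χ 𝔤 ⟨b i, hb.mem i⟩) w} := by
  refine Submodule.span_le.2 ?_
  rintro _ ⟨l, hl, rfl, rfl⟩
  induction l with
  | nil => exact Submodule.subset_span ⟨[], rfl, rfl⟩
  | cons q l ih =>
    have h1 := ih fun q' hq' => hl q' (List.mem_cons_of_mem _ hq')
    have h2 := hb.mem_span h𝒱 q.2.2 (hl q List.mem_cons_self)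
    have h3 := hb.map_mem_wordSpan (RedEnv.ι p ε 𝒱 χ 𝔤) (J := Set.univ) (ω := deg) (z := q.2)
      (μ := q.1) (by simpa using h2)
    have h4 := Submodule.mul_mem_mul h3 h1
    unfold wordSpan at h4
    rw [Submodule.span_mul_span] at h4
    refine Submodule.span_mono ?_ h4
    rintro _ ⟨_, ⟨u, -, -, h5, rfl⟩, _, ⟨w, h6, rfl⟩, rfl⟩
    exact ⟨u ++ w, by simp [h5, h6], (wd_append _ _ _).symm⟩

theorem wd_smul_mem {b : I → Module.End F V} (hb : IsHomFamily p ε 𝒱 S' b deg)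
    {M : Type*} [AddCommGroup M] [Module F M] [Module (RedEnv p ε 𝒱 χ S') M]
    {ℳ : Γ → Submodule F M} (hM : IsGradedModule p ε 𝒱 χ S' ℳ) (w : List I) {β : Γ} {v : M}
    (hv : v ∈ ℳ β) :
    wd (fun i => RedEnv.ι p ε 𝒱 χ S' ⟨b i, hb.mem i⟩) w • v ∈ ℳ ((w.map deg).sum + β) := by
  induction w with
  | nil => simpa using hv
  | cons i w ih =>
    rw [wd_cons, mul_smul, List.map_cons, List.sum_cons, add_assoc]
    exact hM.smul_mem _ _ _ (hb.mem_homEnd i) _ ih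

/-- Rewriting to normal words preserves degrees. The letters of `P₀` stand on the right of a normal
word and can be absorbed into `M`. -/
theorem RootData.grade_le [CharP F p]
    (d : RootData p ε 𝒱 𝔤 Φ P Φ₁ δ bs deg ω r ei fi) (hp : 3 < p)
    (hχ : ∀ i, χ (bs i) ≠ 0 → deg i = 0) (hle : S' ≤ 𝔤)
    (hS' : S' = Submodule.span F ((fun i => (bs i : Module.End F V)) '' {i | m ≤ r i}))
    {M : Type*} [AddCommGroup M] [Module F M] [Module (RedEnv p ε 𝒱 χ S') M]
    {W : Type*} [AddCommGroup W] [Module F W] [Module (RedEnv p ε 𝒱 χ 𝔤) W]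
    [IsScalarTower F (RedEnv p ε 𝒱 χ 𝔤) W] {τ : M →ₗ[F] W}
    (hτ : IsInduced (RedEnv.map p ε 𝒱 χ hle) τ)
    {ℳ : Γ → Submodule F M} (hM : IsGradedModule p ε 𝒱 χ S' ℳ) (γ : Γ) :
    inducedGrade τ (RedEnv.piece p ε 𝒱 χ 𝔤 (homEnd 𝒱)) ℳ γ ≤
      Submodule.span F {z | ∃ k : Fin m → ℕ, ∃ β, ∃ v ∈ ℳ β,
        (∀ j, k j < order p ε deg (fi j)) ∧ ((fword fi k).map deg).sum + β = γ ∧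
        z = wd (fun i => RedEnv.ι p ε 𝒱 χ 𝔤 (bs i)) (fword fi k) • τ v} := by
  classical
  have hb' := d.parabolic hS'
  refine Submodule.span_le.2 ?_
  rintro _ ⟨α, β, rfl, a, ha, v, hv, rfl⟩
  have ha' := d.family.piece_le d.grading α ha
  clear ha
  have hn : a ∈ normalSpan (fun i => ε (deg i) (deg i) ≠ 1) (fun i => ε (deg i) (deg i) = 1) p F
      (fun i => RedEnv.ι p ε 𝒱 χ 𝔤 (bs i)) Set.univ deg α := by
    refine Submodule.span_le.2 ?_ ha'
    rintro _ ⟨w, rfl, rfl⟩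
    refine d.family.wd_mem_normalSpan (RootData.two_ne_zero hp) (by omega) (RedEnv.ι p ε 𝒱 χ 𝔤)
      (fun i j z hz => RedEnv.ι_mul_ι (d.family.mem_homEnd i) (d.family.mem_homEnd j) hz) Set.univ
      deg ?_ _ ?_ w (by simp)
    · intro i _ j _
      have := d.family.mem_span d.grading (d.family.bracket_mem i j)
        (colorBracket_mem_homEnd (d.family.mem_homEnd i) (d.family.mem_homEnd j))
      simpa using this
    · intro i _ ho
      refine ⟨⟨_, d.family.pow_mem _ ho⟩, χ (bs i) ^ p,
        RedEnv.ι_pow ho (d.family.mem_homEnd _) rfl rfl, ?_, ?_⟩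
      · have := d.family.mem_span d.grading (d.family.pow_mem i ho)
          (pow_mem_homEnd (d.family.mem_homEnd i) p)
        simpa using this
      · intro hc
        rw [hχ i (fun h => hc (by rw [h, zero_pow (by omega)])), smul_zero]
  clear ha'
  unfold normalSpan at hn
  induction hn using Submodule.span_induction with
  | mem a ha =>
    obtain ⟨w, hw, -, hsum, rfl⟩ := ha
    have hs := hw.sorted
    have hd : ∀ i ∈ w.dropWhile (r · < m), m ≤ r i := by
      clear hw hsum
      induction w with
      | nil => simp
      | cons a w ih =>
        rw [List.pairwise_cons] at hs
        by_cases ha : r a < m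
        · rw [List.dropWhile_cons_of_pos (by simpa using ha)]
          exact ih hs.2
        · rw [List.dropWhile_cons_of_neg (by simpa using ha)]
          intro i hi
          rcases List.mem_cons.1 hi with rfl | hi
          · exact not_lt.1 ha
          · exact d.isUpperSet m (hs.1 i hi) (not_lt.1 ha)
    obtain ⟨k, hk, -, hk'⟩ := d.eq_fword (hw.of_infix (List.takeWhile_prefix (r · < m)).isInfix)
      le_rfl (fun i hi => by simpa using List.mem_takeWhile_imp hi)
    have e := List.takeWhile_append_dropWhile (p := (r · < m)) (l := w)
    rw [hk'] at e
    obtain ⟨w', hw'⟩ : ∃ w' : List {i | m ≤ r i}, w'.map Subtype.val = w.dropWhile (r · < m) :=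
      ⟨(w.dropWhile (r · < m)).pmap (fun i h => ⟨i, h⟩) hd, by
        rw [List.map_pmap]; exact (List.pmap_eq_map ..).trans (List.map_id' _)⟩
    rw [← hw'] at e
    have e1 : RedEnv.map p ε 𝒱 χ hle (wd (fun i : {i | m ≤ r i} =>
        RedEnv.ι p ε 𝒱 χ S' ⟨bs i, hb'.mem i⟩) w') =
        wd (fun i => RedEnv.ι p ε 𝒱 χ 𝔤 (bs i)) (w'.map Subtype.val) := by
      simp only [wd, map_list_prod, List.map_map]
      congr 2
      funext i
      simp only [Function.comp_apply, RedEnv.map_ι]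
      rfl
    have h5 := wd_smul_mem hb' hM w' hv
    refine Submodule.subset_span ⟨k, _, _, h5, hk, ?_, ?_⟩
    · rw [← hsum, ← e]
      simp [add_assoc, Function.comp_def]
    · rw [← hτ.smul_of, e1, ← mul_smul, ← wd_append, e]
  | zero => rw [zero_smul]; exact Submodule.zero_mem _
  | add x y _ _ hx hy => rw [add_smul]; exact Submodule.add_mem _ hx hy
  | smul c x _ hx => rw [smul_assoc]; exact Submodule.smul_mem _ _ hx

end Coordinates

/-! ### The monomial with all exponents equal to `p̄ - 1`. -/

section Combinatorics

variable {X : Type*} [AddCommGroup X] {Φ P Φ₁ : Set X} {m : ℕ} {δ : Fin m → X}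

theorem IsPositiveSystem.ne_zero (hP : IsPositiveSystem Φ P) {a : X} (ha : a ∈ Φ) : a ≠ 0 := by
  rintro rfl
  have h0 : (0 : X) ∈ P := by simpa using hP.mem_or_neg_mem 0 ha
  exact hP.add_ne_zero h0 (AddSubmonoid.zero_mem _) (add_zero _)

/-- If `a` is positive, the last positive system excludes equality, and if `-a` is positive, `P`
does. -/
theorem IsFPTriple.sum_ne_levi (hFP : IsFPTriple Φ P Φ₁ δ) (hP : IsPositiveSystem Φ P)
    {a : X} (ha : a ∈ Φ₁) (hneg : -a ∈ Φ) (k : Fin m → ℕ) : ∑ j, k j • δ j ≠ a := by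
  intro h
  by_cases hk : k = 0
  · refine hP.ne_zero (hFP.subsystem.1 ha) ?_
    rw [← h, hk]; simp
  · rcases hP.mem_or_neg_mem a (hFP.subsystem.1 ha) with h1 | h1
    · exact hFP.sum_ne hk (AddSubmonoid.subset_closure ⟨ha, h1⟩) h
    · refine hFP.sum_add_ne_zero hP hk (AddSubmonoid.subset_closure h1) ?_
      rw [h, add_neg_cancel]

theorem sum_nsmul_sub {k t : Fin m → ℕ} (h : ∀ j, k j ≤ t j) :
    ∑ j, (t j - k j) • δ j + ∑ j, k j • δ j = ∑ j, t j • δ j := by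
  rw [← Finset.sum_add_distrib]
  refine Finset.sum_congr rfl fun j _ => ?_
  rw [← add_nsmul, Nat.sub_add_cancel (h j)]

end Combinatorics

theorem sq_eq_zero_of_eq_smul {F A : Type*} [Field F] [Ring A] [Algebra F A] {x : A} {q : F}
    (hq : q ≠ 1) (h : x * x = q • (x * x)) : x ^ 2 = 0 := by
  have : (1 - q) • x ^ 2 = 0 := by
    rw [sub_smul, one_smul, pow_two, ← h, sub_self]
  exact (smul_eq_zero.1 this).resolve_left (sub_ne_zero.2 hq.symm)

section RootData

variable {Γ F V I X : Type*} [AddCommGroup Γ] [Field F] [AddCommGroup V] [Module F V]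
  [LinearOrder I] [AddCommGroup X]
  {p : ℕ} {ε : Bicharacter Γ F} {𝒱 : Γ → Submodule F V}
  {𝔤 : Submodule F (Module.End F V)} {Φ P Φ₁ : Set X} {m : ℕ} {δ : Fin m → X}
  {bs : Module.Basis I F 𝔤} {deg : I → Γ} {ω : I → X} {r : I → ℕ} {ei fi : Fin m → I}
  {χ : 𝔤 →ₗ[F] F}

local notation "𝐱" => (fun i => RedEnv.ι p ε 𝒱 χ 𝔤 (bs i))

theorem fword_eq_map {J : Type*} (fi : Fin m → J) (k : Fin m → ℕ) : fword fi k = (fword id k).map fi := by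
  rw [fword, fword, List.map_flatMap]
  simp

/-- Compare the words of indices: both are sorted and have the same multiplicities. The letters
themselves need no order. -/
theorem fword_append {J : Type*} {fi : Fin m → J}
    {k l : Fin m → ℕ} (h : ∀ i j, k i ≠ 0 → l j ≠ 0 → i ≤ j) :
    fword fi (k + l) = fword fi k ++ fword fi l := by
  have hs : ∀ k : Fin m → ℕ, (fword id k).Pairwise (· ≤ ·) := fun k => by
    rw [fword, List.pairwise_flatMap]
    refine ⟨fun j _ => List.pairwise_replicate.2 (.inr le_rfl), ?_⟩
    refine (List.pairwise_lt_finRange m).imp fun {i j} h x hx y hy => ?_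
    rw [List.eq_of_mem_replicate hx, List.eq_of_mem_replicate hy]
    exact h.le
  have : fword id (k + l) = fword id k ++ fword id l := by
    refine List.Perm.eq_of_pairwise (le := (· ≤ ·)) (fun a b _ _ h h' => le_antisymm h h')
      (hs _) ?_ (List.perm_iff_count.2 fun i => ?_)
    · refine List.pairwise_append.2 ⟨hs _, hs _, fun x hx y hy => ?_⟩
      obtain ⟨i, hi, hxi⟩ := mem_fword.1 hx
      obtain ⟨j, hj, hyj⟩ := mem_fword.1 hy
      rw [hxi, hyj]
      exact h i j hi hj
    · have := fun k => count_fword (m := m) Function.injective_id k i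
      simp only [id_eq] at this
      rw [List.count_append, this, this, this, Pi.add_apply]
  rw [fword_eq_map, this, List.map_append, ← fword_eq_map, ← fword_eq_map]

theorem fword_single {J : Type*} {fi : Fin m → J} (j : Fin m) (n : ℕ) :
    fword fi (Pi.single j n) = List.replicate n (fi j) := by
  have h : ∀ l : List (Fin m), l.Nodup → (l.flatMap fun i => List.replicate (Pi.single (M := fun _ => ℕ) j n i) (fi i)) =
      if j ∈ l then List.replicate n (fi j) else [] := by
    intro l hl
    induction l with
    | nil => simp
    | cons a l ih =>
      rw [List.nodup_cons] at hl
      rw [List.flatMap_cons, ih hl.2]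
      by_cases ha : j = a
      · subst ha
        rw [if_neg hl.1]
        simp
      · simp [ha, Pi.single_eq_of_ne' ha]
  rw [fword, h _ (List.nodup_finRange m), if_pos (List.mem_finRange j)]

/-- The `p`-th power of an even vector, or the bracket of an odd one with itself, has as its weight
a proper multiple of `ω i`. No basis vector has that weight. -/
theorem RootData.pow_order_eq_zero (d : RootData p ε 𝒱 𝔤 Φ P Φ₁ δ bs deg ω r ei fi) (hp : 3 < p)
    {i : I} (hχ : χ (bs i) = 0) (hω : ∀ n, 2 ≤ n → ∀ k, ω k ≠ n • ω i) :
    RedEnv.ι p ε 𝒱 χ 𝔤 (bs i) ^ order p ε deg i = 0 := by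
  rw [order]
  split_ifs with h
  · have h0 : (bs i : Module.End F V) ^ p = 0 := by
      have := d.pow_mem i h
      rwa [show {k | ω k = p • ω i} = ∅ from Set.eq_empty_of_forall_notMem (hω p (by omega)),
        Set.image_empty, Submodule.span_empty, Submodule.mem_bot] at this
    rw [RedEnv.ι_pow (z := 0) h (d.family.mem_homEnd i) (by rw [h0]; rfl) rfl, hχ,
      zero_pow (by omega), map_zero, map_zero, add_zero]
  · have h0 : colorBracket ε (deg i) (deg i) (bs i : Module.End F V) (bs i) = 0 := by
      have := d.bracket_mem i i
      rwa [show {k | ω k = ω i + ω i} = ∅ from Set.eq_empty_of_forall_notMem (by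
          rw [← two_nsmul]; exact hω 2 le_rfl),
        Set.image_empty, Submodule.span_empty, Submodule.mem_bot] at this
    have h1 := RedEnv.ι_mul_ι (p := p) (χ := χ) (z := 0) (d.family.mem_homEnd i) (d.family.mem_homEnd i) (by
      rw [h0]; rfl)
    rw [map_zero, add_zero] at h1
    exact sq_eq_zero_of_eq_smul (fun h3 => h (Units.ext h3)) h1

theorem RootData.weight_ne_nsmul (d : RootData p ε 𝒱 𝔤 Φ P Φ₁ δ bs deg ω r ei fi) (j : Fin m)
    {n : ℕ} (hn : 2 ≤ n) (k : I) : ω k ≠ n • δ j := fun h =>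
  d.fp.nsmul_notMem d.pos j hn (h ▸ d.mem_roots k (h ▸ d.fp.nsmul_delta_ne_zero d.pos j (by omega)))

theorem RootData.f_pow_eq_zero (d : RootData p ε 𝒱 𝔤 Φ P Φ₁ δ bs deg ω r ei fi) (hp : 3 < p)
    (hχ : ∀ j, χ (bs (fi j)) = 0) (j : Fin m) :
    RedEnv.ι p ε 𝒱 χ 𝔤 (bs (fi j)) ^ order p ε deg (fi j) = 0 := by
  refine d.pow_order_eq_zero hp (hχ j) fun n hn k h => ?_
  rw [d.weight_f, smul_neg] at h
  have h0 : ω k ≠ 0 := by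
    rw [h, neg_ne_zero]; exact d.fp.nsmul_delta_ne_zero d.pos j (by omega)
  have := d.neg_mem _ (d.mem_roots k h0)
  rw [h, neg_neg] at this
  exact d.fp.nsmul_notMem d.pos j hn this

theorem RootData.e_pow_eq_zero (d : RootData p ε 𝒱 𝔤 Φ P Φ₁ δ bs deg ω r ei fi) (hp : 3 < p)
    (hχ : ∀ j, χ (bs (ei j)) = 0) (j : Fin m) :
    RedEnv.ι p ε 𝒱 χ 𝔤 (bs (ei j)) ^ order p ε deg (ei j) = 0 := by
  refine d.pow_order_eq_zero hp (hχ j) fun n hn k h => ?_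
  rw [d.weight_e] at h
  exact d.weight_ne_nsmul j hn k h

theorem order_pos (hp : 3 < p) (i : I) : 0 < order p ε deg i := by
  rw [order]; split_ifs <;> omega

theorem RootData.wd_fword_eq_zero (d : RootData p ε 𝒱 𝔤 Φ P Φ₁ δ bs deg ω r ei fi) (hp : 3 < p)
    (hχ : ∀ j, χ (bs (fi j)) = 0) {k : Fin m → ℕ} {j : Fin m} (h : order p ε deg (fi j) ≤ k j) :
    wd 𝐱 (fword fi k) = 0 := by
  rw [wd_fword]
  refine List.prod_eq_zero ?_
  rw [List.mem_ofFn]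
  refine ⟨j, ?_⟩
  rw [← Nat.sub_add_cancel h, pow_add]
  show _ * RedEnv.ι p ε 𝒱 χ 𝔤 (bs (fi j)) ^ _ = 0
  rw [d.f_pow_eq_zero hp hχ, mul_zero]

/-- The exponents `p̄ - 1`. -/
noncomputable def top (p : ℕ) (ε : Bicharacter Γ F) (deg : I → Γ) (fi : Fin m → I) : Fin m → ℕ :=
  fun j => order p ε deg (fi j) - 1

theorem top_lt (hp : 3 < p) (j : Fin m) : top p ε deg fi j < order p ε deg (fi j) := by
  have := order_pos (ε := ε) (deg := deg) hp (fi j)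
  rw [top]; omega

theorem RootData.rank_of_f_f (d : RootData p ε 𝒱 𝔤 Φ P Φ₁ δ bs deg ω r ei fi) {a b : Fin m} {k : I}
    (h : ω k = -δ a + -δ b) : ∃ l, l < max a b ∧ k = fi l := by
  have h0 : ω k ≠ 0 := by
    rw [h, ← neg_add, neg_ne_zero]
    exact d.pos.add_ne_zero (d.fp.mem_pos a) (AddSubmonoid.subset_closure (d.fp.mem_pos b))
  obtain ⟨l, hl, h1⟩ := d.fp.neg_delta_add d.pos (h ▸ d.mem_roots k h0)
  exact ⟨l, hl, d.rank_of_weight (h.trans h1)⟩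

/-- Moving `f_n` past the full block `f_1^{p̄-1} ⋯ f_{n-1}^{p̄-1}` could only create monomials in
these letters, and none of them has a weight so low. -/
theorem RootData.f_mul_wd [CharP F p]
    (d : RootData p ε 𝒱 𝔤 Φ P Φ₁ δ bs deg ω r ei fi) (hp : 3 < p)
    (hχ : ∀ j, χ (bs (fi j)) = 0) (n : Fin m) :
    ∃ c : F, c ≠ 0 ∧ ∀ k : Fin m → ℕ, (∀ j < n, k j = top p ε deg fi j) →
      RedEnv.ι p ε 𝒱 χ 𝔤 (bs (fi n)) * wd 𝐱 (fword fi k) =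
        c • wd 𝐱 (fword fi (k + Pi.single n 1)) := by
  classical
  -- The block common to all `k` in question, so that one scalar `c` serves for all of them.
  set t : Fin m → ℕ := fun j => if j < n then top p ε deg fi j else 0 with ht
  obtain ⟨c, hc, h⟩ := d.exists_commute_fword hp hχ (n := n) n.2.le (i := fi n) (by
    intro j hj k hk
    rw [d.weight_f] at hk
    obtain ⟨l, hl, rfl⟩ := d.rank_of_f_f hk
    rw [d.rank_f]
    rw [max_eq_left (Fin.le_def.2 hj.le)] at hl
    exact hl) (w := fword fi t) (by
    intro i hi
    obtain ⟨j, hj, rfl⟩ := mem_fword.1 hi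
    rw [d.rank_f]
    by_contra h
    exact hj (if_neg fun h' => h h'))
  rw [d.sum_fword, d.weight_f, fSpan_eq_bot, Submodule.mem_bot, sub_eq_zero] at h
  · refine ⟨c, hc, fun k hk => ?_⟩
    set s : Fin m → ℕ := fun j => if j < n then 0 else k j with hs
    have e : k = t + s := by
      funext j
      simp only [ht, hs, Pi.add_apply]
      split_ifs with hj
      · rw [hk j hj, add_zero]
      · rw [zero_add]
    have hs0 : ∀ j, s j ≠ 0 → n ≤ j := fun j hj => not_lt.1 fun h => hj (if_pos h)
    have ht0 : ∀ j, t j ≠ 0 → j < n := fun j hj => by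
      by_contra h; exact hj (if_neg h)
    have e1 : fword fi k = fword fi t ++ fword fi s := by
      rw [e, fword_append]
      exact fun i j hi hj => (ht0 i hi).le.trans (hs0 j hj)
    have e2 : fword fi (k + Pi.single n 1) = fword fi t ++ ([fi n] ++ fword fi s) := by
      rw [e, add_assoc, add_comm s, fword_append, fword_append, fword_single]
      · rfl
      · intro i j hi hj
        have : i = n := by
          by_contra h; exact hi (Pi.single_eq_of_ne h _)
        exact this ▸ hs0 j hj
      · intro i j hi hj
        refine (ht0 i hi).le.trans ?_
        rw [Pi.add_apply] at hj
        by_cases hj' : j = n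
        · exact hj'.ge
        · rw [Pi.single_eq_of_ne hj', zero_add] at hj
          exact hs0 j hj
    rw [e1, e2, wd_append, wd_append, wd_append, ← mul_assoc, h]
    simp only [wd_cons, wd_nil, mul_one, smul_mul_assoc, mul_assoc]
  -- A correction term with exponent `k ≤ t` would give `∑ (t_j - k_j) δ_j + δ_n = 0`.
  · intro k hk hk0 he
    have hle : ∀ j, k j ≤ t j := by
      intro j
      by_cases hj : j < n
      · have := hk j
        simp only [ht, if_pos hj, top]; omega
      · rw [hk0 j (Fin.le_def.1 (not_lt.1 hj))]; omega
    have e := sum_nsmul_sub (δ := δ) hle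
    refine d.fp.sum_add_ne_zero d.pos (k := (fun j => t j - k j) + Pi.single n 1) (s := 0) ?_
      (AddSubmonoid.zero_mem _) ?_
    · intro h0
      simpa using congrFun h0 n
    · simp only [Pi.add_apply, add_smul, Finset.sum_add_distrib, add_zero]
      have e3 : ∑ j, (Pi.single n 1 : Fin m → ℕ) j • δ j = δ n := by
        rw [Finset.sum_eq_single n]
        · simp
        · intro j _ hj
          rw [Pi.single_eq_of_ne hj, zero_smul]
        · simp
      rw [e3]
      rw [← e] at he
      have := congrArg (fun x => -x - ∑ j, k j • δ j) he
      simp only [neg_add_rev, neg_neg, sub_self] at this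
      rw [← this]
      abel

theorem fSpan_top_smul_mem {A : Submodule F (RedEnv p ε 𝒱 χ 𝔤)} {μ : X} {x : RedEnv p ε 𝒱 χ 𝔤}
    (hx : x ∈ fSpan p ε 𝒱 χ bs deg δ fi m μ)
    (h : ∀ k : Fin m → ℕ, (∀ j, k j < order p ε deg (fi j)) → μ = -∑ j, k j • δ j →
      wd 𝐱 (fword fi k) ∈ A) : x ∈ A := by
  have : fSpan p ε 𝒱 χ bs deg δ fi m μ ≤ A := by
    refine Submodule.span_le.2 ?_
    rintro _ ⟨k, h1, -, h2, rfl⟩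
    exact h k h1 h2
  exact this hx

theorem RootData.rank_of_levi_f (d : RootData p ε 𝒱 𝔤 Φ P Φ₁ δ bs deg ω r ei fi) {a : X}
    (ha : a ∈ Φ₁) {j : Fin m} {k : I} (h : ω k = a + -δ j) : r k < m := by
  have h0 : ω k ≠ 0 := by
    rw [h, ← sub_eq_add_neg, sub_ne_zero]
    rintro rfl
    exact d.fp.notMem_levi j ha
  obtain ⟨l, h1⟩ := d.fp.levi_sub_delta d.pos d.neg_mem ha (h ▸ d.mem_roots k h0)
  rw [d.rank_of_weight (h.trans h1), d.rank_f]
  exact l.2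

theorem RootData.commute_fword_of_levi [CharP F p]
    (d : RootData p ε 𝒱 𝔤 Φ P Φ₁ δ bs deg ω r ei fi) (hp : 3 < p)
    (hχ : ∀ j, χ (bs (fi j)) = 0) {i : I} (hi : ω i ∈ Φ₁ ∨ ω i = 0) (k : Fin m → ℕ) :
    ∃ c : F, c ≠ 0 ∧ RedEnv.ι p ε 𝒱 χ 𝔤 (bs i) * wd 𝐱 (fword fi k) -
      c • (wd 𝐱 (fword fi k) * RedEnv.ι p ε 𝒱 χ 𝔤 (bs i)) ∈
        fSpan p ε 𝒱 χ bs deg δ fi m (ω i + -∑ j, k j • δ j) := by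
  have := d.exists_commute_fword hp hχ le_rfl (i := i) (w := fword fi k) (fun j _ l hl => by
    rcases hi with hi | hi
    · exact d.rank_of_levi_f hi hl
    · rw [hi, zero_add] at hl
      rw [d.rank_of_weight hl, d.rank_f]
      exact j.2) (fun i hi => by
      obtain ⟨j, -, rfl⟩ := mem_fword.1 hi
      rw [d.rank_f]; exact j.2)
  rwa [d.sum_fword] at this

theorem RootData.f_mul_mem_fSpan [CharP F p]
    (d : RootData p ε 𝒱 𝔤 Φ P Φ₁ δ bs deg ω r ei fi) (hp : 3 < p)
    (hχ : ∀ j, χ (bs (fi j)) = 0) (a : Fin m) (k : Fin m → ℕ) :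
    RedEnv.ι p ε 𝒱 χ 𝔤 (bs (fi a)) * wd 𝐱 (fword fi k) ∈
      fSpan p ε 𝒱 χ bs deg δ fi m (-δ a + -∑ j, k j • δ j) := by
  have := d.wd_mem_fSpan hp hχ le_rfl (w := fi a :: fword fi k) (by
    intro i hi
    rcases List.mem_cons.1 hi with rfl | hi
    · rw [d.rank_f]; exact a.2
    · obtain ⟨j, -, rfl⟩ := mem_fword.1 hi
      rw [d.rank_f]; exact j.2)
  rwa [List.map_cons, List.sum_cons, d.sum_fword, d.weight_f, wd_cons] at this

/-- A correction term with exponent `k` requires `∑ (top_j - k_j) δ_j = ω i`. This is impossible for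
a root of `Φ₁`, and for weight 0 it forces `k = top`. -/
theorem RootData.levi_mul_top [CharP F p]
    (d : RootData p ε 𝒱 𝔤 Φ P Φ₁ δ bs deg ω r ei fi) (hp : 3 < p)
    (hχ : ∀ j, χ (bs (fi j)) = 0) {i : I} (hi : ω i ∈ Φ₁ ∨ ω i = 0) :
    ∃ c a : F, c ≠ 0 ∧ RedEnv.ι p ε 𝒱 χ 𝔤 (bs i) * wd 𝐱 (fword fi (top p ε deg fi)) =
      c • (wd 𝐱 (fword fi (top p ε deg fi)) * RedEnv.ι p ε 𝒱 χ 𝔤 (bs i)) +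
        a • wd 𝐱 (fword fi (top p ε deg fi)) ∧ (ω i ∈ Φ₁ → a = 0) := by
  obtain ⟨c, hc, h⟩ := d.commute_fword_of_levi hp hχ hi (top p ε deg fi)
  rcases hi with hi | hi
  · rw [fSpan_eq_bot, Submodule.mem_bot, sub_eq_zero] at h
    · exact ⟨c, 0, hc, by rw [h, zero_smul, add_zero], fun _ => rfl⟩
    · intro k hk _ he
      have e := sum_nsmul_sub (δ := δ) (k := k) (t := top p ε deg fi) fun j => by
        have := hk j
        rw [top]; omega
      refine d.fp.sum_ne_levi d.pos hi (d.neg_mem _ (d.fp.subsystem.1 hi))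
        (fun j => top p ε deg fi j - k j) ?_
      rw [← sub_eq_add_neg, sub_eq_iff_eq_add, ← e] at he
      rw [he]; abel
  · have h1 := fSpan_top_smul_mem (A := Submodule.span F {wd 𝐱 (fword fi (top p ε deg fi))}) h (by
      intro k hk he
      have e := sum_nsmul_sub (δ := δ) (k := k) (t := top p ε deg fi) fun j => by
        have := hk j
        rw [top]; omega
      rw [hi, zero_add, neg_inj, ← e, add_eq_right] at he
      have hz : (fun j => top p ε deg fi j - k j) = 0 := by
        by_contra hne
        exact d.fp.sum_add_ne_zero d.pos hne (AddSubmonoid.zero_mem _) (by rw [add_zero]; exact he)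
      have : k = top p ε deg fi := by
        funext j
        have h1 := congrFun hz j
        have h2 := hk j
        simp only [Pi.zero_apply, top] at h1 ⊢
        omega
      rw [this]
      exact Submodule.mem_span_singleton_self _)
    obtain ⟨a, ha⟩ := Submodule.mem_span_singleton.1 h1
    refine ⟨c, a, hc, ?_, fun hi' => absurd hi (d.pos.ne_zero (d.fp.subsystem.1 hi'))⟩
    rw [ha]; abel

/-- The weight of the product is lower than that of every admissible monomial. -/
theorem RootData.f_mul_top [CharP F p]
    (d : RootData p ε 𝒱 𝔤 Φ P Φ₁ δ bs deg ω r ei fi) (hp : 3 < p)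
    (hχ : ∀ j, χ (bs (fi j)) = 0) (a : Fin m) :
    RedEnv.ι p ε 𝒱 χ 𝔤 (bs (fi a)) * wd 𝐱 (fword fi (top p ε deg fi)) = 0 := by
  have h := d.f_mul_mem_fSpan hp hχ a (top p ε deg fi)
  rwa [fSpan_eq_bot, Submodule.mem_bot] at h
  intro k hk _ he
  have e := sum_nsmul_sub (δ := δ) (k := k) (t := top p ε deg fi) fun j => by
    have := hk j
    rw [top]; omega
  refine d.pos.add_ne_zero (d.fp.mem_pos a) (sum_nsmul_mem_closure
    (fun j => top p ε deg fi j - k j) fun j _ => d.fp.mem_pos j) ?_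
  rw [← neg_add, neg_inj, ← e, ← add_assoc, add_eq_right] at he
  exact he

end RootData

/-! ### Graded subspaces under homogeneous maps. -/

section GradedSub

variable {Γ F M W : Type*} [AddCommGroup Γ] [Field F] [AddCommGroup M] [Module F M]
  [AddCommGroup W] [Module F W] {ℳ : Γ → Submodule F M} {𝒲 : Γ → Submodule F W}

/-- A map of degree `α` sends components to components, and by independence these agree with the
components of the image inside `N`. -/
theorem map_component_mem (h𝒲 : iSupIndep 𝒲) {L : M →ₗ[F] W} {α : Γ}
    (hL : ∀ γ, ∀ x ∈ ℳ γ, L x ∈ 𝒲 (α + γ)) {N : Submodule F W} (hN : IsGradedSub 𝒲 N) {f : Γ →₀ M}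
    (hf : ∀ γ, f γ ∈ ℳ γ) (hx : L (f.sum fun _ y => y) ∈ N) (γ : Γ) : L (f γ) ∈ N := by
  classical
  have h2 : L (f.sum fun _ y => y) ∈ ⨆ γ, N ⊓ 𝒲 γ := hN ▸ hx
  obtain ⟨g, hg, hgs⟩ := (Submodule.mem_iSup_iff_exists_finsupp ..).1 h2
  have key : L (f γ) = g (α + γ) := by
    -- One finite set of degrees that carries both decompositions.
    set s : Finset Γ := f.support.image (α + ·) ∪ g.support with hs
    have e1 : ∑ β ∈ s, L (f (β - α)) = L (f.sum fun _ y => y) := by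
      rw [Finsupp.sum, map_sum, ← Finset.sum_subset (Finset.subset_union_left :
        f.support.image (α + ·) ⊆ s), Finset.sum_image (fun a _ b _ h => add_left_cancel h)]
      · exact Finset.sum_congr rfl fun γ _ => by rw [add_sub_cancel_left]
      · intro β _ hβ
        have : f (β - α) = 0 := by
          by_contra h
          exact hβ (Finset.mem_image.2 ⟨β - α, Finsupp.mem_support_iff.2 h, add_sub_cancel _ _⟩)
        rw [this, map_zero]
    have e2 : ∑ β ∈ s, g β = g.sum fun _ y => y :=
      (Finset.sum_subset Finset.subset_union_right fun β _ hβ => by simpa using hβ).symm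
    have h3 := (iSupIndep_iff_finsetSum_eq_zero_imp_eq_zero _).1 h𝒲 s
      (fun β => L (f (β - α)) - g β) (fun β _ => Submodule.sub_mem _
        (by simpa using hL (β - α) _ (hf _)) (hg β).2) (by
        rw [Finset.sum_sub_distrib, e1, e2, hgs, sub_self])
    by_cases hγ : α + γ ∈ s
    · have := h3 _ hγ
      rwa [add_sub_cancel_left, sub_eq_zero] at this
    · have h4 : f γ = 0 := by
        by_contra h
        exact hγ (Finset.mem_union_left _ (Finset.mem_image_of_mem _
          (Finsupp.mem_support_iff.2 h)))
      have h5 : g (α + γ) = 0 := by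
        by_contra h
        exact hγ (Finset.mem_union_right _ (Finsupp.mem_support_iff.2 h))
      rw [h4, h5, map_zero]
  rw [key]
  exact (hg _).1

theorem IsGrading.exists_finsupp (hM : IsGrading ℳ) (x : M) :
    ∃ f : Γ →₀ M, (∀ γ, f γ ∈ ℳ γ) ∧ (f.sum fun _ y => y) = x :=
  (Submodule.mem_iSup_iff_exists_finsupp ..).1 (hM.2 ▸ Submodule.mem_top)

theorem IsGrading.isGradedSub_comap (hM : IsGrading ℳ) (h𝒲 : iSupIndep 𝒲) {L : M →ₗ[F] W} {α : Γ}
    (hL : ∀ γ, ∀ x ∈ ℳ γ, L x ∈ 𝒲 (α + γ)) {N : Submodule F W} (hN : IsGradedSub 𝒲 N) :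
    IsGradedSub ℳ (N.comap L) := by
  refine le_antisymm ?_ (iSup_le fun γ => inf_le_left)
  intro x hx
  obtain ⟨f, hf, rfl⟩ := hM.exists_finsupp x
  exact Submodule.sum_mem _ fun γ _ =>
    Submodule.mem_iSup_of_mem γ ⟨map_component_mem h𝒲 hL hN hf hx γ, hf γ⟩

/-- Kernels are preimages of the zero subspace, which is graded; the maps may have different
degrees. -/
theorem IsGrading.isGradedSub_iInf_ker {J : Type*} (hM : IsGrading ℳ) (h𝒲 : iSupIndep 𝒲)
    {L : J → M →ₗ[F] W} {α : J → Γ} (hL : ∀ j γ, ∀ x ∈ ℳ γ, L j x ∈ 𝒲 (α j + γ)) :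
    IsGradedSub ℳ (⨅ j, LinearMap.ker (L j)) := by
  refine le_antisymm ?_ (iSup_le fun γ => inf_le_left)
  intro x hx
  obtain ⟨f, hf, rfl⟩ := hM.exists_finsupp x
  refine Submodule.sum_mem _ fun γ _ =>
    Submodule.mem_iSup_of_mem γ ⟨(Submodule.mem_iInf _).2 fun j => ?_, hf γ⟩
  have h0 : IsGradedSub 𝒲 (⊥ : Submodule F W) :=
    le_antisymm bot_le (iSup_le fun γ => inf_le_left)
  exact map_component_mem h𝒲 (hL j) h0 hf ((Submodule.mem_iInf _).1 hx j) γ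

end GradedSub

theorem RedEnv.mul_mem_piece {Γ F V Y : Type*} [AddCommGroup Γ] [Field F] [AddCommGroup V]
    [Module F V] [AddCommGroup Y] {p : ℕ} {ε : Bicharacter Γ F} {𝒱 : Γ → Submodule F V}
    {𝔤 : Submodule F (Module.End F V)} {χ : 𝔤 →ₗ[F] F} {S : Submodule F (Module.End F V)}
    {𝒢 : Y → Submodule F (Module.End F V)} {α β : Y} {x y : RedEnv p ε 𝒱 χ S}
    (hx : x ∈ RedEnv.piece p ε 𝒱 χ S 𝒢 α) (hy : y ∈ RedEnv.piece p ε 𝒱 χ S 𝒢 β) :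
    x * y ∈ RedEnv.piece p ε 𝒱 χ S 𝒢 (α + β) := by
  have := Submodule.mul_mem_mul hx hy
  unfold RedEnv.piece at this
  rw [Submodule.span_mul_span] at this
  refine Submodule.span_mono ?_ this
  rintro _ ⟨_, ⟨l, h1, h2, rfl⟩, _, ⟨l', h3, h4, rfl⟩, rfl⟩
  refine ⟨l ++ l', ?_, by simp [h2, h4], by simp⟩
  intro q hq
  rcases List.mem_append.1 hq with hq | hq
  · exact h1 q hq
  · exact h3 q hq

theorem IsHomFamily.smul_mem_of_forall {Γ F V I M : Type*} [AddCommGroup Γ] [Field F]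
    [AddCommGroup V] [Module F V] {p : ℕ} {ε : Bicharacter Γ F} {𝒱 : Γ → Submodule F V}
    {𝔤 : Submodule F (Module.End F V)} {χ : 𝔤 →ₗ[F] F} {S : Submodule F (Module.End F V)}
    {b : I → Module.End F V} {deg : I → Γ} (hb : IsHomFamily p ε 𝒱 S b deg)
    [AddCommGroup M] [Module F M] [Module (RedEnv p ε 𝒱 χ S) M]
    [IsScalarTower F (RedEnv p ε 𝒱 χ S) M] {U : Submodule F M}
    (hU : ∀ i, ∀ u ∈ U, RedEnv.ι p ε 𝒱 χ S ⟨b i, hb.mem i⟩ • u ∈ U) (a : RedEnv p ε 𝒱 χ S)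
    {u : M} (hu : u ∈ U) : a • u ∈ U := by
  have ha : a ∈ Submodule.span F _ := hb.span_wd (χ := χ) ▸ Submodule.mem_top
  induction ha using Submodule.span_induction with
  | mem a ha =>
    obtain ⟨w, rfl⟩ := ha
    induction w with
    | nil => simpa using hu
    | cons i w ih => rw [wd_cons, mul_smul]; exact hU i _ ih
  | zero => rw [zero_smul]; exact U.zero_mem
  | add x y _ _ hx hy => rw [add_smul]; exact U.add_mem hx hy
  | smul c x _ hx => rw [smul_assoc]; exact U.smul_mem _ hx

/-! ### The graded induced module in coordinates. -/

section InducedData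

variable {Γ F V I X : Type*} [AddCommGroup Γ] [Field F] [AddCommGroup V] [Module F V]
  [LinearOrder I] [AddCommGroup X]

/-- A graded module `W` induced from a graded `u_χ(P₀)`-module `M`, with the coordinates of the
elements of `W` with respect to the monomials in `f_1, …, f_m`. -/
structure InducedData (p : ℕ) (ε : Bicharacter Γ F) (𝒱 : Γ → Submodule F V)
    (𝔤 : Submodule F (Module.End F V)) (Φ P Φ₁ : Set X) {m : ℕ} (δ : Fin m → X)
    (bs : Module.Basis I F 𝔤) (deg : I → Γ) (ω : I → X) (r : I → ℕ) (ei fi : Fin m → I)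
    (χ : 𝔤 →ₗ[F] F) {S' : Submodule F (Module.End F V)} (hle : S' ≤ 𝔤)
    {M : Type*} [AddCommGroup M] [Module F M] [Module (RedEnv p ε 𝒱 χ S') M]
    (ℳ : Γ → Submodule F M)
    {W : Type*} [AddCommGroup W] [Module F W] [Module (RedEnv p ε 𝒱 χ 𝔤) W]
    (τ : M →ₗ[F] W) (κ : (Fin m → ℕ) → W →ₗ[F] M) : Prop where
  root : RootData p ε 𝒱 𝔤 Φ P Φ₁ δ bs deg ω r ei fi
  three_lt : 3 < p
  deg_of_ne : ∀ i, χ (bs i) ≠ 0 → deg i = 0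
  chi_f : ∀ j, χ (bs (fi j)) = 0
  chi_e : ∀ j, χ (bs (ei j)) = 0
  span_eq : S' = Submodule.span F ((fun i => (bs i : Module.End F V)) '' {i | m ≤ r i})
  induced : IsInduced (RedEnv.map p ε 𝒱 χ hle) τ
  graded : IsGradedModule p ε 𝒱 χ S' ℳ
  coord_wd : ∀ k k' v, (∀ j, k' j < order p ε deg (fi j)) →
    κ k (wd (fun i => RedEnv.ι p ε 𝒱 χ 𝔤 (bs i)) (fword fi k') • τ v) = if k = k' then v else 0
  eq_sum : ∀ z, z = ∑ k ∈ Fintype.piFinset fun j => Finset.range (order p ε deg (fi j)),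
    wd (fun i => RedEnv.ι p ε 𝒱 χ 𝔤 (bs i)) (fword fi k) • τ (κ k z)

variable {p : ℕ} {ε : Bicharacter Γ F} {𝒱 : Γ → Submodule F V}
  {𝔤 : Submodule F (Module.End F V)} {Φ P Φ₁ : Set X} {m : ℕ} {δ : Fin m → X}
  {bs : Module.Basis I F 𝔤} {deg : I → Γ} {ω : I → X} {r : I → ℕ} {ei fi : Fin m → I}
  {χ : 𝔤 →ₗ[F] F} {S' : Submodule F (Module.End F V)} {hle : S' ≤ 𝔤}
  {M : Type*} [AddCommGroup M] [Module F M] [Module (RedEnv p ε 𝒱 χ S') M]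
  {ℳ : Γ → Submodule F M} {W : Type*} [AddCommGroup W] [Module F W]
  [Module (RedEnv p ε 𝒱 χ 𝔤) W] {τ : M →ₗ[F] W} {κ : (Fin m → ℕ) → W →ₗ[F] M}

local notation "𝐱" => (fun i => RedEnv.ι p ε 𝒱 χ 𝔤 (bs i))
local notation "𝒲" => inducedGrade τ (RedEnv.piece p ε 𝒱 χ 𝔤 (homEnd 𝒱)) ℳ

/-- The element of `P₀` with index `i`. -/
theorem InducedData.mem (D : InducedData p ε 𝒱 𝔤 Φ P Φ₁ δ bs deg ω r ei fi χ hle ℳ τ κ) {i : I}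
    (hi : m ≤ r i) : (bs i : Module.End F V) ∈ S' :=
  D.span_eq ▸ Submodule.subset_span ⟨i, hi, rfl⟩

theorem InducedData.smul_of (D : InducedData p ε 𝒱 𝔤 Φ P Φ₁ δ bs deg ω r ei fi χ hle ℳ τ κ) {i : I}
    (hi : m ≤ r i) (x : M) :
    RedEnv.ι p ε 𝒱 χ 𝔤 (bs i) • τ x = τ (RedEnv.ι p ε 𝒱 χ S' ⟨bs i, D.mem hi⟩ • x) := by
  rw [← D.induced.smul_of, RedEnv.map_ι]
  rfl

theorem InducedData.eq_zero (D : InducedData p ε 𝒱 𝔤 Φ P Φ₁ δ bs deg ω r ei fi χ hle ℳ τ κ) {z : W}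
    (hz : ∀ k, (∀ j, k j < order p ε deg (fi j)) → κ k z = 0) : z = 0 := by
  rw [D.eq_sum z]
  refine Finset.sum_eq_zero fun k hk => ?_
  rw [hz k fun j => Finset.mem_range.1 (Fintype.mem_piFinset.1 hk j), map_zero, smul_zero]

theorem InducedData.coord_zero_of
    (D : InducedData p ε 𝒱 𝔤 Φ P Φ₁ δ bs deg ω r ei fi χ hle ℳ τ κ) (x : M) : κ 0 (τ x) = x := by
  have := D.coord_wd 0 0 x fun j => order_pos D.three_lt _
  rwa [fword_zero, wd_nil, one_smul, if_pos rfl] at this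

theorem InducedData.of_ne_zero (D : InducedData p ε 𝒱 𝔤 Φ P Φ₁ δ bs deg ω r ei fi χ hle ℳ τ κ)
    {x : M} (hx : x ≠ 0) : τ x ≠ 0 := fun h => hx (by rw [← D.coord_zero_of x, h, map_zero])

theorem InducedData.wd_smul_mem [IsScalarTower F (RedEnv p ε 𝒱 χ 𝔤) W]
    (D : InducedData p ε 𝒱 𝔤 Φ P Φ₁ δ bs deg ω r ei fi χ hle ℳ τ κ)
    (w : List I) {γ : Γ} {z : W} (hz : z ∈ 𝒲 γ) : wd 𝐱 w • z ∈ 𝒲 ((w.map deg).sum + γ) := by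
  unfold inducedGrade at hz
  induction hz using Submodule.span_induction with
  | mem z hz =>
    obtain ⟨α, β, rfl, a, ha, x, hx, rfl⟩ := hz
    refine Submodule.subset_span ⟨(w.map deg).sum + α, β, by rw [add_assoc], wd 𝐱 w * a,
      RedEnv.mul_mem_piece ?_ ha, x, hx, by rw [mul_smul]⟩
    exact D.root.family.wd_mem_piece D.root.family.mem_homEnd w
  | zero => rw [smul_zero]; exact Submodule.zero_mem _
  | add x y _ _ hx hy => rw [smul_add]; exact Submodule.add_mem _ hx hy
  | smul c x _ hx => rw [smul_comm]; exact Submodule.smul_mem _ _ hx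

theorem InducedData.of_mem_grade (_ : InducedData p ε 𝒱 𝔤 Φ P Φ₁ δ bs deg ω r ei fi χ hle ℳ τ κ)
    {γ : Γ} {x : M} (hx : x ∈ ℳ γ) : τ x ∈ 𝒲 γ :=
  Submodule.subset_span ⟨0, γ, zero_add _, 1, Submodule.subset_span ⟨[], by simp, by simp, by simp⟩,
    x, hx, (one_smul _ _).symm⟩

/-- Taking the coordinate at `k` lowers the degree by that of the monomial `f^k`. -/
theorem InducedData.coord_mem [CharP F p] [IsScalarTower F (RedEnv p ε 𝒱 χ 𝔤) W]
    (D : InducedData p ε 𝒱 𝔤 Φ P Φ₁ δ bs deg ω r ei fi χ hle ℳ τ κ) (k : Fin m → ℕ) {γ : Γ}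
    {z : W} (hz : z ∈ 𝒲 γ) : κ k z ∈ ℳ (γ - ((fword fi k).map deg).sum) := by
  have h := D.root.grade_le D.three_lt D.deg_of_ne hle D.span_eq D.induced D.graded γ hz
  clear hz
  induction h using Submodule.span_induction with
  | mem z hz =>
    obtain ⟨k', β, v, hv, hk', rfl, rfl⟩ := hz
    rw [D.coord_wd k k' v hk']
    split_ifs with h
    · rw [h, add_sub_cancel_left]; exact hv
    · exact Submodule.zero_mem _
  | zero => rw [map_zero]; exact Submodule.zero_mem _
  | add x y _ _ hx hy => rw [map_add]; exact Submodule.add_mem _ hx hy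
  | smul c x _ hx => rw [map_smul]; exact Submodule.smul_mem _ _ hx

/-- A relation between homogeneous elements can be read in each coordinate, where the grading of `M`
is direct. -/
theorem InducedData.iSupIndep_grade [CharP F p] [IsScalarTower F (RedEnv p ε 𝒱 χ 𝔤) W]
    (D : InducedData p ε 𝒱 𝔤 Φ P Φ₁ δ bs deg ω r ei fi χ hle ℳ τ κ) : iSupIndep 𝒲 := by
  rw [iSupIndep_iff_finsetSum_eq_zero_imp_eq_zero]
  intro s v hv hsum γ hγ
  refine D.eq_zero fun k _ => ?_
  classical
  set α := ((fword fi k).map deg).sum with hα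
  have h := (iSupIndep_iff_finsetSum_eq_zero_imp_eq_zero _).1 D.graded.grading.1
    (s.image (· - α)) (fun β => κ k (v (β + α))) (by
      intro β hβ
      obtain ⟨γ, hγ, rfl⟩ := Finset.mem_image.1 hβ
      rw [sub_add_cancel]
      exact D.coord_mem k (hv γ hγ)) (by
      rw [Finset.sum_image (fun a _ b _ h => sub_left_injective h)]
      simp only [sub_add_cancel]
      rw [← map_sum, hsum, map_zero]) (γ - α) (Finset.mem_image_of_mem _ hγ)
  simpa using h

/-- The algebra is spanned by words, and a word maps `z` to a homogeneous element. -/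
theorem InducedData.isGradedSub_span_singleton [IsScalarTower F (RedEnv p ε 𝒱 χ 𝔤) W]
    (D : InducedData p ε 𝒱 𝔤 Φ P Φ₁ δ bs deg ω r ei fi χ hle ℳ τ κ) {γ : Γ} {z : W}
    (hz : z ∈ 𝒲 γ) :
    IsGradedSub 𝒲 ((Submodule.span (RedEnv p ε 𝒱 χ 𝔤) {z}).restrictScalars F) := by
  refine le_antisymm ?_ (iSup_le fun γ => inf_le_left)
  intro y hy
  obtain ⟨a, rfl⟩ := Submodule.mem_span_singleton.1 hy
  clear hy
  have ha : a ∈ Submodule.span F _ := D.root.family.span_wd (χ := χ) ▸ Submodule.mem_top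
  induction ha using Submodule.span_induction with
  | mem a ha =>
    obtain ⟨w, rfl⟩ := ha
    exact Submodule.mem_iSup_of_mem _ ⟨Submodule.smul_mem _ _ (Submodule.mem_span_singleton_self z),
      D.wd_smul_mem w hz⟩
  | zero => rw [zero_smul]; exact Submodule.zero_mem _
  | add x y _ _ hx hy => rw [add_smul]; exact Submodule.add_mem _ hx hy
  | smul c x _ hx => rw [smul_assoc]; exact Submodule.smul_mem _ _ hx

end InducedData

/-- Stability under the generators of the algebra makes `U` a submodule, so simplicity applies. -/
theorem IsGradedSimple.eq_top {Γ F V I M : Type*} [AddCommGroup Γ] [Field F]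
    [AddCommGroup V] [Module F V] {p : ℕ} {ε : Bicharacter Γ F} {𝒱 : Γ → Submodule F V}
    {𝔤 : Submodule F (Module.End F V)} {χ : 𝔤 →ₗ[F] F} {S : Submodule F (Module.End F V)}
    {b : I → Module.End F V} {deg : I → Γ} (hb : IsHomFamily p ε 𝒱 S b deg)
    [AddCommGroup M] [Module F M] [Module (RedEnv p ε 𝒱 χ S) M]
    [IsScalarTower F (RedEnv p ε 𝒱 χ S) M] {ℳ : Γ → Submodule F M}
    (h : IsGradedSimple (RedEnv p ε 𝒱 χ S) ℳ) {U : Submodule F M} (hgr : IsGradedSub ℳ U)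
    (hU : ∀ i, ∀ u ∈ U, RedEnv.ι p ε 𝒱 χ S ⟨b i, hb.mem i⟩ • u ∈ U) {u : M} (hu : u ∈ U)
    (hu0 : u ≠ 0) : U = ⊤ := by
  let N : Submodule (RedEnv p ε 𝒱 χ S) M :=
    { U.toAddSubmonoid with smul_mem' := fun a x hx => hb.smul_mem_of_forall hU a hx }
  have hN : N.restrictScalars F = U := rfl
  rcases h.2 N (hN ▸ hgr) with h1 | h1
  · have : u ∈ N := hu
    rw [h1] at this
    exact absurd ((Submodule.mem_bot _).1 this) hu0
  · rw [← hN, h1]; rfl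

/-! ### Vectors annihilated by root vectors. -/

section Commutator

variable {Γ F V I X : Type*} [AddCommGroup Γ] [Field F] [AddCommGroup V] [Module F V]
  [LinearOrder I] [AddCommGroup X]
  {p : ℕ} {ε : Bicharacter Γ F} {𝒱 : Γ → Submodule F V}
  {𝔤 : Submodule F (Module.End F V)} {Φ P Φ₁ : Set X} {m : ℕ} {δ : Fin m → X}
  {bs : Module.Basis I F 𝔤} {deg : I → Γ} {ω : I → X} {r : I → ℕ} {ei fi : Fin m → I}
  {χ : 𝔤 →ₗ[F] F}
  {W : Type*} [AddCommGroup W] [Module F W]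
  [Module (RedEnv p ε 𝒱 χ 𝔤) W] [IsScalarTower F (RedEnv p ε 𝒱 χ 𝔤) W]

/-- Exchange the two factors: `x_j x_i z` vanishes, and the bracket is a combination of basis
vectors of weight `ω i + ω j`. -/
theorem RootData.smul_smul_eq_zero (d : RootData p ε 𝒱 𝔤 Φ P Φ₁ δ bs deg ω r ei fi) {i j : I}
    {z : W} (hi : RedEnv.ι p ε 𝒱 χ 𝔤 (bs i) • z = 0)
    (h : ∀ k, ω k = ω i + ω j → RedEnv.ι p ε 𝒱 χ 𝔤 (bs k) • z = 0) :
    RedEnv.ι p ε 𝒱 χ 𝔤 (bs i) • RedEnv.ι p ε 𝒱 χ 𝔤 (bs j) • z = 0 := by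
  rw [← mul_smul, RedEnv.ι_mul_ι (d.family.mem_homEnd i) (d.family.mem_homEnd j)
    (z := d.family.br i j) rfl, add_smul, smul_assoc, mul_smul, hi, smul_zero, smul_zero, zero_add]
  have h3 : (d.family.br i j : 𝔤) ∈ Submodule.span F {x | ∃ k, ω k = ω i + ω j ∧ x = bs k} := by
    have e : (fun i => (bs i : Module.End F V)) '' {k | ω k = ω i + ω j} =
        𝔤.subtype '' {x | ∃ k, ω k = ω i + ω j ∧ x = bs k} := by
      ext y
      simp only [Set.mem_image, Set.mem_ofPred_eq]
      constructor
      · rintro ⟨k, hk, rfl⟩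
        exact ⟨bs k, ⟨k, hk, rfl⟩, rfl⟩
      · rintro ⟨_, ⟨k, hk, rfl⟩, rfl⟩
        exact ⟨k, hk, rfl⟩
    have h4 := d.bracket_mem i j
    rw [e, ← Submodule.map_span] at h4
    obtain ⟨y, hy, hy'⟩ := h4
    obtain rfl : y = d.family.br i j := Subtype.ext hy'
    exact hy
  generalize d.family.br i j = y at h3
  induction h3 using Submodule.span_induction with
  | mem x hx =>
    obtain ⟨k, hk, rfl⟩ := hx
    exact h k hk
  | zero => rw [map_zero, zero_smul]
  | add x y _ _ hx hy => rw [map_add, add_smul, hx, hy, add_zero]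
  | smul c x _ hx => rw [map_smul, smul_assoc, hx, smul_zero]

theorem RootData.eq_ei (d : RootData p ε 𝒱 𝔤 Φ P Φ₁ δ bs deg ω r ei fi) {k : I} {l : Fin m}
    (h : ω k = δ l) : k = ei l :=
  d.inj _ _ (by rw [h, d.weight_e]) (by rw [h]; exact d.fp.delta_ne_zero d.pos l)

theorem RootData.rank_e (d : RootData p ε 𝒱 𝔤 Φ P Φ₁ δ bs deg ω r ei fi) (j : Fin m) :
    r (ei j) = m + 2 :=
  d.rank_eq_of_pos (by rw [d.weight_e]; exact d.fp.mem_pos j)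

/-- The Levi part normalizes the span of the `e_j`, so it preserves the vectors killed by all of
them. -/
theorem RootData.e_smul_levi_smul (d : RootData p ε 𝒱 𝔤 Φ P Φ₁ δ bs deg ω r ei fi) {i : I}
    (hi : ω i ∈ Φ₁ ∨ ω i = 0) {z : W} (hz : ∀ j, RedEnv.ι p ε 𝒱 χ 𝔤 (bs (ei j)) • z = 0)
    (j : Fin m) :
    RedEnv.ι p ε 𝒱 χ 𝔤 (bs (ei j)) • RedEnv.ι p ε 𝒱 χ 𝔤 (bs i) • z = 0 := by
  refine d.smul_smul_eq_zero (hz j) fun k hk => ?_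
  rw [d.weight_e] at hk
  rcases hi with hi | hi
  · have h0 : ω k ≠ 0 := by
      intro h
      rw [h] at hk
      have : ω i = -δ j := (neg_eq_of_add_eq_zero_right hk.symm).symm
      exact d.fp.neg_notMem_levi d.pos j (this ▸ hi)
    have h1 := d.mem_roots k h0
    rw [hk, add_comm] at h1
    obtain ⟨l, hl⟩ := d.fp.levi_add_delta d.pos d.neg_mem hi h1
    rw [add_comm, hl] at hk
    rw [d.eq_ei hk]
    exact hz l
  · rw [hi, add_zero] at hk
    rw [d.eq_ei hk]
    exact hz j

end Commutator

/-! ### A nonzero value implies simplicity. -/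

section InducedData

variable {Γ F V I X : Type*} [AddCommGroup Γ] [Field F] [AddCommGroup V] [Module F V]
  [LinearOrder I] [AddCommGroup X]
  {p : ℕ} {ε : Bicharacter Γ F} {𝒱 : Γ → Submodule F V}
  {𝔤 : Submodule F (Module.End F V)} {Φ P Φ₁ : Set X} {m : ℕ} {δ : Fin m → X}
  {bs : Module.Basis I F 𝔤} {deg : I → Γ} {ω : I → X} {r : I → ℕ} {ei fi : Fin m → I}
  {χ : 𝔤 →ₗ[F] F} {S' : Submodule F (Module.End F V)} {hle : S' ≤ 𝔤}
  {M : Type*} [AddCommGroup M] [Module F M] [Module (RedEnv p ε 𝒱 χ S') M]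
  [IsScalarTower F (RedEnv p ε 𝒱 χ S') M]
  {ℳ : Γ → Submodule F M} {W : Type*} [AddCommGroup W] [Module F W]
  [Module (RedEnv p ε 𝒱 χ 𝔤) W] [IsScalarTower F (RedEnv p ε 𝒱 χ 𝔤) W]
  {τ : M →ₗ[F] W} {κ : (Fin m → ℕ) → W →ₗ[F] M}

local notation "𝐱" => (fun i => RedEnv.ι p ε 𝒱 χ 𝔤 (bs i))
local notation "𝒲" => inducedGrade τ (RedEnv.piece p ε 𝒱 χ 𝔤 (homEnd 𝒱)) ℳ

theorem InducedData.of_injective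
    (D : InducedData p ε 𝒱 𝔤 Φ P Φ₁ δ bs deg ω r ei fi χ hle ℳ τ κ) : Function.Injective τ :=
  (injective_iff_map_eq_zero τ).2 fun x hx => by
    by_contra h
    exact D.of_ne_zero h hx

/-- The root vectors `e_{δ_j}` annihilate `M`. -/
theorem InducedData.e_smul_of
    (D : InducedData p ε 𝒱 𝔤 Φ P Φ₁ δ bs deg ω r ei fi χ hle ℳ τ κ)
    (hsimple : IsGradedSimple (RedEnv p ε 𝒱 χ S') ℳ) {v : M} (hv0 : v ≠ 0)
    (hv : ∀ j, RedEnv.ι p ε 𝒱 χ 𝔤 (bs (ei j)) • τ v = 0) (j : Fin m) (x : M) :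
    RedEnv.ι p ε 𝒱 χ 𝔤 (bs (ei j)) • τ x = 0 := by
  have hr : ∀ j, m ≤ r (ei j) := fun j => by rw [D.root.rank_e]; omega
  set L : Fin m → M →ₗ[F] M := fun j =>
    Algebra.lsmul F F M (RedEnv.ι p ε 𝒱 χ S' ⟨bs (ei j), D.mem (hr j)⟩) with hL
  have hmem : ∀ x, x ∈ ⨅ j, LinearMap.ker (L j) ↔
      ∀ j, RedEnv.ι p ε 𝒱 χ 𝔤 (bs (ei j)) • τ x = 0 := by
    intro x
    rw [Submodule.mem_iInf]
    refine forall_congr' fun j => ?_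
    rw [LinearMap.mem_ker, D.smul_of (hr j), map_eq_zero_iff τ D.of_injective]
    rfl
  -- The common kernel is a graded submodule of `M` and contains `v ≠ 0`.
  have key : (⨅ j, LinearMap.ker (L j)) = ⊤ := by
    refine hsimple.eq_top (D.root.parabolic D.span_eq)
      (D.graded.grading.isGradedSub_iInf_ker D.graded.grading.1 (α := fun j => deg (ei j)) ?_) ?_
      ((hmem v).2 hv) hv0
    · intro j γ x hx
      exact D.graded.smul_mem _ _ _ (D.root.family.mem_homEnd _) _ hx
    · intro i u hu
      rw [hmem] at hu ⊢
      intro j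
      have := D.smul_of i.2 u
      show _ • τ (RedEnv.ι p ε 𝒱 χ S' ⟨bs i, D.mem i.2⟩ • u) = 0
      rw [← this]
      rcases D.root.isParabolicWeight i.2 with h | h | ⟨l, h⟩
      · exact D.root.e_smul_levi_smul (.inr h) hu j
      · exact D.root.e_smul_levi_smul (.inl h) hu j
      · rw [D.root.eq_ei h, hu l, smul_zero]
  exact (hmem x).1 (key ▸ Submodule.mem_top) j

theorem InducedData.f_pow_mul_wd [CharP F p]
    (D : InducedData p ε 𝒱 𝔤 Φ P Φ₁ δ bs deg ω r ei fi χ hle ℳ τ κ) (n : Fin m) :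
    ∃ c : F, c ≠ 0 ∧ ∀ (s : ℕ) (k : Fin m → ℕ), (∀ j < n, k j = top p ε deg fi j) →
      RedEnv.ι p ε 𝒱 χ 𝔤 (bs (fi n)) ^ s * wd 𝐱 (fword fi k) =
        c ^ s • wd 𝐱 (fword fi (k + Pi.single n s)) := by
  obtain ⟨c, hc, h⟩ := D.root.f_mul_wd D.three_lt D.chi_f n
  refine ⟨c, hc, fun s => ?_⟩
  induction s with
  | zero => intro k _; simp
  | succ s ih =>
    intro k hk
    rw [pow_succ, mul_assoc, h k hk, mul_smul_comm, ih, smul_smul, ← pow_succ', add_assoc,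
      ← Pi.single_add, add_comm 1 s]
    intro j hj
    rw [Pi.add_apply, hk j hj, Pi.single_eq_of_ne hj.ne, add_zero]

/-- Treat the letters `f_1, f_2, …` in turn. Once the earlier exponents are at the top in all terms,
a power of `f_a` just raises the exponent of `f_a`, up to a nonzero scalar. -/
theorem InducedData.exists_top_prefix [CharP F p]
    (D : InducedData p ε 𝒱 𝔤 Φ P Φ₁ δ bs deg ω r ei fi χ hle ℳ τ κ)
    {N : Submodule (RedEnv p ε 𝒱 χ 𝔤) W} {z : W} (hz : z ∈ N) (hz0 : z ≠ 0) {n : ℕ} (hn : n ≤ m) :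
    ∃ y ∈ N, y ≠ 0 ∧ ∀ k, (∀ j, k j < order p ε deg (fi j)) → κ k y ≠ 0 →
      ∀ j : Fin m, (j : ℕ) < n → k j = top p ε deg fi j := by
  classical
  induction n with
  | zero => exact ⟨z, hz, hz0, by simp⟩
  | succ n ih =>
    obtain ⟨y, hyN, hy0, hy⟩ := ih (by omega)
    set a : Fin m := ⟨n, hn⟩ with ha
    obtain ⟨c, hc, hf⟩ := D.f_pow_mul_wd a
    have hex : ∃ t, ∃ k : Fin m → ℕ, (∀ j, k j < order p ε deg (fi j)) ∧ κ k y ≠ 0 ∧ k a = t := by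
      by_contra! hcon
      exact hy0 (D.eq_zero fun k hk => by
        by_contra h
        exact hcon _ k hk h rfl)
    obtain ⟨k₀, hk₀, hk₀0, hk₀t⟩ := Nat.find_spec hex
    -- The least exponent of `f_a` among the nonzero coordinates. Multiplication by `f_a^{top - t}`
    -- lifts it exactly to the top and kills all terms with a larger exponent.
    set t := Nat.find hex with ht
    have hmin : ∀ k : Fin m → ℕ, (∀ j, k j < order p ε deg (fi j)) → κ k y ≠ 0 → t ≤ k a :=
      fun k hk h => Nat.find_min' hex ⟨k, hk, h, rfl⟩
    have hta : t ≤ top p ε deg fi a := by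
      have := hk₀ a
      rw [hk₀t] at this
      rw [top]; omega
    set s := top p ε deg fi a - t with hs
    have hcoord : ∀ k', κ k' (RedEnv.ι p ε 𝒱 χ 𝔤 (bs (fi a)) ^ s • y) =
        ∑ k ∈ Fintype.piFinset fun j => Finset.range (order p ε deg (fi j)),
          if k' = k + Pi.single a s ∧ k a = t then c ^ s • κ k y else 0 := by
      intro k'
      conv_lhs => rw [D.eq_sum y]
      rw [Finset.smul_sum, map_sum]
      refine Finset.sum_congr rfl fun k hk => ?_
      have hk' : ∀ j, k j < order p ε deg (fi j) :=
        fun j => Finset.mem_range.1 (Fintype.mem_piFinset.1 hk j)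
      by_cases hky : κ k y = 0
      · simp [hky]
      rw [← mul_smul, hf s k fun j hj => hy k hk' hky j hj, smul_assoc, map_smul]
      by_cases hka : k a = t
      · rw [D.coord_wd]
        · by_cases h : k' = k + Pi.single a s
          · rw [if_pos h, if_pos ⟨h, hka⟩]
          · rw [if_neg h, if_neg fun h' => h h'.1, smul_zero]
        · intro j
          by_cases hj : j = a
          · subst hj
            rw [Pi.add_apply, Pi.single_eq_same, hka, hs, Nat.add_sub_cancel' hta]
            exact top_lt D.three_lt _
          · rw [Pi.add_apply, Pi.single_eq_of_ne hj, add_zero]; exact hk' j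
      · rw [if_neg fun h' => hka h'.2, D.root.wd_fword_eq_zero D.three_lt D.chi_f (j := a),
          zero_smul, map_zero, smul_zero]
        have h1 := hmin k hk' hky
        have h2 : order p ε deg (fi a) = top p ε deg fi a + 1 := by
          have := order_pos (ε := ε) (deg := deg) D.three_lt (fi a)
          rw [top]; omega
        rw [Pi.add_apply, Pi.single_eq_same, h2, hs]
        omega
    refine ⟨_, N.smul_mem (RedEnv.ι p ε 𝒱 χ 𝔤 (bs (fi a)) ^ s) hyN, ?_, ?_⟩
    · intro h0
      have := hcoord (k₀ + Pi.single a s)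
      rw [h0, map_zero, Finset.sum_eq_single k₀, if_pos ⟨rfl, hk₀t⟩] at this
      · exact smul_ne_zero (pow_ne_zero s hc) hk₀0 this.symm
      · intro k _ hne
        exact if_neg fun h => hne (add_right_cancel h.1).symm
      · intro h
        exact absurd (Fintype.mem_piFinset.2 fun j => Finset.mem_range.2 (hk₀ j)) h
    · intro k' _ hk'0 j hj
      rw [hcoord] at hk'0
      obtain ⟨k, hkK, hk⟩ := Finset.exists_ne_zero_of_sum_ne_zero hk'0
      have hk' : ∀ j, k j < order p ε deg (fi j) :=
        fun j => Finset.mem_range.1 (Fintype.mem_piFinset.1 hkK j)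
      have hcond : k' = k + Pi.single a s ∧ k a = t := by
        by_contra h; exact hk (if_neg h)
      rw [if_pos hcond] at hk
      rw [hcond.1]
      by_cases hja : j = a
      · subst hja
        rw [Pi.add_apply, Pi.single_eq_same, hcond.2, hs, Nat.add_sub_cancel' hta]
      · rw [Pi.add_apply, Pi.single_eq_of_ne hja, add_zero]
        refine hy k hk' (fun h => hk (by rw [h, smul_zero])) j ?_
        have : (j : ℕ) ≠ n := fun h => hja (Fin.ext h)
        omega

theorem InducedData.exists_top_smul_mem [CharP F p]
    (D : InducedData p ε 𝒱 𝔤 Φ P Φ₁ δ bs deg ω r ei fi χ hle ℳ τ κ)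
    {N : Submodule (RedEnv p ε 𝒱 χ 𝔤) W} (hN : N ≠ ⊥) :
    ∃ x : M, x ≠ 0 ∧ wd 𝐱 (fword fi (top p ε deg fi)) • τ x ∈ N := by
  obtain ⟨z, hz, hz0⟩ := N.ne_bot_iff.1 hN
  obtain ⟨y, hyN, hy0, hy⟩ := D.exists_top_prefix hz hz0 le_rfl
  have h1 : ∀ k, (∀ j, k j < order p ε deg (fi j)) → k ≠ top p ε deg fi → κ k y = 0 := by
    intro k hk hne
    by_contra h
    exact hne (funext fun j => hy k hk h j j.2)
  have e : y = wd 𝐱 (fword fi (top p ε deg fi)) • τ (κ (top p ε deg fi) y) := by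
    conv_lhs => rw [D.eq_sum y]
    refine Finset.sum_eq_single _ (fun k hk hne => ?_) fun h => ?_
    · rw [h1 k (fun j => Finset.mem_range.1 (Fintype.mem_piFinset.1 hk j)) hne, map_zero, smul_zero]
    · exact absurd (Fintype.mem_piFinset.2 fun j => Finset.mem_range.2 (top_lt D.three_lt j)) h
  refine ⟨κ (top p ε deg fi) y, fun h => hy0 ?_, e ▸ hyN⟩
  rw [e, h, map_zero, smul_zero]

theorem InducedData.isGradedSimple_of_smul_eq [CharP F p]
    (D : InducedData p ε 𝒱 𝔤 Φ P Φ₁ δ bs deg ω r ei fi χ hle ℳ τ κ)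
    (hsimple : IsGradedSimple (RedEnv p ε 𝒱 χ S') ℳ) {v : M} (hv0 : v ≠ 0)
    (hv : ∀ j, RedEnv.ι p ε 𝒱 χ 𝔤 (bs (ei j)) • τ v = 0) {a : RedEnv p ε 𝒱 χ 𝔤} {c : F} (hc : c ≠ 0)
    (ha : a • wd 𝐱 (fword fi (top p ε deg fi)) • τ v = c • τ v) :
    IsGradedSimple (RedEnv p ε 𝒱 χ 𝔤) 𝒲 := by
  have hb := D.root.parabolic D.span_eq
  refine ⟨⟨τ v, 0, D.of_ne_zero hv0⟩, fun N hN => ?_⟩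
  by_cases hbot : N = ⊥
  · exact .inl hbot
  right
  obtain ⟨x, hx0, hx⟩ := D.exists_top_smul_mem hbot
  -- The `x` with `f^top τ x ∈ N`: stable under the Levi part because it commutes with `f^top` up to
  -- nonzero scalars and multiples of `f^top`, and under the `e_j` because they kill `M`.
  have h1 : (N.restrictScalars F).comap
      (Algebra.lsmul F F W (wd 𝐱 (fword fi (top p ε deg fi))) ∘ₗ τ) = ⊤ := by
    refine hsimple.eq_top hb (D.graded.grading.isGradedSub_comap D.iSupIndep_grade
      (α := ((fword fi (top p ε deg fi)).map deg).sum) ?_ hN) ?_ (u := x) hx hx0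
    · intro γ x hx
      exact D.wd_smul_mem _ (D.of_mem_grade hx)
    · intro i u hu
      have hu' : wd 𝐱 (fword fi (top p ε deg fi)) • τ u ∈ N := hu
      show wd 𝐱 (fword fi (top p ε deg fi)) • τ (RedEnv.ι p ε 𝒱 χ S' ⟨bs i, D.mem i.2⟩ • u) ∈ N
      rw [← D.smul_of i.2]
      have key : ω i ∈ Φ₁ ∨ ω i = 0 →
          wd 𝐱 (fword fi (top p ε deg fi)) • RedEnv.ι p ε 𝒱 χ 𝔤 (bs i) • τ u ∈ N := by
        intro h
        obtain ⟨c, a', hc, hca, -⟩ := D.root.levi_mul_top D.three_lt D.chi_f h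
        have h1 := congrArg (· • τ u) hca
        simp only [mul_smul, add_smul, smul_assoc] at h1
        have h2 : c • wd 𝐱 (fword fi (top p ε deg fi)) • RedEnv.ι p ε 𝒱 χ 𝔤 (bs i) • τ u ∈
            N.restrictScalars F := by
          rw [eq_sub_of_add_eq h1.symm]
          exact Submodule.sub_mem _ (N.smul_mem _ hu')
            ((N.restrictScalars F).smul_mem a' hu')
        have := (N.restrictScalars F).smul_mem c⁻¹ h2
        rwa [inv_smul_smul₀ hc] at this
      rcases D.root.isParabolicWeight i.2 with h | h | ⟨l, h⟩
      · exact key (.inr h)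
      · exact key (.inl h)
      · rw [D.root.eq_ei h, D.e_smul_of hsimple hv0 hv, smul_zero]
        exact N.zero_mem
  -- Now `f^top τ v ∈ N`, so applying `a` puts `τ v` into `N`.
  have h2 : (N.restrictScalars F).comap τ = ⊤ := by
    refine hsimple.eq_top hb (D.graded.grading.isGradedSub_comap D.iSupIndep_grade
      (α := 0) ?_ hN) ?_ (u := v) ?_ hv0
    · intro γ x hx
      rw [zero_add]
      exact D.of_mem_grade hx
    · intro i u hu
      show τ (RedEnv.ι p ε 𝒱 χ S' ⟨bs i, D.mem i.2⟩ • u) ∈ N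
      rw [← D.smul_of i.2]
      exact N.smul_mem _ hu
    · have h3 : v ∈ (N.restrictScalars F).comap
        (Algebra.lsmul F F W (wd 𝐱 (fword fi (top p ε deg fi))) ∘ₗ τ) := h1 ▸ Submodule.mem_top
      have h4 := N.smul_mem a h3
      have h5 : c • τ v ∈ N.restrictScalars F := ha ▸ h4
      have := (N.restrictScalars F).smul_mem c⁻¹ h5
      rwa [inv_smul_smul₀ hc] at this
  have h3 : (⊤ : Submodule F W) ≤ N.restrictScalars F := by
    rw [← D.induced.span_eq, Submodule.span_le]
    rintro _ ⟨a, x, rfl⟩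
    have : x ∈ (N.restrictScalars F).comap τ := h2 ▸ Submodule.mem_top
    exact N.smul_mem a this
  exact eq_top_iff.2 fun z _ => h3 (Submodule.mem_top : z ∈ (⊤ : Submodule F W))

end InducedData

/-! ### Sorting words by brackets alone. -/

section RootData

variable {Γ F V I X : Type*} [AddCommGroup Γ] [Field F] [AddCommGroup V] [Module F V]
  [LinearOrder I] [AddCommGroup X]
  {p : ℕ} {ε : Bicharacter Γ F} {𝒱 : Γ → Submodule F V}
  {𝔤 : Submodule F (Module.End F V)} {Φ P Φ₁ : Set X} {m : ℕ} {δ : Fin m → X}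
  {bs : Module.Basis I F 𝔤} {deg : I → Γ} {ω : I → X} {r : I → ℕ} {ei fi : Fin m → I}
  {χ : 𝔤 →ₗ[F] F}

theorem RootData.le_of_rank_le (d : RootData p ε 𝒱 𝔤 Φ P Φ₁ δ bs deg ω r ei fi) {i j : I}
    (h : i ≤ j) : r i ≤ r j :=
  not_lt.1 fun h' => absurd (d.lt_of_rank _ _ h') (not_lt.2 h)

/-- Any word in the basis can be sorted modulo shorter words, keeping the weight. -/
theorem RootData.wd_mem_span_sorted [CharP F p] {A : Type*} [Ring A] [Algebra F A]
    (d : RootData p ε 𝒱 𝔤 Φ P Φ₁ δ bs deg ω r ei fi) (hp : 3 < p) (ρ : 𝔤 →ₗ[F] A)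
    (hbr : ∀ i j, ∀ z : 𝔤, (z : Module.End F V) = colorBracket ε (deg i) (deg j) (bs i) (bs j) →
      ρ (bs i) * ρ (bs j) = (ε (deg i) (deg j) : F) • (ρ (bs j) * ρ (bs i)) + ρ z)
    (w : List I) :
    wd (fun i => ρ (bs i)) w ∈ Submodule.span F {x | ∃ u : List I, u.Pairwise (· ≤ ·) ∧
      (u.map ω).sum = (w.map ω).sum ∧ x = wd (fun i => ρ (bs i)) u} := by
  -- With no `p`-th powers to reduce, neither the `p`-map nor the linear function enters.
  have h := d.family.wd_mem_normalSpan (RootData.two_ne_zero hp) (by omega) ρ hbr Set.univ ω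
    (fun i _ j _ => by simpa using d.bracket_mem i j) (fun _ => False)
    (fun _ _ h => h.elim) w (by simp)
  unfold normalSpan at h
  refine Submodule.span_mono ?_ h
  rintro _ ⟨u, h1, -, h2, rfl⟩
  exact ⟨u, h1.sorted, h2, rfl⟩

/-- A sorted word is of the form `u x` with `x ∈ N⁺`, or it has no letters in `N⁺`. -/
theorem RootData.sorted_cases (d : RootData p ε 𝒱 𝔤 Φ P Φ₁ δ bs deg ω r ei fi) {u : List I}
    (hu : u.Pairwise (· ≤ ·)) :
    (∃ u' i, u = u' ++ [i] ∧ r i = m + 2) ∨ ∀ i ∈ u, r i < m + 2 := by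
  rcases List.eq_nil_or_concat u with rfl | ⟨u', i, rfl⟩
  · simp
  · by_cases hi : r i = m + 2
    · exact .inl ⟨u', i, by simp, hi⟩
    · right
      intro j hj
      have h1 := d.rank_le i
      simp only [List.concat_eq_append, List.mem_append, List.mem_singleton] at hj
      rcases hj with hj | rfl
      · rw [List.concat_eq_append, List.pairwise_append] at hu
        have := d.le_of_rank_le (hu.2.2 j hj i (by simp))
        omega
      · omega

theorem sum_map_mem_closure {Q : Set X} {u : List I} (h : ∀ i ∈ u, ω i ∈ AddSubmonoid.closure Q) :
    (u.map ω).sum ∈ AddSubmonoid.closure Q := by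
  refine AddSubmonoid.list_sum_mem _ fun x hx => ?_
  obtain ⟨i, hi, rfl⟩ := List.mem_map.1 hx
  exact h i hi

end RootData

/-! ### The value zero excludes simplicity. -/

section InducedData

variable {Γ F V I X : Type*} [AddCommGroup Γ] [Field F] [AddCommGroup V] [Module F V]
  [LinearOrder I] [AddCommGroup X]
  {p : ℕ} {ε : Bicharacter Γ F} {𝒱 : Γ → Submodule F V}
  {𝔤 : Submodule F (Module.End F V)} {Φ P Φ₁ : Set X} {m : ℕ} {δ : Fin m → X}
  {bs : Module.Basis I F 𝔤} {deg : I → Γ} {ω : I → X} {r : I → ℕ} {ei fi : Fin m → I}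
  {χ : 𝔤 →ₗ[F] F} {S' : Submodule F (Module.End F V)} {hle : S' ≤ 𝔤}
  {M : Type*} [AddCommGroup M] [Module F M] [Module (RedEnv p ε 𝒱 χ S') M]
  {ℳ : Γ → Submodule F M} {W : Type*} [AddCommGroup W] [Module F W]
  [Module (RedEnv p ε 𝒱 χ 𝔤) W] [IsScalarTower F (RedEnv p ε 𝒱 χ 𝔤) W]
  {τ : M →ₗ[F] W} {κ : (Fin m → ℕ) → W →ₗ[F] M}

local notation "𝐱" => (fun i => RedEnv.ι p ε 𝒱 χ 𝔤 (bs i))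
local notation "𝒲" => inducedGrade τ (RedEnv.piece p ε 𝒱 χ 𝔤 (homEnd 𝒱)) ℳ

/-- Only the empty monomial has a component in `M`, and its weight is 0. -/
theorem InducedData.coord_zero_fSpan_smul
    (D : InducedData p ε 𝒱 𝔤 Φ P Φ₁ δ bs deg ω r ei fi χ hle ℳ τ κ) {μ : X} (hμ : μ ≠ 0)
    {y : RedEnv p ε 𝒱 χ 𝔤} (hy : y ∈ fSpan p ε 𝒱 χ bs deg δ fi m μ) (x : M) :
    κ 0 (y • τ x) = 0 := by
  unfold fSpan at hy
  induction hy using Submodule.span_induction with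
  | mem y hy =>
    obtain ⟨k, hk, -, hsum, rfl⟩ := hy
    rw [D.coord_wd 0 k x hk, if_neg]
    rintro rfl
    exact hμ (by rw [hsum]; simp)
  | zero => rw [zero_smul, map_zero]
  | add a b _ _ ha hb => rw [add_smul, map_add, ha, hb, add_zero]
  | smul c a _ ha => rw [smul_assoc, map_smul, ha, smul_zero]

theorem InducedData.coord_zero_smul_eq_zero
    (D : InducedData p ε 𝒱 𝔤 Φ P Φ₁ δ bs deg ω r ei fi χ hle ℳ τ κ) {a : RedEnv p ε 𝒱 χ 𝔤} {z : W}
    (h : ∀ k, (∀ j, k j < order p ε deg (fi j)) → κ 0 (a • wd 𝐱 (fword fi k) • τ (κ k z)) = 0) :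
    κ 0 (a • z) = 0 := by
  rw [D.eq_sum z, Finset.smul_sum, map_sum]
  exact Finset.sum_eq_zero fun k hk =>
    h k fun j => Finset.mem_range.1 (Fintype.mem_piFinset.1 hk j)

theorem InducedData.coord_zero_f_smul [CharP F p]
    (D : InducedData p ε 𝒱 𝔤 Φ P Φ₁ δ bs deg ω r ei fi χ hle ℳ τ κ) (a : Fin m) (z : W) :
    κ 0 (RedEnv.ι p ε 𝒱 χ 𝔤 (bs (fi a)) • z) = 0 := by
  refine D.coord_zero_smul_eq_zero fun k _ => ?_
  rw [← mul_smul]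
  refine D.coord_zero_fSpan_smul ?_ (D.root.f_mul_mem_fSpan D.three_lt D.chi_f a k) _
  rw [← neg_add, neg_ne_zero]
  exact D.root.pos.add_ne_zero (D.root.fp.mem_pos a)
    (sum_nsmul_mem_closure _ fun j _ => D.root.fp.mem_pos j)

/-- Commuting a Levi or torus element past a nonempty monomial never leaves the empty one, since a
root of `Φ₁` or 0 is not a nonzero combination of the `δ_j` with nonnegative coefficients. -/
theorem InducedData.coord_zero_levi_smul [CharP F p]
    (D : InducedData p ε 𝒱 𝔤 Φ P Φ₁ δ bs deg ω r ei fi χ hle ℳ τ κ) {i : I} (hr : m ≤ r i)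
    (hi : ω i ∈ Φ₁ ∨ ω i = 0) {z : W} (hz : κ 0 z = 0) :
    κ 0 (RedEnv.ι p ε 𝒱 χ 𝔤 (bs i) • z) = 0 := by
  refine D.coord_zero_smul_eq_zero fun k hk => ?_
  by_cases hk0 : k = 0
  · rw [hk0, hz, map_zero, smul_zero, smul_zero, map_zero]
  obtain ⟨c, -, h⟩ := D.root.commute_fword_of_levi D.three_lt D.chi_f hi k
  have h1 := D.coord_zero_fSpan_smul (by
    rw [← sub_eq_add_neg, sub_ne_zero]
    rcases hi with hi | hi
    · exact (D.root.fp.sum_ne_levi D.root.pos hi (D.root.neg_mem _ (D.root.fp.subsystem.1 hi)) k).symm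
    · rw [hi]
      intro h
      exact D.root.fp.sum_add_ne_zero D.root.pos hk0 (AddSubmonoid.zero_mem _)
        (by rw [add_zero]; exact h.symm)) h (κ k z)
  rw [sub_smul, smul_assoc, mul_smul, mul_smul, D.smul_of hr, map_sub,
    (κ 0).map_smul c, D.coord_wd 0 k _ hk, if_neg (Ne.symm hk0), smul_zero, sub_zero] at h1
  exact h1

theorem InducedData.map_smul_mem
    (D : InducedData p ε 𝒱 𝔤 Φ P Φ₁ δ bs deg ω r ei fi χ hle ℳ τ κ) {U : Submodule F W}
    (hU : ∀ i, m ≤ r i → ∀ u ∈ U, RedEnv.ι p ε 𝒱 χ 𝔤 (bs i) • u ∈ U) (b : RedEnv p ε 𝒱 χ S') {u : W}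
    (hu : u ∈ U) : RedEnv.map p ε 𝒱 χ hle b • u ∈ U := by
  have hb := D.root.parabolic D.span_eq
  have ha : b ∈ Submodule.span F _ := hb.span_wd (χ := χ) ▸ Submodule.mem_top
  induction ha using Submodule.span_induction with
  | mem a ha =>
    obtain ⟨w, rfl⟩ := ha
    induction w with
    | nil => simpa using hu
    | cons i w ih =>
      rw [wd_cons, map_mul, mul_smul, RedEnv.map_ι]
      exact hU i i.2 _ ih
  | zero => rw [map_zero, zero_smul]; exact U.zero_mem
  | add x y _ _ hx hy => rw [map_add, add_smul]; exact U.add_mem hx hy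
  | smul c x _ hx => rw [map_smul, smul_assoc]; exact U.smul_mem _ hx

/-- The vectors without component in `M` that are killed by all `e_j` form a `P₀`-stable space. A
general element of the algebra is a sum of words in the `f_j` times elements of `u_χ(P₀)`, and the
image of an `f_j` has no component in `M`. -/
theorem InducedData.coord_zero_of_mem_span [CharP F p] [Fact p.Prime]
    (D : InducedData p ε 𝒱 𝔤 Φ P Φ₁ δ bs deg ω r ei fi χ hle ℳ τ κ) {z : W} (hz : κ 0 z = 0)
    (he : ∀ j, RedEnv.ι p ε 𝒱 χ 𝔤 (bs (ei j)) • z = 0) (a : RedEnv p ε 𝒱 χ 𝔤) :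
    κ 0 (a • z) = 0 := by
  set U : Submodule F W := LinearMap.ker (κ 0) ⊓
    ⨅ j, LinearMap.ker (Algebra.lsmul F F W (RedEnv.ι p ε 𝒱 χ 𝔤 (bs (ei j)))) with hUdef
  have hmem : ∀ y, y ∈ U ↔ κ 0 y = 0 ∧ ∀ j, RedEnv.ι p ε 𝒱 χ 𝔤 (bs (ei j)) • y = 0 := by
    intro y
    rw [hUdef, Submodule.mem_inf, Submodule.mem_iInf]
    rfl
  have hU : ∀ i, m ≤ r i → ∀ u ∈ U, RedEnv.ι p ε 𝒱 χ 𝔤 (bs i) • u ∈ U := by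
    intro i hi u hu
    rw [hmem] at hu ⊢
    have key : ω i ∈ Φ₁ ∨ ω i = 0 → κ 0 (RedEnv.ι p ε 𝒱 χ 𝔤 (bs i) • u) = 0 ∧
        ∀ j, RedEnv.ι p ε 𝒱 χ 𝔤 (bs (ei j)) • RedEnv.ι p ε 𝒱 χ 𝔤 (bs i) • u = 0 := fun h =>
      ⟨D.coord_zero_levi_smul hi h hu.1, D.root.e_smul_levi_smul h hu.2⟩
    rcases D.root.isParabolicWeight hi with h | h | ⟨l, h⟩
    · exact key (.inr h)
    · exact key (.inl h)
    · rw [D.root.eq_ei h, hu.2 l]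
      exact ⟨map_zero _, fun j => smul_zero _⟩
  have hb := D.root.parabolic D.span_eq
  have hspan := D.root.family.span_wd_mul_map D.three_lt χ (D.root.isUpperSet m) hle hb
  have ha : a ∈ Submodule.span F _ := hspan.symm ▸ Submodule.mem_top
  induction ha using Submodule.span_induction with
  | mem a ha =>
    obtain ⟨u, s, h1, h2, rfl⟩ := ha
    have h3 := D.map_smul_mem hU s ((hmem z).2 ⟨hz, he⟩)
    rw [mul_smul]
    cases u with
    | nil => rw [wd_nil, one_smul]; exact ((hmem _).1 h3).1
    | cons i u =>
      obtain ⟨j, rfl⟩ := D.root.rank_lt i (not_le.1 (h2 i List.mem_cons_self))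
      rw [wd_cons, mul_smul]
      exact D.coord_zero_f_smul j _
  | zero => rw [zero_smul, map_zero]
  | add x y _ _ hx hy => rw [add_smul, map_add, hx, hy, add_zero]
  | smul c x _ hx => rw [smul_assoc, map_smul, hx, smul_zero]

/-- The submodule generated by `z` is nonzero and graded, and it does not contain `τ v`, whose
component in `M` is `v`. -/
theorem InducedData.not_isGradedSimple [CharP F p] [Fact p.Prime]
    (D : InducedData p ε 𝒱 𝔤 Φ P Φ₁ δ bs deg ω r ei fi χ hle ℳ τ κ) {z : W} (hz : κ 0 z = 0)
    (he : ∀ j, RedEnv.ι p ε 𝒱 χ 𝔤 (bs (ei j)) • z = 0) {γ : Γ} (hγ : z ∈ 𝒲 γ) (hz0 : z ≠ 0)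
    {v : M} (hv0 : v ≠ 0) : ¬ IsGradedSimple (RedEnv p ε 𝒱 χ 𝔤) 𝒲 := by
  intro h
  rcases h.2 _ (D.isGradedSub_span_singleton hγ) with h1 | h1
  · exact hz0 (Submodule.span_singleton_eq_bot.1 h1)
  · have h2 : τ v ∈ Submodule.span (RedEnv p ε 𝒱 χ 𝔤) {z} := h1 ▸ Submodule.mem_top
    obtain ⟨a, ha⟩ := Submodule.mem_span_singleton.1 h2
    refine hv0 ?_
    rw [← D.coord_zero_of v, ← ha, D.coord_zero_of_mem_span hz he]

/-- One step back in the chain of positive systems: take the last nonzero `e_n^s z`. If `β ≠ δ_n` is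
positive in the earlier system and `β + δ_n` is a root, then it is again positive and different from
`δ_n`. So the root vector of `β` still kills. -/
theorem InducedData.exists_e_pow_smul [CharP F p]
    (D : InducedData p ε 𝒱 𝔤 Φ P Φ₁ δ bs deg ω r ei fi χ hle ℳ τ κ) (n : Fin m) {z : W} (hz0 : z ≠ 0)
    (hz : ∀ k, ω k ∈ fpSet P Φ₁ δ (n + 1) → RedEnv.ι p ε 𝒱 χ 𝔤 (bs k) • z = 0) :
    ∃ s < order p ε deg (ei n), RedEnv.ι p ε 𝒱 χ 𝔤 (bs (ei n)) ^ s • z ≠ 0 ∧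
      ∀ k, ω k ∈ fpSet P Φ₁ δ n →
        RedEnv.ι p ε 𝒱 χ 𝔤 (bs k) • RedEnv.ι p ε 𝒱 χ 𝔤 (bs (ei n)) ^ s • z = 0 := by
  classical
  have hQ := D.root.fp.positive n n.2.le
  have hδ : δ n ∈ fpSet P Φ₁ δ n := .inr ⟨n, le_rfl, rfl⟩
  have h1 : ∀ s k, ω k ∈ fpSet P Φ₁ δ n → ω k ≠ δ n →
      RedEnv.ι p ε 𝒱 χ 𝔤 (bs k) • RedEnv.ι p ε 𝒱 χ 𝔤 (bs (ei n)) ^ s • z = 0 := by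
    intro s
    induction s with
    | zero =>
      intro k hk hne
      rw [pow_zero, one_smul]
      exact hz k (IsFPTriple.mem_succ hk hne)
    | succ s ih =>
      intro k hk hne
      rw [pow_succ', mul_smul]
      refine D.root.smul_smul_eq_zero (ih k hk hne) fun l hl => ?_
      rw [D.root.weight_e] at hl
      have h0 : ω l ≠ 0 := by
        rw [hl]
        exact hQ.add_ne_zero hk (AddSubmonoid.subset_closure hδ)
      have h2 := D.root.mem_roots l h0
      refine ih l ?_ ?_
      · rw [hl] at h2 ⊢
        exact hQ.mem_of_add_mem hk (AddSubmonoid.subset_closure hδ) h2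
      · rw [hl, Ne, add_eq_right]
        exact hQ.ne_zero (hQ.subset hk)
  have hex : ∃ s, RedEnv.ι p ε 𝒱 χ 𝔤 (bs (ei n)) ^ s • z = 0 :=
    ⟨_, by rw [D.root.e_pow_eq_zero D.three_lt D.chi_e n, zero_smul]⟩
  have hpos : Nat.find hex ≠ 0 := by
    intro h
    have := Nat.find_spec hex
    rw [h, pow_zero, one_smul] at this
    exact hz0 this
  have hle : Nat.find hex ≤ order p ε deg (ei n) :=
    Nat.find_min' hex (by rw [D.root.e_pow_eq_zero D.three_lt D.chi_e n, zero_smul])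
  refine ⟨Nat.find hex - 1, by omega, Nat.find_min hex (by omega), fun k hk => ?_⟩
  by_cases hne : ω k = δ n
  · rw [D.root.eq_ei hne, ← mul_smul, ← pow_succ', Nat.sub_add_cancel (by omega)]
    exact Nat.find_spec hex
  · exact h1 _ k hk hne

/-- The chain is run from its last positive system to `P`, applying `e_m` first and `e_1` last. -/
theorem InducedData.exists_e_word [CharP F p]
    (D : InducedData p ε 𝒱 𝔤 Φ P Φ₁ δ bs deg ω r ei fi χ hle ℳ τ κ) {z : W} (hz0 : z ≠ 0)
    (hz : ∀ k, ω k ∈ fpSet P Φ₁ δ m → RedEnv.ι p ε 𝒱 χ 𝔤 (bs k) • z = 0) :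
    ∃ s : Fin m → ℕ, (∀ j, s j < order p ε deg (ei j)) ∧ wd 𝐱 (fword ei s) • z ≠ 0 ∧
      ∀ k, ω k ∈ fpSet P Φ₁ δ 0 → RedEnv.ι p ε 𝒱 χ 𝔤 (bs k) • wd 𝐱 (fword ei s) • z = 0 := by
  have key : ∀ n, ∀ hn : n ≤ m, ∃ s : Fin m → ℕ, (∀ j, s j < order p ε deg (ei j)) ∧
      (∀ j : Fin m, (j : ℕ) < m - n → s j = 0) ∧ wd 𝐱 (fword ei s) • z ≠ 0 ∧
      ∀ k, ω k ∈ fpSet P Φ₁ δ (m - n) →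
        RedEnv.ι p ε 𝒱 χ 𝔤 (bs k) • wd 𝐱 (fword ei s) • z = 0 := by
    intro n
    induction n with
    | zero =>
      intro _
      refine ⟨0, fun j => order_pos D.three_lt _, fun _ _ => rfl, ?_, ?_⟩
      · rwa [fword_zero, wd_nil, one_smul]
      · intro k hk
        rw [fword_zero, wd_nil, one_smul]
        exact hz k hk
    | succ n ih =>
      intro hn
      obtain ⟨s, hs, hs0, h1, h2⟩ := ih (by omega)
      set a : Fin m := ⟨m - (n + 1), by omega⟩ with ha
      -- Indices start at 0, so the letter that leads back from the system `m - n` is number `m - n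
      -- - 1`.
      have ha' : (a : ℕ) + 1 = m - n := by rw [ha]; show m - (n + 1) + 1 = m - n; omega
      obtain ⟨t, ht, h3, h4⟩ := D.exists_e_pow_smul a h1 (by rw [ha']; exact h2)
      have e : wd 𝐱 (fword ei (Pi.single a t + s)) =
          RedEnv.ι p ε 𝒱 χ 𝔤 (bs (ei a)) ^ t * wd 𝐱 (fword ei s) := by
        rw [fword_append, fword_single, wd_append, wd_replicate]
        intro i j hi hj
        have hia : i = a := by
          by_contra h; exact hi (Pi.single_eq_of_ne h _)
        subst hia
        by_contra h
        exact hj (hs0 j (by rw [← ha']; have := Fin.lt_def.1 (not_le.1 h); omega))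
      refine ⟨Pi.single a t + s, fun j => ?_, fun j hj => ?_, ?_, ?_⟩
      · by_cases hj : j = a
        · subst hj
          rw [Pi.add_apply, Pi.single_eq_same, hs0 a (by omega), add_zero]
          exact ht
        · rw [Pi.add_apply, Pi.single_eq_of_ne hj, zero_add]
          exact hs j
      · have hja : j ≠ a := by
          rintro rfl
          exact lt_irrefl _ hj
        rw [Pi.add_apply, Pi.single_eq_of_ne hja, zero_add]
        exact hs0 j (by omega)
      · rw [e, mul_smul]; exact h3
      · intro k hk
        rw [e, mul_smul]; exact h4 k hk
  obtain ⟨s, h1, -, h2, h3⟩ := key m le_rfl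
  rw [Nat.sub_self] at h3
  exact ⟨s, h1, h2, h3⟩

/-- The component in `M` of a vector whose weight differs from that of `v` by a nonzero negative
combination of the `δ_j`. -/
theorem InducedData.coord_zero_wd_smul [CharP F p]
    (D : InducedData p ε 𝒱 𝔤 Φ P Φ₁ δ bs deg ω r ei fi χ hle ℳ τ κ) {v : M}
    (hv : ∀ i, r i = m + 2 → RedEnv.ι p ε 𝒱 χ 𝔤 (bs i) • τ v = 0) {w : List I} {t : Fin m → ℕ}
    (ht : t ≠ 0) (hw : (w.map ω).sum = -∑ j, t j • δ j) : κ 0 (wd 𝐱 w • τ v) = 0 := by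
  have h := D.root.wd_mem_span_sorted D.three_lt (RedEnv.ι p ε 𝒱 χ 𝔤)
    (fun i j z hz => RedEnv.ι_mul_ι (D.root.family.mem_homEnd i) (D.root.family.mem_homEnd j) hz) w
  generalize wd 𝐱 w = x at h
  induction h using Submodule.span_induction with
  | mem x hx =>
    obtain ⟨u, h1, h2, rfl⟩ := hx
    rcases D.root.sorted_cases h1 with ⟨u', i, rfl, hi⟩ | h3
    · rw [wd_append, mul_smul]
      simp [hv i hi]
    · cases u with
      | nil =>
        exfalso
        refine D.root.fp.sum_add_ne_zero D.root.pos ht (AddSubmonoid.zero_mem _) ?_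
        rw [add_zero, ← neg_eq_zero, ← hw, ← h2]
        rfl
      | cons i u =>
        by_cases hi : r i < m
        · obtain ⟨j, rfl⟩ := D.root.rank_lt i hi
          rw [wd_cons, mul_smul]
          exact D.coord_zero_f_smul j _
        · exfalso
          rw [List.pairwise_cons] at h1
          have h4 : ∀ j ∈ i :: u, -ω j ∈ AddSubmonoid.closure (Φ₁ ∩ P) := by
            intro j hj
            have h5 : m ≤ r j := by
              rcases List.mem_cons.1 hj with rfl | hj
              · exact not_lt.1 hi
              · exact (not_lt.1 hi).trans (D.root.le_of_rank_le (h1.1 j hj))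
            have h6 := h3 j hj
            rcases (by omega : r j = m ∨ r j = m + 1) with h7 | h7
            · obtain ⟨h8, h9⟩ := D.root.rank_levi j h7
              exact AddSubmonoid.subset_closure ⟨D.root.fp.neg_mem_levi h8 (D.root.pos.subset h9), h9⟩
            · rw [D.root.rank_torus j h7, neg_zero]
              exact AddSubmonoid.zero_mem _
          have h5 := sum_map_mem_closure (ω := fun j => -ω j) h4
          refine D.root.fp.sum_ne ht h5 ?_
          have h6 : ∀ l : List I, (l.map fun j => -ω j).sum = -(l.map ω).sum := by
            intro l
            induction l with
            | nil => simp
            | cons a l ih => rw [List.map_cons, List.sum_cons, ih, List.map_cons, List.sum_cons, neg_add]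
          rw [h6, h2, hw, neg_neg]
  | zero => rw [zero_smul, map_zero]
  | add a b _ _ ha hb => rw [add_smul, map_add, ha, hb, add_zero]
  | smul c a _ ha => rw [smul_assoc, map_smul, ha, smul_zero]

/-- The vector `f^top τ v` is killed by the last positive system, so the chain of `e_j` yields a
nonzero vector killed by `N⁺`. Its weight is strictly below that of `τ v`, hence it has no component
in `M`. -/
theorem InducedData.not_isGradedSimple_of_smul_eq_zero [CharP F p] [Fact p.Prime]
    (D : InducedData p ε 𝒱 𝔤 Φ P Φ₁ δ bs deg ω r ei fi χ hle ℳ τ κ)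
    (hord : ∀ j, order p ε deg (ei j) = order p ε deg (fi j)) {v : M} (hv0 : v ≠ 0)
    {γ : Γ} (hγ : v ∈ ℳ γ) (hv : ∀ i, r i = m + 2 → RedEnv.ι p ε 𝒱 χ 𝔤 (bs i) • τ v = 0)
    (h : wd 𝐱 (fword ei (top p ε deg ei)) • wd 𝐱 (fword fi (top p ε deg fi)) • τ v = 0) :
    ¬ IsGradedSimple (RedEnv p ε 𝒱 χ 𝔤) 𝒲 := by
  obtain ⟨s, hs, h1, h2⟩ := D.exists_e_word
    (z := wd 𝐱 (fword fi (top p ε deg fi)) • τ v) (by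
      intro h0
      have := D.coord_wd (top p ε deg fi) _ v (top_lt D.three_lt)
      rw [h0, map_zero, if_pos rfl] at this
      exact hv0 this.symm) (by
      rintro k ((hk | ⟨j, -, hk⟩) | ⟨j, hj, -⟩)
      · obtain ⟨c, a, -, h1, h2⟩ := D.root.levi_mul_top D.three_lt D.chi_f (.inl hk.1)
        rw [← mul_smul, h1, h2 hk.1, zero_smul, add_zero, smul_assoc, mul_smul,
          hv k (D.root.rank_eq_of_pos hk.2), smul_zero, smul_zero]
      · rw [D.root.rank_of_weight hk, ← mul_smul, D.root.f_mul_top D.three_lt D.chi_f, zero_smul]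
      · exact absurd j.2 (not_lt.2 hj))
  have hle : ∀ j, s j ≤ top p ε deg fi j := fun j => by
    have := hs j
    rw [hord] at this
    rw [top]; omega
  -- Otherwise the vector found would be `e^top f^top τ v`, which is zero by `h`.
  have hne : (fun j => top p ε deg fi j - s j) ≠ 0 := by
    intro h0
    refine h1 ?_
    have : s = top p ε deg ei := by
      funext j
      have h3 := congrFun h0 j
      have h4 := hle j
      simp only [Pi.zero_apply] at h3
      have h5 : top p ε deg ei j = top p ε deg fi j := by rw [top, top, hord]
      omega
    rw [this]; exact h
  refine D.not_isGradedSimple (z := wd 𝐱 (fword ei s) • wd 𝐱 (fword fi (top p ε deg fi)) • τ v)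
    ?_ ?_ (D.wd_smul_mem _ (D.wd_smul_mem _ (D.of_mem_grade hγ))) h1 hv0
  · rw [← mul_smul, ← wd_append]
    refine D.coord_zero_wd_smul hv hne ?_
    rw [List.map_append, List.sum_append, D.root.sum_fword, sum_map_fword]
    simp only [D.root.weight_e]
    rw [← sum_nsmul_sub hle]
    abel
  · intro j
    refine h2 _ ?_
    rw [D.root.weight_e]
    exact .inr ⟨j, Nat.zero_le _, rfl⟩

end InducedData

/-! ### The Harish-Chandra projection and the action on maximal vectors. -/

theorem smul_sub_smul_mem {F A W : Type*} [Field F] [Ring A] [Algebra F A] [AddCommGroup W]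
    [Module F W] [Module A W] [IsScalarTower F A W] {N : Submodule A W} (c : F) {x y : W}
    (h : x - y ∈ N) : c • x - c • y ∈ N := by
  rw [← smul_sub]
  exact (N.restrictScalars F).smul_mem c h

/-- The coefficient of the empty word. -/
theorem IsHomFamily.exists_projection {Γ F V I : Type*} [AddCommGroup Γ] [Field F] [AddCommGroup V]
    [Module F V] [LinearOrder I] {p : ℕ} {ε : Bicharacter Γ F} {𝒱 : Γ → Submodule F V}
    {𝔤 S' : Submodule F (Module.End F V)} {bs : Module.Basis I F 𝔤} {deg : I → Γ}
    [CharP F p] [Fact p.Prime] (hp : 3 < p) (h𝒱 : IsGrading 𝒱)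
    (hb : IsHomFamily p ε 𝒱 𝔤 (fun i => (bs i : Module.End F V)) deg) (χ : 𝔤 →ₗ[F] F)
    (hχ : ∀ i, χ (bs i) ≠ 0 → deg i = 0) {J : Set I} (hJ : IsUpperSet J) (hS' : S' ≤ 𝔤)
    (hb' : IsHomFamily p ε 𝒱 S' (fun i : J => (bs i : Module.End F V)) (fun i : J => deg i)) :
    ∃ κ : RedEnv p ε 𝒱 χ 𝔤 →ₗ[F] RedEnv p ε 𝒱 χ S',
      (∀ a b, κ (a * RedEnv.map p ε 𝒱 χ hS' b) = κ a * b) ∧ κ 1 = 1 := by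
  obtain ⟨κ₀, hκ₀⟩ := hb.exists_coeff hp h𝒱 χ hχ hJ hS' hb'
  refine ⟨κ₀ [], fun a b => ?_, ?_⟩
  · have hspan := hb.span_wd_mul_map hp χ hJ hS' hb'
    have ha : a ∈ Submodule.span F _ := hspan.symm ▸ Submodule.mem_top
    induction ha using Submodule.span_induction with
    | mem a ha =>
      obtain ⟨u', s, h1, h2, rfl⟩ := ha
      rw [mul_assoc, ← map_mul, hκ₀ _ _ h1 h2, hκ₀ _ _ h1 h2]
      split_ifs <;> simp
    | zero => simp
    | add x y _ _ hx hy => rw [add_mul, map_add, map_add, hx, hy, add_mul]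
    | smul c x _ hx => rw [smul_mul_assoc, map_smul, map_smul, hx, smul_mul_assoc]
  · have := hκ₀ [] [] (normal_iff.2 ⟨List.Pairwise.nil, by simp, by simp; omega⟩) (by simp) 1
    rwa [map_one, mul_one, if_pos rfl, wd_nil] at this

section RootData

variable {Γ F V I X : Type*} [AddCommGroup Γ] [Field F] [AddCommGroup V] [Module F V]
  [LinearOrder I] [AddCommGroup X]
  {p : ℕ} {ε : Bicharacter Γ F} {𝒱 : Γ → Submodule F V}
  {𝔤 : Submodule F (Module.End F V)} {Φ P Φ₁ : Set X} {m : ℕ} {δ : Fin m → X}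
  {bs : Module.Basis I F 𝔤} {deg : I → Γ} {ω : I → X} {r : I → ℕ} {ei fi : Fin m → I}
  {χ χs : 𝔤 →ₗ[F] F} {H Np : Submodule F (Module.End F V)}

theorem mem_span_basis {J : Set I} {S : Submodule F (Module.End F V)}
    (hS : S = Submodule.span F ((fun i => (bs i : Module.End F V)) '' J)) {x : 𝔤} :
    (x : Module.End F V) ∈ S ↔ x ∈ Submodule.span F (bs '' J) := by
  have e : (fun i => (bs i : Module.End F V)) '' J = 𝔤.subtype '' (bs '' J) := by
    rw [Set.image_image]; rfl
  rw [hS, e, ← Submodule.map_span]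
  constructor
  · rintro ⟨y, hy, hyx⟩
    obtain rfl : y = x := Subtype.ext hyx
    exact hy
  · exact fun h => ⟨x, h, rfl⟩

/-- The projection of `u(𝔤)` onto `u(H)` along the left ideal generated by `N⁺`, on the Borel
subalgebra and its complement. -/
theorem RootData.exists_hc_projection [CharP F p] [Fact p.Prime]
    (d : RootData p ε 𝒱 𝔤 Φ P Φ₁ δ bs deg ω r ei fi) (hp : 3 < p)
    (hdeg : ∀ i, χs (bs i) ≠ 0 → deg i = 0) (hpos : ∀ i, r i = m + 2 → χs (bs i) = 0)
    (hH : H = Submodule.span F ((fun i => (bs i : Module.End F V)) '' {i | ω i = 0})) (hle : H ≤ 𝔤)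
    (hNp : Np = Submodule.span F ((fun i => (bs i : Module.End F V)) '' {i | r i = m + 2})) :
    ∃ g : RedEnv p ε 𝒱 χs 𝔤 →ₗ[F] RedEnv p ε 𝒱 χs H,
      (∀ y, g (RedEnv.map p ε 𝒱 χs hle y) = y) ∧
      ∀ a, ∀ x : 𝔤, (x : Module.End F V) ∈ Np → g (a * RedEnv.ι p ε 𝒱 χs 𝔤 x) = 0 := by
  classical
  set B : Submodule F (Module.End F V) :=
    Submodule.span F ((fun i => (bs i : Module.End F V)) '' {i | m + 1 ≤ r i}) with hB
  have hBle : B ≤ 𝔤 := by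
    rw [hB, Submodule.span_le]
    rintro _ ⟨i, -, rfl⟩
    exact (bs i).2
  have hHB : H ≤ B := by
    rw [hB, hH]
    refine Submodule.span_mono (Set.image_mono ?_)
    intro i hi
    exact (d.rank_eq_of_zero hi).ge
  have hNB : Np ≤ B := by
    rw [hB, hNp]
    refine Submodule.span_mono (Set.image_mono ?_)
    intro i hi
    have : r i = m + 2 := hi
    show m + 1 ≤ r i
    omega
  have hfB := d.borel (S' := B) rfl
  have hfH := d.torus hH
  have hmH : ∀ i, ω i = 0 → (bs i : Module.End F V) ∈ H := fun i hi => hfH.mem ⟨i, hi⟩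
  obtain ⟨κ, hκ, hκ1⟩ := d.family.exists_projection hp d.grading χs hdeg (d.isUpperSet (m + 1)) hBle hfB
  set ρ' : 𝔤 →ₗ[F] RedEnv p ε 𝒱 χs H := bs.constr F fun i =>
    if h : ω i = 0 then RedEnv.ι p ε 𝒱 χs H ⟨bs i, hmH i h⟩ else 0 with hρ'
  have hρb : ∀ i, ρ' (bs i) = if h : ω i = 0 then RedEnv.ι p ε 𝒱 χs H ⟨bs i, hmH i h⟩ else 0 :=
    fun i => bs.constr_basis F _ i
  have hρ0 : ∀ μ : X, μ ≠ 0 → ∀ x : 𝔤, (x : Module.End F V) ∈ Submodule.span F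
      ((fun i => (bs i : Module.End F V)) '' {k | ω k = μ}) → ρ' x = 0 := by
    intro μ hμ x hx
    have hx' := (mem_span_basis rfl).1 hx
    clear hx
    induction hx' using Submodule.span_induction with
    | mem x hx =>
      obtain ⟨i, hi, rfl⟩ := hx
      rw [hρb, dif_neg]
      rw [show ω i = μ from hi]; exact hμ
    | zero => exact map_zero _
    | add x y _ _ hx hy => rw [map_add, hx, hy, add_zero]
    | smul c x _ hx => rw [map_smul, hx, smul_zero]
  have hρH : ∀ x : 𝔤, ∀ hx : (x : Module.End F V) ∈ H, ρ' x = RedEnv.ι p ε 𝒱 χs H ⟨x, hx⟩ := by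
    intro x hx
    have hx' := (mem_span_basis hH).1 hx
    have : ∀ x ∈ Submodule.span F (bs '' {i | ω i = 0}), ∃ hx : (x : Module.End F V) ∈ H,
        ρ' x = RedEnv.ι p ε 𝒱 χs H ⟨x, hx⟩ := by
      intro x hx
      induction hx using Submodule.span_induction with
      | mem x hx =>
        obtain ⟨i, hi, rfl⟩ := hx
        exact ⟨hmH i hi, by rw [hρb]; exact dif_pos hi⟩
      | zero => exact ⟨H.zero_mem, by rw [map_zero]; exact (map_zero _).symm⟩
      | add x y _ _ hx hy =>
        obtain ⟨hx1, hx2⟩ := hx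
        obtain ⟨hy1, hy2⟩ := hy
        exact ⟨H.add_mem hx1 hy1, by rw [map_add, hx2, hy2, ← map_add]; rfl⟩
      | smul c x _ hx =>
        obtain ⟨hx1, hx2⟩ := hx
        exact ⟨H.smul_mem c hx1, by rw [map_smul, hx2, ← map_smul]; rfl⟩
    exact (this x hx').2
  -- The algebra map `u(B) → u(H)` that kills `N⁺`. It exists because weights of `B` add up to zero
  -- only if they are zero, and because `χs` vanishes on `N⁺`.
  obtain ⟨π, hπ⟩ := hfB.exists_lift d.grading χs hBle (ρ' ∘ₗ Submodule.inclusion hBle) (by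
    rintro ⟨i, hi⟩ ⟨j, hj⟩ z hz
    have hbr : ((Submodule.inclusion hBle z : 𝔤) : Module.End F V) ∈ Submodule.span F
        ((fun i => (bs i : Module.End F V)) '' {k | ω k = ω i + ω j}) := by
      have := d.bracket_mem i j
      rw [← hz] at this
      exact this
    show ρ' (bs i) * ρ' (bs j) = (ε (deg i) (deg j) : F) • (ρ' (bs j) * ρ' (bs i)) +
      ρ' (Submodule.inclusion hBle z)
    by_cases h0 : ω i = 0 ∧ ω j = 0
    · rw [h0.1, h0.2, add_zero] at hbr
      rw [hρH (Submodule.inclusion hBle z) (by rw [hH]; exact hbr), hρb, hρb, dif_pos h0.1, dif_pos h0.2]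
      exact RedEnv.ι_mul_ι (d.family.mem_homEnd i) (d.family.mem_homEnd j) hz
    · have hne : ω i + ω j ≠ 0 := by
        have hi' := d.mem_closure (show m + 1 ≤ r i from hi)
        have hj' := d.mem_closure (show m + 1 ≤ r j from hj)
        by_cases hi0 : ω i = 0
        · rw [hi0, zero_add]
          exact fun h => h0 ⟨hi0, h⟩
        · refine d.pos.add_ne_zero (d.rank_pos i ?_) hj'
          have h1 := d.rank_le i
          have h2 : m + 1 ≤ r i := hi
          by_contra h3
          exact hi0 (d.rank_torus i (by omega))
      rw [hρ0 _ hne _ hbr, hρb, hρb]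
      by_cases hi0 : ω i = 0
      · have hj0 : ω j ≠ 0 := fun h => h0 ⟨hi0, h⟩
        rw [dif_neg hj0, mul_zero, zero_mul, smul_zero, add_zero]
      · rw [dif_neg hi0, mul_zero, zero_mul, smul_zero, add_zero]) (by
    rintro ⟨i, hi⟩ ho z hz
    have hpw : ((Submodule.inclusion hBle z : 𝔤) : Module.End F V) ∈ Submodule.span F
        ((fun i => (bs i : Module.End F V)) '' {k | ω k = p • ω i}) := by
      have := d.pow_mem i ho
      have hz' : (z : Module.End F V) = (bs i : Module.End F V) ^ p := hz
      rw [← hz'] at this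
      exact this
    show ρ' (bs i) ^ p = ρ' (Submodule.inclusion hBle z) + algebraMap F _ (χs (bs i) ^ p)
    by_cases h0 : ω i = 0
    · rw [h0, smul_zero] at hpw
      rw [hρH (Submodule.inclusion hBle z) (by rw [hH]; exact hpw), hρb, dif_pos h0]
      exact RedEnv.ι_pow ho (d.family.mem_homEnd i) hz rfl
    · have hr : r i = m + 2 := by
        have h1 := d.rank_le i
        have h2 : m + 1 ≤ r i := hi
        by_contra h3
        exact h0 (d.rank_torus i (by omega))
      have hne : p • ω i ≠ 0 := by
        obtain ⟨n, rfl⟩ : ∃ n, p = n + 1 := ⟨p - 1, by omega⟩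
        rw [succ_nsmul']
        exact d.pos.add_ne_zero (d.rank_pos i hr)
          (AddSubmonoid.nsmul_mem _ (AddSubmonoid.subset_closure (d.rank_pos i hr)) n)
      rw [hρ0 _ hne _ hpw, hρb, dif_neg h0, hpos i hr, zero_pow (by omega), zero_pow (by omega), map_zero,
        add_zero])
  -- As `κ` is right linear over `u(B)`, the image of `a x` is `π(κ a) π(x)`, which is zero for `x`
  -- in `N⁺`.
  refine ⟨π.toLinearMap ∘ₗ κ, fun y => ?_, fun a x hx => ?_⟩
  · have e1 : RedEnv.map p ε 𝒱 χs hle y =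
        RedEnv.map p ε 𝒱 χs hBle (RedEnv.map p ε 𝒱 χs hHB y) := by
      have : RedEnv.map p ε 𝒱 χs hle =
          (RedEnv.map p ε 𝒱 χs hBle).comp (RedEnv.map p ε 𝒱 χs hHB) := by
        refine RedEnv.algHom_ext fun x => ?_
        rw [AlgHom.comp_apply, RedEnv.map_ι, RedEnv.map_ι, RedEnv.map_ι]
        rfl
      rw [this]; rfl
    have e2 := hκ 1 (RedEnv.map p ε 𝒱 χs hHB y)
    rw [one_mul, hκ1, one_mul] at e2
    show π (κ _) = y
    rw [e1, e2]
    have : π.comp (RedEnv.map p ε 𝒱 χs hHB) = AlgHom.id F _ := by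
      refine RedEnv.algHom_ext fun x => ?_
      rw [AlgHom.comp_apply, RedEnv.map_ι, hπ]
      exact hρH _ x.2
    exact DFunLike.congr_fun this y
  · show π (κ _) = 0
    have e : RedEnv.ι p ε 𝒱 χs 𝔤 x =
        RedEnv.map p ε 𝒱 χs hBle (RedEnv.ι p ε 𝒱 χs B ⟨x, hNB hx⟩) := by
      rw [RedEnv.map_ι]; rfl
    rw [e, hκ, map_mul, hπ]
    have : ρ' x = 0 := by
      have hx' := (mem_span_basis hNp).1 hx
      clear hx e
      induction hx' using Submodule.span_induction with
      | mem x hx =>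
        obtain ⟨i, hi, rfl⟩ := hx
        rw [hρb, dif_neg]
        exact d.pos.ne_zero (d.pos.subset (d.rank_pos i hi))
      | zero => exact map_zero _
      | add x y _ _ hx hy => rw [map_add, hx, hy, add_zero]
      | smul c x _ hx => rw [map_smul, hx, smul_zero]
    show _ * ρ' x = 0
    rw [this, mul_zero]

/-- Without positive letters, a nonzero weight in the word would give a vanishing nonempty sum of
positive roots. -/
theorem RootData.forall_weight_eq_zero (d : RootData p ε 𝒱 𝔤 Φ P Φ₁ δ bs deg ω r ei fi) {u : List I}
    (hu : ∀ i ∈ u, r i < m + 2) (hsum : (u.map ω).sum = 0) : ∀ i ∈ u, ω i = 0 := by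
  have hneg : ∀ i, r i < m + 2 → ω i = 0 ∨ -ω i ∈ P := by
    intro i hi
    rcases lt_trichotomy (r i) m with h | h | h
    · obtain ⟨j, rfl⟩ := d.rank_lt i h
      rw [d.weight_f, neg_neg]
      exact .inr (d.fp.mem_pos j)
    · exact .inr (d.rank_levi i h).2
    · exact .inl (d.rank_torus i (by omega))
  have hcl : ∀ u : List I, (∀ i ∈ u, r i < m + 2) → -(u.map ω).sum ∈ AddSubmonoid.closure P := by
    intro u
    induction u with
    | nil => intro _; simp
    | cons i u ih =>
      intro h
      rw [List.map_cons, List.sum_cons, neg_add]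
      refine AddSubmonoid.add_mem _ ?_ (ih fun j hj => h j (List.mem_cons_of_mem _ hj))
      rcases hneg i (h i List.mem_cons_self) with h0 | h0
      · rw [h0, neg_zero]; exact AddSubmonoid.zero_mem _
      · exact AddSubmonoid.subset_closure h0
  induction u with
  | nil => simp
  | cons i u ih =>
    have hu' : ∀ j ∈ u, r j < m + 2 := fun j hj => hu j (List.mem_cons_of_mem _ hj)
    rw [List.map_cons, List.sum_cons] at hsum
    have h0 : ω i = 0 := by
      refine (hneg i (hu i List.mem_cons_self)).resolve_right fun h => ?_
      refine d.pos.add_ne_zero h (hcl u hu') ?_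
      rw [← neg_add, hsum, neg_zero]
    rw [h0, zero_add] at hsum
    intro j hj
    rcases List.mem_cons.1 hj with rfl | hj
    · exact h0
    · exact ih hu' hsum j hj

/-- A word of weight zero acts on a maximal vector through its Harish-Chandra image. -/
theorem RootData.exists_hc_image [CharP F p]
    (d : RootData p ε 𝒱 𝔤 Φ P Φ₁ δ bs deg ω r ei fi) (hp : 3 < p)
    (hH : H = Submodule.span F ((fun i => (bs i : Module.End F V)) '' {i | ω i = 0})) (hle : H ≤ 𝔤)
    {L : Submodule (RedEnv p ε 𝒱 χs 𝔤) (RedEnv p ε 𝒱 χs 𝔤)}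
    (hL : ∀ i, r i = m + 2 → RedEnv.ι p ε 𝒱 χs 𝔤 (bs i) ∈ L)
    {W : Type*} [AddCommGroup W] [Module F W] [Module (RedEnv p ε 𝒱 χ 𝔤) W]
    [IsScalarTower F (RedEnv p ε 𝒱 χ 𝔤) W] {z : W}
    (hz : ∀ i, r i = m + 2 → RedEnv.ι p ε 𝒱 χ 𝔤 (bs i) • z = 0)
    (ev : RedEnv p ε 𝒱 χs H →ₐ[F] F)
    (hev : ∀ h : H, RedEnv.ι p ε 𝒱 χ 𝔤 (Submodule.inclusion hle h) • z =
      ev (RedEnv.ι p ε 𝒱 χs H h) • z)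
    {w : List I} (hw : (w.map ω).sum = 0) :
    ∃ y, wd (fun i => RedEnv.ι p ε 𝒱 χs 𝔤 (bs i)) w - RedEnv.map p ε 𝒱 χs hle y ∈ L ∧
      wd (fun i => RedEnv.ι p ε 𝒱 χ 𝔤 (bs i)) w • z = ev y • z := by
  classical
  have hmH : ∀ i, ω i = 0 → (bs i : Module.End F V) ∈ H := fun i hi => (d.torus hH).mem ⟨i, hi⟩
  -- Sorting in the product algebra performs the same rewriting for `χ` and for `χs`, so the action
  -- of one is controlled by the Harish-Chandra image in the other.
  set ρ : 𝔤 →ₗ[F] RedEnv p ε 𝒱 χ 𝔤 × RedEnv p ε 𝒱 χs 𝔤 :=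
    (RedEnv.ι p ε 𝒱 χ 𝔤).prod (RedEnv.ι p ε 𝒱 χs 𝔤) with hρ
  have hwd : ∀ u, wd (fun i => ρ (bs i)) u = (wd (fun i => RedEnv.ι p ε 𝒱 χ 𝔤 (bs i)) u,
      wd (fun i => RedEnv.ι p ε 𝒱 χs 𝔤 (bs i)) u) := by
    intro u
    induction u with
    | nil => rfl
    | cons i u ih => rw [wd_cons, ih, wd_cons, wd_cons]; rfl
  have h := d.wd_mem_span_sorted hp ρ (fun i j z hz => Prod.ext
    (RedEnv.ι_mul_ι (d.family.mem_homEnd i) (d.family.mem_homEnd j) hz)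
    (RedEnv.ι_mul_ι (d.family.mem_homEnd i) (d.family.mem_homEnd j) hz)) w
  rw [hw] at h
  suffices key : ∀ x ∈ Submodule.span F {x | ∃ u : List I, u.Pairwise (· ≤ ·) ∧
      (u.map ω).sum = 0 ∧ x = wd (fun i => ρ (bs i)) u},
      ∃ y, x.2 - RedEnv.map p ε 𝒱 χs hle y ∈ L ∧ x.1 • z = ev y • z by
    have := key _ h
    rwa [hwd] at this
  intro x hx
  induction hx using Submodule.span_induction with
  | mem x hx =>
    obtain ⟨u, h1, h2, rfl⟩ := hx
    rw [hwd]
    rcases d.sorted_cases h1 with ⟨u', i, rfl, hi⟩ | h3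
    · refine ⟨0, ?_, ?_⟩
      · rw [map_zero, sub_zero]
        show wd _ (u' ++ [i]) ∈ L
        rw [wd_append, wd_cons, wd_nil, mul_one]
        exact L.smul_mem _ (hL i hi)
      · show wd _ (u' ++ [i]) • z = _
        rw [wd_append, mul_smul, wd_cons, wd_nil, mul_one, hz i hi, map_zero, zero_smul, smul_zero]
    · have h4 := d.forall_weight_eq_zero h3 h2
      clear h1 h2 h3
      refine ⟨wd (fun i => if h : ω i = 0 then RedEnv.ι p ε 𝒱 χs H ⟨bs i, hmH i h⟩ else 0) u, ?_, ?_⟩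
      · have : RedEnv.map p ε 𝒱 χs hle (wd (fun i => if h : ω i = 0 then
            RedEnv.ι p ε 𝒱 χs H ⟨bs i, hmH i h⟩ else 0) u) =
            wd (fun i => RedEnv.ι p ε 𝒱 χs 𝔤 (bs i)) u := by
          induction u with
          | nil => simp
          | cons i u ih =>
            rw [wd_cons, map_mul, ih fun j hj => h4 j (List.mem_cons_of_mem _ hj), wd_cons,
              dif_pos (h4 i List.mem_cons_self), RedEnv.map_ι]
            rfl
        rw [this]
        show _ - _ ∈ L
        rw [sub_self]
        exact L.zero_mem
      · show wd _ u • z = _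
        induction u with
        | nil => simp
        | cons i u ih =>
          rw [wd_cons, mul_smul, ih fun j hj => h4 j (List.mem_cons_of_mem _ hj), wd_cons, map_mul,
            mul_comm, mul_smul, dif_pos (h4 i List.mem_cons_self), smul_comm, ← hev]
          rfl
  | zero => exact ⟨0, by simp, by simp⟩
  | add x y _ _ hx hy =>
    obtain ⟨a, ha1, ha2⟩ := hx
    obtain ⟨b, hb1, hb2⟩ := hy
    refine ⟨a + b, ?_, ?_⟩
    · rw [map_add, Prod.snd_add, add_sub_add_comm]
      exact L.add_mem ha1 hb1
    · rw [Prod.fst_add, add_smul, ha2, hb2, map_add, add_smul]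
  | smul c x _ hx =>
    obtain ⟨a, ha1, ha2⟩ := hx
    refine ⟨c • a, ?_, ?_⟩
    · rw [map_smul, Prod.smul_snd]
      exact smul_sub_smul_mem c ha1
    · rw [Prod.smul_fst, smul_assoc, ha2, map_smul, smul_assoc]

/-- The relations of `u_χ(H)` hold for the action on the nonzero vector `z`, where `h` acts by `wt
h`. They are those of `u_χs(H)`, as the two functions agree on `H`. -/
theorem RootData.exists_character [CharP F p] [Fact p.Prime]
    (d : RootData p ε 𝒱 𝔤 Φ P Φ₁ δ bs deg ω r ei fi)
    (hH : H = Submodule.span F ((fun i => (bs i : Module.End F V)) '' {i | ω i = 0})) (hle : H ≤ 𝔤)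
    (hχ : ∀ i, ω i = 0 → χ (bs i) = χs (bs i))
    {W : Type*} [AddCommGroup W] [Module F W] [Module (RedEnv p ε 𝒱 χ 𝔤) W]
    [IsScalarTower F (RedEnv p ε 𝒱 χ 𝔤) W] {z : W} (hz0 : z ≠ 0) (wt : H →ₗ[F] F)
    (hz : ∀ h : H, RedEnv.ι p ε 𝒱 χ 𝔤 (Submodule.inclusion hle h) • z = wt h • z) :
    ∃ ev : RedEnv p ε 𝒱 χs H →ₐ[F] F, ∀ h, ev (RedEnv.ι p ε 𝒱 χs H h) = wt h := by
  have hfH := d.torus hH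
  refine hfH.exists_lift d.grading χs hle wt ?_ ?_
  · rintro ⟨i, hi⟩ ⟨j, hj⟩ y hy
    refine smul_left_injective F hz0 ?_
    have h1 := hz ⟨bs i, hfH.mem ⟨i, hi⟩⟩
    have h2 := hz ⟨bs j, hfH.mem ⟨j, hj⟩⟩
    have h3 := hz y
    have h4 := congrArg (· • z) (RedEnv.ι_mul_ι (p := p) (χ := χ) (d.family.mem_homEnd i)
      (d.family.mem_homEnd j) (z := Submodule.inclusion hle y) hy)
    simp only [mul_smul, add_smul, smul_assoc] at h4
    have e : ∀ k hk, Submodule.inclusion hle ⟨bs k, hfH.mem ⟨k, hk⟩⟩ = bs k := fun k hk => rfl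
    rw [e i hi] at h1
    rw [e j hj] at h2
    rw [h3, h2, h1, smul_comm _ (wt _) z, smul_comm _ (wt _) z, h1, h2] at h4
    simp only [smul_smul, ← add_smul] at h4
    refine Eq.trans ?_ (h4.trans ?_)
    · show (_ * _) • z = _
      rw [mul_comm]
    · show _ = (_ • (_ * _) + _) • z
      rw [smul_eq_mul, mul_comm (wt ⟨bs j, _⟩) (wt ⟨bs i, _⟩)]
  · rintro ⟨i, hi⟩ ho y hy
    refine smul_left_injective F hz0 ?_
    have h1 := hz ⟨bs i, hfH.mem ⟨i, hi⟩⟩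
    have h3 := hz y
    have h4 := congrArg (· • z) (RedEnv.ι_pow (p := p) (χ := χ) (z := Submodule.inclusion hle y)
      (w := bs i) ho (d.family.mem_homEnd i) hy rfl)
    have e : ∀ k hk, Submodule.inclusion hle ⟨bs k, hfH.mem ⟨k, hk⟩⟩ = bs k := fun k hk => rfl
    rw [e i hi] at h1
    have h5 : ∀ n : ℕ, RedEnv.ι p ε 𝒱 χ 𝔤 (bs i) ^ n • z = wt ⟨bs i, hfH.mem ⟨i, hi⟩⟩ ^ n • z := by
      intro n
      induction n with
      | zero => simp
      | succ n ih => rw [pow_succ', mul_smul, ih, smul_comm, h1, ← mul_smul, ← pow_succ]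
    simp only [add_smul, algebraMap_smul, h5, h3, hχ i hi] at h4
    simp only [add_smul]
    exact h4

end RootData

/-! ### From the given roots to the abstract root data. -/

section Assembly

variable {Γ F V I : Type*} [AddCommGroup Γ] [Field F] [AddCommGroup V] [Module F V]
  [LinearOrder I] {p : ℕ} {ε : Bicharacter Γ F} {𝒱 : Γ → Submodule F V}
  {𝔤 : Submodule F (Module.End F V)} {G T : Subgroup (LinearMap.GeneralLinearGroup F V)}
  {P Φ₁ : Set (Char T)} {m : ℕ} {δ : Fin m → Char T} {e f : Fin m → 𝔤}
  {bs : Module.Basis I F 𝔤} {deg : I → Γ} {ω : I → Char T} {r : I → ℕ} {ei fi : Fin m → I}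

theorem span_range_basis (bs : Module.Basis I F 𝔤) :
    Submodule.span F (Set.range fun i => (bs i : Module.End F V)) = 𝔤 := by
  have : (Set.range fun i => (bs i : Module.End F V)) = 𝔤.subtype '' Set.range bs := by
    rw [← Set.range_comp]; rfl
  rw [this, ← Submodule.map_span, bs.span_eq, Submodule.map_top, Submodule.range_subtype]

theorem IsRootBasis.mem_span (hI : IsRootBasis 𝒱 𝔤 T P Φ₁ δ e f bs deg ω r ei fi)
    (hT : IsMaximalTorus 𝒱 G T) {μ : Char T} {x : Module.End F V} (hx : x ∈ 𝔤)
    (hxμ : x ∈ conjWeight T μ) :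
    x ∈ Submodule.span F ((fun i => (bs i : Module.End F V)) '' {k | ω k = μ}) :=
  mem_span_image_of_iSupIndep hT.torus.conjWeight_iSupIndep hI.mem_conjWeight
    ((span_range_basis bs).symm ▸ hx) hxμ

theorem IsRootBasis.rootData (hI : IsRootBasis 𝒱 𝔤 T P Φ₁ δ e f bs deg ω r ei fi)
    (h𝔤 : IsAlgebraic p ε 𝒱 𝔤 G) (hT : IsMaximalTorus 𝒱 G T)
    (hroot : HasRootDecomposition 𝒱 𝔤 T) (hP : IsPositiveSystem (roots 𝔤 T) P)
    (hFP : IsFPTriple (roots 𝔤 T) P Φ₁ δ) :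
    RootData p ε 𝒱 𝔤 (roots 𝔤 T) P Φ₁ δ bs deg ω r ei fi where
  grading := h𝔤.grading
  family :=
    { span_eq := span_range_basis bs
      mem_homEnd := hI.mem_homEnd
      bracket_mem := fun i j => h𝔤.restricted.bracket_mem _ _ _ ⟨(bs i).2, hI.mem_homEnd i⟩ _
        ⟨(bs j).2, hI.mem_homEnd j⟩
      pow_mem := fun i h => h𝔤.restricted.pow_mem _ h _ ⟨(bs i).2, hI.mem_homEnd i⟩ }
  bracket_mem i j := hI.mem_span hT
    (h𝔤.restricted.bracket_mem _ _ _ ⟨(bs i).2, hI.mem_homEnd i⟩ _ ⟨(bs j).2, hI.mem_homEnd j⟩)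
    (colorBracket_mem_conjWeight (hI.mem_conjWeight i) (hI.mem_conjWeight j))
  pow_mem i h := hI.mem_span hT
    (h𝔤.restricted.pow_mem _ h _ ⟨(bs i).2, hI.mem_homEnd i⟩)
    (pow_mem_conjWeight (hI.mem_conjWeight i) p)
  pos := hP
  fp := hFP
  neg_mem := hroot.neg_mem
  mem_roots := hI.mem_roots
  inj := hI.inj
  lt_of_rank := hI.lt_of_rank
  rank_f := hI.rank_f
  rank_lt := hI.rank_lt
  rank_levi := hI.rank_levi
  rank_torus := hI.rank_torus
  rank_pos := hI.rank_pos
  rank_le := hI.rank_le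
  weight_f := hI.weight_f
  weight_e := hI.weight_e

theorem IsRootBasis.rootSpace_le (hI : IsRootBasis 𝒱 𝔤 T P Φ₁ δ e f bs deg ω r ei fi)
    (hT : IsMaximalTorus 𝒱 G T) {μ : Char T} {J : Set I} (hJ : ∀ i, ω i = μ → i ∈ J) :
    rootSpace 𝔤 T μ ≤ Submodule.span F ((fun i => (bs i : Module.End F V)) '' J) := by
  intro x hx
  exact Submodule.span_mono (Set.image_mono hJ) (hI.mem_span hT hx.1 hx.2)

theorem IsRootBasis.mem_rootSpace (hI : IsRootBasis 𝒱 𝔤 T P Φ₁ δ e f bs deg ω r ei fi) (i : I) :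
    (bs i : Module.End F V) ∈ rootSpace 𝔤 T (ω i) :=
  ⟨(bs i).2, hI.mem_conjWeight i⟩

theorem IsRootBasis.lieOf_eq (hI : IsRootBasis 𝒱 𝔤 T P Φ₁ δ e f bs deg ω r ei fi)
    (hT : IsMaximalTorus 𝒱 G T) (hroot : HasRootDecomposition 𝒱 𝔤 T) :
    lieOf 𝒱 T = Submodule.span F ((fun i => (bs i : Module.End F V)) '' {i | ω i = 0}) := by
  refine le_antisymm ?_ (Submodule.span_le.2 ?_)
  · intro x hx
    exact hI.mem_span hT (hroot.torus_le hx) (hT.torus.lieOf_le_conjWeight hx)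
  · rintro _ ⟨i, hi, rfl⟩
    exact hI.mem_torus i hi

theorem IsRootBasis.nPlus_eq (hI : IsRootBasis 𝒱 𝔤 T P Φ₁ δ e f bs deg ω r ei fi)
    (hT : IsMaximalTorus 𝒱 G T)
    (d : RootData p ε 𝒱 𝔤 (roots 𝔤 T) P Φ₁ δ bs deg ω r ei fi) :
    nPlus 𝔤 T P = Submodule.span F ((fun i => (bs i : Module.End F V)) '' {i | r i = m + 2}) := by
  refine le_antisymm (iSup₂_le fun a ha => hI.rootSpace_le hT fun i hi => ?_)
    (Submodule.span_le.2 ?_)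
  · exact d.rank_eq_of_pos (hi ▸ ha)
  · rintro _ ⟨i, hi, rfl⟩
    exact Submodule.mem_iSup_of_mem _ (Submodule.mem_iSup_of_mem (d.rank_pos i hi)
      (hI.mem_rootSpace i))

theorem IsRootBasis.parabolic_eq (hI : IsRootBasis 𝒱 𝔤 T P Φ₁ δ e f bs deg ω r ei fi)
    (hT : IsMaximalTorus 𝒱 G T) (hroot : HasRootDecomposition 𝒱 𝔤 T)
    (d : RootData p ε 𝒱 𝔤 (roots 𝔤 T) P Φ₁ δ bs deg ω r ei fi) :
    parabolic 𝒱 𝔤 T Φ₁ δ =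
      Submodule.span F ((fun i => (bs i : Module.End F V)) '' {i | m ≤ r i}) := by
  refine le_antisymm (sup_le (sup_le ?_ (iSup₂_le fun a ha => hI.rootSpace_le hT fun i hi => ?_))
    (iSup_le fun j => hI.rootSpace_le hT fun i hi => ?_)) (Submodule.span_le.2 ?_)
  · rw [hI.lieOf_eq hT hroot]
    refine Submodule.span_mono (Set.image_mono ?_)
    intro i hi
    show m ≤ r i
    rw [d.rank_eq_of_zero hi]; omega
  · show m ≤ r i
    refine not_lt.1 fun h => ?_
    obtain ⟨j, rfl⟩ := d.rank_lt i h
    rw [d.weight_f] at hi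
    exact d.fp.neg_notMem_levi d.pos j (hi ▸ ha)
  · show m ≤ r i
    rw [d.rank_eq_of_pos (hi ▸ d.fp.mem_pos j)]; omega
  · rintro _ ⟨i, hi, rfl⟩
    rcases d.isParabolicWeight hi with h | h | ⟨j, h⟩
    · exact Submodule.mem_sup_left (Submodule.mem_sup_left (hI.mem_torus i h))
    · exact Submodule.mem_sup_left (Submodule.mem_sup_right
        (Submodule.mem_iSup_of_mem _ (Submodule.mem_iSup_of_mem h (hI.mem_rootSpace i))))
    · exact Submodule.mem_sup_right (Submodule.mem_iSup_of_mem j (h ▸ hI.mem_rootSpace i))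

/-- A nonzero vector has only one degree, so the existential in `pbar` tests exactly `deg i`. -/
theorem pbar_basis {X : Type*} [AddCommGroup X] {Φ Q Q₁ : Set X} {δ : Fin m → X} {ω : I → X}
    (d : RootData p ε 𝒱 𝔤 Φ Q Q₁ δ bs deg ω r ei fi) (i : I) :
    pbar p ε 𝒱 (bs i : Module.End F V) = order p ε deg i := by
  rw [pbar, order]
  have key : (∃ α, ε α α = 1 ∧ (bs i : Module.End F V) ∈ homEnd 𝒱 α) ↔ ε (deg i) (deg i) = 1 := by
    constructor
    · rintro ⟨α, hα, h⟩
      by_cases hd : α = deg i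
      · rw [← hd]; exact hα
      · exfalso
        have h1 := (homEnd_iSupIndep d.grading).pairwiseDisjoint hd
        have h2 : (bs i : Module.End F V) = 0 :=
          (Submodule.disjoint_def.1 h1) _ h (d.family.mem_homEnd i)
        exact bs.ne_zero i (Subtype.ext h2)
    · exact fun h => ⟨_, h, d.family.mem_homEnd i⟩
  by_cases h : ε (deg i) (deg i) = 1
  · rw [if_pos (key.2 h), if_pos h]
  · rw [if_neg fun h' => h (key.1 h'), if_neg h]

theorem IsRootBasis.topElement_eq (hI : IsRootBasis 𝒱 𝔤 T P Φ₁ δ e f bs deg ω r ei fi)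
    (d : RootData p ε 𝒱 𝔤 (roots 𝔤 T) P Φ₁ δ bs deg ω r ei fi) (χ : 𝔤 →ₗ[F] F) :
    topElement p ε 𝒱 χ e f = wd (fun i => RedEnv.ι p ε 𝒱 χ 𝔤 (bs i))
      (fword ei (top p ε deg ei) ++ fword fi (top p ε deg fi)) := by
  rw [wd_append, wd_fword, wd_fword, topElement]
  simp only [← hI.basis_e, ← hI.basis_f, pbar_basis d, top]

theorem RootData.sum_top {X : Type*} [AddCommGroup X] {Φ Q Q₁ : Set X} {δ : Fin m → X}
    {ω : I → X} (d : RootData p ε 𝒱 𝔤 Φ Q Q₁ δ bs deg ω r ei fi)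
    (hord : ∀ j, order p ε deg (ei j) = order p ε deg (fi j)) :
    ((fword ei (top p ε deg ei) ++ fword fi (top p ε deg fi)).map ω).sum = 0 := by
  have : top p ε deg ei = top p ε deg fi := by
    funext j; rw [top, top, hord]
  rw [List.map_append, List.sum_append, d.sum_fword, sum_map_fword, this]
  simp only [d.weight_e]
  exact add_neg_cancel _

/-- The map `g` is not linear over the algebra, so the vanishing is proved for all left multiples at
once. -/
theorem hc_projection_nPlusIdeal {χ : 𝔤 →ₗ[F] F} {E : Type*} [AddCommGroup E] [Module F E]
    {g : RedEnv p ε 𝒱 χ 𝔤 →ₗ[F] E}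
    (hg : ∀ a, ∀ x : 𝔤, (x : Module.End F V) ∈ nPlus 𝔤 T P → g (a * RedEnv.ι p ε 𝒱 χ 𝔤 x) = 0)
    {u : RedEnv p ε 𝒱 χ 𝔤} (hu : u ∈ nPlusIdeal p ε 𝒱 χ T P) : g u = 0 := by
  suffices h : ∀ a, g (a * u) = 0 by simpa using h 1
  unfold nPlusIdeal at hu
  induction hu using Submodule.span_induction with
  | mem u hu =>
    obtain ⟨x, hx, rfl⟩ := hu
    exact fun a => hg a x hx
  | zero => intro a; rw [mul_zero, map_zero]
  | add x y _ _ hx hy => intro a; rw [mul_add, map_add, hx, hy, add_zero]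
  | smul b x _ hx => intro a; rw [smul_eq_mul, ← mul_assoc, hx]

end Assembly

/-! ### The criterion. -/

section Main

variable {Γ F V : Type*} [AddCommGroup Γ] [Field F] [AddCommGroup V] [Module F V]
  {p : ℕ} {ε : Bicharacter Γ F} {𝒱 : Γ → Submodule F V}
  {𝔤 : Submodule F (Module.End F V)} {G T : Subgroup (LinearMap.GeneralLinearGroup F V)}
  {P Φ₁ : Set (Char T)} {m : ℕ} {δ : Fin m → Char T} {e f : Fin m → 𝔤}

/-- The simplicity criterion for a module `W` induced from the parabolic subalgebra. -/
theorem simplicity_criterion [CharP F p] (hp : 3 < p)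
    (h𝔤 : IsAlgebraic p ε 𝒱 𝔤 G) (hT : IsMaximalTorus 𝒱 G T)
    (hroot : HasRootDecomposition 𝒱 𝔤 T) (hP : IsPositiveSystem (roots 𝔤 T) P)
    (hFP : IsFPTriple (roots 𝔤 T) P Φ₁ δ)
    (he : ∀ i, e i ≠ 0 ∧ (e i : Module.End F V) ∈ rootSpace 𝔤 T (δ i))
    (hf : ∀ i, f i ≠ 0 ∧ (f i : Module.End F V) ∈ rootSpace 𝔤 T (-δ i))
    (hef : ∀ i, pbar p ε 𝒱 (e i : Module.End F V) = pbar p ε 𝒱 (f i : Module.End F V))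
    {χ χs χn : 𝔤 →ₗ[F] F} (hχ : IsStandardForm ε 𝒱 𝔤 T P χ χs χn)
    (hχδ : ∀ i, χ (e i) = 0 ∧ χ (f i) = 0)
    {M : Type*} [AddCommGroup M] [Module F M]
    [Module (RedEnv p ε 𝒱 χ (parabolic 𝒱 𝔤 T Φ₁ δ)) M]
    [IsScalarTower F (RedEnv p ε 𝒱 χ (parabolic 𝒱 𝔤 T Φ₁ δ)) M]
    {ℳ : Γ → Submodule F M}
    (hM : IsGradedModule p ε 𝒱 χ (parabolic 𝒱 𝔤 T Φ₁ δ) ℳ)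
    (hsimple : IsGradedSimple (RedEnv p ε 𝒱 χ (parabolic 𝒱 𝔤 T Φ₁ δ)) ℳ)
    {wt : lieOf 𝒱 T →ₗ[F] F} {v : M}
    (hv : IsMaximalVector p ε 𝒱 χ (parabolic 𝒱 𝔤 T Φ₁ δ) P ℳ wt v)
    {W : Type*} [AddCommGroup W] [Module F W] [Module (RedEnv p ε 𝒱 χ 𝔤) W]
    [IsScalarTower F (RedEnv p ε 𝒱 χ 𝔤) W] {τ : M →ₗ[F] W}
    (hτ : IsInduced (RedEnv.map p ε 𝒱 χ (hroot.parabolic_le Φ₁ δ)) τ) :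
    (∃! y : RedEnv p ε 𝒱 χs (lieOf 𝒱 T),
      IsHarishChandraImage p ε 𝒱 χs P hroot.torus_le (topElement p ε 𝒱 χs e f) y) ∧
    (∃! ev : RedEnv p ε 𝒱 χs (lieOf 𝒱 T) →ₐ[F] F,
      ∀ h, ev (RedEnv.ι p ε 𝒱 χs (lieOf 𝒱 T) h) = wt h) ∧
    ∀ (y : RedEnv p ε 𝒱 χs (lieOf 𝒱 T)) (ev : RedEnv p ε 𝒱 χs (lieOf 𝒱 T) →ₐ[F] F),
      IsHarishChandraImage p ε 𝒱 χs P hroot.torus_le (topElement p ε 𝒱 χs e f) y →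
      (∀ h, ev (RedEnv.ι p ε 𝒱 χs (lieOf 𝒱 T) h) = wt h) →
      (IsGradedSimple (RedEnv p ε 𝒱 χ 𝔤)
        (inducedGrade τ (RedEnv.piece p ε 𝒱 χ 𝔤 (homEnd 𝒱)) ℳ) ↔ ev y ≠ 0) := by
  have : Fact p.Prime := ⟨(CharP.char_is_prime_or_zero F p).resolve_right (by omega)⟩
  obtain ⟨I, _, bs, deg, ω, r, ei, fi, hI⟩ := exists_isRootBasis h𝔤 hT hroot hP hFP he hf
  have d : RootData p ε 𝒱 𝔤 (roots 𝔤 T) P Φ₁ δ bs deg ω r ei fi :=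
    hI.rootData h𝔤 hT hroot hP hFP
  have hH := hI.lieOf_eq hT hroot
  have hNp := hI.nPlus_eq hT d
  have hpar := hI.parabolic_eq hT hroot d
  have hord : ∀ j, order p ε deg (ei j) = order p ε deg (fi j) := fun j => by
    rw [← pbar_basis d, ← pbar_basis d, hI.basis_e, hI.basis_f, hef]
  have hdeg : ∀ i, χ (bs i) ≠ 0 → deg i = 0 := fun i h => by
    by_contra h0
    exact h (hχ.degree_zero _ h0 _ (hI.mem_homEnd i))
  have hs0 : ∀ i, ω i ≠ 0 → χs (bs i) = 0 := fun i h => by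
    refine hχ.semisimple_part _ ?_
    rcases hP.mem_or_neg_mem _ (hI.mem_roots i h) with h1 | h1
    · exact Submodule.mem_sup_left (Submodule.mem_iSup_of_mem _
        (Submodule.mem_iSup_of_mem h1 (hI.mem_rootSpace i)))
    · refine Submodule.mem_sup_right (Submodule.mem_iSup_of_mem _
        (Submodule.mem_iSup_of_mem h1 ?_))
      have h2 : - -ω i = ω i := neg_neg (ω i)
      exact h2.symm ▸ hI.mem_rootSpace i
  -- `χs` is supported on `H`, whose elements have degree 0.
  have hsdeg : ∀ i, χs (bs i) ≠ 0 → deg i = 0 := fun i h =>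
    hI.deg_torus i (by by_contra h0; exact h (hs0 i h0))
  have hspos : ∀ i, r i = m + 2 → χs (bs i) = 0 := fun i h =>
    hs0 i (hP.ne_zero (hP.subset (d.rank_pos i h)))
  have hχH : ∀ i, ω i = 0 → χ (bs i) = χs (bs i) := fun i h => by
    rw [hχ.eq_add, LinearMap.add_apply,
      hχ.nilpotent_part _ (Submodule.mem_sup_left (hI.mem_torus i h)), add_zero]
  obtain ⟨κ, hκ, hsum⟩ := d.exists_coordinates hp hdeg (hroot.parabolic_le Φ₁ δ) hpar M hτ
  have D : InducedData p ε 𝒱 𝔤 (roots 𝔤 T) P Φ₁ δ bs deg ω r ei fi χ (hroot.parabolic_le Φ₁ δ)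
      ℳ τ κ :=
    { root := d, three_lt := hp, deg_of_ne := hdeg
      chi_f := fun j => by rw [hI.basis_f]; exact (hχδ j).2
      chi_e := fun j => by rw [hI.basis_e]; exact (hχδ j).1
      span_eq := hpar, induced := hτ, graded := hM, coord_wd := hκ, eq_sum := hsum }
  have hvP : ∀ i, r i = m + 2 → RedEnv.ι p ε 𝒱 χ 𝔤 (bs i) • τ v = 0 := fun i h => by
    rw [D.smul_of (by omega), hv.nPlus_smul, map_zero]
    rw [hNp]
    exact Submodule.subset_span ⟨i, h, rfl⟩
  have hvH : ∀ h : lieOf 𝒱 T,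
      RedEnv.ι p ε 𝒱 χ 𝔤 (Submodule.inclusion hroot.torus_le h) • τ v = wt h • τ v := fun h => by
    have hle : lieOf 𝒱 T ≤ parabolic 𝒱 𝔤 T Φ₁ δ := le_sup_left.trans le_sup_left
    have h1 := hτ.smul_of (RedEnv.ι p ε 𝒱 χ _ (Submodule.inclusion hle h)) v
    rw [RedEnv.map_ι, hv.torus_smul _ h rfl, map_smul] at h1
    exact h1
  obtain ⟨g, hg1, hg2⟩ := d.exists_hc_projection hp hsdeg hspos hH hroot.torus_le hNp
  have huniq : ∀ y, IsHarishChandraImage p ε 𝒱 χs P hroot.torus_le (topElement p ε 𝒱 χs e f) y →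
      y = g (topElement p ε 𝒱 χs e f) := fun y hy => by
    have := hc_projection_nPlusIdeal hg2 hy.2
    rw [map_sub, hg1, sub_eq_zero] at this
    exact this.symm
  have hL : ∀ i, r i = m + 2 → RedEnv.ι p ε 𝒱 χs 𝔤 (bs i) ∈ nPlusIdeal p ε 𝒱 χs T P := fun i h =>
    Submodule.subset_span ⟨bs i, by rw [hNp]; exact Submodule.subset_span ⟨i, h, rfl⟩, rfl⟩
  -- The image found here comes with its action on `τ v`; by uniqueness it is any given image.
  have himage : ∀ ev : RedEnv p ε 𝒱 χs (lieOf 𝒱 T) →ₐ[F] F,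
      (∀ h, ev (RedEnv.ι p ε 𝒱 χs (lieOf 𝒱 T) h) = wt h) → ∃ y,
      IsHarishChandraImage p ε 𝒱 χs P hroot.torus_le (topElement p ε 𝒱 χs e f) y ∧
      wd (fun i => RedEnv.ι p ε 𝒱 χ 𝔤 (bs i)) (fword ei (top p ε deg ei)) •
        wd (fun i => RedEnv.ι p ε 𝒱 χ 𝔤 (bs i)) (fword fi (top p ε deg fi)) • τ v =
          ev y • τ v := by
    intro ev hev
    obtain ⟨y, hy1, hy2⟩ := d.exists_hc_image hp hH hroot.torus_le hL hvP ev
      (fun h => by rw [hvH, hev]) (d.sum_top hord)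
    rw [← hI.topElement_eq d] at hy1
    refine ⟨y, ⟨?_, hy1⟩, by rw [← hy2, wd_append, mul_smul]⟩
    have := d.family.wd_mem_piece (χ := χs) hI.mem_conjWeight
      (fword ei (top p ε deg ei) ++ fword fi (top p ε deg fi))
    rw [d.sum_top hord] at this
    rw [hI.topElement_eq d]
    exact this
  obtain ⟨ev₀, hev₀⟩ := d.exists_character hH hroot.torus_le hχH (D.of_ne_zero hv.ne_zero) wt hvH
  refine ⟨?_, ⟨ev₀, hev₀, fun ev hev => RedEnv.algHom_ext fun h => by rw [hev, hev₀]⟩, ?_⟩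
  · obtain ⟨y, hy, -⟩ := himage ev₀ hev₀
    exact ⟨y, hy, fun y' hy' => (huniq y' hy').trans (huniq y hy).symm⟩
  · intro y ev hy hev
    obtain ⟨y', hy', hact⟩ := himage ev hev
    obtain rfl : y = y' := (huniq y hy).trans (huniq y' hy').symm
    constructor
    · intro hs h0
      rw [h0, zero_smul] at hact
      obtain ⟨γ, hγ⟩ := hv.homogeneous
      exact D.not_isGradedSimple_of_smul_eq_zero hord hv.ne_zero hγ hvP hact hs
    · intro h0
      exact D.isGradedSimple_of_smul_eq hsimple hv.ne_zero
        (fun j => hvP _ (d.rank_e j)) h0 hact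

end Main
end ColorLie

open ColorLie in
theorem theorem3p11
    {F : Type*} [Field F] [IsAlgClosed F] (p : ℕ) [CharP F p] (hp : 3 < p)
    {Γ : Type*} [AddCommGroup Γ] [Countable Γ] (ε : Bicharacter Γ F)
    {V : Type*} [AddCommGroup V] [Module F V] (𝒱 : Γ → Submodule F V)
    -- the algebraic Lie color algebra, its group, a maximal torus and the positive roots
    (𝔤 : Submodule F (Module.End F V)) (G T : Subgroup (LinearMap.GeneralLinearGroup F V))
    (h𝔤 : IsAlgebraic p ε 𝒱 𝔤 G) (hT : IsMaximalTorus 𝒱 G T)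
    (hroot : HasRootDecomposition 𝒱 𝔤 T)
    (P : Set (Char T)) (hP : IsPositiveSystem (roots 𝔤 T) P)
    -- the FP triple
    (Φ₁ : Set (Char T)) {m : ℕ} (δ : Fin m → Char T) (hFP : IsFPTriple (roots 𝔤 T) P Φ₁ δ)
    -- root vectors
    (e f : Fin m → 𝔤)
    (he : ∀ i, e i ≠ 0 ∧ (e i : Module.End F V) ∈ rootSpace 𝔤 T (δ i))
    (hf : ∀ i, f i ≠ 0 ∧ (f i : Module.End F V) ∈ rootSpace 𝔤 T (-δ i))
    (hef : ∀ i, pbar p ε 𝒱 (e i : Module.End F V) = pbar p ε 𝒱 (f i : Module.End F V))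
    -- the linear function
    (χ χs χn : 𝔤 →ₗ[F] F) (hχ : IsStandardForm ε 𝒱 𝔤 T P χ χs χn)
    (hχδ : ∀ i, χ (e i) = 0 ∧ χ (f i) = 0)
    -- the simple module with its maximal vector
    {M : Type*} [AddCommGroup M] [Module F M]
    [Module (RedEnv p ε 𝒱 χ (parabolic 𝒱 𝔤 T Φ₁ δ)) M]
    [IsScalarTower F (RedEnv p ε 𝒱 χ (parabolic 𝒱 𝔤 T Φ₁ δ)) M]
    (ℳ : Γ → Submodule F M)
    (hM : IsGradedModule p ε 𝒱 χ (parabolic 𝒱 𝔤 T Φ₁ δ) ℳ)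
    (hsimple : IsGradedSimple (RedEnv p ε 𝒱 χ (parabolic 𝒱 𝔤 T Φ₁ δ)) ℳ)
    (wt : lieOf 𝒱 T →ₗ[F] F) (v : M)
    (hv : IsMaximalVector p ε 𝒱 χ (parabolic 𝒱 𝔤 T Φ₁ δ) P ℳ wt v) :
    -- the Harish-Chandra image exists and is unique
    (∃! y : RedEnv p ε 𝒱 χs (lieOf 𝒱 T),
      IsHarishChandraImage p ε 𝒱 χs P hroot.torus_le (topElement p ε 𝒱 χs e f) y) ∧
    -- the weight extends uniquely to a character of the reduced enveloping algebra of the torus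
    (∃! ev : RedEnv p ε 𝒱 χs (lieOf 𝒱 T) →ₐ[F] F,
      ∀ h, ev (RedEnv.ι p ε 𝒱 χs (lieOf 𝒱 T) h) = wt h) ∧
    -- the induced module is simple if and only if the value of the image at the weight is nonzero
    ∀ (y : RedEnv p ε 𝒱 χs (lieOf 𝒱 T)) (ev : RedEnv p ε 𝒱 χs (lieOf 𝒱 T) →ₐ[F] F),
      IsHarishChandraImage p ε 𝒱 χs P hroot.torus_le (topElement p ε 𝒱 χs e f) y →
      (∀ h, ev (RedEnv.ι p ε 𝒱 χs (lieOf 𝒱 T) h) = wt h) →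
      (InducedIsSimple p ε 𝒱 χ (hroot.parabolic_le Φ₁ δ) ℳ ↔ ev y ≠ 0) := by
  obtain ⟨himage, hchar, hiff⟩ := simplicity_criterion hp h𝔤 hT hroot hP hFP he hf hef hχ hχδ hM
    hsimple hv (Induced.isInduced (RedEnv.map p ε 𝒱 χ (hroot.parabolic_le Φ₁ δ)))
  refine ⟨himage, hchar, fun y ev hy hev => ?_⟩
  unfold InducedIsSimple
  rw [Induced.grade_eq]
  exact hiff y ev hy hev
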